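/- Let $n\ge 3$. Let $(E,h)$ be a connected, complete, smooth Riemannian $n$-manifold without boundary that is asymptotically flat with one end: there is a diffeomorphism $\Psi$ from $\{x\in\mathbb R^n:|x|>1\}$ onto an open subset of $E$ such that $E\setminus\Psi(\{|x|>r\})$ is compact for every $r>1$, in these coordinates $h_{ij}=\delta_{ij}+O(|x|^{-\tau})$ and $\partial_kh_{ij}=O(|x|^{-\tau-1})$ as $|x|\to\infty$ for some $\tau>\frac{n-2}{2}$, and the scalar curvature $R_h$ is integrable on $E$. Let $I\subset\mathbb R$ be an interval and let $\overline M=E\times I$ carry the product metric $\langle\,,\rangle=h+dt^2$; put $\overline X=\partial/\partial t$. Let $M$ be a connected, complete, smooth $n$-manifold with (possibly empty) compact boundary $\Gamma$, and let $F:(M,g)\to\overline M$ be an isometric immersion with a continuous unit normal field $N$ along $F$, such that $R_g$ is integrable on $M$ and, outside a compact set, $M$ is a graph over the end of $E$: for some $\rho\ge1$ there are a function $f$ and a smooth map $\Phi$ from $\{|x|>\rho\}$ to $M$ with $F(\Phi(x))=(\Psi(x),f(x))$, the set $M_r=M\setminus\Phi(\{|x|>r\})$ is compact for every $r>\rho$,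 and, for some $\tau>\frac{n-2}{2}$, $\partial_if=O(|x|^{-\tau/2})$ and $\partial_i\partial_jf=O(|x|^{-\tau/2-1})$ as $|x|\to\infty$. The normal $N$ is chosen so that $N\to\overline X$ at infinity. Let $\Theta_{\overline X}=\langle\overline X,N\rangle$. Suppose that $F$ embeds $\Gamma$ in a slice $E\times\{t_0\}$, $t_0\in I$, where it is the boundary of a compact domain $\Omega$ (the closure of its interior), and that $M$ is orthogonal to the slice along $\Gamma$. Let $\mu$ be the unit normal of $\Gamma$ in the slice pointing into $\Omega$, let $\eta$ be the exterior unit conormal of $M$ along $\Gamma$, and suppose that orientations are compatible in the sense that, along $\Gamma$, $(N,\eta)$ and $(\overline X,\mu)$ define the same orientation of the normal plane of $\Gamma$ (that is, $N=\mp\mu$ where $\eta=\pm\overline X$). Let $s_1(\mu)$ be the mean curvature of $\Gamma$ in the slice with respect to $\mu$ (the trace of the shape operator $-\nabla\mu$), and let $N^t$ be the horizontal component of $N$. Let $c_n=\frac{1}{2(n-1)\omega_{n-1}}$, where $\omega_{n-1}$ is the area of the unit sphere in $\mathbb R^n$. Then the ADM masses $$m_h=\lim_{r\to\infty}c_n\int_{|x|=r}(\partial_jh_{ij}-\partial_ih_{jj})\frac{x^i}{|x|}\,d\Sigma_r,\qquad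 m_g=\lim_{r\to\infty}c_n\int_{|x|=r}(\partial_jg_{ij}-\partial_ig_{jj})\frac{x^i}{|x|}\,d\Sigma_r$$ exist, where $h_{ij}$ are the coefficients of $h$ in the coordinates $\Psi$ and $g_{ij}$ those of $g$ in the coordinates $\Phi$, and $$m_g=m_h+c_n\int_\Gamma s_1(\mu)\,d\Gamma+c_n\int_M\Theta_{\overline X}\bigl(R_g-R_h+\mathrm{Ric}_h(N^t,N^t)\bigr)\,dM ,$$ where the last integral is the limit, which exists, of the integrals over $M_r$ as $r\to\infty$ (it is the Lebesgue integral over $M$ whenever the integrand is integrable). -/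

import Mathlib

open Set Filter Topology MeasureTheory Bornology
open scoped Manifold ContDiff Asymptotics

noncomputable section

/-- Euclidean space `ℝ^d` with its Euclidean norm. -/
abbrev Euc (d : ℕ) : Type := EuclideanSpace ℝ (Fin d)

/-- The `i`-th standard basis vector of `ℝ^d`. -/
def stdVec {d : ℕ} (i : Fin d) : Euc d := EuclideanSpace.single i 1

/-! ### Curvature of a metric given by its coefficients in coordinates -/

/-- The partial derivative `∂_i u` at `x` (within `s`, so that it makes sense up to the boundary of
a half-space; on an open set it is the ordinary partial derivative). -/
def partialD {d : ℕ} (s : Set (Euc d)) (u : Euc d → ℝ) (i : Fin d) (x : Euc d) : ℝ :=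
  fderivWithin ℝ u s x (stdVec i)

/-- Christoffel symbols `Γ^k_{ij}` of the metric with coefficient matrix `G`. -/
def christoffel {d : ℕ} (s : Set (Euc d)) (G : Euc d → Matrix (Fin d) (Fin d) ℝ)
    (k i j : Fin d) (x : Euc d) : ℝ :=
  (1 / 2 : ℝ) * ∑ l, (G x)⁻¹ k l *
    (partialD s (fun y => G y j l) i x + partialD s (fun y => G y i l) j x
      - partialD s (fun y => G y i j) l x)

/-- Coefficients of the Ricci tensor,
`R_{jk} = ∂_i Γ^i_{jk} - ∂_j Γ^i_{ik} + Γ^i_{ip} Γ^p_{jk} - Γ^i_{jp} Γ^p_{ik}`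
(positive on round spheres). -/
def ricciCoeff {d : ℕ} (s : Set (Euc d)) (G : Euc d → Matrix (Fin d) (Fin d) ℝ)
    (j k : Fin d) (x : Euc d) : ℝ :=
  ∑ i, (partialD s (christoffel s G i j k) i x - partialD s (christoffel s G i i k) j x
    + ∑ p, (christoffel s G i i p x * christoffel s G p j k x
      - christoffel s G i j p x * christoffel s G p i k x))

/-- Scalar curvature `G^{jk} R_{jk}`. -/
def scalarCoeff {d : ℕ} (s : Set (Euc d)) (G : Euc d → Matrix (Fin d) (Fin d) ℝ)
    (x : Euc d) : ℝ :=
  ∑ j, ∑ k, (G x)⁻¹ j k * ricciCoeff s G j k x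

/-! ### Metrics on manifolds -/

section Manifold

variable {d : ℕ} {H : Type*} [TopologicalSpace H] {I : ModelWithCorners ℝ (Euc d) H}
  {M : Type*} [TopologicalSpace M] [ChartedSpace H M]

/-- A field of (not necessarily smooth) pairings on the tangent spaces of `M`. -/
abbrev MetricField (I : ModelWithCorners ℝ (Euc d) H) (M : Type*) [TopologicalSpace M]
    [ChartedSpace H M] : Type _ :=
  ∀ p : M, TangentSpace I p → TangentSpace I p → ℝ

/-- The pairings underlying a smooth Riemannian metric. -/
def toField [IsManifold I ∞ M]
    (g : Bundle.ContMDiffRiemannianMetric I ∞ (Euc d) (fun p : M => TangentSpace I p)) :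
    MetricField I M :=
  fun p v w => g.inner p v w

/-- Coefficients of `g` in the coordinates given by a parametrization `φ : s → M`, `s ⊆ ℝ^d`. -/
def metricCoeff (g : MetricField I M) (s : Set (Euc d)) (φ : Euc d → M) (x : Euc d) :
    Matrix (Fin d) (Fin d) ℝ :=
  Matrix.of fun i j =>
    g (φ x) (mfderivWithin 𝓘(ℝ, Euc d) I φ s x (stdVec i))
      (mfderivWithin 𝓘(ℝ, Euc d) I φ s x (stdVec j))

/-- Coefficients of `g` in the preferred chart at `p`. -/
def chartCoeff (g : MetricField I M) (p : M) : Euc d → Matrix (Fin d) (Fin d) ℝ :=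
  metricCoeff g (range I) (extChartAt I p).symm

/-- The Ricci tensor of `g` at `p`; a tangent vector at `p` is, by definition of `TangentSpace`, its
coordinate vector in the preferred chart at `p`. -/
def ricci (g : MetricField I M) (p : M) (v w : TangentSpace I p) : ℝ :=
  ∑ j, ∑ k, ricciCoeff (range I) (chartCoeff g p) j k (extChartAt I p p) *
    (show Euc d from v) j * (show Euc d from w) k

/-- The scalar curvature of `g`. -/
def scalarCurvature (g : MetricField I M) (p : M) : ℝ :=
  scalarCoeff (range I) (chartCoeff g p) (extChartAt I p p)

/-- The Riemannian measure of the chart domain at `p`: `√(det g_{ij}) dx`, carried over to `M`. -/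
def chartVolume [MeasurableSpace M] (g : MetricField I M) (p : M) : Measure M :=
  Measure.map (extChartAt I p).symm
    ((volume.restrict (extChartAt I p).target).withDensity
      fun x => ENNReal.ofReal (Real.sqrt (chartCoeff g p x).det))

/-- The Riemannian measure of `(M, g)`. The chart measures are the restrictions of one measure to
the chart domains, and that measure is their least upper bound. -/
def riemannianVolume [MeasurableSpace M] (g : MetricField I M) : Measure M :=
  ⨆ p : M, chartVolume g p

/-! ### Immersions -/

variable {d' : ℕ} {H' : Type*} [TopologicalSpace H'] {J : ModelWithCorners ℝ (Euc d') H'}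
  {E : Type*} [TopologicalSpace E] [ChartedSpace H' E]

/-- The pull-back `γ^* h`. -/
def pullbackMetric (I : ModelWithCorners ℝ (Euc d) H) (h : MetricField J E) (γ : M → E) :
    MetricField I M :=
  fun q v w => h (γ q) (mfderiv I J γ q v) (mfderiv I J γ q w)

/-- Components of `γ` in the preferred charts at `q` and `γ q`. -/
def localComp (I : ModelWithCorners ℝ (Euc d) H) (J : ModelWithCorners ℝ (Euc d') H')
    (γ : M → E) (q : M) (k : Fin d') (x : Euc d) : ℝ :=
  (extChartAt J (γ q) (γ ((extChartAt I q).symm x))) k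

/-- The covariant derivative `∇_{∂_a} ∂_b γ` at `q` of the coordinate fields along `γ`, for the
Levi-Civita connection of `h`; its components are
`∂_a ∂_b γ^k + Γ^k_{ij} ∂_a γ^i ∂_b γ^j`. -/
def covariantHessian (I : ModelWithCorners ℝ (Euc d) H) (h : MetricField J E) (γ : M → E) (q : M)
    (a b : Fin d) : TangentSpace J (γ q) :=
  show Euc d' from WithLp.toLp 2 fun k =>
    partialD (range I)
        (fun x => partialD (range I) (localComp I J γ q k) b x) a (extChartAt I q q)
      + ∑ i, ∑ j,
        christoffel (range J) (chartCoeff h (γ q)) k i j (extChartAt J (γ q) (γ q)) *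
          partialD (range I) (localComp I J γ q i) a (extChartAt I q q) *
          partialD (range I) (localComp I J γ q j) b (extChartAt I q q)

/-- The mean curvature at `q` of a hypersurface `γ` of `(E, h)` with respect to the unit normal `ν`:
the trace of the second fundamental form `⟨∇_{∂_a} ∂_b γ, ν⟩`, which is the trace of the shape
operator `-∇ν`. Round spheres have positive mean curvature with respect to the inner normal. -/
def meanCurvature (I : ModelWithCorners ℝ (Euc d) H) (h : MetricField J E) (γ : M → E) (q : M)
    (ν : TangentSpace J (γ q)) : ℝ :=
  ∑ a, ∑ b, (chartCoeff (pullbackMetric I h γ) q (extChartAt I q q))⁻¹ a b *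
    h (γ q) (covariantHessian I h γ q a b) ν

end Manifold

/-! ### ADM mass -/

/-- The area `ω_{n-1}` of the unit sphere in `ℝ^n`. -/
def sphereArea (n : ℕ) : ℝ := (volume : Measure (Euc n)).toSphere.real univ

/-- `c_n = 1 / (2 (n-1) ω_{n-1})`. -/
def admConst (n : ℕ) : ℝ := 1 / (2 * ((n : ℝ) - 1) * sphereArea n)

/-- `c_n ∫_{Σ_r} (h_{ij,j} - h_{jj,i}) ν^i dΣ_r` over the coordinate sphere of radius `r`,
parametrized by the unit sphere. -/
def admFlux {n : ℕ} (G : Euc n → Matrix (Fin n) (Fin n) ℝ) (r : ℝ) : ℝ :=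
  admConst n * (r ^ (n - 1) * ∫ u : Metric.sphere (0 : Euc n) 1,
    (∑ i, ∑ j, (partialD univ (fun y => G y i j) j (r • (u : Euc n))
      - partialD univ (fun y => G y j j) i (r • (u : Euc n))) * (u : Euc n) i)
    ∂(volume : Measure (Euc n)).toSphere)

/-- The metric with coefficients `G` in coordinates at infinity has ADM mass `m`. -/
def HasADMMass {n : ℕ} (G : Euc n → Matrix (Fin n) (Fin n) ℝ) (m : ℝ) : Prop :=
  Tendsto (admFlux G) atTop (𝓝 m)

/-- The exterior region `{|x| > r}`. -/
def exterior (n : ℕ) (r : ℝ) : Set (Euc n) := {x | r < ‖x‖}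

/-! ### The setting -/

section Setting

variable {n : ℕ} {E : Type*} [TopologicalSpace E] [ChartedSpace (Euc n) E]

/-- `Ψ` is a system of asymptotically flat coordinates on the manifold `(E, h)`: a diffeomorphism
from `{|x| > 1}` onto the complement of a compact set, such that only `|x| → ∞` leaves every compact
subset of `E`, with the decay conditions for `h`, and the scalar curvature of `h` is integrable. -/
structure IsAsymptoticallyFlat [MeasurableSpace E] (h : MetricField (𝓡 n) E)
    (Ψ : OpenPartialHomeomorph (Euc n) E) : Prop where
  source_eq : Ψ.source = exterior n 1
  smooth : ContMDiffOn 𝓘(ℝ, Euc n) (𝓡 n) ∞ Ψ Ψ.source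
  smooth_symm : ContMDiffOn (𝓡 n) 𝓘(ℝ, Euc n) ∞ Ψ.symm Ψ.target
  isCompact_core : ∀ r : ℝ, 1 < r → IsCompact (Ψ '' exterior n r)ᶜ
  decay : ∃ τ : ℝ, ((n : ℝ) - 2) / 2 < τ ∧
    (∀ i j, (fun x => metricCoeff h (exterior n 1) Ψ x i j - (1 : Matrix (Fin n) (Fin n) ℝ) i j)
      =O[cobounded (Euc n)] fun x => ‖x‖ ^ (-τ)) ∧
    (∀ i j k, (fun x => partialD univ (fun y => metricCoeff h (exterior n 1) Ψ y i j) k x)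
      =O[cobounded (Euc n)] fun x => ‖x‖ ^ (-τ - 1))
  integrable_scalar : Integrable (scalarCurvature h) (riemannianVolume h)

/-- The product metric `h + dt²` on `E × ℝ`. -/
def prodMetric (h : MetricField (𝓡 n) E) (q : E × ℝ)
    (v w : TangentSpace ((𝓡 n).prod 𝓘(ℝ, ℝ)) q) : ℝ :=
  h q.1 (show Euc n × ℝ from v).1 (show Euc n × ℝ from w).1
    + (show Euc n × ℝ from v).2 * (show Euc n × ℝ from w).2

/-- The vertical unit field `∂/∂t` on `E × ℝ`. -/
def vertical (q : E × ℝ) : TangentSpace ((𝓡 n).prod 𝓘(ℝ, ℝ)) q :=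
  show Euc n × ℝ from (0, 1)

/-- A tangent vector of `E` as a horizontal tangent vector of `E × ℝ`. -/
def horizontal (q : E × ℝ) (v : TangentSpace (𝓡 n) q.1) :
    TangentSpace ((𝓡 n).prod 𝓘(ℝ, ℝ)) q :=
  show Euc n × ℝ from (v, 0)

/-- The horizontal component of a tangent vector of `E × ℝ`. -/
def horizontalPart (q : E × ℝ) (v : TangentSpace ((𝓡 n).prod 𝓘(ℝ, ℝ)) q) :
    TangentSpace (𝓡 n) q.1 :=
  (show Euc n × ℝ from v).1

variable [NeZero n] {M : Type*} [TopologicalSpace M] [ChartedSpace (EuclideanHalfSpace n) M]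

/-- The derivative of an immersion `F : M → E × ℝ`. -/
def dImm (F : M → E × ℝ) (p : M) (v : TangentSpace (𝓡∂ n) p) :
    TangentSpace ((𝓡 n).prod 𝓘(ℝ, ℝ)) (F p) :=
  mfderiv (𝓡∂ n) ((𝓡 n).prod 𝓘(ℝ, ℝ)) F p v

/-- The angle function `Θ = ⟨∂/∂t, N⟩`. -/
def angleFn (h : MetricField (𝓡 n) E) (F : M → E × ℝ)
    (N : ∀ p : M, TangentSpace ((𝓡 n).prod 𝓘(ℝ, ℝ)) (F p)) (p : M) : ℝ :=
  prodMetric h (F p) (vertical (F p)) (N p)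

/-- `F : (M, g) → E × I` is a two-sided asymptotically flat hypersurface of the Riemannian product,
with unit normal `N`. Outside a compact set `M` is the graph of `f` over the part `{|x| > ρ}` of the
end of `E`; `Φ` gives the nonparametric coordinates on the end of `M`. -/
structure IsAFHypersurface [IsManifold (𝓡 n) ∞ E] [MeasurableSpace M]
    (h : MetricField (𝓡 n) E) (Ψ : OpenPartialHomeomorph (Euc n) E) (Iv : Set ℝ)
    (g : MetricField (𝓡∂ n) M) (F : M → E × ℝ)
    (N : ∀ p : M, TangentSpace ((𝓡 n).prod 𝓘(ℝ, ℝ)) (F p))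
    (ρ : ℝ) (Φ : Euc n → M) (f : Euc n → ℝ) : Prop where
  smooth : ContMDiff (𝓡∂ n) ((𝓡 n).prod 𝓘(ℝ, ℝ)) ∞ F
  mem_interval : ∀ p, (F p).2 ∈ Iv
  isometric : ∀ p v w, g p v w = prodMetric h (F p) (dImm F p v) (dImm F p w)
  normal_continuous :
    Continuous fun p => (⟨F p, N p⟩ : TangentBundle ((𝓡 n).prod 𝓘(ℝ, ℝ)) (E × ℝ))
  normal_unit : ∀ p, prodMetric h (F p) (N p) (N p) = 1
  normal_orthogonal : ∀ p v, prodMetric h (F p) (N p) (dImm F p v) = 0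
  one_le_radius : 1 ≤ ρ
  smooth_end : ContMDiffOn 𝓘(ℝ, Euc n) (𝓡∂ n) ∞ Φ (exterior n ρ)
  isCompact_core : ∀ r : ℝ, ρ < r → IsCompact (Φ '' exterior n r)ᶜ
  graph : ∀ x ∈ exterior n ρ, F (Φ x) = (Ψ x, f x)
  decay : ∃ τ : ℝ, ((n : ℝ) - 2) / 2 < τ ∧
    (∀ i, (fun x => partialD univ f i x) =O[cobounded (Euc n)] fun x => ‖x‖ ^ (-(τ / 2))) ∧
    (∀ i j, (fun x => partialD univ (fun y => partialD univ f i y) j x)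
      =O[cobounded (Euc n)] fun x => ‖x‖ ^ (-(τ / 2) - 1))
  integrable_scalar : Integrable (scalarCurvature g) (riemannianVolume g)
  normal_at_infinity : Tendsto (fun x => angleFn h F N (Φ x)) (cobounded (Euc n)) (𝓝 1)

variable {Γ : Type*} [TopologicalSpace Γ] [ChartedSpace (Euc (n - 1)) Γ]

/-- The projection to `E` of the restriction of `F` to the inner boundary `j : Γ → M`. -/
def boundaryProj (F : M → E × ℝ) (j : Γ → M) (q : Γ) : E := (F (j q)).1

/-- `η` is the exterior unit conormal of `M` at the boundary point `j q`. In the preferred chart at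
`j q`, `M` is a half-space `{x_0 ≥ 0}`, and the vectors that point out of `M` are those with
negative `0`-th coordinate. -/
structure IsExteriorConormal (g : MetricField (𝓡∂ n) M) (j : Γ → M) (q : Γ)
    (η : TangentSpace (𝓡∂ n) (j q)) : Prop where
  unit : g (j q) η η = 1
  orthogonal : ∀ w : TangentSpace (𝓡 (n - 1)) q,
    g (j q) η (mfderiv (𝓡 (n - 1)) (𝓡∂ n) j q w) = 0
  outward : (show Euc n from η) 0 < 0

/-- `μ` is the unit normal of the hypersurface `γ` of `(E, h)` at `γ q` that points into the domain
`Ω` bounded by `γ`. -/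
structure IsInwardNormal (h : MetricField (𝓡 n) E) (γ : Γ → E) (Ω : Set E) (q : Γ)
    (μ : TangentSpace (𝓡 n) (γ q)) : Prop where
  unit : h (γ q) μ μ = 1
  orthogonal : ∀ w : TangentSpace (𝓡 (n - 1)) q,
    h (γ q) μ (mfderiv (𝓡 (n - 1)) (𝓡 n) γ q w) = 0
  inward : ∀ᶠ s : ℝ in 𝓝[>] 0,
    (extChartAt (𝓡 n) (γ q)).symm
      (extChartAt (𝓡 n) (γ q) (γ q) + s • (show Euc n from μ)) ∈ Ω

/-- The inner boundary `Γ = ∂M` (possibly empty) is embedded by `F` in the slice `E × {t₀}`, where it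
bounds the compact domain `Ω`; `M` is orthogonal to the slice along `Γ`, and `μ` is the unit normal
of `Γ` in the slice pointing into `Ω`. The last field says that orientations are compatible: the
orientation of `Γ` as the boundary of `M` (oriented by `N`), followed by `μ`, gives the slice the
orientation defined by `∂/∂t`, that is, `(N, η)` and `(∂/∂t, μ)` define the same orientation of the
normal plane of `Γ`. -/
structure IsHorizon (h : MetricField (𝓡 n) E) (g : MetricField (𝓡∂ n) M) (F : M → E × ℝ)
    (N : ∀ p : M, TangentSpace ((𝓡 n).prod 𝓘(ℝ, ℝ)) (F p)) (j : Γ → M) (t₀ : ℝ) (Ω : Set E)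
    (μ : ∀ q : Γ, TangentSpace (𝓡 n) (boundaryProj F j q)) : Prop where
  smooth : ContMDiff (𝓡 (n - 1)) (𝓡∂ n) ∞ j
  injective_mfderiv : ∀ q, Function.Injective (mfderiv (𝓡 (n - 1)) (𝓡∂ n) j q)
  injective : Function.Injective j
  range_eq : range j = (𝓡∂ n).boundary M
  in_slice : ∀ q, (F (j q)).2 = t₀
  injective_proj : Function.Injective (boundaryProj F j)
  compact_domain : IsCompact Ω
  regular_domain : closure (interior Ω) = Ω
  frontier_domain : frontier Ω = range (boundaryProj F j)
  orthogonal : ∀ q, prodMetric h (F (j q)) (N (j q)) (vertical (F (j q))) = 0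
  inward_normal : ∀ q, IsInwardNormal h (boundaryProj F j) Ω q (μ q)
  orientation : ∀ (q : Γ) (η : TangentSpace (𝓡∂ n) (j q)), IsExteriorConormal g j q η →
    0 < prodMetric h (F (j q)) (N (j q)) (vertical (F (j q))) *
          prodMetric h (F (j q)) (dImm F (j q) η) (horizontal (F (j q)) (μ q))
        - prodMetric h (F (j q)) (N (j q)) (horizontal (F (j q)) (μ q)) *
          prodMetric h (F (j q)) (dImm F (j q) η) (vertical (F (j q)))

/-- `Θ (R_g - R_h + Ric_h(N^t, N^t))` on `M`, where `N^t` is the horizontal component of `N`. -/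
def massDensity (h : MetricField (𝓡 n) E) (g : MetricField (𝓡∂ n) M) (F : M → E × ℝ)
    (N : ∀ p : M, TangentSpace ((𝓡 n).prod 𝓘(ℝ, ℝ)) (F p)) (p : M) : ℝ :=
  angleFn h F N p *
    (scalarCurvature g p - scalarCurvature h (F p).1
      + ricci h (F p).1 (horizontalPart (F p) (N p)) (horizontalPart (F p) (N p)))

end Setting

end

noncomputable section

set_option maxSynthPendingDepth 5
set_option linter.unusedSectionVars false

/-! ### Connections and immersions between normed spaces -/

section Abstract

variable {X Z : Type*} [NormedAddCommGroup X] [NormedSpace ℝ X]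
  [NormedAddCommGroup Z] [NormedSpace ℝ Z]

/-! Let `u` be the height, the second component of `F`, and let `A` be the second fundamental form
with respect to `N`. Since `∂/∂t` is parallel, `∇u` is its tangential part, `∇²u = Θ A`, and the
horizontal part of `∇u` is `-Θ N^t`. The proof is the divergence theorem for the flux field `W = (tr
A) ∇u - A ∇u` on the regions `M_r`.

The divergence of `W` is `Θ ((tr A)² - |A|²)` plus the Codazzi term `(d tr A - div A)(∇u)`. The
traced Codazzi equation turns the latter into `-Θ Ric_h(N^t, N^t)`, and the Gauss equation traced
twice gives `(tr A)² - |A|² = R_g - R_h + 2 Ric_h(N^t, N^t)`. The sum is exactly `massDensity`. This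
is `IsHypOn.divergence_flux`; it rests on `curvOp_immersion`, which yields both structure equations
(`IsHypOn.gauss_codazzi`) by antisymmetrizing the derivative of the Gauss formula.

Along `Γ` the conormal is `η = ε ∂/∂t` with `ε = ±1`, and `∇u = ε η`, so `⟨W, η⟩` is `ε` times the
trace of `A` over `Γ`. On vectors tangent to `Γ`, `A` is the second fundamental form of `Γ` in the
slice with respect to `N`. The orientation condition says `μ = -ε N`, hence `⟨W, η⟩ = -s_1(μ)`
(`IsHorizon.normal_relations`, `IsHorizon.meanCurvature_mul_sqrt_det`).

On the end, `g = h + df ⊗ df`. In graph coordinates `√det g · W` differs from the difference of the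
two ADM integrands by `O(|x|^{-2τ-1})` (`IsGraphEnd.flux_sub`). Since `2τ + 1 > n - 1`, the error
has no flux at infinity, and the outer flux tends to the difference of the masses up to the factor
`c_n`. The masses exist because the scalar curvature is the divergence of a vector field up to
`O(|x|^{-2τ-2})`, which is integrable, and this field agrees with the ADM integrand up to
`O(|x|^{-2τ-1})` (`IsAFDecay.exists_hasADMMass`).

The rest makes the divergence theorem rigorous. `W` is defined in coordinates and shown to be a
vector field (`IsHypersurface.tD_coordFlux`); the normal, only assumed continuous, is smooth
(`IsHypWithin.smooth_normal`). For `χ W` with `χ` a cut-off function, a partition of unity reduces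
the theorem to a half-space (`integral_halfSpace_divergence`, `IsHorizon.integral_cutDensity`). The
part of the cut-off integral that lies on the end is removed by the divergence theorem on annuli
(`sphereFlux_sub`), leaving the core (`IsAFHypersurface.integral_core`). Such cut-off functions
exist because the end of `E`, and with it the end of `M`, does not accumulate at a point
(`SmoothCoord.exists_nhds_disjoint_end`, `IsAFHypersurface.isClosed_image`). -/

/-- The curvature `R(a, b) c` of the connection `D + Γ` on a vector space. -/
def curvOp (Γ : X → X →L[ℝ] X →L[ℝ] X) (x a b c : X) : X :=
  fderiv ℝ Γ x a b c - fderiv ℝ Γ x b a c + Γ x a (Γ x b c) - Γ x b (Γ x a c)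

theorem isSymmSndFDerivAt_of_two {F : X → Z} {x : X} (hF : ContDiffAt ℝ 2 F x) :
    IsSymmSndFDerivAt ℝ F x :=
  hF.isSymmSndFDerivAt (by simp)

/-- The Gauss and Codazzi equations of a map `F` with second fundamental form `II` (relative to
arbitrary connections). -/
theorem curvOp_immersion {F : X → Z} {Γ : X → X →L[ℝ] X →L[ℝ] X} {Γ' : Z → Z →L[ℝ] Z →L[ℝ] Z}
    {II : X → X →L[ℝ] X →L[ℝ] Z} {x : X} (hF : ContDiffAt ℝ 3 F x)
    (hΓ : DifferentiableAt ℝ Γ x) (hΓ' : DifferentiableAt ℝ Γ' (F x))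
    (hII : DifferentiableAt ℝ II x)
    (h : ∀ᶠ y in 𝓝 x, ∀ a b, fderiv ℝ (fderiv ℝ F) y a b
      + Γ' (F y) (fderiv ℝ F y a) (fderiv ℝ F y b) = fderiv ℝ F y (Γ y a b) + II y a b)
    (a b c : X) :
    curvOp Γ' (F x) (fderiv ℝ F x a) (fderiv ℝ F x b) (fderiv ℝ F x c) =
      fderiv ℝ F x (curvOp Γ x a b c)
        + (fderiv ℝ II x a b c + Γ' (F x) (fderiv ℝ F x a) (II x b c) - II x b (Γ x a c))
        - (fderiv ℝ II x b a c + Γ' (F x) (fderiv ℝ F x b) (II x a c) - II x a (Γ x b c)) := by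
  have hF' : ContDiffAt ℝ 2 (fderiv ℝ F) x := hF.fderiv_right (by norm_num)
  have hF'' : ContDiffAt ℝ 1 (fderiv ℝ (fderiv ℝ F)) x := hF'.fderiv_right (by norm_num)
  have d0 : HasFDerivAt F (fderiv ℝ F x) x :=
    (hF.differentiableAt (by norm_num)).hasFDerivAt
  have d1 : HasFDerivAt (fderiv ℝ F) (fderiv ℝ (fderiv ℝ F) x) x :=
    (hF'.differentiableAt (by norm_num)).hasFDerivAt
  have d2 : HasFDerivAt (fderiv ℝ (fderiv ℝ F)) (fderiv ℝ (fderiv ℝ (fderiv ℝ F)) x) x :=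
    (hF''.differentiableAt (by norm_num)).hasFDerivAt
  have dΓ := hΓ.hasFDerivAt
  have dΓ' : HasFDerivAt (fun y => Γ' (F y)) ((fderiv ℝ Γ' (F x)).comp (fderiv ℝ F x)) x :=
    HasFDerivAt.comp (g := Γ') x hΓ'.hasFDerivAt d0
  have dII := hII.hasFDerivAt
  have hs : ∀ a b, fderiv ℝ (fderiv ℝ (fderiv ℝ F)) x a b =
      fderiv ℝ (fderiv ℝ (fderiv ℝ F)) x b a := fun a b =>
    isSymmSndFDerivAt_of_two hF' a b
  have hs2 : ∀ a b, fderiv ℝ (fderiv ℝ F) x a b = fderiv ℝ (fderiv ℝ F) x b a := fun a b =>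
    isSymmSndFDerivAt_of_two (hF.of_le (by norm_num)) a b
  -- The Gauss formula for `(b, c)`, differentiated in the direction `a`. Antisymmetrizing in `a`
  -- and `b` will remove the third derivatives of `F`.
  have key : ∀ a b c, fderiv ℝ (fderiv ℝ (fderiv ℝ F)) x a b c
      + fderiv ℝ Γ' (F x) (fderiv ℝ F x a) (fderiv ℝ F x b) (fderiv ℝ F x c)
      + Γ' (F x) (fderiv ℝ (fderiv ℝ F) x a b) (fderiv ℝ F x c)
      + Γ' (F x) (fderiv ℝ F x b) (fderiv ℝ (fderiv ℝ F) x a c)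
      = fderiv ℝ (fderiv ℝ F) x a (Γ x b c) + fderiv ℝ F x (fderiv ℝ Γ x a b c)
        + fderiv ℝ II x a b c := by
    intro a b c
    have cb := hasFDerivAt_const (𝕜 := ℝ) b x
    have cc := hasFDerivAt_const (𝕜 := ℝ) c x
    have e1 := ((d2.clm_apply cb).clm_apply cc).add
      ((dΓ'.clm_apply (d1.clm_apply cb)).clm_apply (d1.clm_apply cc))
    have e2 := (d1.clm_apply ((dΓ.clm_apply cb).clm_apply cc)).add
      ((dII.clm_apply cb).clm_apply cc)
    have e3 := e1.congr_of_eventuallyEq (f₁ := fun y => fderiv ℝ F y (Γ y b c) + II y b c)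
      (by filter_upwards [h] with y hy; exact (hy b c).symm)
    have e4 := congrArg (fun L => L a) (e3.unique e2)
    simp at e4
    linear_combination (norm := module) e4
  have h0 := h.self_of_nhds
  have k1 := key a b c
  have k2 := key b a c
  -- The remaining second derivatives are eliminated by the undifferentiated formula; this produces
  -- the quadratic Christoffel terms of both curvatures.
  have q : ∀ a b, fderiv ℝ (fderiv ℝ F) x a b = fderiv ℝ F x (Γ x a b) + II x a b
      - Γ' (F x) (fderiv ℝ F x a) (fderiv ℝ F x b) := fun a b => by
    rw [← h0 a b]; abel
  rw [hs2 b a, hs b a, q b c] at k2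
  rw [q a c] at k1
  rw [q a (Γ x b c)] at k1
  rw [q b (Γ x a c)] at k2
  simp only [curvOp, map_add, map_sub] at *
  linear_combination (norm := module) k1 - k2

/-- `Γ` is a symmetric connection at `x`, compatible with the metric `G`. -/
structure IsLC (G : X → X →L[ℝ] X →L[ℝ] ℝ) (Γ : X → X →L[ℝ] X →L[ℝ] X) (x : X) : Prop where
  symm : ∀ a b, Γ x a b = Γ x b a
  symm_metric : ∀ a b, G x a b = G x b a
  diff : DifferentiableAt ℝ G x
  compat : ∀ a b c, fderiv ℝ G x a b c = G x (Γ x a b) c + G x b (Γ x a c)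

/-- The tangential part of the second covariant derivative of an isometric immersion `(π, u)` into a
product with a line is the Levi-Civita connection. -/
theorem IsLC.immersion {G : X → X →L[ℝ] X →L[ℝ] ℝ} {Γ : X → X →L[ℝ] X →L[ℝ] X}
    {H : Z → Z →L[ℝ] Z →L[ℝ] ℝ} {Γ' : Z → Z →L[ℝ] Z →L[ℝ] Z} {π : X → Z} {u : X → ℝ} {x : X}
    (hG : IsLC G Γ x) (hH : IsLC H Γ' (π x)) (hπ : ContDiffAt ℝ 2 π x) (hu : ContDiffAt ℝ 2 u x)
    (h : ∀ᶠ y in 𝓝 x, ∀ a b, G y a b = H (π y) (fderiv ℝ π y a) (fderiv ℝ π y b)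
      + fderiv ℝ u y a * fderiv ℝ u y b) (a b c : X) :
    H (π x) (fderiv ℝ (fderiv ℝ π) x a b + Γ' (π x) (fderiv ℝ π x a) (fderiv ℝ π x b))
        (fderiv ℝ π x c) + fderiv ℝ (fderiv ℝ u) x a b * fderiv ℝ u x c
      = G x (Γ x a b) c := by
  have p0 : HasFDerivAt π (fderiv ℝ π x) x := (hπ.differentiableAt (by norm_num)).hasFDerivAt
  have p1 : HasFDerivAt (fderiv ℝ π) (fderiv ℝ (fderiv ℝ π) x) x :=
    ((hπ.fderiv_right (m := 1) (by norm_num)).differentiableAt (by norm_num)).hasFDerivAt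
  have u1 : HasFDerivAt (fderiv ℝ u) (fderiv ℝ (fderiv ℝ u) x) x :=
    ((hu.fderiv_right (m := 1) (by norm_num)).differentiableAt (by norm_num)).hasFDerivAt
  have dH : HasFDerivAt (fun y => H (π y)) ((fderiv ℝ H (π x)).comp (fderiv ℝ π x)) x :=
    HasFDerivAt.comp (g := H) x hH.diff.hasFDerivAt p0
  have sπ := isSymmSndFDerivAt_of_two hπ
  have su := isSymmSndFDerivAt_of_two hu
  -- `T` is symmetric in its first two slots and satisfies the same compatibility identity as `G (Γ
  -- a b) c`. The Koszul argument shows that these two properties determine it.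
  set T : X → X → X → ℝ := fun a b c =>
    H (π x) (fderiv ℝ (fderiv ℝ π) x a b + Γ' (π x) (fderiv ℝ π x a) (fderiv ℝ π x b))
        (fderiv ℝ π x c) + fderiv ℝ (fderiv ℝ u) x a b * fderiv ℝ u x c with hT
  have key : ∀ a b c, G x (Γ x a b) c + G x b (Γ x a c) = T a b c + T a c b := by
    intro a b c
    have cb := hasFDerivAt_const (𝕜 := ℝ) b x
    have cc := hasFDerivAt_const (𝕜 := ℝ) c x
    have e1 := (((dH.clm_apply (p1.clm_apply cb)).clm_apply (p1.clm_apply cc))).add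
      ((u1.clm_apply cb).mul (u1.clm_apply cc))
    have e2 := (hG.diff.hasFDerivAt.clm_apply cb).clm_apply cc
    have e3 := e1.congr_of_eventuallyEq (f₁ := fun y => G y b c)
      (by filter_upwards [h] with y hy; exact hy b c)
    have e4 := congrArg (fun L => L a) (e3.unique e2)
    simp at e4
    rw [hG.compat, hH.compat] at e4
    rw [← e4, hT]
    simp only [map_add, add_apply]
    rw [hH.symm_metric (fderiv ℝ (fderiv ℝ π) x a c),
      hH.symm_metric (Γ' (π x) (fderiv ℝ π x a) (fderiv ℝ π x c))]
    ring
  have sT : ∀ a b c, T a b c = T b a c := by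
    intro a b c
    simp only [hT]
    rw [sπ.eq a b, su.eq a b, hH.symm]
  have sG : ∀ a b c, G x (Γ x a b) c = G x (Γ x b a) c := fun a b c => by rw [hG.symm]
  have sG' : ∀ a b c, G x b (Γ x a c) = G x (Γ x a c) b := fun a b c => hG.symm_metric _ _
  -- The three cyclic permutations: the first plus the second minus the third isolates one value of
  -- `T`.
  have k1 := key a b c
  have k2 := key b c a
  have k3 := key c a b
  rw [sG'] at k1 k2 k3
  linarith [sT a b c, sT b c a, sT c a b, sG a b c, sG b c a, sG c a b]

set_option maxSynthPendingDepth 5 in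
/-- Antisymmetry of the curvature of the Levi-Civita connection. -/
theorem IsLC.curvOp_skew {G : X → X →L[ℝ] X →L[ℝ] ℝ} {Γ : X → X →L[ℝ] X →L[ℝ] X} {x : X}
    (hG2 : ContDiffAt ℝ 2 G x) (hΓ : DifferentiableAt ℝ Γ x) (hLC : ∀ᶠ y in 𝓝 x, IsLC G Γ y)
    (a b c e : X) : G x (curvOp Γ x a b c) e = - G x (curvOp Γ x a b e) c := by
  have g0 := (hG2.differentiableAt (by norm_num)).hasFDerivAt
  have g1 : HasFDerivAt (fderiv ℝ G) (fderiv ℝ (fderiv ℝ G) x) x :=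
    ((hG2.fderiv_right (m := 1) (by norm_num)).differentiableAt (by norm_num)).hasFDerivAt
  have dΓ := hΓ.hasFDerivAt
  have key : ∀ a b c e, fderiv ℝ (fderiv ℝ G) x a b c e =
      G x (Γ x a (Γ x b c)) e + G x (Γ x b c) (Γ x a e) + G x (fderiv ℝ Γ x a b c) e
      + G x (Γ x a c) (Γ x b e) + G x c (Γ x a (Γ x b e)) + G x c (fderiv ℝ Γ x a b e) := by
    intro a b c e
    have cb := hasFDerivAt_const (𝕜 := ℝ) b x
    have cc := hasFDerivAt_const (𝕜 := ℝ) c x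
    have ce := hasFDerivAt_const (𝕜 := ℝ) e x
    have e1 := ((g1.clm_apply cb).clm_apply cc).clm_apply ce
    have e2 := ((g0.clm_apply ((dΓ.clm_apply cb).clm_apply cc)).clm_apply ce).add
      ((g0.clm_apply cc).clm_apply ((dΓ.clm_apply cb).clm_apply ce))
    have e3 := e1.congr_of_eventuallyEq (f₁ := fun y => G y (Γ y b c) e + G y c (Γ y b e))
      (by filter_upwards [hLC] with y hy; exact (hy.compat b c e).symm)
    have e4 := congrArg (fun L => L a) (e3.unique e2)
    simp at e4
    rw [hLC.self_of_nhds.compat, hLC.self_of_nhds.compat] at e4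
    rw [e4]
    ring
  -- The second derivative of the metric is symmetric, so the antisymmetrized derivative of the
  -- compatibility identity vanishes; the products of two Christoffel terms cancel, and the rest is
  -- the skewness.
  have s := isSymmSndFDerivAt_of_two hG2
  have k1 := key a b c e
  have k2 := key b a c e
  rw [s.eq a b, k2] at k1
  have sm := hLC.self_of_nhds.symm_metric
  simp only [curvOp, map_add, map_sub, add_apply,
    sub_apply]
  rw [sm (fderiv ℝ Γ x a b e), sm (fderiv ℝ Γ x b a e), sm (Γ x a (Γ x b e)),
    sm (Γ x b (Γ x a e))]
  linarith

end Abstract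

/-! ### Bilinear forms and traces in coordinates -/

section Bilinear

variable {d m : ℕ}

@[simp] theorem stdVec_apply (i j : Fin d) : (stdVec i : Euc d) j = if j = i then 1 else 0 := by
  simp [stdVec]

theorem eq_sum_stdVec (v : Euc d) : v = ∑ i, v i • stdVec i := by
  ext j; simp

/-- Applied to one argument after another, this reduces a multilinear identity to coordinate
vectors, where the Christoffel symbols are explicit. -/
theorem euc_induction {P : Euc d → Prop} (h0 : P 0) (hb : ∀ i, P (stdVec i))
    (ha : ∀ v w, P v → P w → P (v + w)) (hs : ∀ (c : ℝ) v, P v → P (c • v)) (v : Euc d) : P v := by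
  rw [eq_sum_stdVec v]
  exact Finset.sum_induction _ P (fun _ _ => ha _ _) h0 fun i _ => hs _ _ (hb i)

/-- The bilinear form with matrix `A`. -/
def bil (A : Matrix (Fin d) (Fin d) ℝ) : Euc d →L[ℝ] Euc d →L[ℝ] ℝ :=
  ∑ i, ∑ j, A i j • (EuclideanSpace.proj i : Euc d →L[ℝ] ℝ).smulRight
    (EuclideanSpace.proj j : Euc d →L[ℝ] ℝ)

theorem bil_apply (A : Matrix (Fin d) (Fin d) ℝ) (v w : Euc d) :
    bil A v w = ∑ i, ∑ j, A i j * (v i * w j) := by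
  simp [bil]

@[simp] theorem bil_stdVec (A : Matrix (Fin d) (Fin d) ℝ) (i j : Fin d) :
    bil A (stdVec i) (stdVec j) = A i j := by
  simp [bil_apply]

theorem bil_stdVec_right (A : Matrix (Fin d) (Fin d) ℝ) (v : Euc d) (j : Fin d) :
    bil A v (stdVec j) = ∑ i, A i j * v i := by
  simp [bil_apply]

theorem bil_stdVec_left (A : Matrix (Fin d) (Fin d) ℝ) (v : Euc d) (i : Fin d) :
    bil A (stdVec i) v = ∑ j, A i j * v j := by
  simp [bil_apply]

/-- The pairing `β` is bilinear. -/
structure IsBilin {X Y : Type*} [AddCommGroup X] [Module ℝ X] [AddCommGroup Y] [Module ℝ Y]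
    (β : X → Y → ℝ) : Prop where
  add_left : ∀ a b c, β (a + b) c = β a c + β b c
  smul_left : ∀ (r : ℝ) a c, β (r • a) c = r * β a c
  add_right : ∀ a b c, β a (b + c) = β a b + β a c
  smul_right : ∀ (r : ℝ) a c, β a (r • c) = r * β a c

theorem IsBilin.clm {X Y : Type*} [NormedAddCommGroup X] [NormedSpace ℝ X]
    [NormedAddCommGroup Y] [NormedSpace ℝ Y] (B : X →L[ℝ] Y →L[ℝ] ℝ) :
    IsBilin fun a b => B a b :=
  ⟨by simp, by simp, by simp, by simp⟩

theorem IsBilin.eq_sum {β : Euc d → Euc m → ℝ} (h : IsBilin β) (v : Euc d) (w : Euc m) :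
    β v w = ∑ i, ∑ j, v i * w j * β (stdVec i) (stdVec j) := by
  let B : Euc d →ₗ[ℝ] Euc m →ₗ[ℝ] ℝ :=
    LinearMap.mk₂ ℝ β h.add_left h.smul_left h.add_right h.smul_right
  have hB : ∀ a b, β a b = B a b := fun _ _ => rfl
  simp only [hB]
  conv_lhs => rw [eq_sum_stdVec v, eq_sum_stdVec w]
  simp only [map_sum, LinearMap.sum_apply, map_smul, LinearMap.smul_apply, smul_eq_mul,
    Finset.mul_sum]
  rw [Finset.sum_comm]
  exact Finset.sum_congr rfl fun i _ => Finset.sum_congr rfl fun j _ => by ring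

theorem IsBilin.eq_bil {β : Euc d → Euc d → ℝ} (h : IsBilin β) (v w : Euc d) :
    β v w = bil (Matrix.of fun i j => β (stdVec i) (stdVec j)) v w := by
  rw [h.eq_sum, bil_apply]
  simp [mul_comm]

/-- The contraction `P^{ij} β_{ij}`. -/
def trB (P : Matrix (Fin d) (Fin d) ℝ) (β : Euc d → Euc d → ℝ) : ℝ :=
  ∑ i, ∑ j, P i j * β (stdVec i) (stdVec j)

theorem trB_add (P : Matrix (Fin d) (Fin d) ℝ) (β γ : Euc d → Euc d → ℝ) :
    trB P (fun a b => β a b + γ a b) = trB P β + trB P γ := by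
  simp [trB, mul_add, Finset.sum_add_distrib]

theorem trB_sub (P : Matrix (Fin d) (Fin d) ℝ) (β γ : Euc d → Euc d → ℝ) :
    trB P (fun a b => β a b - γ a b) = trB P β - trB P γ := by
  simp [trB, mul_sub, Finset.sum_sub_distrib]

theorem trB_mul_left (P : Matrix (Fin d) (Fin d) ℝ) (c : ℝ) (β : Euc d → Euc d → ℝ) :
    trB P (fun a b => c * β a b) = c * trB P β := by
  simp only [trB, Finset.mul_sum]
  exact Finset.sum_congr rfl fun i _ => Finset.sum_congr rfl fun j _ => by ring

theorem trB_mul_right (P : Matrix (Fin d) (Fin d) ℝ) (c : ℝ) (β : Euc d → Euc d → ℝ) :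
    trB P (fun a b => β a b * c) = trB P β * c := by
  simp_rw [mul_comm _ c, trB_mul_left]

theorem trB_swap {P : Matrix (Fin d) (Fin d) ℝ} (hP : P.IsSymm) (β : Euc d → Euc d → ℝ) :
    trB P (fun a b => β b a) = trB P β := by
  simp only [trB]
  rw [Finset.sum_comm]
  exact Finset.sum_congr rfl fun i _ => Finset.sum_congr rfl fun j _ => by rw [hP.apply]

/-- Contraction with `L P L^T + ν ν^T`. -/
theorem trB_split {Q : Matrix (Fin m) (Fin m) ℝ} {P : Matrix (Fin d) (Fin d) ℝ}
    (L : Euc d →L[ℝ] Euc m) (ν : Euc m)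
    (hQ : ∀ i k, Q i k = (∑ a, ∑ b, P a b * (L (stdVec a) i * L (stdVec b) k)) + ν i * ν k)
    {β : Euc m → Euc m → ℝ} (hβ : IsBilin β) :
    trB Q β = trB P (fun a b => β (L a) (L b)) + β ν ν := by
  simp only [trB]
  rw [hβ.eq_sum ν ν]
  simp_rw [hβ.eq_sum (L _) (L _), hQ, add_mul, Finset.sum_add_distrib, Finset.mul_sum,
    Finset.sum_mul]
  congr 1
  have e1 : ∀ f : Fin m → Fin m → Fin d → Fin d → ℝ,
      ∑ i, ∑ j, ∑ a, ∑ b, f i j a b = ∑ a, ∑ b, ∑ i, ∑ j, f i j a b := by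
    intro f
    calc _ = ∑ i, ∑ a, ∑ j, ∑ b, f i j a b :=
          Finset.sum_congr rfl fun i _ => Finset.sum_comm
      _ = ∑ a, ∑ i, ∑ j, ∑ b, f i j a b := Finset.sum_comm
      _ = ∑ a, ∑ i, ∑ b, ∑ j, f i j a b :=
          Finset.sum_congr rfl fun a _ => Finset.sum_congr rfl fun i _ => Finset.sum_comm
      _ = _ := Finset.sum_congr rfl fun a _ => Finset.sum_comm
  rw [e1]
  exact Finset.sum_congr rfl fun a _ => Finset.sum_congr rfl fun b _ =>
    Finset.sum_congr rfl fun i _ => Finset.sum_congr rfl fun j _ => by ring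

/-- The matrix `A` is symmetric and positive definite. -/
structure IsMetric (A : Matrix (Fin d) (Fin d) ℝ) : Prop where
  symm : A.IsSymm
  pos : ∀ v : Euc d, v ≠ 0 → 0 < bil A v v

variable {A : Matrix (Fin d) (Fin d) ℝ}

theorem bil_symm (h : A.IsSymm) (v w : Euc d) : bil A v w = bil A w v := by
  rw [bil_apply, bil_apply, Finset.sum_comm]
  exact Finset.sum_congr rfl fun i _ => Finset.sum_congr rfl fun j _ => by rw [h.apply, mul_comm (v j)]

theorem IsMetric.bil_comm (h : IsMetric A) (v w : Euc d) : bil A v w = bil A w v :=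
  bil_symm h.symm v w

theorem IsMetric.det_pos (h : IsMetric A) : 0 < A.det := by
  have : A.PosDef := by
    refine Matrix.PosDef.of_dotProduct_mulVec_pos ?_ fun x hx => ?_
    · rw [Matrix.IsHermitian, Matrix.conjTranspose_eq_transpose_of_trivial]; exact h.symm
    · have := h.pos (WithLp.toLp 2 x) (by simpa using hx)
      rw [bil_apply] at this
      have e : dotProduct (star x) (A.mulVec x) = ∑ i, ∑ j, A i j * (x i * x j) := by
        simp only [dotProduct, Matrix.mulVec, Finset.mul_sum, Pi.star_apply, star_trivial]
        exact Finset.sum_congr rfl fun i _ => Finset.sum_congr rfl fun j _ => by ring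
      rw [e]
      exact this
  exact this.det_pos

theorem IsMetric.isUnit_det (h : IsMetric A) : IsUnit A.det := h.det_pos.ne'.isUnit

theorem IsMetric.inv_symm (h : IsMetric A) : A⁻¹.IsSymm := by
  rw [Matrix.IsSymm, Matrix.transpose_nonsing_inv, h.symm.eq]

theorem IsMetric.sum_inv_mul (h : IsMetric A) (i k : Fin d) :
    ∑ j, A⁻¹ i j * A j k = if i = k then 1 else 0 := by
  have := congrFun (congrFun (Matrix.nonsing_inv_mul A h.isUnit_det) i) k
  rwa [Matrix.mul_apply, Matrix.one_apply] at this

theorem IsMetric.sum_mul_inv (h : IsMetric A) (i k : Fin d) :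
    ∑ j, A i j * A⁻¹ j k = if i = k then 1 else 0 := by
  have := congrFun (congrFun (Matrix.mul_nonsing_inv A h.isUnit_det) i) k
  rwa [Matrix.mul_apply, Matrix.one_apply] at this

/-- The vector `A^{-1} α`. -/
def sharp (A : Matrix (Fin d) (Fin d) ℝ) (α : Fin d → ℝ) : Euc d :=
  WithLp.toLp 2 (A⁻¹.mulVec α)

theorem sharp_apply (α : Fin d → ℝ) (i : Fin d) : sharp A α i = ∑ j, A⁻¹ i j * α j := by
  simp [sharp, Matrix.mulVec, dotProduct]

theorem IsMetric.bil_stdVec_sharp (h : IsMetric A) (α : Fin d → ℝ) (j : Fin d) :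
    bil A (stdVec j) (sharp A α) = α j := by
  rw [bil_stdVec_left]
  simp_rw [sharp_apply, Finset.mul_sum, ← mul_assoc]
  rw [Finset.sum_comm]
  simp_rw [← Finset.sum_mul, h.sum_mul_inv]
  simp

/-- Index raising inverts index lowering. Together with `IsMetric.eq_of_bil` it lets gradients and
the flux field be handled only through their pairings with vectors. -/
theorem IsMetric.bil_sharp (h : IsMetric A) (α : Euc d →L[ℝ] ℝ) (v : Euc d) :
    bil A (sharp A fun i => α (stdVec i)) v = α v := by
  rw [h.bil_comm]
  conv_lhs => rw [eq_sum_stdVec v]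
  conv_rhs => rw [eq_sum_stdVec v]
  simp only [map_sum, map_smul, sum_apply, smul_apply,
    h.bil_stdVec_sharp]

theorem IsMetric.eq_of_bil (h : IsMetric A) {v w : Euc d} (hvw : ∀ c, bil A v c = bil A w c) :
    v = w := by
  by_contra hne
  have := h.pos (v - w) (sub_ne_zero.2 hne)
  simp [hvw] at this

/-- The trace of an endomorphism by means of a metric. -/
theorem IsMetric.sum_coord (h : IsMetric A) (L : Euc d → Euc d) :
    ∑ i, L (stdVec i) i = trB A⁻¹ fun a b => bil A (L a) b := by
  simp only [trB, bil_stdVec_right, Finset.mul_sum]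
  refine Finset.sum_congr rfl fun a _ => ?_
  rw [Finset.sum_comm]
  have : ∀ k, ∑ b, A⁻¹ a b * (A k b * L (stdVec a) k) = (if a = k then 1 else 0) * L (stdVec a) k := by
    intro k
    rw [← h.sum_inv_mul, Finset.sum_mul]
    exact Finset.sum_congr rfl fun b _ => by rw [h.symm.apply]; ring
  simp_rw [this]
  simp

/-- A rank-one form contracts to one covector evaluated at the raised other. Both `d(tr A)(∇u)` and
`|A|²` arise from traces in this way. -/
theorem trB_mul_sharp (α : Euc d →L[ℝ] ℝ) (β : Euc d →L[ℝ] ℝ) :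
    trB A⁻¹ (fun a b => α a * β b) = α (sharp A fun i => β (stdVec i)) := by
  rw [eq_sum_stdVec (sharp A fun i => β (stdVec i))]
  simp only [map_sum, map_smul, sharp_apply, smul_eq_mul, trB, Finset.sum_mul]
  exact Finset.sum_congr rfl fun i _ => Finset.sum_congr rfl fun j _ => by ring

end Bilinear

/-! ### Smoothness of determinants and inverses -/

section Smooth

variable {d : ℕ} {X : Type*} [NormedAddCommGroup X] [NormedSpace ℝ X] {s : Set X} {x : X}
  {k : WithTop ℕ∞} {A : X → Matrix (Fin d) (Fin d) ℝ}

theorem contDiffWithinAt_det (h : ∀ i j, ContDiffWithinAt ℝ k (fun y => A y i j) s x) :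
    ContDiffWithinAt ℝ k (fun y => (A y).det) s x := by
  simp only [Matrix.det_apply]
  refine ContDiffWithinAt.sum fun σ _ => ?_
  simp only [Units.smul_def, zsmul_eq_mul]
  exact contDiffWithinAt_const.mul (contDiffWithinAt_prod fun i _ => h _ _)

theorem contDiffWithinAt_inv (h : ∀ i j, ContDiffWithinAt ℝ k (fun y => A y i j) s x)
    (hd : (A x).det ≠ 0) (i j : Fin d) : ContDiffWithinAt ℝ k (fun y => (A y)⁻¹ i j) s x := by
  have e : (fun y => (A y)⁻¹ i j) = fun y => (A y).det⁻¹ * (A y).adjugate i j := by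
    funext y; simp [Matrix.inv_def, Ring.inverse_eq_inv']
  rw [e]
  refine ((contDiffWithinAt_det h).inv hd).mul ?_
  simp only [Matrix.adjugate_apply]
  refine contDiffWithinAt_det fun a b => ?_
  simp only [Matrix.updateRow_apply]
  split_ifs
  · exact contDiffWithinAt_const
  · exact h a b

theorem contDiffWithinAt_bil (h : ∀ i j, ContDiffWithinAt ℝ k (fun y => A y i j) s x) :
    ContDiffWithinAt ℝ k (fun y => bil (A y)) s x := by
  unfold bil
  exact ContDiffWithinAt.sum fun i _ => ContDiffWithinAt.sum fun j _ =>
    (h i j).smul contDiffWithinAt_const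

theorem contDiffAt_bil (h : ∀ i j, ContDiffAt ℝ k (fun y => A y i j) x) :
    ContDiffAt ℝ k (fun y => bil (A y)) x := by
  simp only [← contDiffWithinAt_univ] at *
  exact contDiffWithinAt_bil h

end Smooth

/-! ### The Levi-Civita connection in coordinates -/

section LeviCivita

variable {d : ℕ}

/-- `G` is a smooth Riemannian metric on the open set `U`. -/
structure SmoothMetricOn (G : Euc d → Matrix (Fin d) (Fin d) ℝ) (U : Set (Euc d)) : Prop where
  isOpen : IsOpen U
  smooth : ∀ i j, ContDiffOn ℝ ∞ (fun y => G y i j) U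
  metric : ∀ y ∈ U, IsMetric (G y)

/-- The Christoffel symbols as a bilinear map. -/
def chr (G : Euc d → Matrix (Fin d) (Fin d) ℝ) (x : Euc d) : Euc d →L[ℝ] Euc d →L[ℝ] Euc d :=
  ∑ k, ∑ i, ∑ j, christoffel univ G k i j x • (EuclideanSpace.proj i : Euc d →L[ℝ] ℝ).smulRight
    ((EuclideanSpace.proj j : Euc d →L[ℝ] ℝ).smulRight (stdVec k))

theorem chr_apply (G : Euc d → Matrix (Fin d) (Fin d) ℝ) (x v w : Euc d) (k : Fin d) :
    chr G x v w k = ∑ i, ∑ j, christoffel univ G k i j x * (v i * w j) := by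
  simp [chr, Finset.sum_apply]

@[simp] theorem chr_stdVec (G : Euc d → Matrix (Fin d) (Fin d) ℝ) (x : Euc d) (k i j : Fin d) :
    chr G x (stdVec i) (stdVec j) k = christoffel univ G k i j x := by
  simp [chr_apply]

variable {G : Euc d → Matrix (Fin d) (Fin d) ℝ} {U : Set (Euc d)} {x : Euc d}

theorem SmoothMetricOn.contDiffAt (h : SmoothMetricOn G U) (hx : x ∈ U) (i j : Fin d) :
    ContDiffAt ℝ ∞ (fun y => G y i j) x :=
  (h.smooth i j).contDiffAt (h.isOpen.mem_nhds hx)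

theorem SmoothMetricOn.contDiffAt_inv (h : SmoothMetricOn G U) (hx : x ∈ U) (i j : Fin d) :
    ContDiffAt ℝ ∞ (fun y => (G y)⁻¹ i j) x := by
  rw [← contDiffWithinAt_univ]
  exact contDiffWithinAt_inv (fun i j => (h.contDiffAt hx i j).contDiffWithinAt)
    (h.metric x hx).det_pos.ne' i j

theorem contDiffAt_partialD {u : Euc d → ℝ} (hu : ContDiffAt ℝ ∞ u x) (i : Fin d) :
    ContDiffAt ℝ ∞ (partialD univ u i) x := by
  unfold partialD
  simp only [fderivWithin_univ]
  exact (hu.fderiv_right (m := ∞) (by simp)).clm_apply contDiffAt_const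

theorem SmoothMetricOn.contDiffAt_christoffel (h : SmoothMetricOn G U) (hx : x ∈ U)
    (k i j : Fin d) : ContDiffAt ℝ ∞ (christoffel univ G k i j) x := by
  unfold christoffel
  refine contDiffAt_const.mul (ContDiffAt.sum fun l _ => (h.contDiffAt_inv hx _ _).mul ?_)
  exact ((contDiffAt_partialD (h.contDiffAt hx _ _) _).add
    (contDiffAt_partialD (h.contDiffAt hx _ _) _)).sub (contDiffAt_partialD (h.contDiffAt hx _ _) _)

theorem SmoothMetricOn.contDiffAt_chr (h : SmoothMetricOn G U) (hx : x ∈ U) :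
    ContDiffAt ℝ ∞ (chr G) x := by
  unfold chr
  exact ContDiffAt.sum fun k _ => ContDiffAt.sum fun i _ => ContDiffAt.sum fun j _ =>
    (h.contDiffAt_christoffel hx k i j).smul contDiffAt_const

theorem SmoothMetricOn.contDiffAt_bil (h : SmoothMetricOn G U) (hx : x ∈ U) :
    ContDiffAt ℝ ∞ (fun y => bil (G y)) x :=
  _root_.contDiffAt_bil (h.contDiffAt hx)

theorem SmoothMetricOn.fderiv_bil (h : SmoothMetricOn G U) (hx : x ∈ U) (v : Euc d)
    (i j : Fin d) : fderiv ℝ (fun y => bil (G y)) x v (stdVec i) (stdVec j)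
      = fderiv ℝ (fun y => G y i j) x v := by
  have d1 := ((h.contDiffAt_bil hx).differentiableAt (by simp)).hasFDerivAt
  have d2 := (d1.clm_apply (hasFDerivAt_const (stdVec i) x)).clm_apply
    (hasFDerivAt_const (stdVec j) x)
  simp only [bil_stdVec] at d2
  rw [d2.fderiv]
  simp

theorem SmoothMetricOn.partialD_symm (h : SmoothMetricOn G U) (hx : x ∈ U) (i j k : Fin d) :
    partialD univ (fun y => G y i j) k x = partialD univ (fun y => G y j i) k x := by
  simp only [partialD, fderivWithin_univ]
  rw [Filter.EventuallyEq.fderiv_eq]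
  filter_upwards [h.isOpen.mem_nhds hx] with y hy
  exact (h.metric y hy).symm.apply _ _

theorem SmoothMetricOn.christoffel_symm (h : SmoothMetricOn G U) (hx : x ∈ U) (k i j : Fin d) :
    christoffel univ G k i j x = christoffel univ G k j i x := by
  unfold christoffel
  congr 1
  refine Finset.sum_congr rfl fun l _ => ?_
  rw [h.partialD_symm hx i j]; ring

theorem SmoothMetricOn.chr_symm (h : SmoothMetricOn G U) (hx : x ∈ U) (a b : Euc d) :
    chr G x a b = chr G x b a := by
  ext k
  rw [chr_apply, chr_apply, Finset.sum_comm]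
  refine Finset.sum_congr rfl fun i _ => Finset.sum_congr rfl fun j _ => ?_
  rw [h.christoffel_symm hx k j i, mul_comm (a j)]

/-- Lowering the index cancels the inverse matrix in the Christoffel symbols and leaves the Koszul
formula for coordinate fields. -/
theorem SmoothMetricOn.bil_chr_stdVec (h : SmoothMetricOn G U) (hx : x ∈ U) (a b c : Fin d) :
    bil (G x) (chr G x (stdVec a) (stdVec b)) (stdVec c) =
      1 / 2 * (partialD univ (fun y => G y b c) a x + partialD univ (fun y => G y a c) b x
        - partialD univ (fun y => G y a b) c x) := by
  rw [bil_stdVec_right]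
  simp only [chr_stdVec, christoffel, Finset.mul_sum]
  rw [Finset.sum_comm]
  have : ∀ l (t : ℝ), ∑ k, G x k c * (1 / 2 * ((G x)⁻¹ k l * t))
      = (if c = l then 1 else 0) * (1 / 2 * t) := by
    intro l t
    rw [← (h.metric x hx).sum_mul_inv, Finset.sum_mul]
    exact Finset.sum_congr rfl fun k _ => by rw [(h.metric x hx).symm.apply]; ring
  simp_rw [this]
  simp

/-- On coordinate vectors compatibility is the sum of two Koszul formulas, in which all but one
derivative cancel; trilinearity does the rest. -/
theorem SmoothMetricOn.isLC (h : SmoothMetricOn G U) (hx : x ∈ U) :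
    IsLC (fun y => bil (G y)) (chr G) x where
  symm := h.chr_symm hx
  symm_metric := (h.metric x hx).bil_comm
  diff := (h.contDiffAt_bil hx).differentiableAt (by simp)
  compat := by
    intro a b c
    induction a using euc_induction with
    | h0 => simp
    | ha v w hv hw => simp only [map_add, add_apply, hv, hw]; ring
    | hs r v hv => simp only [map_smul, smul_apply, hv, smul_eq_mul]; ring
    | hb a =>
    induction b using euc_induction with
    | h0 => simp
    | ha v w hv hw => simp only [map_add, add_apply, hv, hw]; ring
    | hs r v hv => simp only [map_smul, smul_apply, hv, smul_eq_mul]; ring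
    | hb b =>
    induction c using euc_induction with
    | h0 => simp
    | ha v w hv hw => simp only [map_add, hv, hw]; ring
    | hs r v hv => simp only [map_smul, hv, smul_eq_mul]; ring
    | hb c =>
    rw [h.fderiv_bil hx, (h.metric x hx).bil_comm (stdVec b), h.bil_chr_stdVec hx,
      h.bil_chr_stdVec hx, h.partialD_symm hx c b]
    simp only [partialD, fderivWithin_univ]
    ring

/-- The curvature of the metric `G`. -/
abbrev curvG (G : Euc d → Matrix (Fin d) (Fin d) ℝ) (x a b c : Euc d) : Euc d :=
  curvOp (chr G) x a b c

theorem curvG_bilin12 (x b c : Euc d) (A : Matrix (Fin d) (Fin d) ℝ) :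
    IsBilin fun a e => bil A (curvG G x a b c) e :=
  ⟨by intros; simp [curvOp]; ring, by intros; simp [curvOp]; ring,
    by intros; simp, by intros; simp⟩

theorem curvG_bilin23 (x a e : Euc d) (A : Matrix (Fin d) (Fin d) ℝ) :
    IsBilin fun b c => bil A (curvG G x a b c) e :=
  ⟨by intros; simp [curvOp]; ring, by intros; simp [curvOp]; ring,
    by intros; simp [curvOp]; ring, by intros; simp [curvOp]; ring⟩

/-- The coordinate formula is the trace over the first argument of the curvature operator. From here
on curvature is handled as an operator, to which the Gauss and Codazzi equations apply. -/
theorem SmoothMetricOn.ricciCoeff_eq (h : SmoothMetricOn G U) (hx : x ∈ U) (j k : Fin d) :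
    ricciCoeff univ G j k x = ∑ i, curvG G x (stdVec i) (stdVec j) (stdVec k) i := by
  unfold ricciCoeff
  refine Finset.sum_congr rfl fun i _ => ?_
  have d1 := ((h.contDiffAt_chr hx).differentiableAt (by simp)).hasFDerivAt
  have D : ∀ v (k i j : Fin d), fderiv ℝ (chr G) x v (stdVec i) (stdVec j) k
      = fderiv ℝ (christoffel univ G k i j) x v := by
    intro v k i j
    have d2 := (d1.clm_apply (hasFDerivAt_const (stdVec i) x)).clm_apply
      (hasFDerivAt_const (stdVec j) x)
    have d3 := hasFDerivWithinAt_euclidean.1 (d2.hasFDerivWithinAt (s := univ)) k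
    rw [hasFDerivWithinAt_univ] at d3
    have e : (fun y => chr G y (stdVec i) (stdVec j) k) = christoffel univ G k i j := by
      funext y; simp
    rw [e] at d3
    rw [d3.fderiv]
    simp
  have Q : ∀ a b c : Fin d, chr G x (stdVec a) (chr G x (stdVec b) (stdVec c)) i
      = ∑ p, christoffel univ G i a p x * christoffel univ G p b c x := by
    intro a b c
    rw [chr_apply]
    simp
  simp only [curvOp, PiLp.add_apply, PiLp.sub_apply, D, Q, partialD, fderivWithin_univ,
    Finset.sum_sub_distrib]
  ring

theorem SmoothMetricOn.ricciCoeff_eq_trB (h : SmoothMetricOn G U) (hx : x ∈ U) (j k : Fin d) :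
    ricciCoeff univ G j k x =
      trB (G x)⁻¹ fun a e => bil (G x) (curvG G x a (stdVec j) (stdVec k)) e := by
  rw [h.ricciCoeff_eq hx]
  exact (h.metric x hx).sum_coord fun a => curvG G x a (stdVec j) (stdVec k)

theorem SmoothMetricOn.scalarCoeff_eq (h : SmoothMetricOn G U) (hx : x ∈ U) :
    scalarCoeff univ G x = trB (G x)⁻¹ fun b c => trB (G x)⁻¹ fun a e =>
      bil (G x) (curvG G x a b c) e := by
  unfold scalarCoeff
  simp_rw [h.ricciCoeff_eq_trB hx]
  rfl

theorem SmoothMetricOn.sum_ricciCoeff (h : SmoothMetricOn G U) (hx : x ∈ U) (v : Euc d) :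
    ∑ j, ∑ k, ricciCoeff univ G j k x * v j * v k =
      trB (G x)⁻¹ fun a e => bil (G x) (curvG G x a v v) e := by
  have : ∀ a e, bil (G x) (curvG G x a v v) e = ∑ j, ∑ k, v j * v k *
      bil (G x) (curvG G x a (stdVec j) (stdVec k)) e := fun a e =>
    (curvG_bilin23 x a e (G x)).eq_sum v v
  simp_rw [this, h.ricciCoeff_eq_trB hx, trB, Finset.mul_sum, Finset.sum_mul]
  have e1 : ∀ f : Fin d → Fin d → Fin d → Fin d → ℝ,
      ∑ i, ∑ j, ∑ a, ∑ b, f i j a b = ∑ a, ∑ b, ∑ i, ∑ j, f i j a b := by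
    intro f
    calc _ = ∑ i, ∑ a, ∑ j, ∑ b, f i j a b :=
          Finset.sum_congr rfl fun i _ => Finset.sum_comm
      _ = ∑ a, ∑ i, ∑ j, ∑ b, f i j a b := Finset.sum_comm
      _ = ∑ a, ∑ i, ∑ b, ∑ j, f i j a b :=
          Finset.sum_congr rfl fun a _ => Finset.sum_congr rfl fun i _ => Finset.sum_comm
      _ = _ := Finset.sum_congr rfl fun a _ => Finset.sum_comm
  rw [e1]
  exact Finset.sum_congr rfl fun a _ => Finset.sum_congr rfl fun b _ =>
    Finset.sum_congr rfl fun i _ => Finset.sum_congr rfl fun j _ => by ring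

end LeviCivita

/-! ### Derivatives of determinants and contractions -/

section Derivatives

variable {d : ℕ} {X : Type*} [NormedAddCommGroup X] [NormedSpace ℝ X]

/-- Jacobi's formula. -/
theorem hasFDerivAt_det {A : X → Matrix (Fin d) (Fin d) ℝ} {A' : Fin d → Fin d → X →L[ℝ] ℝ} {x : X}
    (h : ∀ i j, HasFDerivAt (fun y => A y i j) (A' i j) x) :
    HasFDerivAt (fun y => (A y).det) (∑ i, ∑ j, (A x).adjugate j i • A' i j) x := by
  let f : ContinuousMultilinearMap ℝ (fun _ : Fin d => Fin d → ℝ) ℝ :=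
    ⟨Matrix.detRowAlternating.toMultilinearMap, continuous_id.matrix_det⟩
  have hrow : ∀ i, HasFDerivAt (fun y => A y i) (ContinuousLinearMap.pi fun j => A' i j) x :=
    fun i => hasFDerivAt_pi.2 fun j => h i j
  have := HasFDerivAt.multilinear_comp f hrow
  refine this.congr_fderiv ?_
  ext v
  simp only [sum_apply, ContinuousLinearMap.comp_apply, smul_apply, smul_eq_mul]
  refine Finset.sum_congr rfl fun i _ => ?_
  -- The derivative of the determinant in its `i`-th row is the determinant with this row replaced;
  -- Cramer's rule expresses it through the adjugate.
  have e1 : (f.toContinuousLinearMap (fun j => A x j) i)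
      ((ContinuousLinearMap.pi fun j => A' i j) v) =
      ((A x).updateRow i fun j => A' i j v).det := rfl
  rw [e1, ← Matrix.det_transpose, ← Matrix.updateCol_transpose, ← Matrix.cramer_apply,
    Matrix.cramer_eq_adjugate_mulVec, ← Matrix.adjugate_transpose]
  rfl

theorem fderiv_det {A : X → Matrix (Fin d) (Fin d) ℝ} {x : X}
    (h : ∀ i j, DifferentiableAt ℝ (fun y => A y i j) x) (hd : (A x).det ≠ 0) (v : X) :
    fderiv ℝ (fun y => (A y).det) x v
      = (A x).det * ∑ i, ∑ j, (A x)⁻¹ j i * fderiv ℝ (fun y => A y i j) x v := by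
  rw [(hasFDerivAt_det fun i j => (h i j).hasFDerivAt).fderiv]
  simp only [sum_apply, smul_apply, smul_eq_mul, Finset.mul_sum, Matrix.inv_def,
    Ring.inverse_eq_inv', Matrix.smul_apply]
  refine Finset.sum_congr rfl fun i _ => Finset.sum_congr rfl fun j _ => ?_
  field_simp

/-- The derivative of the inverse matrix. -/
theorem fderiv_inv_apply {A : X → Matrix (Fin d) (Fin d) ℝ} {x : X}
    (h : ∀ i j, ContDiffAt ℝ 1 (fun y => A y i j) x) (hd : (A x).det ≠ 0) (v : X) (i j : Fin d) :
    fderiv ℝ (fun y => (A y)⁻¹ i j) x v =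
      - ((A x)⁻¹ * (Matrix.of fun k l => fderiv ℝ (fun y => A y k l) x v) * (A x)⁻¹) i j := by
  have hinv : ∀ i j, ContDiffAt ℝ 1 (fun y => (A y)⁻¹ i j) x := fun i j => by
    rw [← contDiffWithinAt_univ]
    exact contDiffWithinAt_inv (fun i j => (h i j).contDiffWithinAt) hd i j
  have hdet : ∀ᶠ y in 𝓝 x, (A y).det ≠ 0 := by
    have : ContinuousAt (fun y => (A y).det) x := by
      have := contDiffWithinAt_det (s := univ) fun i j => (h i j).contDiffWithinAt
      exact (contDiffWithinAt_univ.1 this).continuousAt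
    exact this.eventually_ne hd
  set DP : Matrix (Fin d) (Fin d) ℝ := Matrix.of fun k l => fderiv ℝ (fun y => (A y)⁻¹ k l) x v
  set DA : Matrix (Fin d) (Fin d) ℝ := Matrix.of fun k l => fderiv ℝ (fun y => A y k l) x v
  -- The product rule for `A⁻¹ A = 1`, an identity that persists near `x` because the determinant
  -- stays nonzero.
  have e : DP * A x + (A x)⁻¹ * DA = 0 := by
    ext a b
    have d1 : HasFDerivAt (fun y => ∑ k, (A y)⁻¹ a k * A y k b)
        (∑ k, ((A x)⁻¹ a k • fderiv ℝ (fun y => A y k b) x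
          + A x k b • fderiv ℝ (fun y => (A y)⁻¹ a k) x)) x :=
      HasFDerivAt.fun_sum fun k _ => ((hinv a k).differentiableAt (by simp)).hasFDerivAt.mul
        ((h k b).differentiableAt (by simp)).hasFDerivAt
    have d2 : (fun y => ∑ k, (A y)⁻¹ a k * A y k b) =ᶠ[𝓝 x] fun _ =>
        (1 : Matrix (Fin d) (Fin d) ℝ) a b := by
      filter_upwards [hdet] with y hy
      rw [← Matrix.nonsing_inv_mul (A y) hy.isUnit, Matrix.mul_apply]
    have d3 := d2.fderiv_eq (𝕜 := ℝ)
    rw [d1.fderiv, fderiv_const_apply] at d3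
    have d4 := congrArg (fun L => L v) d3
    simp only [sum_apply, add_apply, smul_apply, smul_eq_mul, zero_apply,
      Finset.sum_add_distrib] at d4
    rw [Matrix.add_apply, Matrix.mul_apply, Matrix.mul_apply, Matrix.zero_apply, ← d4, add_comm]
    congr 1
    exact Finset.sum_congr rfl fun k _ => by simp [DP]; ring
  have e2 : DP = - ((A x)⁻¹ * DA * (A x)⁻¹) := by
    have := congrArg (fun B => B * (A x)⁻¹) e
    simp only [add_mul, zero_mul, Matrix.mul_assoc, Matrix.mul_nonsing_inv _ hd.isUnit,
      Matrix.mul_one] at this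
    rw [Matrix.mul_assoc]
    exact eq_neg_of_add_eq_zero_left this
  exact congrFun (congrFun e2 i) j

variable {G : Euc d → Matrix (Fin d) (Fin d) ℝ} {U : Set (Euc d)} {x : Euc d}

/-- A contraction is differentiated by means of the covariant derivative. -/
theorem SmoothMetricOn.fderiv_trB (h : SmoothMetricOn G U) (hx : x ∈ U)
    {A : Euc d → Matrix (Fin d) (Fin d) ℝ}
    (hA : ∀ i j, DifferentiableAt ℝ (fun y => A y i j) x) (v : Euc d) :
    fderiv ℝ (fun y => trB (G y)⁻¹ fun a b => bil (A y) a b) x v =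
      trB (G x)⁻¹ fun a b => fderiv ℝ (fun y => bil (A y)) x v a b
        - bil (A x) (chr G x v a) b - bil (A x) a (chr G x v b) := by
  have hm := h.metric x hx
  have hP := fun i j => ((h.contDiffAt_inv hx i j).differentiableAt (by simp)).hasFDerivAt
  have d1 : HasFDerivAt (fun y => trB (G y)⁻¹ fun a b => bil (A y) a b)
      (∑ i, ∑ j, ((G x)⁻¹ i j • fderiv ℝ (fun y => A y i j) x
        + A x i j • fderiv ℝ (fun y => (G y)⁻¹ i j) x)) x := by
    simp only [trB, bil_stdVec]
    exact HasFDerivAt.fun_sum fun i _ => HasFDerivAt.fun_sum fun j _ =>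
      (hP i j).mul (hA i j).hasFDerivAt
  have hbA : DifferentiableAt ℝ (fun y => bil (A y)) x := by
    unfold bil
    exact DifferentiableAt.fun_sum fun i _ => DifferentiableAt.fun_sum fun j _ =>
      (hA i j).smul_const _
  have hDA : ∀ i j, fderiv ℝ (fun y => bil (A y)) x v (stdVec i) (stdVec j)
      = fderiv ℝ (fun y => A y i j) x v := by
    intro i j
    have d2 := (hbA.hasFDerivAt.clm_apply (hasFDerivAt_const (stdVec i) x)).clm_apply
      (hasFDerivAt_const (stdVec j) x)
    simp only [bil_stdVec] at d2
    rw [d2.fderiv]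
    simp
  -- The matrix of `chr G x v`. Compatibility reads `∂_v G = Mᵀ G + G M`, hence `∂_v G⁻¹ = -(M G⁻¹ +
  -- G⁻¹ Mᵀ)`, and these two terms are the connection terms of the covariant derivative.
  set Mx : Matrix (Fin d) (Fin d) ℝ := Matrix.of fun i k => chr G x v (stdVec k) i with hMx
  have hDG : (Matrix.of fun k l => fderiv ℝ (fun y => G y k l) x v)
      = Mx.transpose * G x + G x * Mx := by
    ext k l
    have := (h.isLC hx).compat v (stdVec k) (stdVec l)
    rw [h.fderiv_bil hx, bil_stdVec_right, bil_stdVec_left] at this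
    rw [Matrix.of_apply, this, Matrix.add_apply, Matrix.mul_apply, Matrix.mul_apply]
    congr 1
    exact Finset.sum_congr rfl fun i _ => by simp [hMx, mul_comm]
  have hDP : ∀ i j, fderiv ℝ (fun y => (G y)⁻¹ i j) x v =
      - ((Mx * (G x)⁻¹) i j + ((G x)⁻¹ * Mx.transpose) i j) := by
    intro i j
    rw [fderiv_inv_apply (fun i j => (h.contDiffAt hx i j).of_le (by simp)) hm.det_pos.ne', hDG,
      Matrix.mul_add, Matrix.add_mul, Matrix.add_apply]
    rw [← Matrix.mul_assoc, Matrix.mul_assoc _ (G x) (G x)⁻¹,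
      Matrix.mul_nonsing_inv _ hm.isUnit_det, Matrix.mul_one, ← Matrix.mul_assoc,
      Matrix.nonsing_inv_mul _ hm.isUnit_det, Matrix.one_mul]
    ring
  rw [d1.fderiv]
  simp only [sum_apply, add_apply, smul_apply, smul_eq_mul, hDP]
  rw [trB_sub, trB_sub]
  have t1 : trB (G x)⁻¹ (fun a b => bil (A x) (chr G x v a) b)
      = ∑ i, ∑ j, A x i j * (Mx * (G x)⁻¹) i j := by
    simp only [trB, bil_stdVec_right, Matrix.mul_apply, Finset.mul_sum]
    calc _ = ∑ a, ∑ i, ∑ b, (G x)⁻¹ a b * (A x i b * chr G x v (stdVec a) i) :=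
          Finset.sum_congr rfl fun a _ => Finset.sum_comm
      _ = ∑ i, ∑ a, ∑ b, (G x)⁻¹ a b * (A x i b * chr G x v (stdVec a) i) := Finset.sum_comm
      _ = ∑ i, ∑ b, ∑ a, (G x)⁻¹ a b * (A x i b * chr G x v (stdVec a) i) :=
          Finset.sum_congr rfl fun i _ => Finset.sum_comm
      _ = _ := Finset.sum_congr rfl fun i _ => Finset.sum_congr rfl fun b _ =>
          Finset.sum_congr rfl fun a _ => by simp [hMx]; ring
  have t2 : trB (G x)⁻¹ (fun a b => bil (A x) a (chr G x v b))
      = ∑ i, ∑ j, A x i j * ((G x)⁻¹ * Mx.transpose) i j := by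
    simp only [trB, bil_stdVec_left, Matrix.mul_apply, Finset.mul_sum]
    refine Finset.sum_congr rfl fun i _ => ?_
    rw [Finset.sum_comm]
    exact Finset.sum_congr rfl fun j _ => Finset.sum_congr rfl fun a _ => by simp [hMx]; ring
  rw [t1, t2]
  simp only [trB, hDA, Finset.sum_add_distrib, mul_neg, mul_add, Finset.sum_neg_distrib]
  ring

/-- The divergence of a vector field. -/
theorem SmoothMetricOn.divergence (h : SmoothMetricOn G U) (hx : x ∈ U) {W : Euc d → Euc d}
    (hW : DifferentiableAt ℝ W x) :
    ∑ i, partialD univ (fun y => Real.sqrt (G y).det * W y i) i x =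
      Real.sqrt (G x).det *
        trB (G x)⁻¹ fun a b => bil (G x) (fderiv ℝ W x a + chr G x a (W x)) b := by
  have hm := h.metric x hx
  have hdd := hasFDerivAt_det
    (fun i j => ((h.contDiffAt hx i j).differentiableAt (by simp)).hasFDerivAt)
  have hs := hdd.sqrt hm.det_pos.ne'
  -- The logarithmic derivative of the volume density is the trace of the Christoffel symbols, by
  -- Jacobi's formula and compatibility.
  have htr : ∀ v, fderiv ℝ (fun y => Real.sqrt (G y).det) x v
      = Real.sqrt (G x).det * ∑ i, chr G x v (stdVec i) i := by
    intro v
    have e0 := fderiv_det (fun i j => (h.contDiffAt hx i j).differentiableAt (by simp))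
      hm.det_pos.ne' v
    rw [hdd.fderiv] at e0
    rw [hs.fderiv, smul_apply, e0, hm.sum_coord fun a => chr G x v a]
    have e1 : ∑ i, ∑ j, (G x)⁻¹ j i * fderiv ℝ (fun y => G y i j) x v
        = 2 * trB (G x)⁻¹ fun a b => bil (G x) (chr G x v a) b := by
      have : ∑ i, ∑ j, (G x)⁻¹ j i * fderiv ℝ (fun y => G y i j) x v =
          trB (G x)⁻¹ fun a b => bil (G x) (chr G x v a) b + bil (G x) a (chr G x v b) := by
        refine Finset.sum_congr rfl fun i _ => Finset.sum_congr rfl fun j _ => ?_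
        rw [hm.inv_symm.apply, ← h.fderiv_bil hx, (h.isLC hx).compat]
      rw [this, trB_add, two_mul]
      congr 1
      rw [← trB_swap hm.inv_symm]
      simp only [trB, hm.bil_comm]
    rw [e1, smul_eq_mul]
    have : Real.sqrt (G x).det * Real.sqrt (G x).det = (G x).det :=
      Real.mul_self_sqrt hm.det_pos.le
    have hpos := Real.sqrt_pos.2 hm.det_pos
    field_simp
    rw [sq, this]
  have hWi : ∀ i, HasFDerivAt (fun y => W y i) (PiLp.proj 2 (fun _ => ℝ) i ∘L fderiv ℝ W x) x := by
    intro i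
    have := hasFDerivWithinAt_euclidean.1 (hW.hasFDerivAt.hasFDerivWithinAt (s := univ)) i
    rwa [hasFDerivWithinAt_univ] at this
  have e : ∀ i, partialD univ (fun y => Real.sqrt (G y).det * W y i) i x =
      Real.sqrt (G x).det * (fderiv ℝ W x (stdVec i) i + W x i *
        ∑ k, chr G x (stdVec i) (stdVec k) k) := by
    intro i
    have := (hs.differentiableAt.hasFDerivAt.fun_mul (hWi i)).fderiv
    simp only [partialD, fderivWithin_univ]
    rw [this]
    simp only [add_apply, smul_apply, smul_eq_mul, ContinuousLinearMap.comp_apply]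
    rw [htr]
    simp
    ring
  rw [← hm.sum_coord fun a => fderiv ℝ W x a + chr G x a (W x)]
  simp_rw [e, ← Finset.mul_sum, PiLp.add_apply, Finset.sum_add_distrib]
  congr 2
  have : ∀ k, chr G x (stdVec k) (W x) k = ∑ i, W x i * chr G x (stdVec i) (stdVec k) k := by
    intro k
    rw [h.chr_symm hx]
    conv_lhs => rw [eq_sum_stdVec (W x)]
    simp [Finset.sum_apply]
  simp_rw [this, Finset.mul_sum]
  exact Finset.sum_comm

end Derivatives

theorem two_le_smooth : (2 : WithTop ℕ∞) ≤ ∞ :=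
  WithTop.coe_le_coe.2 (le_top : (2 : ℕ∞) ≤ ⊤)

theorem three_le_smooth : (3 : WithTop ℕ∞) ≤ ∞ :=
  WithTop.coe_le_coe.2 (le_top : (3 : ℕ∞) ≤ ⊤)

theorem one_add_one_le_smooth : (1 + 1 : WithTop ℕ∞) ≤ ∞ := by
  rw [one_add_one_eq_two]; exact two_le_smooth

/-! ### Hypersurfaces of a product with a line: linear algebra at a point -/

section Point

variable {n : ℕ}

/-- `(L, du)` is an isometric embedding of `(ℝ^n, G)` in `(ℝ^n × ℝ, H + dt²)` with unit normal
`(ν, θ)`. -/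
structure IsHypPoint (G H : Matrix (Fin n) (Fin n) ℝ) (L : Euc n →L[ℝ] Euc n) (du : Euc n →L[ℝ] ℝ)
    (ν : Euc n) (θ : ℝ) : Prop where
  metricG : IsMetric G
  metricH : IsMetric H
  isometric : ∀ a b, bil G a b = bil H (L a) (L b) + du a * du b
  unit : bil H ν ν + θ * θ = 1
  orth : ∀ a, bil H ν (L a) + θ * du a = 0

variable {G H : Matrix (Fin n) (Fin n) ℝ} {L : Euc n →L[ℝ] Euc n} {du : Euc n →L[ℝ] ℝ}
  {ν : Euc n} {θ : ℝ}

/-- The map `(v, r) ↦ dF v + r N` is injective between spaces of the same dimension, hence onto; the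
coefficient of `N` is found by pairing with `N`. -/
theorem IsHypPoint.exists_decomp (h : IsHypPoint G H L du ν θ) (p : Euc n) (t : ℝ) :
    ∃ v, p = L v + (bil H p ν + t * θ) • ν ∧ t = du v + (bil H p ν + t * θ) * θ := by
  let B : (Euc n × ℝ) →ₗ[ℝ] (Euc n × ℝ) :=
    { toFun := fun z => (L z.1 + z.2 • ν, du z.1 + z.2 * θ)
      map_add' := by intro a b; simp [add_smul, add_mul]; constructor <;> abel
      map_smul' := by intro r a; simp [mul_smul]; ring }
  have orth' : ∀ a, bil H (L a) ν + θ * du a = 0 := fun a => by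
    rw [h.metricH.bil_comm]; exact h.orth a
  have hinj : Function.Injective B := by
    rw [injective_iff_map_eq_zero]
    rintro ⟨v, r⟩ hv
    simp only [LinearMap.coe_mk, AddHom.coe_mk, Prod.mk_eq_zero, B] at hv
    obtain ⟨h1, h2⟩ := hv
    have hr : r = 0 := by
      have e1 : bil H (L v + r • ν) ν + (du v + r * θ) * θ = 0 := by rw [h1, h2]; simp
      simp only [map_add, map_smul, add_apply, smul_apply, smul_eq_mul] at e1
      linear_combination e1 - orth' v - r * h.unit
    subst hr
    simp only [zero_smul, add_zero, zero_mul] at h1 h2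
    have : v = 0 := by
      by_contra hne
      have := h.metricG.pos v hne
      rw [h.isometric, h1, h2] at this
      simp at this
    simp [this]
  obtain ⟨⟨v, r⟩, hv⟩ := LinearMap.injective_iff_surjective.1 hinj (p, t)
  simp only [LinearMap.coe_mk, AddHom.coe_mk, Prod.mk.injEq, B] at hv
  obtain ⟨h1, h2⟩ := hv
  have hr : bil H p ν + t * θ = r := by
    rw [← h1, ← h2]
    simp only [map_add, map_smul, add_apply, smul_apply, smul_eq_mul]
    linear_combination orth' v + r * h.unit
  exact ⟨v, by rw [hr, h1], by rw [hr, h2]⟩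

/-- A vector orthogonal to the hypersurface is a multiple of the normal. -/
theorem IsHypPoint.eq_normal (h : IsHypPoint G H L du ν θ) {p : Euc n} {t : ℝ}
    (hp : ∀ c, bil H p (L c) + t * du c = 0) :
    p = (bil H p ν + t * θ) • ν ∧ t = (bil H p ν + t * θ) * θ := by
  obtain ⟨v, h1, h2⟩ := h.exists_decomp p t
  set r := bil H p ν + t * θ
  have hv : v = 0 := by
    by_contra hne
    have e := h.metricG.pos v hne
    have e1 := hp v
    rw [h1, h2] at e1
    simp only [map_add, map_smul, add_apply, smul_apply, smul_eq_mul] at e1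
    rw [h.isometric] at e
    have := h.orth v
    have e2 : r * (bil H ν (L v) + θ * du v) = 0 := by rw [this, mul_zero]
    linarith
  subst hv
  simpa using And.intro h1 h2

/-- The inverse of the product metric is the push-forward of `G⁻¹` plus `N ⊗ N`, and this is its
horizontal block. It follows by decomposing the horizontal vector dual to the `k`-th coordinate. -/
theorem IsHypPoint.inv_split (h : IsHypPoint G H L du ν θ) (i k : Fin n) :
    H⁻¹ i k = (∑ a, ∑ b, G⁻¹ a b * (L (stdVec a) i * L (stdVec b) k)) + ν i * ν k := by
  let p : Euc n := sharp H fun j => if j = k then 1 else 0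
  have hp : ∀ w : Euc n, bil H p w = w k := fun w => by
    have := h.metricH.bil_sharp (EuclideanSpace.proj k : Euc n →L[ℝ] ℝ) w
    simp only [PiLp.proj_apply, stdVec_apply] at this
    simp only [p]
    rw [← this]
    congr 3
    funext j
    simp [eq_comm]
  obtain ⟨v, h1, h2⟩ := h.exists_decomp p 0
  have hv : v = sharp G fun b => L (stdVec b) k := by
    refine h.metricG.eq_of_bil fun c => ?_
    have e := h.metricG.bil_sharp ((EuclideanSpace.proj k : Euc n →L[ℝ] ℝ) ∘L L) c
    simp only [ContinuousLinearMap.comp_apply, PiLp.proj_apply] at e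
    rw [e, h.isometric, ← hp (L c)]
    rw [h1]
    simp only [map_add, map_smul, add_apply, smul_apply, smul_eq_mul]
    have := h.orth c
    linear_combination (-(bil H p ν + 0 * θ)) * this - du c * h2
  have e := congrArg (fun w : Euc n => w i) h1
  simp only [PiLp.add_apply, PiLp.smul_apply, smul_eq_mul, zero_mul, add_zero, hp ν] at e
  have e0 : p i = H⁻¹ i k := by simp [p, sharp_apply]
  rw [← e0, e, hv, mul_comm (ν k)]
  congr 1
  conv_lhs => rw [eq_sum_stdVec (sharp G _)]
  simp only [map_sum, map_smul, PiLp.smul_apply, smul_eq_mul, WithLp.ofLp_sum, Finset.sum_apply]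
  refine Finset.sum_congr rfl fun a _ => ?_
  rw [sharp_apply, Finset.sum_mul]
  exact Finset.sum_congr rfl fun b _ => by ring

/-- The vertical vector decomposes into its tangential part and a multiple of the normal. -/
theorem IsHypPoint.vertical_split (h : IsHypPoint G H L du ν θ) :
    L (sharp G fun i => du (stdVec i)) = - θ • ν ∧
      du (sharp G fun i => du (stdVec i)) = 1 - θ * θ := by
  obtain ⟨v, h1, h2⟩ := h.exists_decomp 0 1
  simp only [map_zero, zero_apply, zero_add, one_mul] at h1 h2
  have hv : v = sharp G fun i => du (stdVec i) := by
    refine h.metricG.eq_of_bil fun c => ?_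
    rw [h.metricG.bil_sharp, h.isometric]
    have e : L v = - θ • ν := by rw [neg_smul]; exact eq_neg_of_add_eq_zero_left h1.symm
    rw [e]
    simp only [map_smul, smul_apply, smul_eq_mul]
    linear_combination (-θ) * h.orth c - du c * h2
  rw [← hv]
  constructor
  · rw [neg_smul]; exact eq_neg_of_add_eq_zero_left h1.symm
  · linarith

/-- Traces over `E` become traces over `M` plus a normal term. Only horizontal components occur,
because the vertical direction carries no curvature. -/
theorem IsHypPoint.trB_split (h : IsHypPoint G H L du ν θ) {β : Euc n → Euc n → ℝ}
    (hβ : IsBilin β) : trB H⁻¹ β = trB G⁻¹ (fun a b => β (L a) (L b)) + β ν ν :=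
  _root_.trB_split L ν h.inv_split hβ

end Point

/-! ### The second fundamental form and the flux field -/

section Hypersurface

variable {d n : ℕ}

/-- The second fundamental form of `(π, u)` with respect to `(ν, θ)`. -/
def secondForm (s : Set (Euc d)) (H : Euc n → Matrix (Fin n) (Fin n) ℝ) (π : Euc d → Euc n)
    (u : Euc d → ℝ) (ν : Euc n) (θ : ℝ) (x a b : Euc d) : ℝ :=
  bil (H (π x)) (fderivWithin ℝ (fderivWithin ℝ π s) s x a b
      + chr H (π x) (fderivWithin ℝ π s x a) (fderivWithin ℝ π s x b)) ν
    + fderivWithin ℝ (fderivWithin ℝ u s) s x a b * θ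

theorem secondForm_bilin (s : Set (Euc d)) (H : Euc n → Matrix (Fin n) (Fin n) ℝ)
    (π : Euc d → Euc n) (u : Euc d → ℝ) (ν : Euc n) (θ : ℝ) (x : Euc d) :
    IsBilin (secondForm s H π u ν θ x) :=
  ⟨by intros; simp [secondForm]; ring, by intros; simp [secondForm]; ring,
    by intros; simp [secondForm]; ring, by intros; simp [secondForm]; ring⟩

/-- The matrix of the second fundamental form. -/
def sffMatrix (s : Set (Euc d)) (H : Euc n → Matrix (Fin n) (Fin n) ℝ) (π : Euc d → Euc n)
    (u : Euc d → ℝ) (ν : Euc n) (θ : ℝ) (x : Euc d) : Matrix (Fin d) (Fin d) ℝ :=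
  Matrix.of fun i j => secondForm s H π u ν θ x (stdVec i) (stdVec j)

theorem bil_sffMatrix (s : Set (Euc d)) (H : Euc n → Matrix (Fin n) (Fin n) ℝ) (π : Euc d → Euc n)
    (u : Euc d → ℝ) (ν : Euc n) (θ : ℝ) (x a b : Euc d) :
    bil (sffMatrix s H π u ν θ x) a b = secondForm s H π u ν θ x a b :=
  ((secondForm_bilin s H π u ν θ x).eq_bil a b).symm

/-- The vector `(tr A) ∇u - A ∇u`, where `w` holds the partial derivatives of `u`. -/
def newtonField (G A : Matrix (Fin d) (Fin d) ℝ) (w : Fin d → ℝ) : Euc d :=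
  sharp G fun i => trB G⁻¹ (fun a b => bil A a b) * w i - bil A (stdVec i) (sharp G w)

variable {G H : Euc n → Matrix (Fin n) (Fin n) ℝ} {U U' : Set (Euc n)} {π ν : Euc n → Euc n}
  {u θ : Euc n → ℝ} {x : Euc n}

/-- `(π, u)` is a smooth isometric immersion of `(U, G)` in `(U', H) × ℝ` with unit normal
`(ν, θ)`. -/
structure IsHypOn (G H : Euc n → Matrix (Fin n) (Fin n) ℝ) (U U' : Set (Euc n))
    (π : Euc n → Euc n) (u : Euc n → ℝ) (ν : Euc n → Euc n) (θ : Euc n → ℝ) : Prop where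
  smoothG : SmoothMetricOn G U
  smoothH : SmoothMetricOn H U'
  maps : ∀ y ∈ U, π y ∈ U'
  smooth_π : ContDiffOn ℝ ∞ π U
  smooth_u : ContDiffOn ℝ ∞ u U
  smooth_ν : ContDiffOn ℝ ∞ ν U
  smooth_θ : ContDiffOn ℝ ∞ θ U
  point : ∀ y ∈ U, IsHypPoint (G y) (H (π y)) (fderiv ℝ π y) (fderiv ℝ u y) (ν y) (θ y)

/-- The second fundamental form along the hypersurface. -/
abbrev IsHypOn.sff (_ : IsHypOn G H U U' π u ν θ) (y : Euc n) : Matrix (Fin n) (Fin n) ℝ :=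
  sffMatrix univ H π u (ν y) (θ y) y

namespace IsHypOn

variable (h : IsHypOn G H U U' π u ν θ) (hx : x ∈ U)
include h hx

theorem nhds : U ∈ 𝓝 x := h.smoothG.isOpen.mem_nhds hx

theorem cπ : ContDiffAt ℝ ∞ π x := h.smooth_π.contDiffAt (h.nhds hx)
theorem cu : ContDiffAt ℝ ∞ u x := h.smooth_u.contDiffAt (h.nhds hx)
theorem cν : ContDiffAt ℝ ∞ ν x := h.smooth_ν.contDiffAt (h.nhds hx)
theorem cθ : ContDiffAt ℝ ∞ θ x := h.smooth_θ.contDiffAt (h.nhds hx)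

omit hx in
theorem sff_apply (a b : Euc n) : bil (h.sff x) a b =
    bil (H (π x)) (fderiv ℝ (fderiv ℝ π) x a b
      + chr H (π x) (fderiv ℝ π x a) (fderiv ℝ π x b)) (ν x)
    + fderiv ℝ (fderiv ℝ u) x a b * θ x := by
  rw [bil_sffMatrix]
  simp only [secondForm, fderivWithin_univ]

theorem sff_contDiffAt (i j : Fin n) : ContDiffAt ℝ ∞ (fun y => h.sff y i j) x := by
  have cπ' : ContDiffAt ℝ ∞ (fderiv ℝ π) x := (h.cπ hx).fderiv_right (by simp)
  have cπ'' : ContDiffAt ℝ ∞ (fderiv ℝ (fderiv ℝ π)) x := cπ'.fderiv_right (by simp)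
  have cu' : ContDiffAt ℝ ∞ (fderiv ℝ u) x := (h.cu hx).fderiv_right (by simp)
  have cu'' : ContDiffAt ℝ ∞ (fderiv ℝ (fderiv ℝ u)) x := cu'.fderiv_right (by simp)
  have cH : ContDiffAt ℝ ∞ (fun y => bil (H (π y))) x :=
    (h.smoothH.contDiffAt_bil (h.maps x hx)).comp x (h.cπ hx)
  have cΓ : ContDiffAt ℝ ∞ (fun y => chr H (π y)) x :=
    (h.smoothH.contDiffAt_chr (h.maps x hx)).comp x (h.cπ hx)
  have c := contDiffAt_const (𝕜 := ℝ) (n := ∞) (c := (stdVec i : Euc n)) (x := x)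
  have c' := contDiffAt_const (𝕜 := ℝ) (n := ∞) (c := (stdVec j : Euc n)) (x := x)
  simp only [sff, sffMatrix, Matrix.of_apply, secondForm, fderivWithin_univ]
  exact ((cH.clm_apply (((cπ''.clm_apply c).clm_apply c').add
    ((cΓ.clm_apply (cπ'.clm_apply c)).clm_apply (cπ'.clm_apply c')))).clm_apply (h.cν hx)).add
    (((cu''.clm_apply c).clm_apply c').mul (h.cθ hx))

theorem sff_symm (a b : Euc n) : bil (h.sff x) a b = bil (h.sff x) b a := by
  rw [h.sff_apply, h.sff_apply,
    (isSymmSndFDerivAt_of_two ((h.cπ hx).of_le two_le_smooth)).eq,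
    (isSymmSndFDerivAt_of_two ((h.cu hx).of_le two_le_smooth)).eq, h.smoothH.chr_symm (h.maps x hx)]

/-- The Gauss formula. -/
theorem gauss_formula (a b : Euc n) :
    fderiv ℝ (fderiv ℝ π) x a b + chr H (π x) (fderiv ℝ π x a) (fderiv ℝ π x b)
        = fderiv ℝ π x (chr G x a b) + bil (h.sff x) a b • ν x ∧
      fderiv ℝ (fderiv ℝ u) x a b
        = fderiv ℝ u x (chr G x a b) + bil (h.sff x) a b * θ x := by
  have hp := h.point x hx
  -- By `IsLC.immersion` the tangential part of the second covariant derivative is the Levi-Civita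
  -- connection of `G`, so the difference is orthogonal to the hypersurface and thus a multiple of
  -- the normal.
  have key : ∀ c, bil (H (π x)) (fderiv ℝ (fderiv ℝ π) x a b
      + chr H (π x) (fderiv ℝ π x a) (fderiv ℝ π x b) - fderiv ℝ π x (chr G x a b))
      (fderiv ℝ π x c)
      + (fderiv ℝ (fderiv ℝ u) x a b - fderiv ℝ u x (chr G x a b)) * fderiv ℝ u x c = 0 := by
    intro c
    have e := (h.smoothG.isLC hx).immersion (π := π) (u := u) (h.smoothH.isLC (h.maps x hx))
      ((h.cπ hx).of_le two_le_smooth) ((h.cu hx).of_le two_le_smooth)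
      (by filter_upwards [h.nhds hx] with y hy; exact (h.point y hy).isometric) a b c
    rw [hp.isometric] at e
    rw [map_sub, sub_apply]
    linear_combination e
  have e := hp.eq_normal key
  have hA : bil (H (π x)) (fderiv ℝ (fderiv ℝ π) x a b
      + chr H (π x) (fderiv ℝ π x a) (fderiv ℝ π x b) - fderiv ℝ π x (chr G x a b)) (ν x)
      + (fderiv ℝ (fderiv ℝ u) x a b - fderiv ℝ u x (chr G x a b)) * θ x
      = bil (h.sff x) a b := by
    rw [h.sff_apply, map_sub, sub_apply, hp.metricH.bil_comm (fderiv ℝ π x (chr G x a b))]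
    linear_combination -hp.orth (chr G x a b)
  rw [hA] at e
  exact ⟨by rw [← e.1]; abel, by rw [← e.2]; ring⟩

/-- The Weingarten formula and the derivative of the normalization. -/
theorem weingarten (a b : Euc n) :
    bil (H (π x)) (fderiv ℝ ν x a + chr H (π x) (fderiv ℝ π x a) (ν x)) (fderiv ℝ π x b)
        + fderiv ℝ θ x a * fderiv ℝ u x b = - bil (h.sff x) a b ∧
      bil (H (π x)) (fderiv ℝ ν x a + chr H (π x) (fderiv ℝ π x a) (ν x)) (ν x)
        + fderiv ℝ θ x a * θ x = 0 := by
  have p0 := ((h.cπ hx).differentiableAt (by simp)).hasFDerivAt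
  have p1 : HasFDerivAt (fderiv ℝ π) (fderiv ℝ (fderiv ℝ π) x) x :=
    (((h.cπ hx).fderiv_right (m := 1) one_add_one_le_smooth).differentiableAt (by simp)).hasFDerivAt
  have u1 : HasFDerivAt (fderiv ℝ u) (fderiv ℝ (fderiv ℝ u) x) x :=
    (((h.cu hx).fderiv_right (m := 1) one_add_one_le_smooth).differentiableAt (by simp)).hasFDerivAt
  have ν0 := ((h.cν hx).differentiableAt (by simp)).hasFDerivAt
  have θ0 := ((h.cθ hx).differentiableAt (by simp)).hasFDerivAt
  have hLC := h.smoothH.isLC (h.maps x hx)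
  have dH : HasFDerivAt (fun y => bil (H (π y)))
      ((fderiv ℝ (fun z => bil (H z)) (π x)).comp (fderiv ℝ π x)) x :=
    HasFDerivAt.comp (g := fun z => bil (H z)) x hLC.diff.hasFDerivAt p0
  have cb := hasFDerivAt_const (𝕜 := ℝ) b x
  have sm := hLC.symm_metric
  constructor
  -- The first identity is the derivative of `⟨N, dF b⟩ = 0`; the second, below, is that of `⟨N, N⟩
  -- = 1`.
  · have e1 := ((dH.clm_apply ν0).clm_apply (p1.clm_apply cb)).add (θ0.mul (u1.clm_apply cb))
    have e2 := e1.congr_of_eventuallyEq (f₁ := fun _ => (0 : ℝ))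
      (by filter_upwards [h.nhds hx] with y hy; exact ((h.point y hy).orth b).symm)
    have e3 := congrArg (fun T => T a) (e2.unique (hasFDerivAt_const (0 : ℝ) x))
    simp at e3
    rw [hLC.compat] at e3
    rw [h.sff_apply]
    simp only [map_add, add_apply]
    have s1 := sm (fderiv ℝ (fderiv ℝ π) x a b) (ν x)
    have s2 := sm (chr H (π x) (fderiv ℝ π x a) (fderiv ℝ π x b)) (ν x)
    rw [s1, s2]
    linear_combination e3
  · have e1 := ((dH.clm_apply ν0).clm_apply ν0).add (θ0.mul θ0)
    have e2 := e1.congr_of_eventuallyEq (f₁ := fun _ => (1 : ℝ))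
      (by filter_upwards [h.nhds hx] with y hy; exact ((h.point y hy).unit).symm)
    have e3 := congrArg (fun T => T a) (e2.unique (hasFDerivAt_const (1 : ℝ) x))
    simp at e3
    rw [hLC.compat] at e3
    simp only [map_add, add_apply]
    have s1 := sm (fderiv ℝ ν x a) (ν x)
    have s2 := sm (chr H (π x) (fderiv ℝ π x a) (ν x)) (ν x)
    linear_combination (1 / 2) * e3 + (1 / 2) * s1 + (1 / 2) * s2

end IsHypOn

end Hypersurface

/-! ### Invariance of the scalar curvature -/

section Invariance

variable {n : ℕ} {G H : Euc n → Matrix (Fin n) (Fin n) ℝ} {U U' : Set (Euc n)}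
  {T : Euc n → Euc n} {x : Euc n}

/-- A linear isometry is the case of a horizontal hypersurface: height zero and normal `(0, 1)`, so
the normal term of `IsHypPoint.inv_split` has no horizontal component. -/
theorem sum_inv_of_isometric {A B : Matrix (Fin n) (Fin n) ℝ} (hA : IsMetric A) (hB : IsMetric B)
    {L : Euc n →L[ℝ] Euc n} (h : ∀ a b, bil A a b = bil B (L a) (L b)) (i k : Fin n) :
    B⁻¹ i k = (∑ a, ∑ b, A⁻¹ a b * (L (stdVec a) i * L (stdVec b) k))
      + (0 : Euc n) i * (0 : Euc n) k := by
  have hp : IsHypPoint A B L 0 0 1 := ⟨hA, hB, by simp [h], by simp, by simp⟩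
  exact hp.inv_split i k

/-- The derivative of an isometry intertwines the curvatures. -/
theorem curvG_isometry (hG : SmoothMetricOn G U) (hH : SmoothMetricOn H U')
    (hT : ContDiffOn ℝ ∞ T U) (hmaps : ∀ y ∈ U, T y ∈ U')
    (h : ∀ y ∈ U, ∀ a b, bil (G y) a b = bil (H (T y)) (fderiv ℝ T y a) (fderiv ℝ T y b)) :
    (∀ x ∈ U, ∀ a b, fderiv ℝ (fderiv ℝ T) x a b
        + chr H (T x) (fderiv ℝ T x a) (fderiv ℝ T x b) = fderiv ℝ T x (chr G x a b)) ∧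
    ∀ x ∈ U, ∀ a b c, curvG H (T x) (fderiv ℝ T x a) (fderiv ℝ T x b) (fderiv ℝ T x c) =
      fderiv ℝ T x (curvG G x a b c) := by
  -- An isometry is treated as a hypersurface inside a slice with vertical normal. Its second
  -- fundamental form vanishes, so the Gauss formula says that `T` is affine and `curvOp_immersion`
  -- has no correction terms.
  have hyp : IsHypOn G H U U' T (fun _ => 0) (fun _ => 0) (fun _ => 1) :=
    { smoothG := hG, smoothH := hH, maps := hmaps, smooth_π := hT
      smooth_u := contDiffOn_const, smooth_ν := contDiffOn_const, smooth_θ := contDiffOn_const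
      point := fun y hy => ⟨hG.metric y hy, hH.metric _ (hmaps y hy), by simp [h y hy], by simp,
        by simp⟩ }
  have h1 : ∀ x ∈ U, ∀ a b, fderiv ℝ (fderiv ℝ T) x a b
      + chr H (T x) (fderiv ℝ T x a) (fderiv ℝ T x b) = fderiv ℝ T x (chr G x a b) := by
    intro x hx a b
    have := (hyp.gauss_formula hx a b).1
    simpa using this
  refine ⟨h1, fun x hx a b c => ?_⟩
  have := curvOp_immersion (F := T) (Γ := chr G) (Γ' := chr H) (II := fun _ => 0) (x := x)
    ((hyp.cπ hx).of_le three_le_smooth) ((hG.contDiffAt_chr hx).differentiableAt (by simp))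
    ((hH.contDiffAt_chr (hmaps x hx)).differentiableAt (by simp)) (differentiableAt_const _)
    (by filter_upwards [hyp.nhds hx] with y hy a b; rw [h1 y hy a b]; simp) a b c
  simpa using this

/-- The two contractions are transported one after the other, the inner one first, each by
`trB_split` with zero normal. -/
theorem scalarCoeff_isometry (hG : SmoothMetricOn G U) (hH : SmoothMetricOn H U')
    (hT : ContDiffOn ℝ ∞ T U) (hmaps : ∀ y ∈ U, T y ∈ U')
    (h : ∀ y ∈ U, ∀ a b, bil (G y) a b = bil (H (T y)) (fderiv ℝ T y a) (fderiv ℝ T y b))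
    (hx : x ∈ U) : scalarCoeff univ G x = scalarCoeff univ H (T x) := by
  have hc := (curvG_isometry hG hH hT hmaps h).2 x hx
  have hinv := sum_inv_of_isometric (hG.metric x hx) (hH.metric _ (hmaps x hx)) (h x hx)
  rw [hG.scalarCoeff_eq hx, hH.scalarCoeff_eq (hmaps x hx)]
  have s1 : ∀ b c, trB (H (T x))⁻¹ (fun a e => bil (H (T x)) (curvG H (T x) a b c) e) =
      trB (G x)⁻¹ fun a e => bil (H (T x)) (curvG H (T x) (fderiv ℝ T x a) b c)
        (fderiv ℝ T x e) := by
    intro b c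
    rw [trB_split _ _ hinv (curvG_bilin12 (T x) b c (H (T x)))]
    simp
  simp_rw [s1]
  have hb : IsBilin fun b c => trB (G x)⁻¹ fun a e =>
      bil (H (T x)) (curvG H (T x) (fderiv ℝ T x a) b c) (fderiv ℝ T x e) := by
    have := fun a e => curvG_bilin23 (G := H) (T x) (fderiv ℝ T x a) (fderiv ℝ T x e) (H (T x))
    constructor
    · intro p q r; simp only [(this _ _).add_left, trB_add]
    · intro p q r; simp only [(this _ _).smul_left, trB_mul_left]
    · intro p q r; simp only [(this _ _).add_right, trB_add]
    · intro p q r; simp only [(this _ _).smul_right, trB_mul_left]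
  rw [trB_split _ _ hinv hb]
  simp only [hc, ← h x hx]
  have : ∀ a, curvG H (T x) a 0 0 = 0 := fun a => by simp [curvOp]
  simp [this, trB]

end Invariance

/-! ### The Gauss and Codazzi equations and the divergence of the flux field -/

section Divergence

variable {n : ℕ} {G H : Euc n → Matrix (Fin n) (Fin n) ℝ} {U U' : Set (Euc n)}
  {π ν : Euc n → Euc n} {u θ : Euc n → ℝ} {x : Euc n}

/-- The bilinear map `(a, b) ↦ A(a, b) ν`. -/
def bilV (A : Matrix (Fin n) (Fin n) ℝ) (ν : Euc n) : Euc n →L[ℝ] Euc n →L[ℝ] Euc n :=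
  ∑ i, ∑ j, ∑ k, (A i j * ν k) • (EuclideanSpace.proj i : Euc n →L[ℝ] ℝ).smulRight
    ((EuclideanSpace.proj j : Euc n →L[ℝ] ℝ).smulRight (stdVec k))

theorem bilV_apply (A : Matrix (Fin n) (Fin n) ℝ) (ν a b : Euc n) :
    bilV A ν a b = bil A a b • ν := by
  ext k
  simp [bilV, bil_apply, Finset.sum_apply, Finset.sum_mul]
  exact Finset.sum_congr rfl fun i _ => Finset.sum_congr rfl fun j _ => by ring

theorem differentiableAt_bilV {A : Euc n → Matrix (Fin n) (Fin n) ℝ}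
    (hA : ∀ i j, DifferentiableAt ℝ (fun y => A y i j) x) (hν : DifferentiableAt ℝ ν x) :
    DifferentiableAt ℝ (fun y => bilV (A y) (ν y)) x := by
  unfold bilV
  exact DifferentiableAt.fun_sum fun i _ => DifferentiableAt.fun_sum fun j _ =>
    DifferentiableAt.fun_sum fun k _ =>
      ((hA i j).mul (differentiableAt_euclidean.1 hν k)).smul_const _

theorem differentiableAt_bil {A : Euc n → Matrix (Fin n) (Fin n) ℝ}
    (hA : ∀ i j, DifferentiableAt ℝ (fun y => A y i j) x) :
    DifferentiableAt ℝ (fun y => bil (A y)) x := by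
  unfold bil
  exact DifferentiableAt.fun_sum fun i _ => DifferentiableAt.fun_sum fun j _ =>
    (hA i j).smul_const _

namespace IsHypOn

variable (h : IsHypOn G H U U' π u ν θ) (hx : x ∈ U)
include h hx

/-- `curvOp_immersion` is applied separately to `π` and to `u`, the latter with the zero connection
on the line. Adding the pairings with a tangent vector gives Gauss, with the normal gives Codazzi;
the derivatives of the normal are removed by `weingarten`. -/
theorem gauss_codazzi (a b c : Euc n) :
    (∀ e, bil (H (π x)) (curvG H (π x) (fderiv ℝ π x a) (fderiv ℝ π x b) (fderiv ℝ π x c))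
        (fderiv ℝ π x e) = bil (G x) (curvG G x a b c) e
          - bil (h.sff x) b c * bil (h.sff x) a e + bil (h.sff x) a c * bil (h.sff x) b e) ∧
    bil (H (π x)) (curvG H (π x) (fderiv ℝ π x a) (fderiv ℝ π x b) (fderiv ℝ π x c)) (ν x) =
      (fderiv ℝ (fun y => bil (h.sff y)) x a b c - bil (h.sff x) b (chr G x a c))
        - (fderiv ℝ (fun y => bil (h.sff y)) x b a c - bil (h.sff x) a (chr G x b c)) := by
  have hA : ∀ i j, DifferentiableAt ℝ (fun y => h.sff y i j) x := fun i j =>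
    (h.sff_contDiffAt hx i j).differentiableAt (by simp)
  have dA := (differentiableAt_bil hA).hasFDerivAt
  have dν := ((h.cν hx).differentiableAt (by simp)).hasFDerivAt
  have dθ := ((h.cθ hx).differentiableAt (by simp)).hasFDerivAt
  have dV := differentiableAt_bilV (A := h.sff) hA dν.differentiableAt
  have dS : DifferentiableAt ℝ (fun y => θ y • bil (h.sff y)) x :=
    dθ.differentiableAt.smul dA.differentiableAt
  have hV : ∀ a b c, fderiv ℝ (fun y => bilV (h.sff y) (ν y)) x a b c =
      fderiv ℝ (fun y => bil (h.sff y)) x a b c • ν x + bil (h.sff x) b c • fderiv ℝ ν x a := by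
    intro a b c
    have cb := hasFDerivAt_const (𝕜 := ℝ) b x
    have cc := hasFDerivAt_const (𝕜 := ℝ) c x
    have e1 := (dV.hasFDerivAt.clm_apply cb).clm_apply cc
    have e2 := ((dA.clm_apply cb).clm_apply cc).smul dν
    have e3 := e1.congr_of_eventuallyEq (f₁ := fun y => bil (h.sff y) b c • ν y)
      (Eventually.of_forall fun y => (bilV_apply _ _ _ _).symm)
    have e4 := congrArg (fun T => T a) (e3.unique e2)
    simp at e4
    rw [e4, add_comm]
  have hS : ∀ a b c, fderiv ℝ (fun y => θ y • bil (h.sff y)) x a b c =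
      fderiv ℝ (fun y => bil (h.sff y)) x a b c * θ x + bil (h.sff x) b c * fderiv ℝ θ x a := by
    intro a b c
    have := (dθ.smul dA).fderiv
    rw [show (fun y => θ y • bil (h.sff y)) = θ • fun y => bil (h.sff y) from rfl, this]
    simp
    ring
  have k1 := curvOp_immersion (F := π) (Γ := chr G) (Γ' := chr H)
    (II := fun y => bilV (h.sff y) (ν y)) (x := x)
    ((h.cπ hx).of_le three_le_smooth) ((h.smoothG.contDiffAt_chr hx).differentiableAt (by simp))
    ((h.smoothH.contDiffAt_chr (h.maps x hx)).differentiableAt (by simp)) dV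
    (by filter_upwards [h.nhds hx] with y hy a b
        rw [(h.gauss_formula hy a b).1, bilV_apply]) a b c
  have k2 := curvOp_immersion (F := u) (Γ := chr G) (Γ' := fun _ => 0)
    (II := fun y => θ y • bil (h.sff y)) (x := x)
    ((h.cu hx).of_le three_le_smooth) ((h.smoothG.contDiffAt_chr hx).differentiableAt (by simp))
    (differentiableAt_const _) dS
    (by filter_upwards [h.nhds hx] with y hy a b
        rw [(h.gauss_formula hy a b).2]; simp [mul_comm]) a b c
  simp only [hV, bilV_apply] at k1
  simp only [hS] at k2
  simp [curvOp] at k2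
  have hp := h.point x hx
  constructor
  · intro e
    have w1 := (h.weingarten hx a e).1
    have w2 := (h.weingarten hx b e).1
    have hi := hp.isometric (curvG G x a b c) e
    have ho := hp.orth e
    rw [curvG, k1]
    simp only [curvOp] at hi ⊢
    simp only [map_add, map_sub, map_smul, add_apply, sub_apply, smul_apply, smul_eq_mul]
      at w1 w2 hi ⊢
    linear_combination (fderiv ℝ u x e) * k2 + hi * (-1) + bil (h.sff x) b c * w1
      - bil (h.sff x) a c * w2
      + (fderiv ℝ (fun y => bil (h.sff y)) x a b c - bil (h.sff x) b (chr G x a c)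
        - fderiv ℝ (fun y => bil (h.sff y)) x b a c + bil (h.sff x) a (chr G x b c)) * ho
  · have w1 := (h.weingarten hx a 0).2
    have w2 := (h.weingarten hx b 0).2
    have ho := hp.orth (curvG G x a b c)
    rw [hp.metricH.bil_comm] at ho
    have hu := hp.unit
    rw [curvG, k1]
    simp only [curvOp] at ho ⊢
    simp only [map_add, map_sub, map_smul, add_apply, sub_apply, smul_apply, smul_eq_mul]
      at w1 w2 ho ⊢
    linear_combination (θ x) * k2 + ho + bil (h.sff x) b c * w1 - bil (h.sff x) a c * w2
      + (fderiv ℝ (fun y => bil (h.sff y)) x a b c - bil (h.sff x) b (chr G x a c)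
        - fderiv ℝ (fun y => bil (h.sff y)) x b a c + bil (h.sff x) a (chr G x b c)) * hu

/-- The flux field `(tr A) ∇u - A ∇u` of the hypersurface. -/
theorem exists_flux_contDiffAt :
    ContDiffAt ℝ ∞ (fun y => newtonField (G y) (h.sff y) fun i => fderiv ℝ u y (stdVec i)) x ∧
    ContDiffAt ℝ ∞ (fun y => sharp (G y) fun i => fderiv ℝ u y (stdVec i)) x ∧
    ContDiffAt ℝ ∞ (fun y => trB (G y)⁻¹ fun a b => bil (h.sff y) a b) x := by
  have cP := fun i j => h.smoothG.contDiffAt_inv hx i j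
  have cu' : ContDiffAt ℝ ∞ (fderiv ℝ u) x := (h.cu hx).fderiv_right (by simp)
  have cξ : ContDiffAt ℝ ∞ (fun y => sharp (G y) fun i => fderiv ℝ u y (stdVec i)) x := by
    rw [contDiffAt_euclidean]
    intro i
    simp only [sharp_apply]
    exact ContDiffAt.sum fun j _ => (cP i j).mul (cu'.clm_apply contDiffAt_const)
  have cA := contDiffAt_bil (h.sff_contDiffAt hx)
  have ct : ContDiffAt ℝ ∞ (fun y => trB (G y)⁻¹ fun a b => bil (h.sff y) a b) x := by
    simp only [trB]
    exact ContDiffAt.sum fun i _ => ContDiffAt.sum fun j _ => (cP i j).mul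
      ((cA.clm_apply contDiffAt_const).clm_apply contDiffAt_const)
  refine ⟨?_, cξ, ct⟩
  rw [contDiffAt_euclidean]
  intro i
  simp only [newtonField, sharp_apply (A := G _)]
  exact ContDiffAt.sum fun j _ => (cP i j).mul
    ((ct.mul (cu'.clm_apply contDiffAt_const)).sub ((cA.clm_apply contDiffAt_const).clm_apply cξ))

/-- The divergence of the flux field. -/
theorem divergence_flux :
    ∑ i, partialD univ (fun y => Real.sqrt (G y).det *
        newtonField (G y) (h.sff y) (fun i => fderiv ℝ u y (stdVec i)) i) i x =
      Real.sqrt (G x).det * (θ x * (scalarCoeff univ G x - scalarCoeff univ H (π x)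
        + ∑ j, ∑ k, ricciCoeff univ H j k (π x) * ν x j * ν x k)) := by
  obtain ⟨cW, cξ, ct⟩ := h.exists_flux_contDiffAt hx
  set W : Euc n → Euc n := fun y => newtonField (G y) (h.sff y) fun i => fderiv ℝ u y (stdVec i)
    with hWdef
  set ξ : Euc n → Euc n := fun y => sharp (G y) fun i => fderiv ℝ u y (stdVec i) with hξdef
  set t : Euc n → ℝ := fun y => trB (G y)⁻¹ fun a b => bil (h.sff y) a b with htdef
  have hp := h.point x hx
  have hm := hp.metricG
  have hA : ∀ i j, DifferentiableAt ℝ (fun y => h.sff y i j) x := fun i j =>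
    (h.sff_contDiffAt hx i j).differentiableAt (by simp)
  have dA := (differentiableAt_bil hA).hasFDerivAt
  have dW := (cW.differentiableAt (by simp)).hasFDerivAt
  have dξ := (cξ.differentiableAt (by simp)).hasFDerivAt
  have dt := (ct.differentiableAt (by simp)).hasFDerivAt
  have u1 : HasFDerivAt (fderiv ℝ u) (fderiv ℝ (fderiv ℝ u) x) x :=
    (((h.cu hx).fderiv_right (m := 1) one_add_one_le_smooth).differentiableAt
      (by simp)).hasFDerivAt
  have hLC := h.smoothG.isLC hx
  have dG := hLC.diff.hasFDerivAt
  have pW : ∀ y ∈ U, ∀ b, bil (G y) (W y) b = t y * fderiv ℝ u y b - bil (h.sff y) b (ξ y) := by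
    intro y hy b
    have := (h.point y hy).metricG.bil_sharp
      (t y • fderiv ℝ u y - (bil (h.sff y)).flip (ξ y)) b
    simp only [sub_apply, smul_apply, smul_eq_mul, ContinuousLinearMap.flip_apply] at this
    exact this
  have pξ : ∀ y ∈ U, ∀ b, bil (G y) (ξ y) b = fderiv ℝ u y b := fun y hy b =>
    (h.point y hy).metricG.bil_sharp _ b
  -- The vertical component of the Gauss formula: the Hessian of the height is `Θ A`, because `∂/∂t`
  -- is parallel.
  have hess : ∀ a b, fderiv ℝ (fderiv ℝ u) x a b - fderiv ℝ u x (chr G x a b)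
      = θ x * bil (h.sff x) a b := fun a b => by
    rw [(h.gauss_formula hx a b).2]; ring
  set S : Euc n → Euc n := fun a => sharp (G x) fun i => bil (h.sff x) a (stdVec i)
  have pS : ∀ a b, bil (G x) (S a) b = bil (h.sff x) a b := fun a b => hm.bil_sharp _ b
  -- The same statement for the gradient: `∇_a ∇u = Θ S a`, where `S` is the shape operator.
  have nξ : ∀ a, fderiv ℝ ξ x a = θ x • S a - chr G x a (ξ x) := by
    intro a
    refine hm.eq_of_bil fun c => ?_
    have cc := hasFDerivAt_const (𝕜 := ℝ) c x
    have e1 := (dG.clm_apply dξ).clm_apply cc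
    have e2 := u1.clm_apply cc
    have e3 := e1.congr_of_eventuallyEq (f₁ := fun y => fderiv ℝ u y c)
      (by filter_upwards [h.nhds hx] with y hy; exact (pξ y hy c).symm)
    have e4 := congrArg (fun T => T a) (e3.unique e2)
    simp at e4
    rw [hLC.compat, pξ x hx] at e4
    simp only [map_sub, map_smul, sub_apply, smul_apply, smul_eq_mul, pS]
    linear_combination e4 + hess a c
  -- The covariant derivative of `W`, by the product rule for its pairing `pW`. Its trace gives `Θ
  -- ((tr A)² - |A|²)` and the Codazzi term.
  have nW : ∀ a b, bil (G x) (fderiv ℝ W x a + chr G x a (W x)) b =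
      (fderiv ℝ t x a * fderiv ℝ u x b + θ x * t x * bil (h.sff x) a b)
      - (fderiv ℝ (fun y => bil (h.sff y)) x a b (ξ x) - bil (h.sff x) b (chr G x a (ξ x))
        - bil (h.sff x) (chr G x a b) (ξ x)) - θ x * bil (h.sff x) b (S a) := by
    intro a b
    have cb := hasFDerivAt_const (𝕜 := ℝ) b x
    have e1 := (dG.clm_apply dW).clm_apply cb
    have e2 := (dt.fun_mul (u1.clm_apply cb)).fun_sub ((dA.clm_apply cb).clm_apply dξ)
    have e3 := e1.congr_of_eventuallyEq
      (f₁ := fun y => t y * fderiv ℝ u y b - bil (h.sff y) b (ξ y))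
      (by filter_upwards [h.nhds hx] with y hy; exact (pW y hy b).symm)
    have e4 := congrArg (fun T => T a) (e3.unique e2)
    simp at e4
    rw [hLC.compat, pW x hx, nξ] at e4
    simp only [map_add, map_sub, map_smul, smul_eq_mul, add_apply] at e4 ⊢
    linear_combination e4 + t x * hess a b
  rw [h.smoothG.divergence hx (W := W) (cW.differentiableAt (by simp))]
  congr 1
  have hc := h.gauss_codazzi hx
  have Aξ := h.smoothG.fderiv_trB hx (A := h.sff) hA (ξ x)
  simp only [nW]
  rw [trB_sub, trB_sub, trB_add, trB_mul_left, trB_mul_left, trB_mul_sharp]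
  -- The Codazzi equation for `(∇u, e_i, e_j)`, contracted over `i` and `j`. The horizontal part of
  -- `∇u` is `-Θ ν`, so the ambient curvature appears with `ν` in both end slots.
  have cod : fderiv ℝ t x (ξ x) - trB (G x)⁻¹ (fun a b =>
      fderiv ℝ (fun y => bil (h.sff y)) x a b (ξ x) - bil (h.sff x) b (chr G x a (ξ x))
        - bil (h.sff x) (chr G x a b) (ξ x)) =
      - θ x * trB (G x)⁻¹ (fun a b => bil (H (π x))
        (curvG H (π x) (ν x) (fderiv ℝ π x a) (fderiv ℝ π x b)) (ν x)) := by
    have sA : ∀ a b, bil (h.sff x) a b = bil (h.sff x) b a := h.sff_symm hx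
    have sDA : ∀ v a b, fderiv ℝ (fun y => bil (h.sff y)) x v a b =
        fderiv ℝ (fun y => bil (h.sff y)) x v b a := by
      intro v a b
      have ca := hasFDerivAt_const (𝕜 := ℝ) a x
      have cb := hasFDerivAt_const (𝕜 := ℝ) b x
      have e1 := (dA.clm_apply ca).clm_apply cb
      have e2 := (dA.clm_apply cb).clm_apply ca
      have e3 := e1.congr_of_eventuallyEq (f₁ := fun y => bil (h.sff y) b a)
        (by filter_upwards [h.nhds hx] with y hy; exact h.sff_symm hy b a)
      have e4 := congrArg (fun T => T v) (e3.unique e2)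
      simpa using e4
    rw [Aξ, ← trB_sub, ← trB_mul_left]
    simp only [trB]
    refine Finset.sum_congr rfl fun i _ => Finset.sum_congr rfl fun j _ => ?_
    congr 1
    have e := (hc (ξ x) (stdVec i) (stdVec j)).2
    rw [hp.vertical_split.1] at e
    have e' : curvG H (π x) (-θ x • ν x) (fderiv ℝ π x (stdVec i)) (fderiv ℝ π x (stdVec j)) =
        -θ x • curvG H (π x) (ν x) (fderiv ℝ π x (stdVec i)) (fderiv ℝ π x (stdVec j)) := by
      simp [curvOp]
      module
    rw [e'] at e
    simp only [map_smul, smul_apply, smul_eq_mul] at e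
    rw [e, sDA (stdVec i) (ξ x), h.smoothG.chr_symm hx (ξ x) (stdVec i),
      sA (chr G x (stdVec i) (stdVec j)), sA (stdVec j)]
    ring
  have skew := IsLC.curvOp_skew (G := fun z => bil (H z)) (Γ := chr H) (x := π x)
    ((h.smoothH.contDiffAt_bil (h.maps x hx)).of_le two_le_smooth)
    ((h.smoothH.contDiffAt_chr (h.maps x hx)).differentiableAt (by simp))
    (by filter_upwards [h.smoothH.isOpen.mem_nhds (h.maps x hx)] with y hy
        exact h.smoothH.isLC hy)
  have alt : ∀ a b c, curvG H (π x) a b c = - curvG H (π x) b a c := fun a b c => by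
    simp only [curvG, curvOp]; abel
  have zero : ∀ b, bil (H (π x)) (curvG H (π x) (ν x) (ν x) b) (ν x) = 0 := fun b => by
    have : curvG H (π x) (ν x) (ν x) b = 0 := by simp [curvOp]
    simp [this]
  -- The Ricci curvature of `ν` as a trace over `M` alone: the normal term vanishes by antisymmetry,
  -- and the two skew symmetries move `ν` to the outer slots.
  have hRic : ∑ j, ∑ k, ricciCoeff univ H j k (π x) * ν x j * ν x k =
      trB (G x)⁻¹ (fun a b => bil (H (π x))
        (curvG H (π x) (ν x) (fderiv ℝ π x a) (fderiv ℝ π x b)) (ν x)) := by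
    rw [h.smoothH.sum_ricciCoeff (h.maps x hx),
      hp.trB_split (curvG_bilin12 (π x) (ν x) (ν x) (H (π x))), zero, add_zero]
    simp only [trB]
    refine Finset.sum_congr rfl fun i _ => Finset.sum_congr rfl fun j _ => ?_
    rw [alt, map_neg, neg_apply]
    have := skew (ν x) (fderiv ℝ π x (stdVec i)) (ν x) (fderiv ℝ π x (stdVec j))
    rw [curvG, this, neg_neg]
  -- Both traces are split into tangential and normal parts. The two mixed terms are each the Ricci
  -- curvature of `ν`; the purely normal one is zero.
  have hRh : scalarCoeff univ H (π x) =
      trB (G x)⁻¹ (fun b c => trB (G x)⁻¹ fun a e => bil (H (π x))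
        (curvG H (π x) (fderiv ℝ π x a) (fderiv ℝ π x b) (fderiv ℝ π x c)) (fderiv ℝ π x e))
      + 2 * ∑ j, ∑ k, ricciCoeff univ H j k (π x) * ν x j * ν x k := by
    rw [h.smoothH.scalarCoeff_eq (h.maps x hx)]
    have hb : IsBilin fun b c => trB (H (π x))⁻¹ fun a e =>
        bil (H (π x)) (curvG H (π x) a b c) e := by
      have := fun a e => curvG_bilin23 (G := H) (π x) a e (H (π x))
      constructor
      · intro p q r; simp only [(this _ _).add_left, trB_add]
      · intro p q r; simp only [(this _ _).smul_left, trB_mul_left]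
      · intro p q r; simp only [(this _ _).add_right, trB_add]
      · intro p q r; simp only [(this _ _).smul_right, trB_mul_left]
    rw [hp.trB_split hb, ← h.smoothH.sum_ricciCoeff (h.maps x hx), two_mul, ← add_assoc]
    congr 1
    have : ∀ b c, trB (H (π x))⁻¹ (fun a e => bil (H (π x)) (curvG H (π x) a b c) e) =
        trB (G x)⁻¹ (fun a e => bil (H (π x)) (curvG H (π x) (fderiv ℝ π x a) b c)
          (fderiv ℝ π x e)) + bil (H (π x)) (curvG H (π x) (ν x) b c) (ν x) := fun b c =>
      hp.trB_split (curvG_bilin12 (π x) b c (H (π x)))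
    simp only [this]
    rw [trB_add, hRic]
  -- The Gauss equation traced twice. The last term is `|A|²`, written with the shape operator.
  have hG : trB (G x)⁻¹ (fun b c => trB (G x)⁻¹ fun a e => bil (H (π x))
        (curvG H (π x) (fderiv ℝ π x a) (fderiv ℝ π x b) (fderiv ℝ π x c)) (fderiv ℝ π x e)) =
      scalarCoeff univ G x - t x * t x
        + trB (G x)⁻¹ fun a b => bil (h.sff x) b (S a) := by
    rw [h.smoothG.scalarCoeff_eq hx]
    have e1 : ∀ b c, trB (G x)⁻¹ (fun a e => bil (H (π x))
        (curvG H (π x) (fderiv ℝ π x a) (fderiv ℝ π x b) (fderiv ℝ π x c)) (fderiv ℝ π x e)) =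
        trB (G x)⁻¹ (fun a e => bil (G x) (curvG G x a b c) e) - bil (h.sff x) b c * t x
        + bil (h.sff x) c (S b) := by
      intro b c
      simp only [(hc _ _ _).1]
      rw [trB_add, trB_sub, trB_mul_left]
      congr 1
      have := trB_mul_sharp (A := G x) ((bil (h.sff x)).flip c) (bil (h.sff x) b)
      rw [h.sff_symm hx c]
      simpa using this
    simp only [e1]
    rw [trB_add, trB_sub, trB_mul_right]
  have key : scalarCoeff univ G x - t x * t x + (trB (G x)⁻¹ fun a b => bil (h.sff x) b (S a))
      = scalarCoeff univ H (π x)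
        - 2 * ∑ j, ∑ k, ricciCoeff univ H j k (π x) * ν x j * ν x k := by
    rw [← hG, hRh]; ring
  rw [← hRic] at cod
  -- The coefficients of the Ricci term add up as `-1` from Codazzi and `+2` from Gauss.
  change fderiv ℝ t x (ξ x) + θ x * t x * t x - _ - _ = _
  linear_combination cod - θ x * key

end IsHypOn

end Divergence

/-! ### Locality -/

section Locality

variable {d : ℕ} {G G' : Euc d → Matrix (Fin d) (Fin d) ℝ} {s : Set (Euc d)} {x : Euc d}

/-- Curvature depends only on the germ of the metric, and at interior points derivatives within `s`
are ordinary ones. These lemmas replace the model range in the definitions of curvature by the whole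
space. -/
theorem partialD_congr {u v : Euc d → ℝ} (hs : s ∈ 𝓝 x) (h : u =ᶠ[𝓝 x] v) (i : Fin d) :
    partialD s u i x = partialD univ v i x := by
  simp only [partialD, fderivWithin_univ, fderivWithin_of_mem_nhds hs, h.fderiv_eq]

theorem christoffel_congr (hs : s ∈ 𝓝 x) (h : G =ᶠ[𝓝 x] G') (k i j : Fin d) :
    christoffel s G k i j x = christoffel univ G' k i j x := by
  have : ∀ i j l, partialD s (fun y => G y i j) l x = partialD univ (fun y => G' y i j) l x :=
    fun i j l => partialD_congr hs (h.mono fun y hy => by simp [hy]) l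
  simp only [christoffel, this, h.eq_of_nhds]

theorem ricciCoeff_congr (hs : s ∈ 𝓝 x) (h : G =ᶠ[𝓝 x] G') (j k : Fin d) :
    ricciCoeff s G j k x = ricciCoeff univ G' j k x := by
  have e : ∀ k i j, christoffel s G k i j =ᶠ[𝓝 x] christoffel univ G' k i j := fun k i j => by
    filter_upwards [eventually_mem_nhds_iff.2 hs, h.eventuallyEq_nhds] with y h1 h2
    exact christoffel_congr h1 h2 k i j
  simp only [ricciCoeff, fun k i j => (e k i j).eq_of_nhds, fun k i j l => partialD_congr hs (e k i j) l]

theorem scalarCoeff_congr (hs : s ∈ 𝓝 x) (h : G =ᶠ[𝓝 x] G') :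
    scalarCoeff s G x = scalarCoeff univ G' x := by
  simp only [scalarCoeff, ricciCoeff_congr hs h, h.eq_of_nhds]

end Locality

/-! ### The second fundamental form under changes of the parameters and of the ambient coordinates
-/

section SecondForm

variable {d e n : ℕ} {H : Euc n → Matrix (Fin n) (Fin n) ℝ} {s t : Set (Euc d)}
  {π π' : Euc d → Euc n} {u u' : Euc d → ℝ} {ν : Euc n} {θ : ℝ} {x : Euc d}

theorem snd_fderivWithin_congr {Z : Type*} [NormedAddCommGroup Z] [NormedSpace ℝ Z]
    {f f' : Euc d → Z} (h : f =ᶠ[𝓝[s] x] f') (hx : x ∈ s) :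
    fderivWithin ℝ (fderivWithin ℝ f s) s x = fderivWithin ℝ (fderivWithin ℝ f' s) s x := by
  have h1 : fderivWithin ℝ f s =ᶠ[𝓝[s] x] fderivWithin ℝ f' s := h.fderivWithin (𝕜 := ℝ)
  exact h1.fderivWithin_eq_of_mem hx

theorem snd_fderivWithin_congr_set {Z : Type*} [NormedAddCommGroup Z] [NormedSpace ℝ Z]
    {f : Euc d → Z} (h : s =ᶠ[𝓝 x] t) :
    fderivWithin ℝ (fderivWithin ℝ f s) s x = fderivWithin ℝ (fderivWithin ℝ f t) t x := by
  rw [fderivWithin_congr_set h]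
  exact Filter.EventuallyEq.fderivWithin_eq
    ((fderivWithin_eventually_congr_set h).filter_mono nhdsWithin_le_nhds)
    (fderivWithin_congr_set h)

theorem secondForm_congr (hπ : π =ᶠ[𝓝[s] x] π') (hu : u =ᶠ[𝓝[s] x] u') (hx : x ∈ s)
    (a b : Euc d) : secondForm s H π u ν θ x a b = secondForm s H π' u' ν θ x a b := by
  simp only [secondForm, snd_fderivWithin_congr hπ hx, snd_fderivWithin_congr hu hx,
    hπ.fderivWithin_eq_of_mem hx, hπ.eq_of_nhdsWithin hx]

theorem secondForm_congr_set (h : s =ᶠ[𝓝 x] t) (a b : Euc d) :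
    secondForm s H π u ν θ x a b = secondForm t H π u ν θ x a b := by
  simp only [secondForm, snd_fderivWithin_congr_set h, fderivWithin_congr_set h]

/-- The chain rule for second derivatives. -/
theorem snd_fderivWithin_comp {X Y Z : Type*} [NormedAddCommGroup X] [NormedSpace ℝ X]
    [NormedAddCommGroup Y] [NormedSpace ℝ Y] [NormedAddCommGroup Z] [NormedSpace ℝ Z]
    {f : Y → Z} {T : X → Y} {s : Set X} {t : Set Y} {x : X} (hf : ContDiffOn ℝ 2 f t)
    (hT : ContDiffOn ℝ 2 T s) (hs : UniqueDiffOn ℝ s) (ht : UniqueDiffOn ℝ t) (hm : MapsTo T s t)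
    (hx : x ∈ s) (a b : X) :
    fderivWithin ℝ (fderivWithin ℝ (f ∘ T) s) s x a b =
      fderivWithin ℝ (fderivWithin ℝ f t) t (T x) (fderivWithin ℝ T s x a)
        (fderivWithin ℝ T s x b)
      + fderivWithin ℝ f t (T x) (fderivWithin ℝ (fderivWithin ℝ T s) s x a b) := by
  have h1 : ∀ y ∈ s, fderivWithin ℝ (f ∘ T) s y =
      (fderivWithin ℝ f t (T y)).comp (fderivWithin ℝ T s y) := fun y hy =>
    fderivWithin_comp y (hf.differentiableOn (by simp) _ (hm hy))
      (hT.differentiableOn (by simp) _ hy) hm (hs y hy)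
  have df : DifferentiableWithinAt ℝ (fderivWithin ℝ f t) t (T x) :=
    (hf.fderivWithin ht (m := 1) (by norm_num)).differentiableOn (by simp) _ (hm hx)
  have dT : DifferentiableWithinAt ℝ (fderivWithin ℝ T s) s x :=
    (hT.fderivWithin hs (m := 1) (by norm_num)).differentiableOn (by simp) _ hx
  have d0 : HasFDerivWithinAt T (fderivWithin ℝ T s x) s x :=
    (hT.differentiableOn (by simp) _ hx).hasFDerivWithinAt
  have d1 := HasFDerivWithinAt.comp (g := fderivWithin ℝ f t) x df.hasFDerivWithinAt d0 hm
  have d2 := d1.clm_comp dT.hasFDerivWithinAt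
  have d3 := (d2.congr (fun y hy => h1 y hy) (h1 x hx)).fderivWithin (hs x hx)
  rw [d3]
  simp [add_comm]

/-- The second fundamental form under a change of the parameters. -/
theorem secondForm_comp {t : Set (Euc e)} {T : Euc d → Euc e} {π : Euc e → Euc n} {u : Euc e → ℝ}
    (hπ : ContDiffOn ℝ 2 π t) (hu : ContDiffOn ℝ 2 u t) (hT : ContDiffOn ℝ 2 T s)
    (hs : UniqueDiffOn ℝ s) (ht : UniqueDiffOn ℝ t) (hm : MapsTo T s t) (hx : x ∈ s)
    (ho : ∀ c, bil (H (π (T x))) ν (fderivWithin ℝ π t (T x) c)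
      + θ * fderivWithin ℝ u t (T x) c = 0) (hH : IsMetric (H (π (T x)))) (a b : Euc d) :
    secondForm s H (π ∘ T) (u ∘ T) ν θ x a b =
      secondForm t H π u ν θ (T x) (fderivWithin ℝ T s x a) (fderivWithin ℝ T s x b) := by
  have h1 : ∀ v, fderivWithin ℝ (π ∘ T) s x v =
      fderivWithin ℝ π t (T x) (fderivWithin ℝ T s x v) := fun v => by
    rw [fderivWithin_comp x (hπ.differentiableOn (by simp) _ (hm hx))
      (hT.differentiableOn (by simp) _ hx) hm (hs x hx)]
    rfl
  -- The second derivative of the change of parameters enters only through a tangential vector,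
  -- which is orthogonal to the normal.
  have := ho (fderivWithin ℝ (fderivWithin ℝ T s) s x a b)
  rw [hH.bil_comm] at this
  simp only [secondForm, snd_fderivWithin_comp hπ hT hs ht hm hx,
    snd_fderivWithin_comp hu hT hs ht hm hx, h1, Function.comp_apply]
  simp only [map_add, add_apply]
  linear_combination this

/-- The second fundamental form under a change of the coordinates of the ambient space. -/
theorem secondForm_isometry {H' : Euc n → Matrix (Fin n) (Fin n) ℝ} {V V' : Set (Euc n)}
    {σ : Euc n → Euc n} (hH : SmoothMetricOn H V) (hH' : SmoothMetricOn H' V')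
    (hσ : ContDiffOn ℝ ∞ σ V) (hmaps : ∀ y ∈ V, σ y ∈ V')
    (h : ∀ y ∈ V, ∀ a b, bil (H y) a b = bil (H' (σ y)) (fderiv ℝ σ y a) (fderiv ℝ σ y b))
    (hπ : ContDiffOn ℝ 2 π s) (hs : UniqueDiffOn ℝ s) (hm : MapsTo π s V) (hx : x ∈ s)
    (a b : Euc d) :
    secondForm s H' (σ ∘ π) u (fderiv ℝ σ (π x) ν) θ x a b = secondForm s H π u ν θ x a b := by
  have hV := hH.isOpen
  have e0 : ∀ y ∈ V, fderivWithin ℝ σ V y = fderiv ℝ σ y := fun y hy =>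
    fderivWithin_of_isOpen hV hy
  have h1 : ∀ v, fderivWithin ℝ (σ ∘ π) s x v =
      fderiv ℝ σ (π x) (fderivWithin ℝ π s x v) := fun v => by
    rw [fderivWithin_comp x ((hσ.differentiableOn (by simp)) _ (hm hx))
      (hπ.differentiableOn (by simp) _ hx) hm (hs x hx), e0 _ (hm hx)]
    rfl
  have e1 : fderivWithin ℝ (fderivWithin ℝ σ V) V (π x) = fderiv ℝ (fderiv ℝ σ) (π x) := by
    rw [snd_fderivWithin_congr_set (t := univ) (eventuallyEq_univ.2 (hV.mem_nhds (hm hx)))]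
    simp [fderivWithin_univ]
  -- An isometry intertwines the connections, so its second derivative cancels against the change of
  -- the Christoffel terms.
  have hc := (curvG_isometry hH hH' hσ hmaps h).1 (π x) (hm hx) (fderivWithin ℝ π s x a)
    (fderivWithin ℝ π s x b)
  have h2 := snd_fderivWithin_comp (hσ.of_le two_le_smooth) hπ hs hV.uniqueDiffOn hm hx a b
  rw [e1, e0 _ (hm hx)] at h2
  simp only [secondForm, h2, h1, Function.comp_apply]
  rw [h _ (hm hx)]
  congr 3
  rw [map_add, ← hc]
  abel

end SecondForm

/-! ### The flux field as a vector field -/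

section NewtonField

variable {n : ℕ} {G G' A A' : Matrix (Fin n) (Fin n) ℝ} {L : Euc n →L[ℝ] Euc n}

theorem IsMetric.bil_newtonField (h : IsMetric G) (w : Euc n →L[ℝ] ℝ) (b : Euc n) :
    bil G (newtonField G A fun i => w (stdVec i)) b =
      trB G⁻¹ (fun a b => bil A a b) * w b - bil A b (sharp G fun i => w (stdVec i)) := by
  have := h.bil_sharp (trB G⁻¹ (fun a b => bil A a b) • w
    - (bil A).flip (sharp G fun i => w (stdVec i))) b
  simp only [sub_apply, smul_apply, smul_eq_mul, ContinuousLinearMap.flip_apply] at this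
  exact this

theorem surjective_of_isometric (h' : IsMetric G')
    (h : ∀ a b, bil G' a b = bil G (L a) (L b)) : Function.Surjective L := by
  have : Function.Injective L.toLinearMap := by
    rw [injective_iff_map_eq_zero]
    intro v hv
    by_contra hne
    have e := h'.pos v hne
    have hv' : L v = 0 := hv
    rw [h, hv'] at e
    simp at e
  exact LinearMap.injective_iff_surjective.1 this

/-- The flux field under a change of coordinates. -/
theorem newtonField_transform (h' : IsMetric G') (hG : IsMetric G)
    (h : ∀ a b, bil G' a b = bil G (L a) (L b)) (hA : ∀ a b, bil A' a b = bil A (L a) (L b))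
    (w : Euc n →L[ℝ] ℝ) :
    L (newtonField G' A' fun i => w (L (stdVec i))) = newtonField G A fun i => w (stdVec i) := by
  have hL := surjective_of_isometric h' h
  have hξ : L (sharp G' fun i => w (L (stdVec i))) = sharp G fun i => w (stdVec i) := by
    refine hG.eq_of_bil fun c => ?_
    obtain ⟨c, rfl⟩ := hL c
    rw [← h, hG.bil_sharp]
    exact h'.bil_sharp (w ∘L L) c
  have ht : trB G⁻¹ (fun a b => bil A a b) = trB G'⁻¹ (fun a b => bil A' a b) := by
    rw [trB_split L 0 (sum_inv_of_isometric h' hG h) (IsBilin.clm (bil A))]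
    simp [hA]
  refine hG.eq_of_bil fun c => ?_
  obtain ⟨c, rfl⟩ := hL c
  rw [← h, hG.bil_newtonField]
  have := h'.bil_newtonField (A := A') (w ∘L L) c
  simp only [ContinuousLinearMap.comp_apply] at this
  rw [this, ht, hA, hξ]

end NewtonField

/-! ### Derivatives as maps of the model vector spaces -/

section Derivative

variable {V : Type*} [NormedAddCommGroup V] [NormedSpace ℝ V] {V' : Type*} [NormedAddCommGroup V']
  [NormedSpace ℝ V'] {V'' : Type*} [NormedAddCommGroup V''] [NormedSpace ℝ V'']
  {H H' H'' : Type*} [TopologicalSpace H] [TopologicalSpace H'] [TopologicalSpace H'']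
  (I : ModelWithCorners ℝ V H) (I' : ModelWithCorners ℝ V' H') (I'' : ModelWithCorners ℝ V'' H'')
  {M M' M'' : Type*} [TopologicalSpace M] [ChartedSpace H M] [TopologicalSpace M']
  [ChartedSpace H' M'] [TopologicalSpace M''] [ChartedSpace H'' M'']

/-- The derivative `mfderivWithin` with the tangent spaces replaced by the model vector spaces. -/
def tD (φ : M → M') (s : Set M) (x : M) : V →L[ℝ] V' := mfderivWithin I I' φ s x

variable {I I' I''} {φ : M → M'} {s : Set M} {x : M}

theorem tD_comp {ψ : M' → M''} {t : Set M'}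
    (hψ : MDifferentiableWithinAt I' I'' ψ t (φ x)) (hφ : MDifferentiableWithinAt I I' φ s x)
    (hm : MapsTo φ s t) (hu : UniqueMDiffWithinAt I s x) :
    tD I I'' (ψ ∘ φ) s x = (tD I' I'' ψ t (φ x)).comp (tD I I' φ s x) :=
  mfderivWithin_comp x hψ hφ hm hu

theorem tD_congr {φ' : M → M'} (h : ∀ y ∈ s, φ y = φ' y) (hx : φ x = φ' x) :
    tD I I' φ s x = tD I I' φ' s x :=
  mfderivWithin_congr h hx

theorem tD_congr_nhds {φ' : M → M'} (h : φ =ᶠ[𝓝[s] x] φ') (hx : φ x = φ' x) :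
    tD I I' φ s x = tD I I' φ' s x :=
  h.mfderivWithin_eq hx

theorem tD_congr_set {t : Set M} (h : s =ᶠ[𝓝 x] t) : tD I I' φ s x = tD I I' φ t x :=
  mfderivWithin_congr_set h

theorem tD_inter {u : Set M} (hu : u ∈ 𝓝 x) : tD I I' φ (s ∩ u) x = tD I I' φ s x :=
  mfderivWithin_inter hu

theorem tD_of_mem_nhds (hs : s ∈ 𝓝 x) : tD I I' φ s x = tD I I' φ univ x :=
  tD_congr_set (eventuallyEq_univ.2 hs)

theorem tD_univ : tD I I' φ univ x = mfderiv I I' φ x :=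
  congrFun mfderivWithin_univ x

theorem tD_id (hu : UniqueMDiffWithinAt I s x) :
    tD I I (id : M → M) s x = ContinuousLinearMap.id ℝ V :=
  mfderivWithin_id hu

theorem tD_vectorSpace {φ : V → V'} {s : Set V} {x : V} :
    tD 𝓘(ℝ, V) 𝓘(ℝ, V') φ s x = fderivWithin ℝ φ s x :=
  mfderivWithin_eq_fderivWithin

theorem tD_eq_fderivWithin {φ : V → M'} {s : Set V} {x : V}
    (h : MDifferentiableWithinAt 𝓘(ℝ, V) I' φ s x) :
    tD 𝓘(ℝ, V) I' φ s x = fderivWithin ℝ (extChartAt I' (φ x) ∘ φ) s x := by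
  have := h.mfderivWithin
  simp only [writtenInExtChartAt, mfld_simps] at this
  exact this

end Derivative

/-! ### Smooth metrics on manifolds in coordinates -/

section ManifoldMetric

variable {d k : ℕ} {H : Type*} [TopologicalSpace H] {I : ModelWithCorners ℝ (Euc d) H}
  {M : Type*} [TopologicalSpace M] [ChartedSpace H M] [IsManifold I ∞ M]

variable (I M) in
/-- Smooth Riemannian metrics on `M`. -/
abbrev SmoothMetric : Type _ :=
  Bundle.ContMDiffRiemannianMetric I ∞ (Euc d) (fun p : M => TangentSpace I p)

theorem contMDiffOn_mfderivWithin_const {φ : Euc k → M} {s : Set (Euc k)}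
    (hφ : ContMDiffOn 𝓘(ℝ, Euc k) I ∞ φ s) (hs : UniqueDiffOn ℝ s) (v : Euc k) :
    ContMDiffOn 𝓘(ℝ, Euc k) I.tangent ∞
      (fun y => (⟨φ y, mfderivWithin 𝓘(ℝ, Euc k) I φ s y v⟩ : TangentBundle I M)) s := by
  have h1 := hφ.contMDiffOn_tangentMapWithin (m := ∞) (by simp) hs.uniqueMDiffOn
  have h2 : ContMDiff 𝓘(ℝ, Euc k) 𝓘(ℝ, Euc k).tangent ∞
      (fun y => (⟨y, v⟩ : TangentBundle 𝓘(ℝ, Euc k) (Euc k))) := by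
    have := (contMDiff_vectorSpace_iff_contDiff (𝕜 := ℝ) (n := ∞)
      (V := fun _ : Euc k => v)).2 contDiff_const
    exact this
  exact h1.comp h2.contMDiffOn fun y hy => hy

/-- Smoothness is seen in the bundles: `g ∘ φ` is a smooth section of the bilinear forms, and `dφ
v`, `dφ w` are smooth lifts of `φ` to the tangent bundle; the pairing is then read in the trivial
line bundle. -/
theorem contDiffOn_metric
    (g : SmoothMetric I M)
    {φ : Euc k → M} {s : Set (Euc k)} (hφ : ContMDiffOn 𝓘(ℝ, Euc k) I ∞ φ s)
    (hs : UniqueDiffOn ℝ s) (v w : Euc k) :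
    ContDiffOn ℝ ∞ (fun y => toField g (φ y) (mfderivWithin 𝓘(ℝ, Euc k) I φ s y v)
      (mfderivWithin 𝓘(ℝ, Euc k) I φ s y w)) s := by
  rw [← contMDiffOn_iff_contDiffOn]
  have hv := contMDiffOn_mfderivWithin_const hφ hs v
  have hw := contMDiffOn_mfderivWithin_const hφ hs w
  have hg : ContMDiffOn 𝓘(ℝ, Euc k) (I.prod 𝓘(ℝ, Euc d →L[ℝ] Euc d →L[ℝ] ℝ)) ∞
      (fun y => Bundle.TotalSpace.mk' (Euc d →L[ℝ] Euc d →L[ℝ] ℝ)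
        (E := fun p : M => TangentSpace I p →L[ℝ] TangentSpace I p →L[ℝ] ℝ)
        (φ y) (g.inner (φ y))) s :=
    g.contMDiff.comp_contMDiffOn hφ
  have := ContMDiffOn.clm_bundle_apply₂ (F₁ := Euc d) (F₂ := Euc d) (F₃ := ℝ)
    (E₁ := fun p : M => TangentSpace I p) (E₂ := fun p : M => TangentSpace I p)
    (E₃ := Bundle.Trivial M ℝ) hg hv hw
  intro y hy
  have h3 := this y hy
  rw [Bundle.contMDiffWithinAt_totalSpace] at h3
  exact h3.2

theorem IsBilin.comp {d k : ℕ} {β : Euc d → Euc d → ℝ} (h : IsBilin β) (L : Euc k →L[ℝ] Euc d) :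
    IsBilin fun a b => β (L a) (L b) :=
  ⟨fun a b c => by simp only [map_add, h.add_left], fun r a c => by simp only [map_smul, h.smul_left],
    fun a b c => by simp only [map_add, h.add_right],
    fun r a c => by simp only [map_smul, h.smul_right]⟩

/-- The pairings of `g` are bilinear. -/
def FieldBilin (g : MetricField I M) : Prop := ∀ p, IsBilin (g p)

omit [IsManifold I ∞ M] in
theorem FieldBilin.bil_metricCoeff {g : MetricField I M} (hg : FieldBilin g) (s : Set (Euc d))
    (φ : Euc d → M) (x a b : Euc d) :
    bil (metricCoeff g s φ x) a b = g (φ x) (tD 𝓘(ℝ, Euc d) I φ s x a)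
      (tD 𝓘(ℝ, Euc d) I φ s x b) :=
  (((hg (φ x)).comp (tD 𝓘(ℝ, Euc d) I φ s x)).eq_bil a b).symm

theorem fieldBilin_toField
    (g : SmoothMetric I M) :
    FieldBilin (toField g) := fun p =>
  ⟨by intros; simp [toField], by intros; simp [toField], by intros; simp [toField],
    by intros; simp [toField]⟩

variable (I) in
/-- `φ` is a smooth immersion of the set `s` of full dimension. -/
structure IsParam (φ : Euc d → M) (s : Set (Euc d)) : Prop where
  uniq : UniqueDiffOn ℝ s
  smooth : ContMDiffOn 𝓘(ℝ, Euc d) I ∞ φ s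
  inj : ∀ x ∈ s, Function.Injective (tD 𝓘(ℝ, Euc d) I φ s x)

variable {φ : Euc d → M} {s : Set (Euc d)} {x : Euc d}

theorem IsParam.isMetric (h : IsParam I φ s) (hx : x ∈ s)
    (g : SmoothMetric I M) :
    IsMetric (metricCoeff (toField g) s φ x) := by
  constructor
  · ext i j
    exact g.symm _ _ _
  · intro v hv
    rw [(fieldBilin_toField g).bil_metricCoeff]
    refine g.pos _ _ fun h0 => hv (h.inj x hx ?_)
    exact h0.trans (map_zero (tD 𝓘(ℝ, Euc d) I φ s x)).symm

theorem IsParam.contDiffOn_metricCoeff (h : IsParam I φ s)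
    (g : SmoothMetric I M)
    (i j : Fin d) : ContDiffOn ℝ ∞ (fun y => metricCoeff (toField g) s φ y i j) s :=
  contDiffOn_metric g h.smooth h.uniq _ _

theorem IsParam.smoothMetricOn (h : IsParam I φ s) (hs : IsOpen s)
    (g : SmoothMetric I M) :
    SmoothMetricOn (metricCoeff (toField g) s φ) s :=
  ⟨hs, h.contDiffOn_metricCoeff g, fun _ hy => h.isMetric hy g⟩

omit [IsManifold I ∞ M] in
theorem metricCoeff_congr_set (g : MetricField I M) {t : Set (Euc d)} (h : s =ᶠ[𝓝 x] t) :
    metricCoeff g s φ x = metricCoeff g t φ x := by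
  simp only [metricCoeff, mfderivWithin_congr_set h]

omit [IsManifold I ∞ M] in
theorem IsParam.inter_open (h : IsParam I φ s) {u : Set (Euc d)} (hu : IsOpen u) :
    IsParam I φ (s ∩ u) :=
  ⟨h.uniq.inter hu, h.smooth.mono inter_subset_left, fun x hx => by
    rw [tD_inter (hu.mem_nhds hx.2)]; exact h.inj x hx.1⟩

omit [IsManifold I ∞ M] in
theorem IsParam.exists_open (h : IsParam I φ s) {O : Set M} (hO : IsOpen O) :
    ∃ u, IsOpen u ∧ ∀ x ∈ s, x ∈ u ↔ φ x ∈ O := by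
  obtain ⟨u, hu, h1⟩ := continuousOn_iff'.1 h.smooth.continuousOn O hO
  refine ⟨u, hu, fun x hx => ⟨fun hxu => ?_, fun hxO => ?_⟩⟩
  · exact ((Set.ext_iff.1 h1 x).2 ⟨hxu, hx⟩).1
  · exact ((Set.ext_iff.1 h1 x).1 ⟨hxO, hx⟩).1

/-- The chart at `q` as a parametrization. -/
theorem isParam_chart (q : M) : IsParam I (extChartAt I q).symm (extChartAt I q).target := by
  have hs : ContMDiffOn 𝓘(ℝ, Euc d) I ∞ (extChartAt I q).symm (extChartAt I q).target :=
    contMDiffOn_extChartAt_symm q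
  refine ⟨uniqueDiffOn_extChartAt_target q, hs, fun x hx => ?_⟩
  have hq : (extChartAt I q).symm x ∈ (extChartAt I q).source := (extChartAt I q).map_target hx
  have h1 : MDifferentiableAt I 𝓘(ℝ, Euc d) (extChartAt I q) ((extChartAt I q).symm x) :=
    (contMDiffAt_extChartAt' (n := ∞) (by simpa using hq)).mdifferentiableAt (by simp)
  have h2 := (hs x hx).mdifferentiableWithinAt (by simp)
  have hu : UniqueMDiffWithinAt 𝓘(ℝ, Euc d) (extChartAt I q).target x :=
    (uniqueDiffOn_extChartAt_target (I := I) q).uniqueMDiffOn x hx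
  have h3 := tD_comp (t := univ) h1.mdifferentiableWithinAt h2 (mapsTo_univ _ _) hu
  rw [tD_congr (φ := extChartAt I q ∘ (extChartAt I q).symm) (φ' := id)
    (fun y hy => (extChartAt I q).right_inv hy) ((extChartAt I q).right_inv hx), tD_id hu] at h3
  intro a b hab
  have e := congrArg (tD I 𝓘(ℝ, Euc d) (extChartAt I q) univ ((extChartAt I q).symm x)) hab
  simpa using (congrArg (fun L => L a) h3).trans (e.trans (congrArg (fun L => L b) h3).symm)

-- A chart target is relatively open in the model range, so derivatives within either set agree at
-- points of the target, including boundary points.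
omit [IsManifold I ∞ M] in
theorem chart_target_eventuallyEq (q : M) (hx : x ∈ (extChartAt I q).target) :
    (extChartAt I q).target =ᶠ[𝓝 x] range I := by
  have h1 := extChartAt_target_mem_nhdsWithin_of_mem hx
  have h2 : (extChartAt I q).target ⊆ range I := extChartAt_target_subset_range q
  rw [mem_nhdsWithin_iff_eventually] at h1
  filter_upwards [h1] with y hy
  exact propext ⟨fun h => h2 h, hy⟩

omit [IsManifold I ∞ M] in
theorem chartCoeff_eq (g : MetricField I M) (q : M) (hx : x ∈ (extChartAt I q).target) :
    chartCoeff g q x = metricCoeff g (extChartAt I q).target (extChartAt I q).symm x := by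
  exact (metricCoeff_congr_set g (chart_target_eventuallyEq q hx)).symm

/-- The transition from a parametrization to a chart. -/
theorem IsParam.transition (h : IsParam I φ s) (q : M)
    (hm : ∀ y ∈ s, φ y ∈ (extChartAt I q).source) :
    ContDiffOn ℝ ∞ (extChartAt I q ∘ φ) s ∧
    MapsTo (extChartAt I q ∘ φ) s (extChartAt I q).target ∧
    ∀ y ∈ s, tD 𝓘(ℝ, Euc d) I φ s y =
      (tD 𝓘(ℝ, Euc d) I (extChartAt I q).symm (extChartAt I q).target
        (extChartAt I q (φ y))).comp (fderivWithin ℝ (extChartAt I q ∘ φ) s y) := by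
  have hmap : MapsTo (extChartAt I q ∘ φ) s (extChartAt I q).target := fun y hy =>
    (extChartAt I q).map_source (hm y hy)
  have hT : ContMDiffOn 𝓘(ℝ, Euc d) 𝓘(ℝ, Euc d) ∞ (extChartAt I q ∘ φ) s :=
    (contMDiffOn_extChartAt (n := ∞)).comp h.smooth fun y hy => by
      simpa using hm y hy
  refine ⟨contMDiffOn_iff_contDiffOn.1 hT, hmap, fun y hy => ?_⟩
  have hc := isParam_chart (I := I) q
  have hu : UniqueMDiffWithinAt 𝓘(ℝ, Euc d) s y := h.uniq.uniqueMDiffOn y hy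
  have h3 := tD_comp (I'' := I) ((hc.smooth _ (hmap hy)).mdifferentiableWithinAt (by simp))
    ((hT y hy).mdifferentiableWithinAt (by simp)) hmap hu
  rw [tD_vectorSpace] at h3
  rw [← Function.comp_apply (f := extChartAt I q) (g := φ), ← h3]
  exact tD_congr (fun z hz => ((extChartAt I q).left_inv (hm z hz)).symm)
    ((extChartAt I q).left_inv (hm y hy)).symm

theorem FieldBilin.metricCoeff_transition {g : MetricField I M} (hg : FieldBilin g)
    (h : IsParam I φ s) (q : M) (hm : ∀ y ∈ s, φ y ∈ (extChartAt I q).source) (hx : x ∈ s)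
    (a b : Euc d) :
    bil (metricCoeff g s φ x) a b = bil (metricCoeff g (extChartAt I q).target
      (extChartAt I q).symm (extChartAt I q (φ x)))
      (fderivWithin ℝ (extChartAt I q ∘ φ) s x a) (fderivWithin ℝ (extChartAt I q ∘ φ) s x b) := by
  rw [hg.bil_metricCoeff, hg.bil_metricCoeff, (h.transition q hm).2.2 x hx,
    (extChartAt I q).left_inv (hm x hx)]
  rfl

theorem surjective_of_injective_euc (L : Euc d →L[ℝ] Euc d) (h : Function.Injective L) :
    Function.Surjective L :=
  (LinearMap.injective_iff_surjective (f := L.toLinearMap)).1 h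

omit [IsManifold I ∞ M] in
/-- A parametrization of an open set has its image in the interior. -/
theorem IsParam.isInteriorPoint (h : IsParam I φ s) (hs : IsOpen s) (hx : x ∈ s) :
    I.IsInteriorPoint (φ x) := by
  have hsurj : Function.Surjective (mfderiv 𝓘(ℝ, Euc d) I φ x) := by
    have := h.inj x hx
    rw [tD_of_mem_nhds (hs.mem_nhds hx), tD_univ] at this
    exact surjective_of_injective_euc _ this
  have hd : MDifferentiableAt 𝓘(ℝ, Euc d) I φ x :=
    ((h.smooth x hx).contMDiffAt (hs.mem_nhds hx)).mdifferentiableAt (by simp)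
  exact hd.isInteriorPoint_of_surjective_mfderiv hsurj BoundarylessManifold.isInteriorPoint

/-- The scalar curvature can be computed in every parametrization of an open set. -/
theorem IsParam.scalarCurvature_eq (h : IsParam I φ s) (hs : IsOpen s) (hx : x ∈ s)
    (g : SmoothMetric I M) :
    scalarCurvature (toField g) (φ x) = scalarCoeff univ (metricCoeff (toField g) s φ) x := by
  set q := φ x with hq
  set κ := extChartAt I q with hκ
  have hxq : φ x ∈ κ.source := mem_extChartAt_source (I := I) q
  have hxi : κ (φ x) ∈ interior κ.target :=
    ModelWithCorners.isInteriorPoint_iff.1 (h.isInteriorPoint hs hx)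
  obtain ⟨u, hu, hus⟩ := h.exists_open (isOpen_extChartAt_source (I := I) q)
  have hp := h.inter_open hu
  have hm : ∀ y ∈ s ∩ u, φ y ∈ κ.source := fun y hy => (hus y hy.1).1 hy.2
  obtain ⟨hT, hmap, hder⟩ := hp.transition q hm
  -- After shrinking, the transition to the preferred chart is an isometry between open sets, to
  -- which `scalarCoeff_isometry` applies. The point stays inside because a parametrization of an
  -- open set hits only interior points.
  have hU : IsOpen ((s ∩ u) ∩ (κ ∘ φ) ⁻¹' interior κ.target) :=
    hT.continuousOn.isOpen_inter_preimage (hs.inter hu) isOpen_interior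
  set U := (s ∩ u) ∩ (κ ∘ φ) ⁻¹' interior κ.target with hUdef
  have hxU : x ∈ U := ⟨⟨hx, (hus x hx).2 hxq⟩, hxi⟩
  have hUs : IsParam I φ U := by
    have := hp.inter_open hU
    rwa [inter_eq_self_of_subset_right inter_subset_left] at this
  have hc : IsParam I κ.symm (interior κ.target) := by
    have := (isParam_chart (I := I) q).inter_open (isOpen_interior (s := κ.target))
    rwa [inter_eq_self_of_subset_right interior_subset] at this
  have key : ∀ y ∈ U, ∀ a b, bil (metricCoeff (toField g) U φ y) a b =
      bil (metricCoeff (toField g) (interior κ.target) κ.symm ((κ ∘ φ) y))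
        (fderiv ℝ (κ ∘ φ) y a) (fderiv ℝ (κ ∘ φ) y b) := by
    intro y hy a b
    have e := (fieldBilin_toField g).metricCoeff_transition hUs q (fun z hz => hm z hz.1) hy a b
    rw [fderivWithin_of_isOpen hU hy, metricCoeff_congr_set (s := κ.target)
      (t := interior κ.target)] at e
    · exact e
    · have : interior κ.target ∈ 𝓝 (κ (φ y)) := isOpen_interior.mem_nhds hy.2
      filter_upwards [this] with z hz
      exact propext ⟨fun _ => hz, fun _ => interior_subset hz⟩
  have e1 := scalarCoeff_isometry (hUs.smoothMetricOn hU g) (hc.smoothMetricOn isOpen_interior g)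
    (hT.mono inter_subset_left) (fun y hy => hy.2) key hxU
  have e2 : scalarCoeff univ (metricCoeff (toField g) s φ) x =
      scalarCoeff univ (metricCoeff (toField g) U φ) x := by
    refine scalarCoeff_congr univ_mem ?_
    filter_upwards [hU.mem_nhds hxU] with y hy
    refine metricCoeff_congr_set _ ?_
    filter_upwards [hU.mem_nhds hy] with z hz
    exact propext ⟨fun _ => hz, fun _ => hz.1.1⟩
  rw [e2, e1]
  refine scalarCoeff_congr (range_mem_nhds_isInteriorPoint (h.isInteriorPoint hs hx)) ?_
  filter_upwards [isOpen_interior.mem_nhds hxi] with y hy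
  rw [chartCoeff_eq _ _ (interior_subset hy)]
  refine metricCoeff_congr_set _ ?_
  filter_upwards [isOpen_interior.mem_nhds hy] with z hz
  exact propext ⟨fun _ => hz, fun _ => interior_subset hz⟩

end ManifoldMetric

/-! ### Coordinates of the ambient manifold -/

section SmoothCoord

variable {n : ℕ} {E : Type*} [TopologicalSpace E] [ChartedSpace (Euc n) E]

/-- `ψ` is the inverse of a coordinate system of `E`. -/
structure SmoothCoord (ψ : OpenPartialHomeomorph (Euc n) E) : Prop where
  smooth : ContMDiffOn 𝓘(ℝ, Euc n) (𝓡 n) ∞ ψ ψ.source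
  smooth_symm : ContMDiffOn (𝓡 n) 𝓘(ℝ, Euc n) ∞ ψ.symm ψ.target

variable {ψ : OpenPartialHomeomorph (Euc n) E}

namespace SmoothCoord

variable (hψ : SmoothCoord ψ)
include hψ

theorem mdiff_symm {e : E} (he : e ∈ ψ.target) :
    MDifferentiableAt (𝓡 n) 𝓘(ℝ, Euc n) ψ.symm e :=
  ((hψ.smooth_symm e he).contMDiffAt (ψ.open_target.mem_nhds he)).mdifferentiableAt (by simp)

theorem tD_symm_comp {z : Euc n} (hz : z ∈ ψ.source) :
    (tD (𝓡 n) 𝓘(ℝ, Euc n) ψ.symm ψ.target (ψ z)).comp (tD 𝓘(ℝ, Euc n) (𝓡 n) ψ ψ.source z) =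
      ContinuousLinearMap.id ℝ _ := by
  have hu : UniqueMDiffWithinAt 𝓘(ℝ, Euc n) ψ.source z :=
    ψ.open_source.uniqueMDiffWithinAt hz
  rw [← tD_comp ((hψ.smooth_symm _ (ψ.map_source hz)).mdifferentiableWithinAt (by simp))
    ((hψ.smooth z hz).mdifferentiableWithinAt (by simp)) (fun y hy => ψ.map_source hy) hu,
    tD_congr (φ := ψ.symm ∘ ψ) (φ' := id) (fun y hy => ψ.left_inv hy) (ψ.left_inv hz), tD_id hu]

theorem tD_comp_symm {e : E} (he : e ∈ ψ.target) :
    (tD 𝓘(ℝ, Euc n) (𝓡 n) ψ ψ.source (ψ.symm e)).comp (tD (𝓡 n) 𝓘(ℝ, Euc n) ψ.symm ψ.target e) =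
      ContinuousLinearMap.id ℝ _ := by
  have hu : UniqueMDiffWithinAt (𝓡 n) ψ.target e := ψ.open_target.uniqueMDiffWithinAt he
  rw [← tD_comp ((hψ.smooth _ (ψ.map_target he)).mdifferentiableWithinAt (by simp))
    ((hψ.smooth_symm e he).mdifferentiableWithinAt (by simp)) (fun y hy => ψ.map_target hy) hu,
    tD_congr (φ := ψ ∘ ψ.symm) (φ' := id) (fun y hy => ψ.right_inv hy) (ψ.right_inv he), tD_id hu]

theorem isParam [IsManifold (𝓡 n) ∞ E] : IsParam (𝓡 n) ψ ψ.source := by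
  refine ⟨ψ.open_source.uniqueDiffOn, hψ.smooth, fun z hz a b hab => ?_⟩
  have h1 := hψ.tD_symm_comp hz
  have := congrArg (tD (𝓡 n) 𝓘(ℝ, Euc n) ψ.symm ψ.target (ψ z)) hab
  simpa using ((congrArg (fun L => L a) h1).symm.trans this).trans (congrArg (fun L => L b) h1)

theorem bil_metricCoeff {h : MetricField (𝓡 n) E} (hb : FieldBilin h) {e : E} (he : e ∈ ψ.target)
    (a b : Euc n) :
    bil (metricCoeff h ψ.source ψ (ψ.symm e)) (tD (𝓡 n) 𝓘(ℝ, Euc n) ψ.symm ψ.target e a)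
      (tD (𝓡 n) 𝓘(ℝ, Euc n) ψ.symm ψ.target e b) = h e a b := by
  rw [hb.bil_metricCoeff, ← ContinuousLinearMap.comp_apply, ← ContinuousLinearMap.comp_apply,
    hψ.tD_comp_symm he, ψ.right_inv he]
  rfl

end SmoothCoord

theorem smoothCoord_chart [IsManifold (𝓡 n) ∞ E] (e : E) : SmoothCoord (chartAt (Euc n) e).symm := by
  constructor
  · have := contMDiffOn_chart_symm (I := 𝓡 n) (n := ∞) (x := e)
    exact this
  · have := contMDiffOn_chart (I := 𝓡 n) (n := ∞) (x := e)
    exact this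

/-- The coefficients of a metric in two coordinate systems. -/
theorem SmoothCoord.metricCoeff_change {ψ' : OpenPartialHomeomorph (Euc n) E} (hψ : SmoothCoord ψ)
    (hψ' : SmoothCoord ψ') {h : MetricField (𝓡 n) E} (hb : FieldBilin h) {z : Euc n}
    (hz : z ∈ ψ.source) (hz' : ψ z ∈ ψ'.target) (a b : Euc n) :
    fderiv ℝ (ψ'.symm ∘ ψ) z = (tD (𝓡 n) 𝓘(ℝ, Euc n) ψ'.symm ψ'.target (ψ z)).comp
      (tD 𝓘(ℝ, Euc n) (𝓡 n) ψ ψ.source z) ∧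
    bil (metricCoeff h ψ.source ψ z) a b = bil (metricCoeff h ψ'.source ψ' (ψ'.symm (ψ z)))
      (fderiv ℝ (ψ'.symm ∘ ψ) z a) (fderiv ℝ (ψ'.symm ∘ ψ) z b) := by
  have hV : IsOpen (ψ.source ∩ ψ ⁻¹' ψ'.target) :=
    ψ.continuousOn.isOpen_inter_preimage ψ.open_source ψ'.open_target
  have hzV : z ∈ ψ.source ∩ ψ ⁻¹' ψ'.target := ⟨hz, hz'⟩
  have hd : fderiv ℝ (ψ'.symm ∘ ψ) z = (tD (𝓡 n) 𝓘(ℝ, Euc n) ψ'.symm ψ'.target (ψ z)).comp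
      (tD 𝓘(ℝ, Euc n) (𝓡 n) ψ ψ.source z) := by
    have h1 := tD_comp (s := ψ.source ∩ ψ ⁻¹' ψ'.target) (t := ψ'.target)
      ((hψ'.smooth_symm _ hz').mdifferentiableWithinAt (by simp))
      (((hψ.smooth z hz).mono inter_subset_left).mdifferentiableWithinAt (by simp))
      (fun y hy => hy.2) (hV.uniqueMDiffWithinAt hzV (I := 𝓘(ℝ, Euc n)))
    rw [tD_vectorSpace, fderivWithin_of_isOpen hV hzV] at h1
    rw [h1]
    congr 1
    rw [tD_of_mem_nhds (hV.mem_nhds hzV), tD_of_mem_nhds (ψ.open_source.mem_nhds hz)]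
  refine ⟨hd, ?_⟩
  rw [hd, ContinuousLinearMap.comp_apply, ContinuousLinearMap.comp_apply,
    hψ'.bil_metricCoeff hb hz', hb.bil_metricCoeff]

theorem SmoothCoord.contDiffOn_change {ψ' : OpenPartialHomeomorph (Euc n) E} (hψ : SmoothCoord ψ)
    (hψ' : SmoothCoord ψ') : ContDiffOn ℝ ∞ (ψ'.symm ∘ ψ) (ψ.source ∩ ψ ⁻¹' ψ'.target) :=
  contMDiffOn_iff_contDiffOn.1
    (hψ'.smooth_symm.comp (hψ.smooth.mono inter_subset_left) fun _ hy => hy.2)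

/-- In the chart at `e` the curvature of `h` at `e` is given by the definitions. -/
theorem scalarCurvature_eq_chart (h : MetricField (𝓡 n) E) (e : E) :
    scalarCurvature h e = scalarCoeff univ (metricCoeff h (chartAt (Euc n) e).symm.source
      (chartAt (Euc n) e).symm) ((chartAt (Euc n) e) e) := by
  refine scalarCoeff_congr (by simp) ?_
  filter_upwards [(chartAt (Euc n) e).open_target.mem_nhds (mem_chart_target _ e)] with y hy
  refine (metricCoeff_congr_set h (φ := (chartAt (Euc n) e).symm) ?_)
  filter_upwards [(chartAt (Euc n) e).open_target.mem_nhds hy] with z hz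
  exact propext ⟨fun _ => hz, fun _ => ⟨z, rfl⟩⟩

theorem ricci_eq_chart (h : MetricField (𝓡 n) E) (e : E) (v : Euc n) :
    ricci h e v v = ∑ j, ∑ k, ricciCoeff univ (metricCoeff h (chartAt (Euc n) e).symm.source
      (chartAt (Euc n) e).symm) j k ((chartAt (Euc n) e) e) * v j * v k := by
  refine Finset.sum_congr rfl fun j _ => Finset.sum_congr rfl fun k _ => ?_
  congr 2
  refine ricciCoeff_congr (by simp) ?_ _ _
  filter_upwards [(chartAt (Euc n) e).open_target.mem_nhds (mem_chart_target _ e)] with y hy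
  refine (metricCoeff_congr_set h (φ := (chartAt (Euc n) e).symm) ?_)
  filter_upwards [(chartAt (Euc n) e).open_target.mem_nhds hy] with z hz
  exact propext ⟨fun _ => hz, fun _ => ⟨z, rfl⟩⟩

/-- Tangent vectors at `e` are by definition coordinate vectors in the preferred chart at `e`, so
this chart has the identity as its derivative at its centre. Thus components of the normal in this
chart are the normal itself. -/
theorem tD_chart_self [IsManifold (𝓡 n) ∞ E] (e : E) :
    tD (𝓡 n) 𝓘(ℝ, Euc n) (chartAt (Euc n) e).symm.symm (chartAt (Euc n) e).symm.target e =
      ContinuousLinearMap.id ℝ _ := by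
  have h1 := (smoothCoord_chart (n := n) e).tD_comp_symm (e := e) (mem_chart_source _ e)
  have h2 := (smoothCoord_chart (n := n) e).smooth _ (mem_chart_target (Euc n) e)
  have h3 := tD_eq_fderivWithin (h2.mdifferentiableWithinAt (by simp))
  have h4 : (chartAt (Euc n) e).symm ((chartAt (Euc n) e) e) = e :=
    (chartAt (Euc n) e).left_inv (mem_chart_source _ e)
  have h5 : fderivWithin ℝ (extChartAt (𝓡 n) ((chartAt (Euc n) e).symm ((chartAt (Euc n) e) e)) ∘
      (chartAt (Euc n) e).symm) (chartAt (Euc n) e).symm.source ((chartAt (Euc n) e) e) =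
      ContinuousLinearMap.id ℝ _ := by
    rw [h4, fderivWithin_congr (f := id), fderivWithin_id]
    · exact (chartAt (Euc n) e).open_target.uniqueDiffWithinAt (mem_chart_target _ e)
    · intro y hy
      simpa using (chartAt (Euc n) e).right_inv hy
    · simp
  have h6 : tD 𝓘(ℝ, Euc n) (𝓡 n) (chartAt (Euc n) e).symm (chartAt (Euc n) e).symm.source
      ((chartAt (Euc n) e).symm.symm e) = ContinuousLinearMap.id ℝ _ := h3.trans h5
  rw [h6] at h1
  simpa using h1

end SmoothCoord

/-! ### Hypersurfaces parametrized by sets that need not be open -/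

section Within

variable {n : ℕ} {G H : Euc n → Matrix (Fin n) (Fin n) ℝ} {s U' : Set (Euc n)}
  {π ν : Euc n → Euc n} {u θ : Euc n → ℝ} {x : Euc n}

/-- `(π, u)` is a smooth isometric immersion of `(s, G)` in `(U', H) × ℝ` with continuous unit
normal `(ν, θ)`. -/
structure IsHypWithin (G H : Euc n → Matrix (Fin n) (Fin n) ℝ) (s U' : Set (Euc n))
    (π : Euc n → Euc n) (u : Euc n → ℝ) (ν : Euc n → Euc n) (θ : Euc n → ℝ) : Prop where
  uniq : UniqueDiffOn ℝ s
  smoothG : ∀ i j, ContDiffOn ℝ ∞ (fun y => G y i j) s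
  smoothH : SmoothMetricOn H U'
  maps : MapsTo π s U'
  smooth_π : ContDiffOn ℝ ∞ π s
  smooth_u : ContDiffOn ℝ ∞ u s
  cont_ν : ContinuousOn ν s
  cont_θ : ContinuousOn θ s
  point : ∀ y ∈ s, IsHypPoint (G y) (H (π y)) (fderivWithin ℝ π s y) (fderivWithin ℝ u s y)
    (ν y) (θ y)

/-- The flux field `(tr A) ∇u - A ∇u`. -/
def fluxField (G H : Euc n → Matrix (Fin n) (Fin n) ℝ) (s : Set (Euc n))
    (π : Euc n → Euc n) (u : Euc n → ℝ) (ν : Euc n → Euc n) (θ : Euc n → ℝ) (y : Euc n) : Euc n :=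
  newtonField (G y) (sffMatrix s H π u (ν y) (θ y) y) fun i => fderivWithin ℝ u s y (stdVec i)

namespace IsHypWithin

variable (h : IsHypWithin G H s U' π u ν θ)
include h

theorem contDiffOn_inv (i j : Fin n) : ContDiffOn ℝ ∞ (fun y => (G y)⁻¹ i j) s := fun y hy =>
  contDiffWithinAt_inv (fun i j => h.smoothG i j y hy) (h.point y hy).metricG.det_pos.ne' i j

theorem contDiffOn_bilH : ContDiffOn ℝ ∞ (fun y => bil (H (π y))) s := fun y hy =>
  (h.smoothH.contDiffAt_bil (h.maps hy)).comp_contDiffWithinAt y (h.smooth_π y hy)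

theorem contDiffOn_chrH : ContDiffOn ℝ ∞ (fun y => chr H (π y)) s := fun y hy =>
  (h.smoothH.contDiffAt_chr (h.maps hy)).comp_contDiffWithinAt y (h.smooth_π y hy)

/-- The normal is smooth: near a point it is the normalized projection of its value there. -/
theorem smooth_normal : ContDiffOn ℝ ∞ ν s ∧ ContDiffOn ℝ ∞ θ s := by
  have cπ' : ContDiffOn ℝ ∞ (fderivWithin ℝ π s) s := h.smooth_π.fderivWithin h.uniq (by simp)
  have cu' : ContDiffOn ℝ ∞ (fderivWithin ℝ u s) s := h.smooth_u.fderivWithin h.uniq (by simp)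
  have key : ∀ x ∈ s, ContDiffWithinAt ℝ ∞ ν s x ∧ ContDiffWithinAt ℝ ∞ θ s x := by
    intro x hx
    set n0 := ν x
    set t0 := θ x
    -- `r y` is the product of the components of `N(x)`, held constant in coordinates, with `N(y)`;
    -- `v y` is the tangential part of the constant vector. The rest `(N1, T1)` is smooth without
    -- any use of regularity of `N`, and equals `r N`.
    let r : Euc n → ℝ := fun y => bil (H (π y)) n0 (ν y) + t0 * θ y
    let v : Euc n → Euc n := fun y => sharp (G y) fun i =>
      bil (H (π y)) n0 (fderivWithin ℝ π s y (stdVec i)) + t0 * fderivWithin ℝ u s y (stdVec i)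
    let N1 : Euc n → Euc n := fun y => n0 - fderivWithin ℝ π s y (v y)
    let T1 : Euc n → ℝ := fun y => t0 - fderivWithin ℝ u s y (v y)
    have c0 : ∀ c : Euc n, ContDiffOn ℝ ∞ (fun _ : Euc n => c) s := fun c => contDiffOn_const
    have cv : ContDiffOn ℝ ∞ v s := by
      rw [contDiffOn_euclidean]
      intro i
      simp only [v, sharp_apply]
      exact ContDiffOn.sum fun j _ => (h.contDiffOn_inv i j).mul
        (((h.contDiffOn_bilH.clm_apply (c0 n0)).clm_apply (cπ'.clm_apply (c0 _))).add
          (contDiffOn_const.mul (cu'.clm_apply (c0 _))))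
    have cN1 : ContDiffOn ℝ ∞ N1 s := contDiffOn_const.sub (cπ'.clm_apply cv)
    have cT1 : ContDiffOn ℝ ∞ T1 s := contDiffOn_const.sub (cu'.clm_apply cv)
    have hdec : ∀ y ∈ s, N1 y = r y • ν y ∧ T1 y = r y * θ y := by
      intro y hy
      have hp := h.point y hy
      obtain ⟨w, h1, h2⟩ := hp.exists_decomp n0 t0
      have hw : w = v y := by
        refine hp.metricG.eq_of_bil fun c => ?_
        have e := hp.metricG.bil_sharp ((bil (H (π y)) n0) ∘L (fderivWithin ℝ π s y)
          + t0 • fderivWithin ℝ u s y) c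
        simp only [add_apply, smul_apply, ContinuousLinearMap.comp_apply, smul_eq_mul] at e
        rw [e, hp.isometric]
        have o := hp.orth c
        have e1 : bil (H (π y)) n0 (fderivWithin ℝ π s y c) =
            bil (H (π y)) (fderivWithin ℝ π s y w) (fderivWithin ℝ π s y c)
            + r y * bil (H (π y)) (ν y) (fderivWithin ℝ π s y c) := by
          conv_lhs => rw [h1]
          simp only [map_add, map_smul, add_apply, smul_apply, smul_eq_mul, r]
        have e2 : t0 = fderivWithin ℝ u s y w + r y * θ y := h2
        rw [e1]
        linear_combination (-(fderivWithin ℝ u s y c)) * e2 - r y * o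
      subst hw
      refine ⟨?_, ?_⟩
      · simp only [N1]
        exact sub_eq_of_eq_add' h1
      · simp only [T1]
        exact sub_eq_of_eq_add' h2
    have hr2 : ∀ y ∈ s, r y * r y = bil (H (π y)) (N1 y) (N1 y) + T1 y * T1 y := by
      intro y hy
      obtain ⟨e1, e2⟩ := hdec y hy
      rw [e1, e2]
      simp only [map_smul, smul_apply, smul_eq_mul]
      linear_combination (-(r y * r y)) * (h.point y hy).unit
    have crc : ContinuousOn r s :=
      ((h.contDiffOn_bilH.continuousOn.clm_apply continuousOn_const).clm_apply h.cont_ν).add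
        (continuousOn_const.mul h.cont_θ)
    have hrx : r x = 1 := (h.point x hx).unit
    -- Here the continuity of the normal is used: it fixes the sign of `r`, whose square is already
    -- smooth.
    have hpos : ∀ᶠ y in 𝓝[s] x, 0 < r y := by
      have := crc x hx
      exact this.eventually (by rw [hrx]; exact lt_mem_nhds one_pos)
    have cr : ContDiffWithinAt ℝ ∞ r s x := by
      have c2 : ContDiffWithinAt ℝ ∞
          (fun y => Real.sqrt (bil (H (π y)) (N1 y) (N1 y) + T1 y * T1 y)) s x := by
        refine ContDiffWithinAt.sqrt ?_ ?_
        · exact ((((h.contDiffOn_bilH.clm_apply cN1).clm_apply cN1).add (cT1.mul cT1)) x hx)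
        · rw [← hr2 x hx, hrx]; norm_num
      refine c2.congr_of_eventuallyEq_of_mem ?_ hx
      filter_upwards [hpos, self_mem_nhdsWithin] with y hy hys
      rw [← hr2 y hys, Real.sqrt_mul_self hy.le]
    have cri : ContDiffWithinAt ℝ ∞ (fun y => (r y)⁻¹) s x := cr.inv (by rw [hrx]; norm_num)
    constructor
    · refine (cri.smul (cN1 x hx)).congr_of_eventuallyEq_of_mem ?_ hx
      filter_upwards [hpos, self_mem_nhdsWithin] with y hy hys
      change ν y = (r y)⁻¹ • N1 y
      rw [(hdec y hys).1, smul_smul, inv_mul_cancel₀ hy.ne', one_smul]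
    · refine (cri.mul (cT1 x hx)).congr_of_eventuallyEq_of_mem ?_ hx
      filter_upwards [hpos, self_mem_nhdsWithin] with y hy hys
      rw [(hdec y hys).2, ← mul_assoc, inv_mul_cancel₀ hy.ne', one_mul]
  exact ⟨fun x hx => (key x hx).1, fun x hx => (key x hx).2⟩

theorem isHypOn (hs : IsOpen s) : IsHypOn G H s U' π u ν θ where
  smoothG := ⟨hs, h.smoothG, fun y hy => (h.point y hy).metricG⟩
  smoothH := h.smoothH
  maps := h.maps
  smooth_π := h.smooth_π
  smooth_u := h.smooth_u
  smooth_ν := h.smooth_normal.1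
  smooth_θ := h.smooth_normal.2
  point := fun y hy => by
    have := h.point y hy
    rwa [fderivWithin_of_isOpen hs hy, fderivWithin_of_isOpen hs hy] at this

theorem contDiffOn_fluxField : ContDiffOn ℝ ∞ (fluxField G H s π u ν θ) s := by
  have cπ' : ContDiffOn ℝ ∞ (fderivWithin ℝ π s) s := h.smooth_π.fderivWithin h.uniq (by simp)
  have cu' : ContDiffOn ℝ ∞ (fderivWithin ℝ u s) s := h.smooth_u.fderivWithin h.uniq (by simp)
  have cπ'' : ContDiffOn ℝ ∞ (fderivWithin ℝ (fderivWithin ℝ π s) s) s :=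
    cπ'.fderivWithin h.uniq (by simp)
  have cu'' : ContDiffOn ℝ ∞ (fderivWithin ℝ (fderivWithin ℝ u s) s) s :=
    cu'.fderivWithin h.uniq (by simp)
  obtain ⟨cν, cθ⟩ := h.smooth_normal
  have c0 : ∀ c : Euc n, ContDiffOn ℝ ∞ (fun _ : Euc n => c) s := fun c => contDiffOn_const
  have cA : ∀ i j, ContDiffOn ℝ ∞ (fun y => sffMatrix s H π u (ν y) (θ y) y i j) s := by
    intro i j
    simp only [sffMatrix, Matrix.of_apply, secondForm]
    exact ((h.contDiffOn_bilH.clm_apply (((cπ''.clm_apply (c0 _)).clm_apply (c0 _)).add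
      ((h.contDiffOn_chrH.clm_apply (cπ'.clm_apply (c0 _))).clm_apply
        (cπ'.clm_apply (c0 _))))).clm_apply cν).add
      (((cu''.clm_apply (c0 _)).clm_apply (c0 _)).mul cθ)
  have cB : ContDiffOn ℝ ∞ (fun y => bil (sffMatrix s H π u (ν y) (θ y) y)) s := fun y hy =>
    contDiffWithinAt_bil fun i j => cA i j y hy
  have cξ : ContDiffOn ℝ ∞ (fun y => sharp (G y) fun i => fderivWithin ℝ u s y (stdVec i)) s := by
    rw [contDiffOn_euclidean]
    intro i
    simp only [sharp_apply]
    exact ContDiffOn.sum fun j _ => (h.contDiffOn_inv i j).mul (cu'.clm_apply (c0 _))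
  have ct : ContDiffOn ℝ ∞
      (fun y => trB (G y)⁻¹ fun a b => bil (sffMatrix s H π u (ν y) (θ y) y) a b) s := by
    simp only [trB]
    exact ContDiffOn.sum fun i _ => ContDiffOn.sum fun j _ => (h.contDiffOn_inv i j).mul
      ((cB.clm_apply (c0 _)).clm_apply (c0 _))
  rw [contDiffOn_euclidean]
  intro i
  simp only [fluxField, newtonField, sharp_apply (A := G _)]
  exact ContDiffOn.sum fun j _ => (h.contDiffOn_inv i j).mul
    ((ct.mul (cu'.clm_apply (c0 _))).sub ((cB.clm_apply (c0 _)).clm_apply cξ))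

end IsHypWithin

theorem newtonField_congr {A A' : Matrix (Fin n) (Fin n) ℝ} {G₁ : Matrix (Fin n) (Fin n) ℝ}
    {w w' : Fin n → ℝ} (hA : A = A') (hw : w = w') :
    newtonField G₁ A w = newtonField G₁ A' w' := by rw [hA, hw]

theorem sffMatrix_ext {d : ℕ} {t : Set (Euc d)} {H' : Euc n → Matrix (Fin n) (Fin n) ℝ}
    {s : Set (Euc d)} {π π' : Euc d → Euc n} {u u' : Euc d → ℝ} {ν ν' : Euc n} {θ θ' : ℝ}
    {x : Euc d} (h : ∀ a b, secondForm s H π u ν θ x a b = secondForm t H' π' u' ν' θ' x a b) :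
    sffMatrix s H π u ν θ x = sffMatrix t H' π' u' ν' θ' x := by
  ext i j
  exact h _ _

end Within

/-! ### Hypersurfaces of the product of a manifold with a line -/

section HypManifold

variable {n : ℕ} {E : Type*} [TopologicalSpace E] [ChartedSpace (Euc n) E]
  [NeZero n] {M : Type*} [TopologicalSpace M] [ChartedSpace (EuclideanHalfSpace n) M]

/-- `F` is an isometric immersion of `(M, g)` in `(E × ℝ, h + dt²)` with continuous unit normal
`N`. -/
structure IsHypersurface [IsManifold (𝓡 n) ∞ E] (h : MetricField (𝓡 n) E)
    (g : MetricField (𝓡∂ n) M) (F : M → E × ℝ)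
    (N : ∀ p : M, TangentSpace ((𝓡 n).prod 𝓘(ℝ, ℝ)) (F p)) : Prop where
  smooth : ContMDiff (𝓡∂ n) ((𝓡 n).prod 𝓘(ℝ, ℝ)) ∞ F
  isometric : ∀ p v w, g p v w = prodMetric h (F p) (dImm F p v) (dImm F p w)
  normal_continuous :
    Continuous fun p => (⟨F p, N p⟩ : TangentBundle ((𝓡 n).prod 𝓘(ℝ, ℝ)) (E × ℝ))
  normal_unit : ∀ p, prodMetric h (F p) (N p) (N p) = 1
  normal_orthogonal : ∀ p v, prodMetric h (F p) (N p) (dImm F p v) = 0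

theorem IsAFHypersurface.isHypersurface [IsManifold (𝓡 n) ∞ E] [MeasurableSpace M]
    {h : MetricField (𝓡 n) E} {Ψ : OpenPartialHomeomorph (Euc n) E} {Iv : Set ℝ}
    {g : MetricField (𝓡∂ n) M} {F : M → E × ℝ}
    {N : ∀ p : M, TangentSpace ((𝓡 n).prod 𝓘(ℝ, ℝ)) (F p)}
    {ρ : ℝ} {Φ : Euc n → M} {f : Euc n → ℝ} (hM : IsAFHypersurface h Ψ Iv g F N ρ Φ f) :
    IsHypersurface h g F N :=
  ⟨hM.smooth, hM.isometric, hM.normal_continuous, hM.normal_unit, hM.normal_orthogonal⟩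

/-- The horizontal component of `F` in the coordinates `ψ`. -/
def coordProj (ψ : OpenPartialHomeomorph (Euc n) E) (F : M → E × ℝ) (φ : Euc n → M) (y : Euc n) :
    Euc n := ψ.symm (F (φ y)).1

/-- The vertical component of `F`. -/
def coordHeight (F : M → E × ℝ) (φ : Euc n → M) (y : Euc n) : ℝ := (F (φ y)).2

/-- The horizontal component of the normal in the coordinates `ψ`. -/
def coordNormal (ψ : OpenPartialHomeomorph (Euc n) E) (F : M → E × ℝ)
    (N : ∀ p : M, TangentSpace ((𝓡 n).prod 𝓘(ℝ, ℝ)) (F p)) (φ : Euc n → M) (y : Euc n) : Euc n :=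
  tD (𝓡 n) 𝓘(ℝ, Euc n) ψ.symm ψ.target (F (φ y)).1 (show Euc n × ℝ from N (φ y)).1

/-- The vertical component of the normal. -/
def coordAngle (F : M → E × ℝ) (N : ∀ p : M, TangentSpace ((𝓡 n).prod 𝓘(ℝ, ℝ)) (F p))
    (φ : Euc n → M) (y : Euc n) : ℝ := (show Euc n × ℝ from N (φ y)).2

variable [IsManifold (𝓡 n) ∞ E] [IsManifold (𝓡∂ n) ∞ M]
  {h : SmoothMetric (𝓡 n) E}
  {g : SmoothMetric (𝓡∂ n) M}
  {F : M → E × ℝ} {N : ∀ p : M, TangentSpace ((𝓡 n).prod 𝓘(ℝ, ℝ)) (F p)}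
  {ψ : OpenPartialHomeomorph (Euc n) E} {φ : Euc n → M} {s : Set (Euc n)}

theorem contMDiffOn_coord_fst (hψ : SmoothCoord ψ) :
    ContMDiffOn ((𝓡 n).prod 𝓘(ℝ, ℝ)) 𝓘(ℝ, Euc n) ∞ (fun q : E × ℝ => ψ.symm q.1)
      (Prod.fst ⁻¹' ψ.target) :=
  hψ.smooth_symm.comp contMDiff_fst.contMDiffOn fun _ hq => hq

theorem isOpen_fst_preimage : IsOpen (Prod.fst ⁻¹' ψ.target : Set (E × ℝ)) :=
  ψ.open_target.preimage continuous_fst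

theorem tD_coord_fst (hψ : SmoothCoord ψ) {q : E × ℝ} (hq : q.1 ∈ ψ.target) (v : Euc n × ℝ) :
    tD ((𝓡 n).prod 𝓘(ℝ, ℝ)) 𝓘(ℝ, Euc n) (fun q : E × ℝ => ψ.symm q.1)
      (Prod.fst ⁻¹' ψ.target) q v = tD (𝓡 n) 𝓘(ℝ, Euc n) ψ.symm ψ.target q.1 v.1 := by
  have h1 := tD_comp (I := (𝓡 n).prod 𝓘(ℝ, ℝ)) (I' := 𝓡 n) (I'' := 𝓘(ℝ, Euc n))
    (φ := (Prod.fst : E × ℝ → E)) (s := Prod.fst ⁻¹' ψ.target) (x := q) (t := ψ.target)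
    ((hψ.smooth_symm _ hq).mdifferentiableWithinAt (by simp))
    (mdifferentiableAt_fst.mdifferentiableWithinAt) (fun _ h => h)
    (isOpen_fst_preimage.uniqueMDiffWithinAt hq)
  have h2 : tD ((𝓡 n).prod 𝓘(ℝ, ℝ)) (𝓡 n) (Prod.fst : E × ℝ → E) (Prod.fst ⁻¹' ψ.target) q =
      ContinuousLinearMap.fst ℝ (Euc n) ℝ := by
    rw [tD_of_mem_nhds (isOpen_fst_preimage.mem_nhds hq), tD_univ]
    exact mfderiv_fst
  rw [h2] at h1
  exact congrArg (fun L : Euc n × ℝ →L[ℝ] Euc n => L v) h1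

theorem tD_snd (q : E × ℝ) :
    tD ((𝓡 n).prod 𝓘(ℝ, ℝ)) 𝓘(ℝ, ℝ) (Prod.snd : E × ℝ → ℝ) univ q =
      ContinuousLinearMap.snd ℝ (Euc n) ℝ := by
  rw [tD_univ]
  exact mfderiv_snd

namespace IsHypersurface

variable (hF : IsHypersurface (toField h) (toField g) F N)
include hF

theorem contDiffOn_coordProj (hψ : SmoothCoord ψ) (hφ : IsParam (𝓡∂ n) φ s)
    (hm : ∀ y ∈ s, (F (φ y)).1 ∈ ψ.target) : ContDiffOn ℝ ∞ (coordProj ψ F φ) s :=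
  contMDiffOn_iff_contDiffOn.1 ((contMDiffOn_coord_fst hψ).comp
    (hF.smooth.comp_contMDiffOn hφ.smooth) hm)

theorem contDiffOn_coordHeight (hφ : IsParam (𝓡∂ n) φ s) :
    ContDiffOn ℝ ∞ (coordHeight F φ) s :=
  contMDiffOn_iff_contDiffOn.1 (contMDiff_snd.comp_contMDiffOn
    (hF.smooth.comp_contMDiffOn hφ.smooth))

theorem tD_imm (hφ : IsParam (𝓡∂ n) φ s) {y : Euc n} (hy : y ∈ s) (v : Euc n) :
    tD 𝓘(ℝ, Euc n) ((𝓡 n).prod 𝓘(ℝ, ℝ)) (F ∘ φ) s y v =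
      dImm F (φ y) (tD 𝓘(ℝ, Euc n) (𝓡∂ n) φ s y v) := by
  have h1 := tD_comp (t := univ) (hF.smooth.mdifferentiable (by simp) (φ y)).mdifferentiableWithinAt
    ((hφ.smooth y hy).mdifferentiableWithinAt (by simp)) (mapsTo_univ _ _)
    (hφ.uniq.uniqueMDiffOn y hy)
  rw [h1, tD_univ]
  rfl

theorem fderivWithin_coordProj (hψ : SmoothCoord ψ) (hφ : IsParam (𝓡∂ n) φ s)
    (hm : ∀ y ∈ s, (F (φ y)).1 ∈ ψ.target) {y : Euc n} (hy : y ∈ s) (v : Euc n) :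
    fderivWithin ℝ (coordProj ψ F φ) s y v = tD (𝓡 n) 𝓘(ℝ, Euc n) ψ.symm ψ.target (F (φ y)).1
      (show Euc n × ℝ from dImm F (φ y) (tD 𝓘(ℝ, Euc n) (𝓡∂ n) φ s y v)).1 := by
  have h1 := tD_comp (φ := F ∘ φ) ((contMDiffOn_coord_fst hψ _ (hm y hy)).mdifferentiableWithinAt
      (by simp))
    ((hF.smooth.comp_contMDiffOn hφ.smooth y hy).mdifferentiableWithinAt (by simp))
    hm (hφ.uniq.uniqueMDiffOn y hy)
  rw [tD_vectorSpace] at h1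
  have h2 := congrArg (fun L => L v) h1
  refine h2.trans ?_
  rw [ContinuousLinearMap.comp_apply, hF.tD_imm hφ hy]
  exact tD_coord_fst hψ (hm y hy) _

theorem fderivWithin_coordHeight (hφ : IsParam (𝓡∂ n) φ s) {y : Euc n} (hy : y ∈ s) (v : Euc n) :
    fderivWithin ℝ (coordHeight F φ) s y v =
      (show Euc n × ℝ from dImm F (φ y) (tD 𝓘(ℝ, Euc n) (𝓡∂ n) φ s y v)).2 := by
  have h1 := tD_comp (φ := F ∘ φ) (t := univ) (I'' := 𝓘(ℝ, ℝ))
    (mdifferentiableAt_snd (I := 𝓡 n) (I' := 𝓘(ℝ, ℝ))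
      (x := (F (φ y) : E × ℝ))).mdifferentiableWithinAt
    ((hF.smooth.comp_contMDiffOn hφ.smooth y hy).mdifferentiableWithinAt (by simp))
    (mapsTo_univ _ _) (hφ.uniq.uniqueMDiffOn y hy)
  rw [tD_vectorSpace, tD_snd] at h1
  have h2 := congrArg (fun L => L v) h1
  refine h2.trans ?_
  rw [ContinuousLinearMap.comp_apply, hF.tD_imm hφ hy]
  rfl

/-- Continuity of the normal is given in the tangent bundle; it passes to coordinates through the
continuous tangent map of the coordinates of `E`. -/
theorem continuousOn_coordNormal (hψ : SmoothCoord ψ) (hφ : IsParam (𝓡∂ n) φ s)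
    (hm : ∀ y ∈ s, (F (φ y)).1 ∈ ψ.target) : ContinuousOn (coordNormal ψ F N φ) s := by
  have h1 := (contMDiffOn_coord_fst hψ).continuousOn_tangentMapWithin (by simp)
    isOpen_fst_preimage.uniqueMDiffOn
  have h2 : ContinuousOn (fun y => (⟨F (φ y), N (φ y)⟩ :
      TangentBundle ((𝓡 n).prod 𝓘(ℝ, ℝ)) (E × ℝ))) s :=
    hF.normal_continuous.comp_continuousOn hφ.smooth.continuousOn
  have h3 := h1.comp h2 fun y hy => hm y hy
  have h4 := (contMDiff_snd_tangentBundle_modelSpace (Euc n) 𝓘(ℝ, Euc n)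
    (n := ∞)).continuous.comp_continuousOn h3
  refine h4.congr fun y hy => ?_
  exact (tD_coord_fst hψ (hm y hy) _).symm

theorem continuousOn_coordAngle (hφ : IsParam (𝓡∂ n) φ s) : ContinuousOn (coordAngle F N φ) s := by
  have h1 : Continuous (tangentMap ((𝓡 n).prod 𝓘(ℝ, ℝ)) 𝓘(ℝ, ℝ) (Prod.snd : E × ℝ → ℝ)) :=
    (contMDiff_snd (I := 𝓡 n) (J := 𝓘(ℝ, ℝ)) (M := E) (N := ℝ) (n := ∞)).continuous_tangentMap
      (by simp)
  have h2 : ContinuousOn (fun y => (⟨F (φ y), N (φ y)⟩ :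
      TangentBundle ((𝓡 n).prod 𝓘(ℝ, ℝ)) (E × ℝ))) s :=
    hF.normal_continuous.comp_continuousOn hφ.smooth.continuousOn
  have h3 := h1.comp_continuousOn h2
  have h4 := (contMDiff_snd_tangentBundle_modelSpace ℝ 𝓘(ℝ, ℝ)
    (n := ∞)).continuous.comp_continuousOn h3
  refine h4.congr fun y hy => ?_
  have := tD_snd (n := n) (F (φ y))
  rw [tD_univ] at this
  exact (congrArg (fun L : Euc n × ℝ →L[ℝ] ℝ => L (N (φ y))) this).symm

/-- The hypersurface in coordinates. -/
theorem isHypWithin (hψ : SmoothCoord ψ) (hφ : IsParam (𝓡∂ n) φ s)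
    (hm : ∀ y ∈ s, (F (φ y)).1 ∈ ψ.target) :
    IsHypWithin (metricCoeff (toField g) s φ) (metricCoeff (toField h) ψ.source ψ) s ψ.source
      (coordProj ψ F φ) (coordHeight F φ) (coordNormal ψ F N φ) (coordAngle F N φ) where
  uniq := hφ.uniq
  smoothG := hφ.contDiffOn_metricCoeff g
  smoothH := hψ.isParam.smoothMetricOn ψ.open_source h
  maps := fun y hy => ψ.map_target (hm y hy)
  smooth_π := hF.contDiffOn_coordProj hψ hφ hm
  smooth_u := hF.contDiffOn_coordHeight hφ
  cont_ν := hF.continuousOn_coordNormal hψ hφ hm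
  cont_θ := hF.continuousOn_coordAngle hφ
  point := fun y hy => by
    have hb := fieldBilin_toField h
    refine ⟨hφ.isMetric hy g, hψ.isParam.isMetric (ψ.map_target (hm y hy)) h, fun a b => ?_, ?_,
      fun a => ?_⟩
    · rw [(fieldBilin_toField g).bil_metricCoeff]
      refine (hF.isometric _ _ _).trans ?_
      rw [hF.fderivWithin_coordProj hψ hφ hm hy, hF.fderivWithin_coordProj hψ hφ hm hy,
        hF.fderivWithin_coordHeight hφ hy, hF.fderivWithin_coordHeight hφ hy, coordProj,
        hψ.bil_metricCoeff hb (hm y hy)]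
      rfl
    · rw [coordProj, coordNormal, hψ.bil_metricCoeff hb (hm y hy)]
      exact hF.normal_unit (φ y)
    · rw [hF.fderivWithin_coordProj hψ hφ hm hy, hF.fderivWithin_coordHeight hφ hy, coordProj,
        coordNormal, hψ.bil_metricCoeff hb (hm y hy)]
      exact hF.normal_orthogonal (φ y) _

end IsHypersurface

end HypManifold

/-! ### The flux field on the hypersurface -/

section Flux

variable {n : ℕ} {E : Type*} [TopologicalSpace E] [ChartedSpace (Euc n) E]
  [NeZero n] {M : Type*} [TopologicalSpace M] [ChartedSpace (EuclideanHalfSpace n) M]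

/-- The flux field of the hypersurface `F` in the coordinates `φ` of `M` and `ψ` of `E`. -/
def coordFlux (h : MetricField (𝓡 n) E) (g : MetricField (𝓡∂ n) M) (F : M → E × ℝ)
    (N : ∀ p : M, TangentSpace ((𝓡 n).prod 𝓘(ℝ, ℝ)) (F p))
    (ψ : OpenPartialHomeomorph (Euc n) E) (φ : Euc n → M) (s : Set (Euc n)) : Euc n → Euc n :=
  fluxField (metricCoeff g s φ) (metricCoeff h ψ.source ψ) s
      (coordProj ψ F φ) (coordHeight F φ) (coordNormal ψ F N φ) (coordAngle F N φ)

/-- The flux field at `p`. -/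
def fluxVec (h : MetricField (𝓡 n) E) (g : MetricField (𝓡∂ n) M) (F : M → E × ℝ)
    (N : ∀ p : M, TangentSpace ((𝓡 n).prod 𝓘(ℝ, ℝ)) (F p)) (p : M) : Euc n :=
  coordFlux h g F N (chartAt (Euc n) (F p).1).symm (extChartAt (𝓡∂ n) p).symm
    (extChartAt (𝓡∂ n) p).target (extChartAt (𝓡∂ n) p p)

/-- The flux field in the coordinates `φ`. -/
def paramFlux (h : MetricField (𝓡 n) E) (g : MetricField (𝓡∂ n) M) (F : M → E × ℝ)
    (N : ∀ p : M, TangentSpace ((𝓡 n).prod 𝓘(ℝ, ℝ)) (F p)) (φ : Euc n → M) (s : Set (Euc n))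
    (y : Euc n) : Euc n :=
  coordFlux h g F N (chartAt (Euc n) (F (φ y)).1).symm φ s y

variable [IsManifold (𝓡 n) ∞ E] [IsManifold (𝓡∂ n) ∞ M]
  {h : SmoothMetric (𝓡 n) E}
  {g : SmoothMetric (𝓡∂ n) M}
  {F : M → E × ℝ} {N : ∀ p : M, TangentSpace ((𝓡 n).prod 𝓘(ℝ, ℝ)) (F p)}
  {ψ ψ' : OpenPartialHomeomorph (Euc n) E} {φ φ' : Euc n → M} {s t : Set (Euc n)} {y : Euc n}

theorem coordFlux_congr_set (hst : s =ᶠ[𝓝 y] t) :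
    coordFlux (toField h) (toField g) F N ψ φ s y =
      coordFlux (toField h) (toField g) F N ψ φ t y := by
  simp only [coordFlux, fluxField]
  rw [metricCoeff_congr_set _ hst, fderivWithin_congr_set hst,
    sffMatrix_ext fun a b => secondForm_congr_set hst a b]

theorem angleFn_eq (p : M) : angleFn (toField h) F N p = (show Euc n × ℝ from N p).2 := by
  have h0 : toField h (F p).1 (0 : Euc n) (show Euc n × ℝ from N p).1 = 0 := by
    have := (fieldBilin_toField h (F p).1).smul_left 0 0 (show Euc n × ℝ from N p).1
    rw [zero_mul, zero_smul] at this
    exact this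
  have e : angleFn (toField h) F N p = toField h (F p).1 (0 : Euc n) (show Euc n × ℝ from N p).1
    + 1 * (show Euc n × ℝ from N p).2 := rfl
  rw [e, h0, zero_add, one_mul]

namespace IsHypersurface

variable (hF : IsHypersurface (toField h) (toField g) F N)
include hF

theorem exists_open_maps (hφ : IsParam (𝓡∂ n) φ s) {O : Set E} (hO : IsOpen O) :
    ∃ u, IsOpen u ∧ ∀ y ∈ s, y ∈ u ↔ (F (φ y)).1 ∈ O :=
  hφ.exists_open (hO.preimage (continuous_fst.comp hF.smooth.continuous))

/-- The coordinates of `E` enter the flux field only through the second fundamental form, which is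
invariant under isometries (`secondForm_isometry`); the coordinate change is one for the coefficient
metrics. -/
theorem coordFlux_change_target (hψ : SmoothCoord ψ) (hψ' : SmoothCoord ψ')
    (hφ : IsParam (𝓡∂ n) φ s) (hy : y ∈ s) (h1 : (F (φ y)).1 ∈ ψ.target)
    (h2 : (F (φ y)).1 ∈ ψ'.target) :
    coordFlux (toField h) (toField g) F N ψ φ s y =
      coordFlux (toField h) (toField g) F N ψ' φ s y := by
  obtain ⟨u, hu, hus⟩ := hF.exists_open_maps hφ (ψ.open_target.inter ψ'.open_target)
  have hyu : y ∈ u := (hus y hy).2 ⟨h1, h2⟩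
  have hst : s =ᶠ[𝓝 y] (s ∩ u : Set (Euc n)) := by
    filter_upwards [hu.mem_nhds hyu] with z hz
    exact propext ⟨fun h => ⟨h, hz⟩, fun h => h.1⟩
  rw [coordFlux_congr_set hst, coordFlux_congr_set (ψ := ψ') hst]
  have hφu := hφ.inter_open hu
  have hyt : y ∈ s ∩ u := ⟨hy, hyu⟩
  have hm1 : ∀ z ∈ s ∩ u, (F (φ z)).1 ∈ ψ.target := fun z hz => ((hus z hz.1).1 hz.2).1
  have hm2 : ∀ z ∈ s ∩ u, (F (φ z)).1 ∈ ψ'.target := fun z hz => ((hus z hz.1).1 hz.2).2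
  have hV : IsOpen (ψ.source ∩ ψ ⁻¹' ψ'.target) :=
    ψ.continuousOn.isOpen_inter_preimage ψ.open_source ψ'.open_target
  have hb := fieldBilin_toField h
  have A := hF.isHypWithin hψ hφu hm1
  have A' := hF.isHypWithin hψ' hφu hm2
  simp only [coordFlux, fluxField]
  refine newtonField_congr (sffMatrix_ext fun a b => ?_) rfl
  have hHV : SmoothMetricOn (metricCoeff (toField h) ψ.source ψ) (ψ.source ∩ ψ ⁻¹' ψ'.target) :=
    ⟨hV, fun i j => (A.smoothH.smooth i j).mono inter_subset_left,
      fun z hz => A.smoothH.metric z hz.1⟩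
  have e := secondForm_isometry (ν := coordNormal ψ F N φ y) (θ := coordAngle F N φ y)
    (u := coordHeight F φ) hHV A'.smoothH (hψ.contDiffOn_change hψ')
    (fun z hz => ψ'.map_target hz.2)
    (fun z hz a b => (hψ.metricCoeff_change hψ' hb hz.1 hz.2 a b).2)
    (A.smooth_π.of_le two_le_smooth) A.uniq
    (fun z hz => ⟨A.maps hz, by
      change ψ (ψ.symm (F (φ z)).1) ∈ ψ'.target
      rw [ψ.right_inv (hm1 z hz)]; exact hm2 z hz⟩) hyt a b
  rw [← e]
  have hν : fderiv ℝ (ψ'.symm ∘ ψ) (coordProj ψ F φ y) (coordNormal ψ F N φ y) =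
      coordNormal ψ' F N φ y := by
    have hr : ψ (coordProj ψ F φ y) = (F (φ y)).1 := ψ.right_inv (hm1 y hyt)
    rw [(hψ.metricCoeff_change hψ' hb (A.maps hyt) (by rw [hr]; exact hm2 y hyt) 0 0).1, hr,
      coordNormal, coordNormal, ContinuousLinearMap.comp_apply]
    congr 1
    have := congrArg (fun L => L (show Euc n × ℝ from N (φ y)).1)
      (hψ.tD_comp_symm (hm1 y hyt))
    exact this
  rw [hν]
  refine secondForm_congr ?_ Filter.EventuallyEq.rfl hyt a b
  filter_upwards [self_mem_nhdsWithin] with z hz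
  simp only [Function.comp_apply, coordProj]
  rw [ψ.right_inv (hm1 z hz)]

omit hF in
theorem metricCoeff_comp (hφ : IsParam (𝓡∂ n) φ s) (hφ' : IsParam (𝓡∂ n) φ' t)
    {T : Euc n → Euc n} (hT : ContDiffOn ℝ ∞ T s) (hm : MapsTo T s t)
    (he : ∀ z ∈ s, φ z = φ' (T z)) (hy : y ∈ s) :
    tD 𝓘(ℝ, Euc n) (𝓡∂ n) φ s y =
      (tD 𝓘(ℝ, Euc n) (𝓡∂ n) φ' t (T y)).comp (fderivWithin ℝ T s y) ∧
    ∀ a b, bil (metricCoeff (toField g) s φ y) a b =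
      bil (metricCoeff (toField g) t φ' (T y)) (fderivWithin ℝ T s y a)
        (fderivWithin ℝ T s y b) := by
  have h1 := tD_comp (φ := T) ((hφ'.smooth _ (hm hy)).mdifferentiableWithinAt (by simp))
    ((contMDiffOn_iff_contDiffOn.2 hT y hy).mdifferentiableWithinAt (by simp)) hm
    (hφ.uniq.uniqueMDiffOn y hy)
  rw [tD_vectorSpace] at h1
  have h2 : tD 𝓘(ℝ, Euc n) (𝓡∂ n) φ s y =
      (tD 𝓘(ℝ, Euc n) (𝓡∂ n) φ' t (T y)).comp (fderivWithin ℝ T s y) := by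
    rw [← h1]
    exact tD_congr (fun z hz => he z hz) (he y hy)
  refine ⟨h2, fun a b => ?_⟩
  rw [(fieldBilin_toField g).bil_metricCoeff, (fieldBilin_toField g).bil_metricCoeff, h2, he y hy]
  rfl

/-- The metric, the second fundamental form and `du` all pull back as tensors (`metricCoeff_comp`,
`secondForm_comp`), so `newtonField_transform` applies. -/
theorem coordFlux_change_source (hψ : SmoothCoord ψ)
    (hφ : IsParam (𝓡∂ n) φ s) (hφ' : IsParam (𝓡∂ n) φ' t)
    (h' : ∀ z ∈ t, (F (φ' z)).1 ∈ ψ.target)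
    {T : Euc n → Euc n} (hT : ContDiffOn ℝ ∞ T s) (hm : MapsTo T s t)
    (he : ∀ z ∈ s, φ z = φ' (T z)) (hy : y ∈ s) :
    fderivWithin ℝ T s y (coordFlux (toField h) (toField g) F N ψ φ s y) =
      coordFlux (toField h) (toField g) F N ψ φ' t (T y) := by
  have h1 : ∀ z ∈ s, (F (φ z)).1 ∈ ψ.target := fun z hz => by rw [he z hz]; exact h' _ (hm hz)
  have A := hF.isHypWithin hψ hφ h1
  have A' := hF.isHypWithin hψ hφ' h'
  have hν : coordNormal ψ F N φ y = coordNormal ψ F N φ' (T y) := by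
    simp only [coordNormal]
    rw [he y hy]
  have hθ : coordAngle F N φ y = coordAngle F N φ' (T y) := by
    simp only [coordAngle]
    rw [he y hy]
  have hu : ∀ v, fderivWithin ℝ (coordHeight F φ) s y v =
      fderivWithin ℝ (coordHeight F φ') t (T y) (fderivWithin ℝ T s y v) := by
    intro v
    have e : fderivWithin ℝ (coordHeight F φ) s y =
        fderivWithin ℝ (coordHeight F φ' ∘ T) s y :=
      fderivWithin_congr (fun z hz => by simp only [coordHeight, Function.comp_apply, he z hz])
        (by simp only [coordHeight, Function.comp_apply, he y hy])
    rw [e, fderivWithin_comp y (A'.smooth_u.differentiableOn (by simp) _ (hm hy))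
      (hT.differentiableOn (by simp) _ hy) hm (A.uniq y hy)]
    rfl
  simp only [coordFlux, fluxField, hu]
  refine newtonField_transform (A.point y hy).metricG (A'.point _ (hm hy)).metricG
    (metricCoeff_comp hφ hφ' hT hm he hy).2 (fun a b => ?_) _
  rw [bil_sffMatrix, bil_sffMatrix, hν, hθ]
  have hp := A'.point _ (hm hy)
  rw [← secondForm_comp (A'.smooth_π.of_le two_le_smooth) (A'.smooth_u.of_le two_le_smooth)
    (hT.of_le two_le_smooth) A.uniq A'.uniq hm hy hp.orth hp.metricH]
  refine secondForm_congr ?_ ?_ hy a b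
  · filter_upwards [self_mem_nhdsWithin] with z hz
    simp only [coordProj, Function.comp_apply, he z hz]
  · filter_upwards [self_mem_nhdsWithin] with z hz
    simp only [coordHeight, Function.comp_apply, he z hz]

/-- The coordinate expressions define a vector field on the hypersurface. -/
theorem tD_coordFlux (hψ : SmoothCoord ψ) (hφ : IsParam (𝓡∂ n) φ s) (hy : y ∈ s)
    (h1 : (F (φ y)).1 ∈ ψ.target) :
    tD 𝓘(ℝ, Euc n) (𝓡∂ n) φ s y (coordFlux (toField h) (toField g) F N ψ φ s y) =
      fluxVec (toField h) (toField g) F N (φ y) := by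
  set q := φ y with hq
  set κ := extChartAt (𝓡∂ n) q with hκ
  have hψ' := smoothCoord_chart (n := n) (F q).1
  set ψ' := (chartAt (Euc n) (F q).1).symm with hψ'def
  have h1' : (F q).1 ∈ ψ'.target := mem_chart_source _ _
  rw [hF.coordFlux_change_target hψ hψ' hφ hy h1 h1']
  have hc := isParam_chart (I := 𝓡∂ n) q
  have hqs : q ∈ κ.source := mem_extChartAt_source (I := 𝓡∂ n) q
  have hqt : κ q ∈ κ.target := κ.map_source hqs
  obtain ⟨u', hu', hus'⟩ := hF.exists_open_maps hc ψ'.open_target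
  have hqu' : κ q ∈ u' := (hus' _ hqt).2 (by rw [κ.left_inv hqs]; exact h1')
  obtain ⟨u, hu, hus⟩ := hφ.exists_open ((isOpen_extChartAt_source (I := 𝓡∂ n) q).inter
    (ψ'.open_target.preimage (continuous_fst.comp hF.smooth.continuous)))
  have hyu : y ∈ u := (hus y hy).2 ⟨hqs, h1'⟩
  have hst : s =ᶠ[𝓝 y] (s ∩ u : Set (Euc n)) := by
    filter_upwards [hu.mem_nhds hyu] with z hz
    exact propext ⟨fun h => ⟨h, hz⟩, fun h => h.1⟩
  have hst' : κ.target =ᶠ[𝓝 (κ q)] (κ.target ∩ u' : Set (Euc n)) := by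
    filter_upwards [hu'.mem_nhds hqu'] with z hz
    exact propext ⟨fun h => ⟨h, hz⟩, fun h => h.1⟩
  have hφu := hφ.inter_open hu
  have hcu := hc.inter_open hu'
  have hys : y ∈ s ∩ u := ⟨hy, hyu⟩
  have hsrc : ∀ z ∈ s ∩ u, φ z ∈ κ.source := fun z hz => ((hus z hz.1).1 hz.2).1
  have htr := hφu.transition q hsrc
  have e := hF.coordFlux_change_source hψ' hφu hcu (fun z hz => (hus' z hz.1).1 hz.2) htr.1
    (fun z hz => ⟨htr.2.1 hz, (hus' _ (htr.2.1 hz)).2 (by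
      change (F (κ.symm (κ (φ z)))).1 ∈ _
      rw [κ.left_inv (hsrc z hz)]
      exact ((hus z hz.1).1 hz.2).2)⟩)
    (fun z hz => (κ.left_inv (hsrc z hz)).symm) hys
  have d := tD_eq_fderivWithin ((hφu.smooth y hys).mdifferentiableWithinAt (by simp))
  rw [tD_congr_set hst, d, coordFlux_congr_set hst]
  refine e.trans ?_
  exact (coordFlux_congr_set (g := g) (F := F) (N := N) hst').symm

theorem tD_paramFlux (hφ : IsParam (𝓡∂ n) φ s) (hy : y ∈ s) :
    tD 𝓘(ℝ, Euc n) (𝓡∂ n) φ s y (paramFlux (toField h) (toField g) F N φ s y) =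
      fluxVec (toField h) (toField g) F N (φ y) :=
  hF.tD_coordFlux (smoothCoord_chart _) hφ hy (mem_chart_source _ _)

theorem paramFlux_eq (hψ : SmoothCoord ψ) (hφ : IsParam (𝓡∂ n) φ s) (hy : y ∈ s)
    (h1 : (F (φ y)).1 ∈ ψ.target) :
    paramFlux (toField h) (toField g) F N φ s y = coordFlux (toField h) (toField g) F N ψ φ s y :=
  hF.coordFlux_change_target (smoothCoord_chart _) hψ hφ hy (mem_chart_source _ _) h1

/-- `paramFlux` uses a different chart of `E` at every point. Near a given point all of them may be
replaced by one fixed chart, where smoothness is known. -/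
theorem contDiffOn_paramFlux (hφ : IsParam (𝓡∂ n) φ s) :
    ContDiffOn ℝ ∞ (paramFlux (toField h) (toField g) F N φ s) s := by
  intro y hy
  set ψ := (chartAt (Euc n) (F (φ y)).1).symm with hψdef
  have hψ : SmoothCoord ψ := smoothCoord_chart _
  obtain ⟨u, hu, hus⟩ := hF.exists_open_maps hφ ψ.open_target
  have hyu : y ∈ u := (hus y hy).2 (mem_chart_source _ _)
  have A := hF.isHypWithin hψ (hφ.inter_open hu) fun z hz => (hus z hz.1).1 hz.2
  have c := A.contDiffOn_fluxField y ⟨hy, hyu⟩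
  rw [contDiffWithinAt_inter (hu.mem_nhds hyu)] at c
  refine c.congr_of_eventuallyEq_of_mem ?_ hy
  filter_upwards [self_mem_nhdsWithin, nhdsWithin_le_nhds (hu.mem_nhds hyu)] with z hzs hzu
  rw [hF.paramFlux_eq hψ hφ hzs ((hus z hzs).1 hzu)]
  refine coordFlux_congr_set (g := g) (F := F) (N := N) ?_
  filter_upwards [hu.mem_nhds hzu] with w hw
  exact propext ⟨fun h => ⟨h, hw⟩, fun h => h.1⟩

/-- The divergence of the flux field. -/
theorem divergence_paramFlux (hφ : IsParam (𝓡∂ n) φ s) (hs : IsOpen s) (hy : y ∈ s) :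
    ∑ i, partialD univ (fun z => Real.sqrt (metricCoeff (toField g) s φ z).det *
        paramFlux (toField h) (toField g) F N φ s z i) i y =
      Real.sqrt (metricCoeff (toField g) s φ y).det *
        massDensity (toField h) (toField g) F N (φ y) := by
  set e := (F (φ y)).1 with he
  set ψ := (chartAt (Euc n) e).symm with hψdef
  have hψ : SmoothCoord ψ := smoothCoord_chart _
  have hyψ : (F (φ y)).1 ∈ ψ.target := mem_chart_source _ _
  obtain ⟨u, hu, hus⟩ := hF.exists_open_maps hφ ψ.open_target
  have hyu : y ∈ u := (hus y hy).2 hyψ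
  have hU : IsOpen (s ∩ u) := hs.inter hu
  have hyU : y ∈ s ∩ u := ⟨hy, hyu⟩
  have hφu := hφ.inter_open hu
  have A := (hF.isHypWithin hψ hφu fun z hz => (hus z hz.1).1 hz.2).isHypOn hU
  have D := A.divergence_flux hyU
  have hset : ∀ z ∈ s ∩ u, s =ᶠ[𝓝 z] (s ∩ u : Set (Euc n)) := fun z hz => by
    filter_upwards [hu.mem_nhds hz.2] with w hw
    exact propext ⟨fun h => ⟨h, hw⟩, fun h => h.1⟩
  have hG : ∀ z ∈ s ∩ u, metricCoeff (toField g) s φ z = metricCoeff (toField g) (s ∩ u) φ z :=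
    fun z hz => metricCoeff_congr_set _ (hset z hz)
  have hW : ∀ z ∈ s ∩ u, paramFlux (toField h) (toField g) F N φ s z =
      newtonField (metricCoeff (toField g) (s ∩ u) φ z) (A.sff z)
        fun i => fderiv ℝ (coordHeight F φ) z (stdVec i) := by
    intro z hz
    rw [hF.paramFlux_eq hψ hφ hz.1 ((hus z hz.1).1 hz.2), coordFlux_congr_set (hset z hz)]
    simp only [coordFlux, fluxField, fderivWithin_of_isOpen hU hz]
    refine newtonField_congr (sffMatrix_ext fun a b => ?_) rfl
    exact secondForm_congr_set (eventuallyEq_univ.2 (hU.mem_nhds hz)) a b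
  have e1 : ∀ i, partialD univ (fun z => Real.sqrt (metricCoeff (toField g) s φ z).det *
        paramFlux (toField h) (toField g) F N φ s z i) i y =
      partialD univ (fun z => Real.sqrt (metricCoeff (toField g) (s ∩ u) φ z).det *
        newtonField (metricCoeff (toField g) (s ∩ u) φ z) (A.sff z)
          (fun i => fderiv ℝ (coordHeight F φ) z (stdVec i)) i) i y := by
    intro i
    refine partialD_congr univ_mem ?_ i
    filter_upwards [hU.mem_nhds hyU] with z hz
    rw [hG z hz, hW z hz]
  rw [Finset.sum_congr rfl fun i _ => e1 i, D, hG y hyU]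
  congr 1
  -- The chart of `E` was centred at the image point, so the coordinate Ricci term is literally the
  -- one in `massDensity`.
  have eν : coordNormal ψ F N φ y = (show Euc n × ℝ from N (φ y)).1 := by
    rw [coordNormal, ← he, hψdef, tD_chart_self]
    rfl
  have eθ : coordAngle F N φ y = angleFn (toField h) F N (φ y) := (angleFn_eq (φ y)).symm
  rw [massDensity, ← eθ]
  congr 1
  rw [eν, hφu.scalarCurvature_eq hU hyU g, scalarCurvature_eq_chart]
  congr 1
  exact (ricci_eq_chart _ _ _).symm

end IsHypersurface
end Flux

/-! ### The Riemannian measure in coordinates -/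

/-- The hypothesis is the matrix identity `G = Pᵀ G' P` with `P` the matrix of `L`. It makes the
volume density transform by the absolute value of the Jacobian. -/
theorem sqrt_det_of_bil {d : ℕ} {G G' : Matrix (Fin d) (Fin d) ℝ} {L : Euc d →L[ℝ] Euc d}
    (h : ∀ a b, bil G a b = bil G' (L a) (L b)) :
    Real.sqrt G.det = |L.det| * Real.sqrt G'.det := by
  set P : Matrix (Fin d) (Fin d) ℝ := Matrix.of fun i j => L (stdVec j) i with hP
  have e : G = P.transpose * G' * P := by
    ext i j
    have := h (stdVec i) (stdVec j)
    rw [bil_stdVec, bil_apply] at this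
    rw [this]
    simp only [Matrix.mul_apply, Matrix.transpose_apply, hP, Matrix.of_apply, Finset.sum_mul]
    rw [Finset.sum_comm]
    refine Finset.sum_congr rfl fun k _ => Finset.sum_congr rfl fun l _ => ?_
    ring
  have hd : P.det = L.det := by
    have : P = LinearMap.toMatrix (EuclideanSpace.basisFun (Fin d) ℝ).toBasis
        (EuclideanSpace.basisFun (Fin d) ℝ).toBasis L.toLinearMap := by
      ext i j
      simp [hP, LinearMap.toMatrix_apply, stdVec]
    rw [this, LinearMap.det_toMatrix]
  rw [e, Matrix.det_mul, Matrix.det_mul, Matrix.det_transpose, hd,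
    show L.det * G'.det * L.det = L.det ^ 2 * G'.det by ring, Real.sqrt_mul (sq_nonneg _),
    Real.sqrt_sq_eq_abs]

section ChartMetric

variable {d : ℕ} {H : Type*} [TopologicalSpace H] {I : ModelWithCorners ℝ (Euc d) H}
  {M : Type*} [TopologicalSpace M] [ChartedSpace H M] [IsManifold I ∞ M]

theorem FieldBilin.bil_chartCoeff {g : MetricField I M} (hg : FieldBilin g) (q : M) {p : M}
    (hp : p ∈ (extChartAt I q).source) (a b : Euc d) :
    g p a b = bil (chartCoeff g q (extChartAt I q p))
      (tD I 𝓘(ℝ, Euc d) (extChartAt I q) univ p a)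
      (tD I 𝓘(ℝ, Euc d) (extChartAt I q) univ p b) := by
  set κ := extChartAt I q with hκ
  have ht := κ.map_source hp
  rw [chartCoeff_eq _ _ ht, hg.bil_metricCoeff, κ.left_inv hp]
  have hc := isParam_chart (I := I) q
  have h1 : MDifferentiableAt I 𝓘(ℝ, Euc d) κ p :=
    (contMDiffAt_extChartAt' (n := ∞) (by simpa [hκ] using hp)).mdifferentiableAt (by simp)
  have hO := isOpen_extChartAt_source (I := I) q
  have hu : UniqueMDiffWithinAt I κ.source p := hO.uniqueMDiffWithinAt hp
  have h2 := tD_comp ((hc.smooth _ ht).mdifferentiableWithinAt (by simp))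
    h1.mdifferentiableWithinAt (fun z hz => κ.map_source hz) hu
  rw [tD_congr (φ := κ.symm ∘ κ) (φ' := id) (fun z hz => κ.left_inv hz) (κ.left_inv hp),
    tD_id hu, tD_of_mem_nhds (φ := κ) (hO.mem_nhds hp)] at h2
  have e : ∀ v : Euc d, tD 𝓘(ℝ, Euc d) I κ.symm κ.target (κ p) (tD I 𝓘(ℝ, Euc d) κ univ p v)
      = v := fun v => (congrArg (fun L => L v) h2).symm
  rw [e, e]

end ChartMetric

/-! ### Change of variables and the gluing of the chart measures -/

section Volume

variable {d : ℕ} {H : Type*} [TopologicalSpace H] {I : ModelWithCorners ℝ (Euc d) H}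
  {M : Type*} [TopologicalSpace M] [ChartedSpace H M] [IsManifold I ∞ M]
  [MeasurableSpace M] [BorelSpace M]

theorem measurableSet_extChartAt_target (p : M) : MeasurableSet (extChartAt I p).target := by
  rw [extChartAt_target]
  exact ((chartAt H p).open_target.preimage I.continuous_symm).measurableSet.inter
    I.isClosed_range.measurableSet

theorem measurableSet_target_inter_preimage (p : M) {A : Set M} (hA : MeasurableSet A) :
    MeasurableSet ((extChartAt I p).target ∩ (extChartAt I p).symm ⁻¹' A) := by
  have h1 := (continuousOn_iff_continuous_domRestrict.1
    (continuousOn_extChartAt_symm (I := I) p)).measurable hA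
  have h2 := (measurableSet_extChartAt_target (I := I) p).subtype_image h1
  convert h2 using 1
  ext x
  simp only [mem_inter_iff, mem_preimage, mem_image, Subtype.exists]
  constructor
  · rintro ⟨h1, h2⟩
    exact ⟨x, h1, h2, rfl⟩
  · rintro ⟨y, h1, h2, rfl⟩
    exact ⟨h1, h2⟩

theorem chartVolume_apply (g : MetricField I M) (p : M) {A : Set M} (hA : MeasurableSet A) :
    chartVolume g p A = ∫⁻ x in (extChartAt I p).target ∩ (extChartAt I p).symm ⁻¹' A,
      ENNReal.ofReal (Real.sqrt (chartCoeff g p x).det) := by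
  have hm := measurableSet_extChartAt_target (I := I) p
  have h0 : AEMeasurable (extChartAt I p).symm (volume.restrict (extChartAt I p).target) :=
    (continuousOn_extChartAt_symm (I := I) p).aemeasurable hm
  have h1 := h0.mono_ac (withDensity_absolutelyContinuous
    (volume.restrict (extChartAt I p).target)
    fun x => ENNReal.ofReal (Real.sqrt (chartCoeff g p x).det))
  have hB := measurableSet_target_inter_preimage (I := I) p hA
  rw [chartVolume, Measure.map_apply_of_aemeasurable h1 hA, ← restrict_withDensity hm,
    Measure.restrict_apply' hm, inter_comm, withDensity_apply _ hB]

variable (I) in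
/-- `τ` maps `D` injectively to `ℝ^d`, and `g` has coefficients `Gτ` in these coordinates. -/
structure IsMetricCoord (g : MetricField I M) (D : Set M) (τ : M → Euc d)
    (Gτ : Euc d → Matrix (Fin d) (Fin d) ℝ) : Prop where
  meas : MeasurableSet D
  inj : InjOn τ D
  diff : ∀ p ∈ D, MDifferentiableAt I 𝓘(ℝ, Euc d) τ p
  metric : ∀ p ∈ D, ∀ a b : Euc d, g p a b =
    bil (Gτ (τ p)) (tD I 𝓘(ℝ, Euc d) τ univ p a) (tD I 𝓘(ℝ, Euc d) τ univ p b)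

variable {g : MetricField I M} {D : Set M} {τ : M → Euc d} {Gτ : Euc d → Matrix (Fin d) (Fin d) ℝ}

/-- Change of variables for the injective map from the chart to the coordinates `τ`, with
`sqrt_det_of_bil` absorbing the Jacobian. Injectivity also gives measurability of the image. -/
theorem IsMetricCoord.chartVolume_eq (h : IsMetricCoord I g D τ Gτ) (hg : FieldBilin g) (q : M)
    {A : Set M} (hA : MeasurableSet A) (hAD : A ⊆ D) (hAq : A ⊆ (extChartAt I q).source) :
    MeasurableSet (τ '' A) ∧ chartVolume g q A =
      ∫⁻ x in τ '' A, ENNReal.ofReal (Real.sqrt (Gτ x).det) := by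
  set κ := extChartAt I q with hκ
  set B := κ.target ∩ κ.symm ⁻¹' A with hB
  have hBm : MeasurableSet B := measurableSet_target_inter_preimage q hA
  have himg : τ '' A = (τ ∘ κ.symm) '' B := by
    rw [image_comp]
    congr 1
    ext p
    constructor
    · intro hp
      exact ⟨κ p, ⟨κ.map_source (hAq hp), by
        rw [mem_preimage, κ.left_inv (hAq hp)]; exact hp⟩, κ.left_inv (hAq hp)⟩
    · rintro ⟨x, hx, rfl⟩
      exact hx.2
  have hc := isParam_chart (I := I) q
  have hder : ∀ x ∈ B, HasFDerivWithinAt (τ ∘ κ.symm)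
      ((tD I 𝓘(ℝ, Euc d) τ univ (κ.symm x)).comp (tD 𝓘(ℝ, Euc d) I κ.symm κ.target x)) B x := by
    intro x hx
    have h1 := h.diff _ (hAD hx.2)
    have h2 := (hc.smooth x hx.1).mdifferentiableWithinAt (by simp)
    have h3 : MDifferentiableWithinAt 𝓘(ℝ, Euc d) 𝓘(ℝ, Euc d) (τ ∘ κ.symm) κ.target x :=
      h1.comp_mdifferentiableWithinAt x h2
    have h4 : DifferentiableWithinAt ℝ (τ ∘ κ.symm) κ.target x :=
      mdifferentiableWithinAt_iff_differentiableWithinAt.1 h3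
    have h5 := tD_comp (t := univ) h1.mdifferentiableWithinAt h2 (mapsTo_univ _ _)
      (hc.uniq.uniqueMDiffOn x hx.1)
    rw [tD_vectorSpace] at h5
    rw [← h5]
    exact h4.hasFDerivWithinAt.mono inter_subset_left
  have hinj : InjOn (τ ∘ κ.symm) B := by
    intro x hx y hy hxy
    have := h.inj (hAD hx.2) (hAD hy.2) hxy
    exact κ.symm.injOn hx.1 hy.1 this
  refine ⟨?_, ?_⟩
  · rw [himg]
    exact measurable_image_of_fderivWithin hBm hder hinj
  rw [chartVolume_apply g q hA, himg,
    lintegral_image_eq_lintegral_abs_det_fderiv_mul volume hBm hder hinj]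
  refine setLIntegral_congr_fun hBm fun x hx => ?_
  rw [← ENNReal.ofReal_mul (abs_nonneg _)]
  congr 1
  rw [chartCoeff_eq _ _ hx.1]
  refine sqrt_det_of_bil fun a b => ?_
  rw [hg.bil_metricCoeff]
  exact h.metric _ (hAD hx.2) _ _

theorem isMetricCoord_chart (hg : FieldBilin g) (q : M) :
    IsMetricCoord I g (extChartAt I q).source (extChartAt I q) (chartCoeff g q) where
  meas := (isOpen_extChartAt_source (I := I) q).measurableSet
  inj := (extChartAt I q).injOn
  diff := fun p hp =>
    (contMDiffAt_extChartAt' (n := ∞) (by simpa using hp)).mdifferentiableAt (by simp)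
  metric := fun p hp => hg.bil_chartCoeff q hp

variable [SecondCountableTopology M]

/-- Countably many chart domains cover a second countable space; they are then made disjoint in
order. -/
theorem exists_chart_partition [Nonempty M] : ∃ (p : ℕ → M) (D : ℕ → Set M),
    (∀ k, MeasurableSet (D k)) ∧ Pairwise (Function.onFun Disjoint D) ∧ ⋃ k, D k = univ ∧
    ∀ k, D k ⊆ (extChartAt I (p k)).source := by
  obtain ⟨S, hS, hcov⟩ := TopologicalSpace.countable_cover_nhds
    (f := fun p : M => (extChartAt I p).source) fun p => extChartAt_source_mem_nhds p
  have hne : S.Nonempty := by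
    by_contra h0
    rw [not_nonempty_iff_eq_empty] at h0
    obtain ⟨x⟩ := ‹Nonempty M›
    have : x ∈ (univ : Set M) := mem_univ x
    rw [← hcov, h0] at this
    simp at this
  obtain ⟨p, rfl⟩ := hS.exists_eq_range hne
  refine ⟨p, disjointed fun k => (extChartAt I (p k)).source, fun k => ?_, ?_, ?_, fun k => ?_⟩
  · exact MeasurableSet.disjointed
      (fun k => (isOpen_extChartAt_source (I := I) (p k)).measurableSet) k
  · exact disjoint_disjointed _
  · rw [iUnion_disjointed]
    rw [← hcov]
    simp
  · exact disjointed_subset _ k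

/-- Chart measures agree on overlaps. Hence the measure glued from a countable partition dominates
every chart measure and agrees with each on its own domain, which squeezes the supremum. -/
theorem riemannianVolume_of_subset (hg : FieldBilin g) (q : M) {A : Set M} (hA : MeasurableSet A)
    (hAq : A ⊆ (extChartAt I q).source) : riemannianVolume g A = chartVolume g q A := by
  have : Nonempty M := ⟨q⟩
  obtain ⟨p, D, hDm, hdis, hcov, hsub⟩ := exists_chart_partition (I := I) (M := M)
  have compat : ∀ q q' : M, ∀ B, MeasurableSet B → B ⊆ (extChartAt I q).source →
      B ⊆ (extChartAt I q').source → chartVolume g q B = chartVolume g q' B := by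
    intro q q' B hB h1 h2
    rw [((isMetricCoord_chart hg q).chartVolume_eq hg q hB h1 h1).2,
      ((isMetricCoord_chart hg q).chartVolume_eq hg q' hB h1 h2).2]
  set ν : Measure M := Measure.sum fun k => (chartVolume g (p k)).restrict (D k) with hν
  have hsum : ∀ (m : Measure M) (B : Set M), MeasurableSet B → m B = ∑' k, m (B ∩ D k) := by
    intro m B hB
    rw [← measure_iUnion (fun i j hij => (hdis hij).mono inter_subset_right inter_subset_right)
      (fun k => hB.inter (hDm k)), ← inter_iUnion, hcov, inter_univ]
  have hνB : ∀ q B, MeasurableSet B → B ⊆ (extChartAt I q).source →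
      ν B = chartVolume g q B := by
    intro q B hB h1
    rw [hν, Measure.sum_apply _ hB, hsum (chartVolume g q) B hB]
    congr 1
    funext k
    rw [Measure.restrict_apply hB]
    exact compat _ _ _ (hB.inter (hDm k)) (inter_subset_right.trans (hsub k))
      (inter_subset_left.trans h1)
  have hle : riemannianVolume g ≤ ν := by
    refine iSup_le fun q => Measure.le_intro fun B hB _ => ?_
    have hO := (isOpen_extChartAt_source (I := I) q).measurableSet
    have : chartVolume g q B = chartVolume g q (B ∩ (extChartAt I q).source) := by
      rw [chartVolume_apply g q hB, chartVolume_apply g q (hB.inter hO)]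
      congr 2
      ext x
      simp only [mem_inter_iff, mem_preimage]
      exact ⟨fun h => ⟨h.1, h.2, (extChartAt I q).map_target h.1⟩, fun h => ⟨h.1, h.2.1⟩⟩
    rw [this, ← hνB q _ (hB.inter hO) inter_subset_right]
    exact measure_mono inter_subset_left
  refine le_antisymm ?_ ?_
  · rw [← hνB q A hA hAq]
    exact hle A
  · exact (le_iSup (fun q => chartVolume g q) q) A

/-- The Riemannian measure in coordinates. -/
theorem IsMetricCoord.volume_eq (h : IsMetricCoord I g D τ Gτ) (hg : FieldBilin g)
    {A : Set M} (hA : MeasurableSet A) (hAD : A ⊆ D) :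
    MeasurableSet (τ '' A) ∧ riemannianVolume g A =
      ∫⁻ x in τ '' A, ENNReal.ofReal (Real.sqrt (Gτ x).det) := by
  rcases isEmpty_or_nonempty M with hM | hM
  · have : A = ∅ := Subsingleton.elim _ _
    simp [this]
  obtain ⟨p, C, hCm, hdis, hcov, hsub⟩ := exists_chart_partition (I := I) (M := M)
  have key : ∀ k, MeasurableSet (τ '' (A ∩ C k)) ∧ riemannianVolume g (A ∩ C k) =
      ∫⁻ x in τ '' (A ∩ C k), ENNReal.ofReal (Real.sqrt (Gτ x).det) := by
    intro k
    have h1 : A ∩ C k ⊆ (extChartAt I (p k)).source := inter_subset_right.trans (hsub k)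
    rw [riemannianVolume_of_subset hg (p k) (hA.inter (hCm k)) h1]
    exact h.chartVolume_eq hg (p k) (hA.inter (hCm k)) (inter_subset_left.trans hAD) h1
  have hAU : A = ⋃ k, A ∩ C k := by rw [← inter_iUnion, hcov, inter_univ]
  have hτU : τ '' A = ⋃ k, τ '' (A ∩ C k) := by rw [← image_iUnion, ← hAU]
  refine ⟨by rw [hτU]; exact MeasurableSet.iUnion fun k => (key k).1, ?_⟩
  rw [hτU, lintegral_iUnion (fun k => (key k).1)]
  · conv_lhs => rw [hAU]
    rw [measure_iUnion (fun i j hij => (hdis hij).mono inter_subset_right inter_subset_right)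
      (fun k => hA.inter (hCm k))]
    exact tsum_congr fun k => (key k).2
  · intro i j hij
    refine disjoint_left.2 ?_
    rintro _ ⟨a, ha, rfl⟩ ⟨b, hb, hab⟩
    have := h.inj (hAD hb.1) (hAD ha.1) hab
    subst this
    exact disjoint_left.1 (hdis hij) ha.2 hb.2

theorem IsMetricCoord.continuousOn (h : IsMetricCoord I g D τ Gτ) : ContinuousOn τ D := fun p hp =>
  (h.diff p hp).continuousAt.continuousWithinAt

theorem IsMetricCoord.map_restrict (h : IsMetricCoord I g D τ Gτ) (hg : FieldBilin g) :
    Measure.map τ ((riemannianVolume g).restrict D) =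
      (volume.restrict (τ '' D)).withDensity fun x => ENNReal.ofReal (Real.sqrt (Gτ x).det) := by
  have hτ : AEMeasurable τ ((riemannianVolume g).restrict D) := h.continuousOn.aemeasurable h.meas
  ext B hB
  have hDm := (h.volume_eq hg h.meas Subset.rfl).1
  have hm : MeasurableSet (D ∩ τ ⁻¹' B) := by
    have h1 := (continuousOn_iff_continuous_domRestrict.1 h.continuousOn).measurable hB
    have h2 := h.meas.subtype_image h1
    convert h2 using 1
    ext x
    simp only [mem_inter_iff, mem_preimage, mem_image, Subtype.exists]
    constructor
    · rintro ⟨h1, h2⟩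
      exact ⟨x, h1, h2, rfl⟩
    · rintro ⟨y, h1, h2, rfl⟩
      exact ⟨h1, h2⟩
  have hτD : τ '' (D ∩ τ ⁻¹' B) = B ∩ τ '' D := by
    rw [image_inter_preimage, inter_comm]
  rw [Measure.map_apply_of_aemeasurable hτ hB, withDensity_apply _ hB,
    Measure.restrict_restrict hB, Measure.restrict_apply' h.meas, inter_comm,
    (h.volume_eq hg hm inter_subset_left).2, hτD]

/-- Integration in coordinates. -/
theorem IsMetricCoord.integral_eq (h : IsMetricCoord I g D τ Gτ) (hg : FieldBilin g)
    (hG : ContinuousOn (fun x => Real.sqrt (Gτ x).det) (τ '' D)) {f : M → ℝ} {b : Euc d → ℝ}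
    (hb : AEStronglyMeasurable b (volume.restrict (τ '' D))) (hf : ∀ p ∈ D, f p = b (τ p)) :
    (IntegrableOn f D (riemannianVolume g) ↔
      IntegrableOn (fun x => Real.sqrt (Gτ x).det * b x) (τ '' D)) ∧
    ∫ p in D, f p ∂(riemannianVolume g) = ∫ x in τ '' D, Real.sqrt (Gτ x).det * b x := by
  have hDm := (h.volume_eq hg h.meas Subset.rfl).1
  have hτ : AEMeasurable τ ((riemannianVolume g).restrict D) := h.continuousOn.aemeasurable h.meas
  have hρ : AEMeasurable (fun x => ENNReal.ofReal (Real.sqrt (Gτ x).det))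
      (volume.restrict (τ '' D)) := (hG.aemeasurable hDm).ennreal_ofReal
  have hlt : ∀ᵐ x ∂(volume.restrict (τ '' D)), ENNReal.ofReal (Real.sqrt (Gτ x).det) < ⊤ :=
    Eventually.of_forall fun x => ENNReal.ofReal_lt_top
  have hb' : AEStronglyMeasurable b (Measure.map τ ((riemannianVolume g).restrict D)) := by
    rw [h.map_restrict hg]
    exact hb.mono_ac (withDensity_absolutelyContinuous _ _)
  have hfb : f =ᵐ[(riemannianVolume g).restrict D] b ∘ τ := by
    filter_upwards [ae_restrict_mem h.meas] with p hp
    exact hf p hp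
  constructor
  · rw [IntegrableOn, integrable_congr hfb, ← integrable_map_measure hb' hτ, h.map_restrict hg,
      integrable_withDensity_iff_integrable_smul₀' hρ hlt]
    simp only [ENNReal.toReal_ofReal (Real.sqrt_nonneg _), smul_eq_mul]
    rfl
  · rw [integral_congr_ae hfb]
    simp only [Function.comp_apply]
    rw [← integral_map hτ hb', h.map_restrict hg,
      integral_withDensity_eq_integral_toReal_smul₀ hρ hlt]
    simp only [ENNReal.toReal_ofReal (Real.sqrt_nonneg _), smul_eq_mul]

end Volume

/-! ### The divergence theorem on exterior domains -/

section Weak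

/-- A continuous function whose weak derivative is continuous is a primitive of it. -/
theorem sub_eq_integral_of_weak_deriv {S D : ℝ → ℝ} {ρ : ℝ} (hS : ContinuousOn S (Ioi ρ))
    (hD : ContinuousOn D (Ioi ρ))
    (h : ∀ η : ℝ → ℝ, ContDiff ℝ ∞ η → HasCompactSupport η → tsupport η ⊆ Ioi ρ →
      ∫ r, η r * D r = - ∫ r, deriv η r * S r) {a b : ℝ} (ha : ρ < a) (hb : ρ < b) :
    S b - S a = ∫ r in a..b, D r := by
  have hfi : ∀ c ∈ Ioi ρ, ∀ e ∈ Ioi ρ, IntervalIntegrable D volume c e := fun c hc e he =>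
    (hD.mono (by
      intro r hr
      rcases le_total c e with hce | hce
      · rw [uIcc_of_le hce] at hr; exact lt_of_lt_of_le hc hr.1
      · rw [uIcc_of_ge hce] at hr; exact lt_of_lt_of_le he hr.1)).intervalIntegrable
  -- A classical primitive of `D`. The difference `S - P` has zero weak derivative, and it suffices
  -- to show that it is constant.
  set P : ℝ → ℝ := fun r => ∫ t in a..r, D t with hP
  have hPd : ∀ r ∈ Ioi ρ, HasDerivAt P (D r) r := fun r hr =>
    intervalIntegral.integral_hasDerivAt_right (hfi a ha r hr)
      (hD.stronglyMeasurableAtFilter isOpen_Ioi r hr) (hD.continuousAt (isOpen_Ioi.mem_nhds hr))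
  set G : ℝ → ℝ := fun r => S r - P r with hG
  have hPc : ContinuousOn P (Ioi ρ) := fun r hr => (hPd r hr).continuousAt.continuousWithinAt
  have hGc : ContinuousOn G (Ioi ρ) := hS.sub hPc
  have hmulint : ∀ (f k : ℝ → ℝ), Continuous f → HasCompactSupport f → tsupport f ⊆ Ioi ρ →
      ContinuousOn k (Ioi ρ) → Integrable fun r => f r * k r := by
    intro f k hf hc hs hk
    refine Continuous.integrable_of_hasCompactSupport ?_ (hc.mul_right)
    refine continuous_of_tsupport fun r hr => ?_
    have hr' : r ∈ Ioi ρ := hs (tsupport_mul_subset_left hr)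
    exact hf.continuousAt.mul (hk.continuousAt (isOpen_Ioi.mem_nhds hr'))
  have hweak : ∀ η : ℝ → ℝ, ContDiff ℝ ∞ η → HasCompactSupport η → tsupport η ⊆ Ioi ρ →
      ∫ r, deriv η r * G r = 0 := by
    intro η hη hc hs
    have hη' : Continuous (deriv η) := hη.continuous_deriv (by simp)
    have hc' : HasCompactSupport (deriv η) := hc.deriv
    have hs' : tsupport (deriv η) ⊆ Ioi ρ := fun r hr => hs (tsupport_deriv_subset hr)
    have e1 := h η hη hc hs
    have e2 : ∫ r, η r * fderiv ℝ P r 1 = - ∫ r, fderiv ℝ η r 1 * P r := by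
      refine integral_mul_fderiv_eq_neg_fderiv_mul_of_integrable ?_ ?_ ?_ ?_ ?_
      · simpa using hmulint (deriv η) P hη' hc' hs' hPc
      · refine hmulint η _ hη.continuous hc hs (hD.congr fun r hr => ?_)
        simpa using (hPd r hr).deriv
      · exact hmulint η P hη.continuous hc hs hPc
      · exact fun r _ => (hη.differentiable (by simp)) r
      · exact fun r hr => (hPd r (hs hr)).differentiableAt
    have e3 : ∫ r, η r * fderiv ℝ P r 1 = ∫ r, η r * D r := by
      refine integral_congr_ae (Eventually.of_forall fun r => ?_)
      by_cases hr : r ∈ tsupport η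
      · have := (hPd r (hs hr)).deriv
        simp [this]
      · simp [image_eq_zero_of_notMem_tsupport hr]
    simp only [hG, mul_sub]
    rw [integral_sub (hmulint _ S hη' hc' hs' hS) (hmulint _ P hη' hc' hs' hPc)]
    simp only [fderiv_apply_one_eq_deriv] at e2 e3
    linarith
  -- A bump of integral one supported in `[ρ + 1, ρ + 3]`, used to correct the mean of test
  -- functions.
  obtain ⟨φ, hφs, hφc, hφd, hφt, hφ1⟩ : ∃ φ : ℝ → ℝ, True ∧ HasCompactSupport φ ∧
      ContDiff ℝ ∞ φ ∧ tsupport φ ⊆ Ioi ρ ∧ ∫ r, φ r = 1 := by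
    let B : ContDiffBump (ρ + 2) := ⟨1 / 2, 1, by norm_num, by norm_num⟩
    refine ⟨B.normed volume, trivial, B.hasCompactSupport_normed, B.contDiff_normed, ?_,
      B.integral_normed⟩
    rw [B.tsupport_normed_eq]
    intro r hr
    simp only [Metric.mem_closedBall, Real.dist_eq] at hr
    have := (abs_le.1 hr).1
    simp only [B] at this
    simp only [mem_Ioi]; linarith
  set c : ℝ := ∫ r, φ r * G r with hc
  have hae : ∀ᵐ r, r ∈ Ioi ρ → G r - c = 0 := by
    refine isOpen_Ioi.ae_eq_zero_of_integral_contDiff_smul_eq_zero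
      ((hGc.sub continuousOn_const).locallyIntegrableOn measurableSet_Ioi) fun k hk hkc hks => ?_
    set I0 : ℝ := ∫ r, k r with hI0
    -- The corrected test function has mean zero, so its primitive `η` is again compactly supported
    -- and can be used in the weak identity.
    set ψ : ℝ → ℝ := fun r => k r - I0 * φ r with hψ
    have hψd : ContDiff ℝ ∞ ψ := hk.sub (contDiff_const.mul hφd)
    have hψ0 : ∫ r, ψ r = 0 := by
      simp only [hψ]
      rw [integral_sub (hk.continuous.integrable_of_hasCompactSupport hkc)
        ((hφd.continuous.integrable_of_hasCompactSupport hφc).const_mul _), integral_const_mul, hφ1]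
      simp [hI0]
    have hcomp : IsCompact (tsupport k ∪ tsupport φ) := IsCompact.union hkc hφc
    have hsub : tsupport k ∪ tsupport φ ⊆ Ioi ρ := union_subset hks hφt
    -- A base point below both supports but still beyond `ρ`: it keeps the support of the primitive
    -- inside the half-line.
    obtain ⟨α, hα, hαlb⟩ : ∃ α ∈ Ioi ρ, ∀ r ∈ tsupport k ∪ tsupport φ, α ≤ r := by
      rcases (tsupport k ∪ tsupport φ).eq_empty_or_nonempty with h0 | hne
      · exact ⟨ρ + 1, by simp, by simp [h0]⟩
      · obtain ⟨α, h1, h2⟩ := hcomp.exists_isLeast hne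
        exact ⟨α, hsub h1, fun r hr => h2 hr⟩
    obtain ⟨β, hβub⟩ := hcomp.bddAbove
    have hψz : ∀ r, r ∉ tsupport k ∪ tsupport φ → ψ r = 0 := by
      intro r hr
      have h1 : k r = 0 := image_eq_zero_of_notMem_tsupport fun h => hr (Or.inl h)
      have h2 : φ r = 0 := image_eq_zero_of_notMem_tsupport fun h => hr (Or.inr h)
      simp [hψ, h1, h2]
    have hψc : HasCompactSupport ψ := HasCompactSupport.intro hcomp hψz
    have hψi : Integrable ψ := hψd.continuous.integrable_of_hasCompactSupport hψc
    set η : ℝ → ℝ := fun r => ∫ t in α..r, ψ t with hη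
    have hηd : ∀ r, HasDerivAt η (ψ r) r := fun r =>
      intervalIntegral.integral_hasDerivAt_right (hψd.continuous.intervalIntegrable _ _)
        (hψd.continuous.stronglyMeasurableAtFilter _ _) hψd.continuous.continuousAt
    have hηderiv : deriv η = ψ := funext fun r => (hηd r).deriv
    have hηc : ContDiff ℝ ∞ η := by
      rw [contDiff_infty_iff_deriv]
      exact ⟨fun r => (hηd r).differentiableAt, by rw [hηderiv]; exact hψd⟩
    have hηz : ∀ r, r ∉ Icc α β → η r = 0 := by
      intro r hr
      by_cases hrα : r < α
      · simp only [hη]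
        rw [intervalIntegral.integral_symm, neg_eq_zero]
        rw [intervalIntegral.integral_of_le hrα.le, integral_Ioc_eq_integral_Ioo]
        exact setIntegral_eq_zero_of_forall_eq_zero fun t ht =>
          hψz t fun hm => absurd (hαlb t hm) (not_le.2 ht.2)
      · have hrβ : β < r := by
          by_contra hcon
          exact hr ⟨not_lt.1 hrα, not_lt.1 hcon⟩
        simp only [hη]
        rw [intervalIntegral.integral_of_le (not_lt.1 hrα), ← integral_Icc_eq_integral_Ioc, ← hψ0]
        exact setIntegral_eq_integral_of_forall_compl_eq_zero fun t ht =>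
          hψz t fun hm => ht ⟨hαlb t hm, (hβub hm).trans hrβ.le⟩
    have hηcs : HasCompactSupport η := HasCompactSupport.intro isCompact_Icc hηz
    have hηs : tsupport η ⊆ Ioi ρ := by
      refine (closure_minimal (t := Icc α β) (fun r hr => ?_) isClosed_Icc).trans
        fun r hr => lt_of_lt_of_le hα hr.1
      by_contra hcon
      exact hr (hηz r hcon)
    have e := hweak η hηc hηcs hηs
    rw [hηderiv] at e
    have i1 := hmulint k G hk.continuous hkc hks hGc
    have i2 := hmulint φ G hφd.continuous hφc hφt hGc
    have e' : ∫ r, ψ r * G r = (∫ r, k r * G r) - I0 * c := by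
      simp only [hψ, sub_mul, mul_assoc]
      rw [integral_sub i1 (i2.const_mul I0), integral_const_mul]
    simp only [smul_eq_mul, mul_sub]
    rw [integral_sub i1 ((hk.continuous.integrable_of_hasCompactSupport hkc).mul_const c),
      integral_mul_const]
    linarith
  have hall : EqOn G (fun _ => c) (Ioi ρ) := by
    refine MeasureTheory.Measure.eqOn_open_of_ae_eq (μ := volume) ?_ isOpen_Ioi hGc
      continuousOn_const
    rw [Filter.EventuallyEq, ae_restrict_iff' measurableSet_Ioi]
    filter_upwards [hae] with r hr hr'
    linarith [hr hr']
  have e1 := hall ha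
  have e2 := hall hb
  simp only [hG, hP, intervalIntegral.integral_same] at e1 e2
  linarith

end Weak

/-! ### Polar coordinates and the divergence theorem on annuli -/

section Polar

variable {n : ℕ}

/-- Integration in polar coordinates. -/
theorem integral_polar [NeZero n] {f : Euc n → ℝ} (hf : Integrable f) :
    ∫ x, f x = ∫ r in Ioi (0 : ℝ), r ^ (n - 1) *
      ∫ u : Metric.sphere (0 : Euc n) 1, f (r • (u : Euc n)) ∂(volume : Measure (Euc n)).toSphere := by
  have : Nontrivial (Euc n) := by
    have : Nonempty (Fin n) := ⟨0⟩
    infer_instance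
  set μ : Measure (Euc n) := volume
  have hdim : Module.finrank ℝ (Euc n) = n := by simp
  have hmp := μ.measurePreserving_homeomorphUnitSphereProd
  rw [hdim] at hmp
  have hemb := (homeomorphUnitSphereProd (Euc n)).measurableEmbedding
  set k : Metric.sphere (0 : Euc n) 1 × Ioi (0 : ℝ) → ℝ := fun z => f ((z.2 : ℝ) • (z.1 : Euc n))
    with hk
  have hkf : ∀ x : ({0}ᶜ : Set (Euc n)), k (homeomorphUnitSphereProd (Euc n) x) = f x := by
    intro x
    have hx : ‖(x : Euc n)‖ ≠ 0 := norm_ne_zero_iff.2 x.2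
    simp only [hk, homeomorphUnitSphereProd_apply_snd_coe, homeomorphUnitSphereProd_apply_fst_coe]
    rw [smul_smul, mul_inv_cancel₀ hx, one_smul]
  have hm : MeasurableSet ({0}ᶜ : Set (Euc n)) := (measurableSet_singleton _).compl
  have hfi : Integrable (fun x : ({0}ᶜ : Set (Euc n)) => f x) (μ.comap (↑)) := by
    have := (integrableOn_iff_comap_subtypeVal hm (f := f) (μ := μ)).1 hf.integrableOn
    exact this
  have hki : Integrable k (μ.toSphere.prod (Measure.volumeIoiPow (n - 1))) := by
    rw [← hmp.integrable_comp_emb hemb]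
    exact hfi.congr (Eventually.of_forall fun x => (hkf x).symm)
  calc ∫ x, f x = ∫ x : ({0}ᶜ : Set (Euc n)), f x ∂(μ.comap (↑)) := by
        rw [integral_subtype_comap hm, restrict_compl_singleton]
    _ = ∫ z, k z ∂(μ.toSphere.prod (Measure.volumeIoiPow (n - 1))) := by
        rw [← hmp.integral_comp hemb]
        exact integral_congr_ae (Eventually.of_forall fun x => (hkf x).symm)
    _ = ∫ r : Ioi (0 : ℝ), ∫ u, k (u, r) ∂μ.toSphere ∂(Measure.volumeIoiPow (n - 1)) :=
        integral_prod_symm _ hki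
    _ = _ := by
        rw [Measure.volumeIoiPow, integral_withDensity_eq_integral_toReal_smul
          (by fun_prop) (Eventually.of_forall fun r => ENNReal.ofReal_lt_top)]
        rw [← integral_subtype_comap measurableSet_Ioi]
        refine integral_congr_ae (Eventually.of_forall fun r => ?_)
        simp only [hk, smul_eq_mul]
        rw [ENNReal.toReal_ofReal (pow_nonneg (le_of_lt r.2) _)]

/-- The flux of `V` through the sphere of radius `r`. -/
def sphereFlux (V : Euc n → Euc n) (r : ℝ) : ℝ :=
  r ^ (n - 1) * ∫ u : Metric.sphere (0 : Euc n) 1, (∑ i, V (r • (u : Euc n)) i * (u : Euc n) i)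
    ∂(volume : Measure (Euc n)).toSphere

/-- The divergence of a vector field on `ℝ^n`. -/
def diverg (V : Euc n → Euc n) (x : Euc n) : ℝ := ∑ i, partialD univ (fun y => V y i) i x

theorem hasFDerivAt_norm_euc {x : Euc n} (hx : x ≠ 0) :
    HasFDerivAt (norm : Euc n → ℝ) (‖x‖⁻¹ • innerSL ℝ x) x := by
  have h1 := (hasStrictFDerivAt_norm_sq x).hasFDerivAt.sqrt (pow_ne_zero 2 (norm_ne_zero_iff.2 hx))
  simp only [Real.sqrt_sq (norm_nonneg _)] at h1
  refine h1.congr_fderiv ?_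
  ext v
  simp only [smul_apply, smul_eq_mul, nsmul_eq_mul]
  have := norm_ne_zero_iff.2 hx
  field_simp
  simp

theorem isOpen_exterior (r : ℝ) : IsOpen (exterior n r) := isOpen_lt continuous_const continuous_norm

theorem continuousOn_sphere_integral {ρ : ℝ}
    {k : ℝ → Metric.sphere (0 : Euc n) 1 → ℝ}
    (hk : Continuous fun z : Ioi ρ × Metric.sphere (0 : Euc n) 1 => k z.1 z.2) :
    ContinuousOn (fun r => ∫ u, k r u ∂(volume : Measure (Euc n)).toSphere) (Ioi ρ) := by
  rw [continuousOn_iff_continuous_domRestrict]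
  have : LocallyCompactSpace (Ioi ρ) := isOpen_Ioi.locallyCompactSpace
  have := continuous_parametric_integral_of_continuous
    (μ := (volume : Measure (Euc n)).toSphere) (f := fun (r : Ioi ρ) u => k r u) hk
    (s := univ) isCompact_univ
  simpa using! this

variable {V : Euc n → Euc n} {ρ : ℝ}

theorem continuousOn_diverg (hV : ContDiffOn ℝ 1 V (exterior n ρ)) :
    ContinuousOn (diverg V) (exterior n ρ) := by
  have ho := isOpen_exterior (n := n) ρ
  unfold diverg partialD
  simp only [fderivWithin_univ]
  refine continuousOn_finsetSum _ fun i _ => ?_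
  have h1 : ContDiffOn ℝ 1 (fun y => V y i) (exterior n ρ) := (contDiffOn_euclidean.1 hV) i
  exact (h1.continuousOn_fderiv_of_isOpen ho (by simp)).clm_apply continuousOn_const

theorem continuousOn_sphereFlux (hρ : 0 ≤ ρ) (hV : ContinuousOn V (exterior n ρ)) :
    ContinuousOn (sphereFlux V) (Ioi ρ) := by
  refine (continuousOn_id.pow _).mul (continuousOn_sphere_integral ?_)
  refine continuous_finsetSum _ fun i _ => ?_
  have h1 : Continuous fun z : Ioi ρ × Metric.sphere (0 : Euc n) 1 =>
      V ((z.1 : ℝ) • (z.2 : Euc n)) := by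
    refine hV.comp_continuous (by fun_prop) fun z => ?_
    have : ‖(z.2 : Euc n)‖ = 1 := by simp
    have h0 : (0 : ℝ) < z.1 := lt_of_le_of_lt hρ z.1.2
    simp only [exterior, mem_ofPred_eq, norm_smul, this, mul_one, Real.norm_eq_abs, abs_of_pos h0]
    exact z.1.2
  have h2 : Continuous fun z : Ioi ρ × Metric.sphere (0 : Euc n) 1 => (z.2 : Euc n) i :=
    (EuclideanSpace.proj i : Euc n →L[ℝ] ℝ).continuous.comp
      (continuous_subtype_val.comp continuous_snd)
  exact ((EuclideanSpace.proj i : Euc n →L[ℝ] ℝ).continuous.comp h1).mul h2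

theorem continuousOn_sphere_diverg (hρ : 0 ≤ ρ) {k : Euc n → ℝ}
    (hk : ContinuousOn k (exterior n ρ)) :
    ContinuousOn (fun r : ℝ => r ^ (n - 1) * ∫ u : Metric.sphere (0 : Euc n) 1,
      k (r • (u : Euc n)) ∂(volume : Measure (Euc n)).toSphere) (Ioi ρ) := by
  refine (continuousOn_id.pow _).mul (continuousOn_sphere_integral ?_)
  refine hk.comp_continuous (by fun_prop) fun z => ?_
  have : ‖(z.2 : Euc n)‖ = 1 := by simp
  have h0 : (0 : ℝ) < z.1 := lt_of_le_of_lt hρ z.1.2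
  simp only [exterior, mem_ofPred_eq, norm_smul, this, mul_one, Real.norm_eq_abs, abs_of_pos h0]
  exact z.1.2

/-- The divergence theorem on annuli. -/
theorem sphereFlux_sub [NeZero n] (hρ : 0 ≤ ρ) (hV : ContDiffOn ℝ 1 V (exterior n ρ)) {a b : ℝ}
    (ha : ρ < a) (hab : a ≤ b) :
    IntegrableOn (diverg V) {x | a < ‖x‖ ∧ ‖x‖ ≤ b} ∧
    sphereFlux V b - sphereFlux V a = ∫ x in {x : Euc n | a < ‖x‖ ∧ ‖x‖ ≤ b}, diverg V x := by
  have ho := isOpen_exterior (n := n) ρ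
  have hdc := continuousOn_diverg hV
  set D : ℝ → ℝ := fun r => r ^ (n - 1) * ∫ u : Metric.sphere (0 : Euc n) 1,
      diverg V (r • (u : Euc n)) ∂(volume : Measure (Euc n)).toSphere with hD
  have hmeas : MeasurableSet {x : Euc n | a < ‖x‖ ∧ ‖x‖ ≤ b} :=
    (measurableSet_lt measurable_const measurable_norm).inter
      (measurableSet_le measurable_norm measurable_const)
  have hfi : IntegrableOn (diverg V) {x : Euc n | a < ‖x‖ ∧ ‖x‖ ≤ b} := by
    have hcomp : IsCompact {x : Euc n | a ≤ ‖x‖ ∧ ‖x‖ ≤ b} := by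
      refine (isCompact_closedBall (0 : Euc n) b).of_isClosed_subset
        ((isClosed_le continuous_const continuous_norm).inter
          (isClosed_le continuous_norm continuous_const)) fun x hx => by simpa using hx.2
    have : IntegrableOn (diverg V) {x : Euc n | a ≤ ‖x‖ ∧ ‖x‖ ≤ b} :=
      (hdc.mono fun x hx => lt_of_lt_of_le ha hx.1).integrableOn_compact hcomp
    exact this.mono_set fun x hx => ⟨hx.1.le, hx.2⟩
  refine ⟨hfi, ?_⟩
  -- It is enough to show that the weak radial derivative of the flux is the spherical integral of
  -- the divergence. No differentiation under the integral and no theorem on curved domains is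
  -- needed.
  have key := sub_eq_integral_of_weak_deriv (continuousOn_sphereFlux hρ hV.continuousOn)
    (continuousOn_sphere_diverg hρ hdc) (fun η hη hc hs => ?_) ha (ha.trans_le hab)
  · rw [key, ← integral_indicator hmeas, integral_polar ((integrable_indicator_iff hmeas).2 hfi),
      intervalIntegral.integral_of_le hab]
    have h1 : Ioc a b ⊆ Ioi 0 := fun r hr => lt_of_le_of_lt hρ (ha.trans hr.1)
    rw [setIntegral_eq_of_subset_of_forall_sdiff_eq_zero measurableSet_Ioi h1 (f := fun r : ℝ =>
      r ^ (n - 1) * ∫ u : Metric.sphere (0 : Euc n) 1,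
        indicator {x : Euc n | a < ‖x‖ ∧ ‖x‖ ≤ b} (diverg V) (r • (u : Euc n))
          ∂(volume : Measure (Euc n)).toSphere)]
    · refine setIntegral_congr_fun measurableSet_Ioc fun r hr => ?_
      congr 1
      refine integral_congr_ae (Eventually.of_forall fun u => ?_)
      have hu : ‖(u : Euc n)‖ = 1 := by simp
      have h0 : (0 : ℝ) < r := h1 hr
      simp only
      rw [indicator_of_mem]
      simp only [mem_ofPred_eq, norm_smul, hu, mul_one, Real.norm_eq_abs, abs_of_pos h0]
      exact hr
    · intro r hr
      rw [mul_eq_zero]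
      right
      refine integral_eq_zero_of_ae (Eventually.of_forall fun u => ?_)
      have hu : ‖(u : Euc n)‖ = 1 := by simp
      have h0 : (0 : ℝ) < r := hr.1
      simp only [Pi.zero_apply]
      rw [indicator_of_notMem]
      simp only [mem_ofPred_eq, norm_smul, hu, mul_one, Real.norm_eq_abs, abs_of_pos h0]
      exact hr.2
  · have h0η : (0 : ℝ) ∉ tsupport η := fun h => absurd (hs h) (not_lt.2 hρ)
    have hηd : Continuous (deriv η) := hη.continuous_deriv (by simp)
    set f : Euc n → ℝ := fun x => η ‖x‖ with hf
    -- The support of `η` stays away from `0` since `ρ ≥ 0`, so the radial test function is smooth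
    -- although the norm is not.
    have hf0 : f =ᶠ[𝓝 0] fun _ => 0 := by
      have h1 : ∀ᶠ t in 𝓝 (0 : ℝ), η t = 0 := by
        filter_upwards [(isClosed_tsupport η).isOpen_compl.mem_nhds h0η] with t ht
        exact image_eq_zero_of_notMem_tsupport ht
      have h2 : Tendsto (fun x : Euc n => ‖x‖) (𝓝 0) (𝓝 0) := by
        simpa using (continuous_norm (E := Euc n)).tendsto 0
      exact h2.eventually h1
    have hfd : ContDiff ℝ ∞ f := by
      rw [contDiff_iff_contDiffAt]
      intro x
      by_cases hx : x = 0
      · rw [hx]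
        exact contDiffAt_const.congr_of_eventuallyEq hf0
      · exact hη.contDiffAt.comp x (contDiffAt_norm ℝ hx)
    obtain ⟨R, hR⟩ := hc.isBounded.subset_closedBall 0
    have hfc : HasCompactSupport f := by
      refine HasCompactSupport.intro (isCompact_closedBall (0 : Euc n) R) fun x hx => ?_
      refine image_eq_zero_of_notMem_tsupport (f := η) fun h => hx ?_
      have := hR h
      simpa using this
    have hts : tsupport f ⊆ norm ⁻¹' tsupport η :=
      closure_minimal (fun x hx => subset_tsupport η hx)
        ((isClosed_tsupport η).preimage continuous_norm)
    have hft : tsupport f ⊆ exterior n ρ := fun x hx => hs (hts hx)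
    have hVi : ∀ i, ContDiffOn ℝ 1 (fun y => V y i) (exterior n ρ) := contDiffOn_euclidean.1 hV
    have hmulint : ∀ (p k : Euc n → ℝ), Continuous p → HasCompactSupport p →
        tsupport p ⊆ exterior n ρ → ContinuousOn k (exterior n ρ) →
        Integrable fun x => p x * k x := by
      intro p k hp hpc hps hk
      refine Continuous.integrable_of_hasCompactSupport ?_ (hpc.mul_right)
      refine continuous_of_tsupport fun r hr => ?_
      have hr' : r ∈ exterior n ρ := hps (tsupport_mul_subset_left hr)
      exact hp.continuousAt.mul (hk.continuousAt (ho.mem_nhds hr'))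
    have hf'c : ∀ v, Continuous fun x => fderiv ℝ f x v := fun v =>
      (hfd.continuous_fderiv (by simp)).clm_apply continuous_const
    have hf'cs : ∀ v, HasCompactSupport fun x => fderiv ℝ f x v := fun v =>
      hfc.fderiv_apply (𝕜 := ℝ) v
    have hf'ts : ∀ v, tsupport (fun x => fderiv ℝ f x v) ⊆ exterior n ρ := fun v =>
      (tsupport_fderiv_apply_subset ℝ v).trans hft
    have hdi : ∀ i, ContinuousOn (fun x => fderiv ℝ (fun y => V y i) x (stdVec i)) (exterior n ρ) :=
      fun i => ((hVi i).continuousOn_fderiv_of_isOpen ho (by simp)).clm_apply continuousOn_const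
    have i1 : ∀ i, Integrable fun x => f x * fderiv ℝ (fun y => V y i) x (stdVec i) := fun i =>
      hmulint f _ hfd.continuous hfc hft (hdi i)
    have i2 : ∀ i, Integrable fun x => fderiv ℝ f x (stdVec i) * V x i := fun i =>
      hmulint _ _ (hf'c _) (hf'cs _) (hf'ts _) (hVi i).continuousOn
    -- Integration by parts against the radial test function; `e2` and `e3` rewrite both sides in
    -- polar coordinates, where the gradient of `f` is `η'` times the unit radial vector.
    have e1 : ∫ x, f x * diverg V x = - ∫ x, ∑ i, fderiv ℝ f x (stdVec i) * V x i := by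
      rw [integral_finsetSum _ fun i _ => i2 i, ← Finset.sum_neg_distrib]
      simp only [diverg, partialD, fderivWithin_univ, Finset.mul_sum]
      rw [integral_finsetSum _ fun i _ => i1 i]
      refine Finset.sum_congr rfl fun i _ => ?_
      refine integral_mul_fderiv_eq_neg_fderiv_mul_of_integrable (i2 i) (i1 i)
        (hmulint f _ hfd.continuous hfc hft (hVi i).continuousOn)
        (fun x _ => hfd.differentiable (by simp) x) fun x hx => ?_
      exact ((hVi i).differentiableOn (by simp)).differentiableAt (ho.mem_nhds (hft hx))
    have hz : ∀ r, r ∉ Ioi (0 : ℝ) → r ∉ tsupport η := fun r hr h =>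
      hr (lt_of_le_of_lt hρ (hs h))
    have e2 : ∫ x, f x * diverg V x = ∫ r, η r * D r := by
      rw [integral_polar (hmulint f _ hfd.continuous hfc hft hdc),
        ← setIntegral_eq_integral_of_forall_compl_eq_zero (s := Ioi (0 : ℝ))
          (f := fun r => η r * D r)]
      · refine setIntegral_congr_fun measurableSet_Ioi fun r hr => ?_
        simp only [hD, hf]
        rw [mul_left_comm, ← integral_const_mul (η r)]
        congr 1
        refine integral_congr_ae (Eventually.of_forall fun u => ?_)
        have hu : ‖(u : Euc n)‖ = 1 := by simp
        simp only [norm_smul, hu, mul_one, Real.norm_eq_abs, abs_of_pos (mem_Ioi.1 hr)]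
      · intro r hr
        rw [image_eq_zero_of_notMem_tsupport (hz r hr), zero_mul]
    have e3 : ∫ x, ∑ i, fderiv ℝ f x (stdVec i) * V x i = ∫ r, deriv η r * sphereFlux V r := by
      rw [integral_polar (integrable_finsetSum _ fun i _ => i2 i),
        ← setIntegral_eq_integral_of_forall_compl_eq_zero (s := Ioi (0 : ℝ))
          (f := fun r => deriv η r * sphereFlux V r)]
      · refine setIntegral_congr_fun measurableSet_Ioi fun r hr => ?_
        simp only [sphereFlux]
        rw [mul_left_comm, ← integral_const_mul (deriv η r)]
        congr 1
        refine integral_congr_ae (Eventually.of_forall fun u => ?_)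
        have hu : ‖(u : Euc n)‖ = 1 := by simp
        have hr0 : (0 : ℝ) < r := hr
        have hne : r • (u : Euc n) ≠ 0 := by
          rw [← norm_ne_zero_iff, norm_smul, hu]; simp [hr0.ne']
        simp only
        rw [Finset.mul_sum]
        refine Finset.sum_congr rfl fun i _ => ?_
        have hn : ‖r • (u : Euc n)‖ = r := by
          rw [norm_smul, hu, mul_one, Real.norm_eq_abs, abs_of_pos hr0]
        have hd : HasFDerivAt f (deriv η r • (‖r • (u : Euc n)‖⁻¹ • innerSL ℝ (r • (u : Euc n))))
            (r • (u : Euc n)) := by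
          have h1 : HasDerivAt η (deriv η r) ‖r • (u : Euc n)‖ := by
            rw [hn]; exact ((hη.differentiable (by simp)) r).hasDerivAt
          exact h1.comp_hasFDerivAt _ (hasFDerivAt_norm_euc hne)
        have hnorm : (‖r • (u : Euc n)‖⁻¹ • innerSL ℝ (r • (u : Euc n))) (stdVec i) =
            (u : Euc n) i := by
          rw [hn]
          simp [stdVec, EuclideanSpace.inner_single_right, hr0.ne']
        rw [hd.fderiv, smul_apply, hnorm, smul_eq_mul]
        ring
      · intro r hr
        have : deriv η r = 0 := by
          refine image_eq_zero_of_notMem_tsupport fun h => hz r hr (tsupport_deriv_subset h)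
        rw [this, zero_mul]
    rw [← e2, e1, e3]

end Polar

/-! ### The divergence theorem on the half-space -/

section HalfSpace

/-- The closed half-space `{x_0 ≥ 0}`. -/
def halfSpace (n : ℕ) [NeZero n] : Set (Euc n) := {x | 0 ≤ x 0}

theorem isClosed_halfSpace (n : ℕ) [NeZero n] : IsClosed (halfSpace n) :=
  isClosed_le continuous_const (EuclideanSpace.proj (0 : Fin n) : Euc n →L[ℝ] ℝ).continuous

theorem interior_halfSpace_of_pos {n : ℕ} [NeZero n] {x : Euc n} (hx : 0 < x 0) :
    halfSpace n ∈ 𝓝 x := by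
  have : IsOpen {x : Euc n | 0 < x 0} :=
    isOpen_lt continuous_const (EuclideanSpace.proj (0 : Fin n) : Euc n →L[ℝ] ℝ).continuous
  exact mem_of_superset (this.mem_nhds hx) fun y hy => le_of_lt (show 0 < y 0 from hy)

theorem range_halfSpace (n : ℕ) [NeZero n] : range (𝓡∂ n) = halfSpace n := by
  rw [range_modelWithCornersEuclideanHalfSpace]
  rfl

theorem uniqueDiffOn_halfSpace (n : ℕ) [NeZero n] : UniqueDiffOn ℝ (halfSpace n) := by
  rw [← range_halfSpace]
  exact (𝓡∂ n).uniqueDiffOn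

/-- The inclusion of the boundary hyperplane `{x_0 = 0}`. -/
def bdryIncl (n : ℕ) [NeZero n] : Euc (n - 1) →L[ℝ] Euc n :=
  LinearMap.toContinuousLinearMap
    { toFun := fun y => WithLp.toLp 2 fun i : Fin n =>
        if h : i = 0 then 0 else y ⟨i - 1, by
          have : (i : ℕ) ≠ 0 := fun h' => h (Fin.ext (by simpa using h'))
          omega⟩
      map_add' := fun y z => by
        ext i
        by_cases h : i = 0 <;> simp [h]
      map_smul' := fun r y => by
        ext i
        by_cases h : i = 0 <;> simp [h] }

/-- The projection along the `0`-th coordinate. -/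
def bdryProj (n : ℕ) : Euc n →L[ℝ] Euc (n - 1) :=
  LinearMap.toContinuousLinearMap
    { toFun := fun y => WithLp.toLp 2 fun i : Fin (n - 1) => y ⟨i + 1, by omega⟩
      map_add' := fun y z => by ext i; simp
      map_smul' := fun r y => by ext i; simp }

variable {n : ℕ} [NeZero n]

theorem bdryIncl_zero (y : Euc (n - 1)) : bdryIncl n y 0 = 0 := by
  simp [bdryIncl]

theorem bdryProj_incl (y : Euc (n - 1)) : bdryProj n (bdryIncl n y) = y := by
  ext i
  simp [bdryIncl, bdryProj]

theorem bdryIncl_proj {x : Euc n} (hx : x 0 = 0) : bdryIncl n (bdryProj n x) = x := by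
  ext i
  simp only [bdryIncl, bdryProj, LinearMap.coe_toContinuousLinearMap', LinearMap.coe_mk,
    AddHom.coe_mk]
  split_ifs with h
  · rw [h, hx]
  · have : (i : ℕ) ≠ 0 := fun h' => h (Fin.ext (by simpa using h'))
    exact congrArg (fun k => x k) (Fin.ext (Nat.sub_add_cancel (Nat.one_le_iff_ne_zero.2 this)))

/-- The divergence theorem on the box `[0, R] × [-R, R]^d`, with `R` so large that the field
vanishes on every face except `{x_0 = 0}`. -/
theorem integral_halfSpace_divergence_aux {d : ℕ} {Z : Euc (d + 1) → Euc (d + 1)}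
    (hZ : ContDiffOn ℝ 1 Z (halfSpace (d + 1))) {K : Set (Euc (d + 1))} (hK : IsCompact K)
    (hZK : ∀ x ∈ halfSpace (d + 1), x ∉ K → Z x = 0) :
    IntegrableOn (fun x => ∑ i, fderivWithin ℝ Z (halfSpace (d + 1)) x (stdVec i) i)
      (halfSpace (d + 1)) ∧
    ∫ x in halfSpace (d + 1), ∑ i, fderivWithin ℝ Z (halfSpace (d + 1)) x (stdVec i) i =
      - ∫ y : Fin d → ℝ, Z (WithLp.toLp 2 (Fin.cons 0 y)) 0 := by
  set S := halfSpace (d + 1) with hS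
  have hSc : IsClosed S := isClosed_halfSpace _
  set f : Euc (d + 1) → ℝ := fun x => ∑ i, fderivWithin ℝ Z S x (stdVec i) i with hf
  have hfc : ContinuousOn f S := by
    refine continuousOn_finsetSum _ fun i _ => ?_
    have h1 := (hZ.continuousOn_fderivWithin (uniqueDiffOn_halfSpace _) (by simp)).clm_apply
      (continuousOn_const (c := (stdVec i : Euc (d + 1))))
    exact (EuclideanSpace.proj i : Euc (d + 1) →L[ℝ] ℝ).continuous.comp_continuousOn h1
  have hf0 : ∀ x ∈ S, x ∉ K → f x = 0 := by
    intro x hx hxK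
    have h1 : Z =ᶠ[𝓝[S] x] fun _ => 0 := by
      filter_upwards [self_mem_nhdsWithin, nhdsWithin_le_nhds (hK.isClosed.isOpen_compl.mem_nhds hxK)]
        with y hy hyK
      exact hZK y hy hyK
    have h2 : fderivWithin ℝ Z S x = 0 := by
      rw [h1.fderivWithin_eq_of_mem hx]
      simp
    simp only [hf, h2]
    simp
  obtain ⟨R0, hR0⟩ := hK.isBounded.subset_ball 0
  -- The maximum keeps the box nondegenerate even when `K` is empty or `R0` is not positive.
  set R := max R0 1 with hR
  have hRpos : 0 < R := lt_of_lt_of_le one_pos (le_max_right _ _)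
  have hKR : ∀ x ∈ K, ‖x‖ < R := fun x hx => by
    have := hR0 hx
    rw [mem_ball_zero_iff] at this
    exact lt_of_lt_of_le this (le_max_left _ _)
  have hco : ∀ (x : Euc (d + 1)) i, |x i| ≤ ‖x‖ := fun x i => PiLp.norm_apply_le x i
  let Lε : (Fin (d + 1) → ℝ) ≃L[ℝ] Euc (d + 1) := (EuclideanSpace.equiv (Fin (d + 1)) ℝ).symm
  have hLε : ∀ y, Lε y = WithLp.toLp 2 y := fun y => rfl
  set a : Fin (d + 1) → ℝ := Fin.cons 0 fun _ => -R with ha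
  set b : Fin (d + 1) → ℝ := fun _ => R with hb
  have hab : a ≤ b := by
    intro i
    refine Fin.cases ?_ (fun j => ?_) i
    · simp [ha, hb, hRpos.le]
    · simp [ha, hb, hRpos.le]
  have hIS : ∀ y ∈ Icc a b, Lε y ∈ S := fun y hy => by
    have h0 := hy.1 0
    have h1 : a 0 = 0 := rfl
    exact (show (0 : ℝ) ≤ y 0 from h1 ▸ h0)
  have hmaps : MapsTo Lε (Icc a b) S := hIS
  have hZL : ContinuousOn (fun y => Z (Lε y)) (Icc a b) :=
    hZ.continuousOn.comp Lε.continuous.continuousOn hmaps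
  have hbig : ∀ (x : Euc (d + 1)) i, x ∈ S → R ≤ |x i| → Z x = 0 := fun x i hx hi =>
    hZK x hx fun hK' => absurd (hKR x hK') (not_lt.2 (hi.trans (hco x i)))
  have hout : ∀ y, Lε y ∈ S → y ∉ Icc a b → Lε y ∉ K := by
    intro y hyS hy hyK
    refine hy ⟨fun i => ?_, fun i => ?_⟩
    · refine Fin.cases ?_ (fun j => ?_) i
      · simpa [ha] using! hyS
      · simp only [ha, Fin.cons_succ]
        exact (abs_le.1 ((hco (Lε y) j.succ).trans (hKR _ hyK).le)).1
    · exact (abs_le.1 ((hco (Lε y) i).trans (hKR _ hyK).le)).2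
  have hmp := PiLp.volume_preserving_toLp (Fin (d + 1))
  have hemb : MeasurableEmbedding (@WithLp.toLp 2 (Fin (d + 1) → ℝ)) :=
    Lε.toHomeomorph.measurableEmbedding
  have hpre : MeasurableSet ((@WithLp.toLp 2 (Fin (d + 1) → ℝ)) ⁻¹' S) :=
    hemb.measurable hSc.measurableSet
  have hfi : IntegrableOn f S := by
    have h1 : IntegrableOn f (S ∩ K) :=
      (hfc.mono inter_subset_left).integrableOn_compact (hK.inter_left hSc)
    exact IntegrableOn.of_forall_sdiff_eq_zero h1 hSc.measurableSet fun x hx =>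
      hf0 x hx.1 fun h => hx.2 ⟨hx.1, h⟩
  refine ⟨hfi, ?_⟩
  have hintI : IntegrableOn (fun y => f (Lε y)) (Icc a b) :=
    (hfc.comp Lε.continuous.continuousOn hmaps).integrableOn_compact isCompact_Icc
  have hdiv := integral_divergence_of_hasFDerivAt_off_countable' a b hab
    (fun i y => Z (Lε y) i)
    (fun i y => (EuclideanSpace.proj i : Euc (d + 1) →L[ℝ] ℝ).comp
      ((fderivWithin ℝ Z S (Lε y)).comp (Lε : (Fin (d + 1) → ℝ) →L[ℝ] Euc (d + 1)))) ∅
    countable_empty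
    (fun i => (EuclideanSpace.proj i : Euc (d + 1) →L[ℝ] ℝ).continuous.comp_continuousOn hZL)
    (fun y hy i => by
      have hy0 : 0 < (Lε y) 0 := by
        have := (hy.1 0 (mem_univ _)).1
        simpa [ha] using! this
      have hn := interior_halfSpace_of_pos hy0
      have h1 : HasFDerivAt Z (fderivWithin ℝ Z S (Lε y)) (Lε y) :=
        ((hZ.differentiableOn (by simp) _ (mem_of_mem_nhds hn)).hasFDerivWithinAt).hasFDerivAt hn
      exact (EuclideanSpace.proj i : Euc (d + 1) →L[ℝ] ℝ).hasFDerivAt.comp y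
        (h1.comp y Lε.hasFDerivAt))
    hintI
  have e1 : ∫ x in S, f x = ∫ y in Icc a b, f (Lε y) := by
    rw [← hmp.setIntegral_preimage_emb hemb]
    refine setIntegral_eq_of_subset_of_forall_sdiff_eq_zero hpre hIS fun y hy => ?_
    exact hf0 _ hy.1 (hout y hy.1 hy.2)
  have hfront : ∀ i : Fin (d + 1), ∀ x ∈ Icc (a ∘ i.succAbove) (b ∘ i.succAbove),
      Z (Lε (i.insertNth (b i) x)) i = 0 := by
    intro i x hx
    have hS' : Lε (i.insertNth (b i) x) ∈ S := by
      refine hIS _ ?_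
      rw [Fin.insertNth_mem_Icc]
      exact ⟨⟨hab i, le_rfl⟩, hx⟩
    rw [hbig _ i hS' (by rw [hLε]; simp [hb, abs_of_pos hRpos])]
    rfl
  have hback : ∀ i : Fin d, ∀ x ∈ Icc (a ∘ i.succ.succAbove) (b ∘ i.succ.succAbove),
      Z (Lε (i.succ.insertNth (a i.succ) x)) i.succ = 0 := by
    intro i x hx
    have hS' : Lε (i.succ.insertNth (a i.succ) x) ∈ S := by
      refine hIS _ ?_
      rw [Fin.insertNth_mem_Icc]
      exact ⟨⟨le_rfl, hab _⟩, hx⟩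
    rw [hbig _ i.succ hS' (by rw [hLε]; simp [ha, abs_of_pos hRpos])]
    rfl
  have e2 : ∫ y in Icc a b, f (Lε y) =
      - ∫ x in Icc (a ∘ (0 : Fin (d + 1)).succAbove) (b ∘ (0 : Fin (d + 1)).succAbove),
        Z (Lε ((0 : Fin (d + 1)).insertNth (a 0) x)) 0 := by
    have : ∀ y, f (Lε y) = ∑ i, ((EuclideanSpace.proj i : Euc (d + 1) →L[ℝ] ℝ).comp
      ((fderivWithin ℝ Z S (Lε y)).comp (Lε : (Fin (d + 1) → ℝ) →L[ℝ] Euc (d + 1))))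
        (Pi.single i 1) := fun y => rfl
    simp_rw [this]
    rw [hdiv, Fin.sum_univ_succ]
    rw [Finset.sum_eq_zero fun i _ => ?_, add_zero,
      setIntegral_eq_zero_of_forall_eq_zero (hfront 0), zero_sub]
    rw [setIntegral_eq_zero_of_forall_eq_zero (hfront i.succ),
      setIntegral_eq_zero_of_forall_eq_zero (hback i), sub_zero]
  rw [e1, e2, setIntegral_eq_integral_of_forall_compl_eq_zero]
  · congr 1
    refine integral_congr_ae (Eventually.of_forall fun x => ?_)
    simp only [hLε, Fin.insertNth_zero, ha, Fin.cons_zero]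
    rfl
  · intro x hx
    have hS' : Lε ((0 : Fin (d + 1)).insertNth (a 0) x) ∈ S := by
      have h0 : (Lε ((0 : Fin (d + 1)).insertNth (a 0) x)) 0 = 0 := by
        rw [hLε]
        simp [ha]
      exact h0.ge
    have hn : (0 : Fin (d + 1)).insertNth (a 0) x ∉ Icc a b := by
      rw [Fin.insertNth_mem_Icc]
      exact fun h => hx h.2
    rw [hZK _ hS' (hout _ hS' hn)]
    rfl

/-- The divergence theorem on the half-space. -/
theorem integral_halfSpace_divergence {Z : Euc n → Euc n}
    (hZ : ContDiffOn ℝ 1 Z (halfSpace n)) {K : Set (Euc n)} (hK : IsCompact K)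
    (hZK : ∀ x ∈ halfSpace n, x ∉ K → Z x = 0) :
    IntegrableOn (fun x => ∑ i, fderivWithin ℝ Z (halfSpace n) x (stdVec i) i) (halfSpace n) ∧
    ∫ x in halfSpace n, ∑ i, fderivWithin ℝ Z (halfSpace n) x (stdVec i) i =
      - ∫ y : Euc (n - 1), Z (bdryIncl n y) 0 := by
  obtain ⟨d, rfl⟩ : ∃ d, n = d + 1 := ⟨n - 1, (Nat.sub_add_cancel (NeZero.one_le)).symm⟩
  obtain ⟨h1, h2⟩ := integral_halfSpace_divergence_aux hZ hK hZK
  refine ⟨h1, h2.trans ?_⟩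
  congr 1
  have hmp := PiLp.volume_preserving_ofLp (Fin d)
  have hemb : MeasurableEmbedding (@WithLp.ofLp 2 (Fin d → ℝ)) :=
    (EuclideanSpace.equiv (Fin d) ℝ).toHomeomorph.measurableEmbedding
  rw [← hmp.integral_comp hemb]
  refine integral_congr_ae (Eventually.of_forall fun y => ?_)
  have h3 : bdryIncl (d + 1) y = WithLp.toLp 2 (Fin.cons 0 y.ofLp) := by
    ext i
    refine Fin.cases ?_ (fun j => ?_) i
    · simp [bdryIncl]
    · simp [bdryIncl]
  exact congrArg (fun w => Z w 0) h3.symm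

end HalfSpace

/-! ### The divergence theorem on the hypersurface in a chart -/

section ChartDivergence

variable {n : ℕ} {E : Type*} [TopologicalSpace E] [ChartedSpace (Euc n) E]
  [NeZero n] {M : Type*} [TopologicalSpace M] [ChartedSpace (EuclideanHalfSpace n) M]

/-- The divergence of the flux field multiplied by `χ`. -/
def cutDensity (h : MetricField (𝓡 n) E) (g : MetricField (𝓡∂ n) M) (F : M → E × ℝ)
    (N : ∀ p : M, TangentSpace ((𝓡 n).prod 𝓘(ℝ, ℝ)) (F p)) (χ : M → ℝ) (p : M) : ℝ :=
  χ p * massDensity h g F N p + tD (𝓡∂ n) 𝓘(ℝ, ℝ) χ univ p (fluxVec h g F N p)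

/-- The flux field as a density in the coordinates `φ`. -/
def fluxDensity (h : MetricField (𝓡 n) E) (g : MetricField (𝓡∂ n) M) (F : M → E × ℝ)
    (N : ∀ p : M, TangentSpace ((𝓡 n).prod 𝓘(ℝ, ℝ)) (F p)) (φ : Euc n → M) (s : Set (Euc n))
    (y : Euc n) : Euc n :=
  Real.sqrt (metricCoeff g s φ y).det • paramFlux h g F N φ s y

variable [IsManifold (𝓡 n) ∞ E] [IsManifold (𝓡∂ n) ∞ M]
  {h : SmoothMetric (𝓡 n) E}
  {g : SmoothMetric (𝓡∂ n) M}
  {F : M → E × ℝ} {N : ∀ p : M, TangentSpace ((𝓡 n).prod 𝓘(ℝ, ℝ)) (F p)}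
  {φ : Euc n → M} {s : Set (Euc n)} {y : Euc n} {χ : M → ℝ}

theorem cutDensity_eq_zero {p : M} (hp : p ∉ tsupport χ) :
    cutDensity (toField h) (toField g) F N χ p = 0 := by
  have h1 : χ =ᶠ[𝓝 p] fun _ => 0 := by
    filter_upwards [(isClosed_tsupport χ).isOpen_compl.mem_nhds hp] with q hq
    exact image_eq_zero_of_notMem_tsupport hq
  have h2 : tD (𝓡∂ n) 𝓘(ℝ, ℝ) χ univ p = 0 := by
    rw [tD_congr_nhds (φ' := fun _ => 0) (by rwa [nhdsWithin_univ]) h1.self_of_nhds, tD_univ]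
    exact mfderiv_const
  rw [cutDensity, h2, h1.self_of_nhds]
  simp

theorem contDiffOn_sqrt_det (hφ : IsParam (𝓡∂ n) φ s) :
    ContDiffOn ℝ ∞ (fun z => Real.sqrt (metricCoeff (toField g) s φ z).det) s := fun z hz =>
  (contDiffWithinAt_det fun i j => hφ.contDiffOn_metricCoeff g i j z hz).sqrt
    (hφ.isMetric hz g).det_pos.ne'

namespace IsHypersurface

variable (hF : IsHypersurface (toField h) (toField g) F N)
include hF

theorem contDiffOn_fluxDensity (hφ : IsParam (𝓡∂ n) φ s) :
    ContDiffOn ℝ ∞ (fluxDensity (toField h) (toField g) F N φ s) s :=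
  (contDiffOn_sqrt_det hφ).smul (hF.contDiffOn_paramFlux hφ)

/-- The product rule: `√det · χ` times the divergence of the flux field, plus `dχ` applied to it.
The latter is independent of coordinates by `tD_paramFlux`. -/
theorem diverg_cut (hφ : IsParam (𝓡∂ n) φ s) (hs : IsOpen s) (hy : y ∈ s)
    (hχ : MDifferentiable (𝓡∂ n) 𝓘(ℝ, ℝ) χ) :
    diverg (fun z => χ (φ z) • fluxDensity (toField h) (toField g) F N φ s z) y =
      Real.sqrt (metricCoeff (toField g) s φ y).det *
        cutDensity (toField h) (toField g) F N χ (φ y) := by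
  have hφy := ((hφ.smooth y hy).mdifferentiableWithinAt (by simp))
  have h1 := tD_comp (t := univ) (hχ (φ y)).mdifferentiableWithinAt hφy (mapsTo_univ _ _)
    (hφ.uniq.uniqueMDiffOn y hy)
  rw [tD_vectorSpace] at h1
  have hc : DifferentiableAt ℝ (fun z => χ (φ z)) y := by
    have h3 : MDifferentiableWithinAt 𝓘(ℝ, Euc n) 𝓘(ℝ, ℝ) (χ ∘ φ) s y :=
      (hχ (φ y)).comp_mdifferentiableWithinAt y hφy
    exact (mdifferentiableWithinAt_iff_differentiableWithinAt.1 h3).differentiableAt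
      (hs.mem_nhds hy)
  have hV := contDiffOn_euclidean.1 (hF.contDiffOn_fluxDensity hφ)
  have hVd : ∀ i, DifferentiableAt ℝ
      (fun z => fluxDensity (toField h) (toField g) F N φ s z i) y := fun i =>
    ((hV i).differentiableOn (by simp) y hy).differentiableAt (hs.mem_nhds hy)
  have hd := hF.divergence_paramFlux hφ hs hy
  have e : ∀ i, partialD univ
      (fun z => (χ (φ z) • fluxDensity (toField h) (toField g) F N φ s z) i) i y =
      χ (φ y) * partialD univ (fun z => fluxDensity (toField h) (toField g) F N φ s z i) i y +
      fluxDensity (toField h) (toField g) F N φ s y i *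
        fderiv ℝ (fun z => χ (φ z)) y (stdVec i) := by
    intro i
    simp only [partialD, fderivWithin_univ, PiLp.smul_apply, smul_eq_mul]
    rw [fderiv_fun_mul hc (hVd i)]
    simp
  simp only [diverg]
  rw [Finset.sum_congr rfl fun i _ => e i, Finset.sum_add_distrib, ← Finset.mul_sum]
  have e2 : ∑ i, fluxDensity (toField h) (toField g) F N φ s y i *
      fderiv ℝ (fun z => χ (φ z)) y (stdVec i) =
      fderiv ℝ (fun z => χ (φ z)) y (fluxDensity (toField h) (toField g) F N φ s y) := by
    conv_rhs => rw [eq_sum_stdVec (fluxDensity (toField h) (toField g) F N φ s y)]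
    simp only [map_sum, map_smul, smul_eq_mul]
  rw [e2]
  have e3 : fderiv ℝ (fun z => χ (φ z)) y = fderivWithin ℝ (χ ∘ φ) s y :=
    (fderivWithin_of_isOpen hs hy).symm
  rw [e3, h1, ContinuousLinearMap.comp_apply]
  simp only [fluxDensity, map_smul, smul_eq_mul, PiLp.smul_apply] at hd ⊢
  rw [hd, hF.tD_paramFlux hφ hy, cutDensity]
  ring

end IsHypersurface

/-- The flux field multiplied by `χ` in the chart at `p`, extended by zero. -/
def cutFlux (h : MetricField (𝓡 n) E) (g : MetricField (𝓡∂ n) M) (F : M → E × ℝ)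
    (N : ∀ p : M, TangentSpace ((𝓡 n).prod 𝓘(ℝ, ℝ)) (F p)) (χ : M → ℝ) (p : M) :
    Euc n → Euc n :=
  (extChartAt (𝓡∂ n) p).target.indicator fun x => χ ((extChartAt (𝓡∂ n) p).symm x) •
    fluxDensity h g F N (extChartAt (𝓡∂ n) p).symm (extChartAt (𝓡∂ n) p).target x

section CutFlux

variable [T2Space M] {p : M}

theorem cutFlux_eq_zero {x : Euc n}
    (hx : x ∉ extChartAt (𝓡∂ n) p '' tsupport χ) :
    cutFlux (toField h) (toField g) F N χ p x = 0 := by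
  by_cases hxt : x ∈ (extChartAt (𝓡∂ n) p).target
  · have h0 : χ ((extChartAt (𝓡∂ n) p).symm x) = 0 :=
      image_eq_zero_of_notMem_tsupport fun hm => hx ⟨_, hm, (extChartAt (𝓡∂ n) p).right_inv hxt⟩
    rw [cutFlux, indicator_of_mem hxt, h0, zero_smul]
  · rw [cutFlux, indicator_of_notMem hxt]

theorem isCompact_image_chart (hK : HasCompactSupport χ)
    (hp : tsupport χ ⊆ (extChartAt (𝓡∂ n) p).source) :
    IsCompact (extChartAt (𝓡∂ n) p '' tsupport χ) :=
  hK.image_of_continuousOn ((continuousOn_extChartAt p).mono hp)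

/-- The support of `χ` is a compact subset of the chart, so its image is closed and the extension by
zero creates no jump. -/
theorem IsHypersurface.contDiffOn_cutFlux (hF : IsHypersurface (toField h) (toField g) F N)
    (hχ : ContMDiff (𝓡∂ n) 𝓘(ℝ, ℝ) ∞ χ) (hK : HasCompactSupport χ)
    (hp : tsupport χ ⊆ (extChartAt (𝓡∂ n) p).source) :
    ContDiffOn ℝ 1 (cutFlux (toField h) (toField g) F N χ p) (halfSpace n) := by
  set κ := extChartAt (𝓡∂ n) p with hκ
  have hφ := isParam_chart (I := 𝓡∂ n) p
  have hsm : ContDiffOn ℝ ∞ (fun x => χ (κ.symm x) •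
      fluxDensity (toField h) (toField g) F N κ.symm κ.target x) κ.target :=
    (contMDiffOn_iff_contDiffOn.1 (hχ.comp_contMDiffOn hφ.smooth)).smul
      (hF.contDiffOn_fluxDensity hφ)
  intro x hx
  by_cases hxK : x ∈ κ '' tsupport χ
  · have hxt : x ∈ κ.target := by
      obtain ⟨q, hq, rfl⟩ := hxK
      exact κ.map_source (hp hq)
    have h1 := ((hsm x hxt).of_le (m := 1) (by simp)).congr_of_eventuallyEq_of_mem
      (f₁ := cutFlux (toField h) (toField g) F N χ p) (by
        filter_upwards [self_mem_nhdsWithin] with z hz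
        exact indicator_of_mem hz _) hxt
    refine h1.congr_set ?_
    rw [← range_halfSpace]
    exact chart_target_eventuallyEq p hxt
  · have h1 : cutFlux (toField h) (toField g) F N χ p =ᶠ[𝓝 x] fun _ => 0 := by
      filter_upwards [(isCompact_image_chart hK hp).isClosed.isOpen_compl.mem_nhds hxK] with z hz
      exact cutFlux_eq_zero hz
    exact (contDiffAt_const.congr_of_eventuallyEq h1).contDiffWithinAt

end CutFlux

theorem volume_hyperplane : volume {x : Euc n | x 0 = 0} = 0 := by
  have := Measure.addHaar_submodule (volume : Measure (Euc n))
    (LinearMap.ker (EuclideanSpace.proj (0 : Fin n) : Euc n →L[ℝ] ℝ).toLinearMap) (by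
      intro htop
      have : (stdVec 0 : Euc n) ∈ LinearMap.ker
        (EuclideanSpace.proj (0 : Fin n) : Euc n →L[ℝ] ℝ).toLinearMap := by rw [htop]; trivial
      simp [stdVec] at this)
  exact this

variable [SecondCountableTopology M] [MeasurableSpace M] [BorelSpace M] [T2Space M]

/-- The half-space divergence theorem for the flux field of `χ W` in the chart. The pointwise
formula for the divergence is needed only at interior points, since the boundary hyperplane is a
null set. -/
theorem IsHypersurface.integral_cutDensity_chart
    (hF : IsHypersurface (toField h) (toField g) F N) (hχ : ContMDiff (𝓡∂ n) 𝓘(ℝ, ℝ) ∞ χ)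
    (hK : HasCompactSupport χ) (p : M) (hp : tsupport χ ⊆ (extChartAt (𝓡∂ n) p).source) :
    Integrable (cutDensity (toField h) (toField g) F N χ) (riemannianVolume (toField g)) ∧
    ∫ q, cutDensity (toField h) (toField g) F N χ q ∂(riemannianVolume (toField g)) =
      - ∫ y : Euc (n - 1), cutFlux (toField h) (toField g) F N χ p (bdryIncl n y) 0 := by
  set κ := extChartAt (𝓡∂ n) p with hκ
  set Z := cutFlux (toField h) (toField g) F N χ p with hZdef
  have hφ := isParam_chart (I := 𝓡∂ n) p
  have hts : κ.target ⊆ halfSpace n := by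
    rw [← range_halfSpace]; exact extChartAt_target_subset_range p
  have hnear : ∀ x ∈ κ.target, κ.target =ᶠ[𝓝 x] halfSpace n := by
    intro x hx
    rw [← range_halfSpace]; exact chart_target_eventuallyEq p hx
  set K := κ '' tsupport χ with hKdef
  have hKc : IsCompact K := isCompact_image_chart hK hp
  have hZ0 : ∀ x, x ∉ K → Z x = 0 := fun x hx => cutFlux_eq_zero hx
  have hKt : K ⊆ κ.target := by
    rintro _ ⟨q, hq, rfl⟩
    exact κ.map_source (hp hq)
  have hZs : ContDiffOn ℝ 1 Z (halfSpace n) := hF.contDiffOn_cutFlux hχ hK hp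
  obtain ⟨hfi, hdiv⟩ := integral_halfSpace_divergence hZs hKc fun x _ => hZ0 x
  set D : Euc n → ℝ := fun x => ∑ i, fderivWithin ℝ Z (halfSpace n) x (stdVec i) i with hD
  have hDc : ContinuousOn D (halfSpace n) := by
    refine continuousOn_finsetSum _ fun i _ => ?_
    have h1 := (hZs.continuousOn_fderivWithin (uniqueDiffOn_halfSpace _) (by simp)).clm_apply
      (continuousOn_const (c := (stdVec i : Euc n)))
    exact (EuclideanSpace.proj i : Euc n →L[ℝ] ℝ).continuous.comp_continuousOn h1
  have hD0 : ∀ x ∈ halfSpace n \ κ.target, D x = 0 := by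
    intro x hx
    have h1 : Z =ᶠ[𝓝[halfSpace n] x] fun _ => 0 := by
      filter_upwards [nhdsWithin_le_nhds (hKc.isClosed.isOpen_compl.mem_nhds
        fun h => hx.2 (hKt h))] with z hz
      exact hZ0 z hz
    have h2 : fderivWithin ℝ Z (halfSpace n) x = 0 := by
      rw [h1.fderivWithin_eq_of_mem hx.1]; simp
    simp only [hD, h2]
    simp
  have key : ∀ x ∈ κ.target, 0 < x 0 → D x = Real.sqrt (chartCoeff (toField g) p x).det *
      cutDensity (toField h) (toField g) F N χ (κ.symm x) := by
    intro x hx hx0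
    have hnb := interior_halfSpace_of_pos hx0
    have hxt : κ.target ∈ 𝓝 x := by
      filter_upwards [hnear x hx, hnb] with z h1 h2
      exact h1.mpr h2
    have hxi : x ∈ interior κ.target := mem_interior_iff_mem_nhds.2 hxt
    have hc : IsParam (𝓡∂ n) κ.symm (interior κ.target) := by
      have := hφ.inter_open (isOpen_interior (s := κ.target))
      rwa [inter_eq_self_of_subset_right interior_subset] at this
    have hset : ∀ z ∈ interior κ.target, κ.target =ᶠ[𝓝 z] interior κ.target := by
      intro z hz
      filter_upwards [isOpen_interior.mem_nhds hz] with w hw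
      exact propext ⟨fun _ => hw, fun _ => interior_subset hw⟩
    have e := hF.diverg_cut hc isOpen_interior hxi (hχ.mdifferentiable (by simp))
    rw [chartCoeff_eq _ _ hx, metricCoeff_congr_set _ (hset x hxi)]
    refine Eq.trans ?_ e
    have hev : (fun z => χ (κ.symm z) • fluxDensity (toField h) (toField g) F N κ.symm
        (interior κ.target) z) =ᶠ[𝓝 x] Z := by
      filter_upwards [isOpen_interior.mem_nhds hxi] with z hz
      rw [hZdef, cutFlux, indicator_of_mem (interior_subset hz), fluxDensity, fluxDensity,
        metricCoeff_congr_set _ (hset z hz), paramFlux, paramFlux,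
        coordFlux_congr_set (hset z hz)]
    simp only [hD, diverg]
    refine Finset.sum_congr rfl fun i _ => ?_
    have h3 : (fun z => (χ (κ.symm z) • fluxDensity (toField h) (toField g) F N κ.symm
        (interior κ.target) z) i) =ᶠ[𝓝 x] fun z => Z z i := by
      filter_upwards [hev] with z hz
      rw [hz]
    have h4 : DifferentiableAt ℝ Z x :=
      (hZs.differentiableOn (by simp) x (hts hx)).differentiableAt hnb
    have h5 := (EuclideanSpace.proj i : Euc n →L[ℝ] ℝ).hasFDerivAt.comp x h4.hasFDerivAt
    rw [partialD, fderivWithin_univ, h3.fderiv_eq, fderivWithin_of_mem_nhds hnb]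
    exact (congrArg (fun L => L (stdVec i)) h5.fderiv).symm
  have hmt : MeasurableSet κ.target := measurableSet_extChartAt_target p
  -- Discarding the hyperplane avoids comparing one-sided second derivatives with the curvature
  -- formulas at the boundary.
  have hpos : ∀ᵐ x ∂(volume.restrict κ.target), 0 < x 0 := by
    have h1 : ∀ᵐ x : Euc n, ¬ (x 0 = 0) := by
      rw [ae_iff]
      simpa using! volume_hyperplane (n := n)
    filter_upwards [ae_restrict_mem hmt, ae_restrict_of_ae h1] with x hx hx0
    exact lt_of_le_of_ne (show 0 ≤ x 0 from hts hx) (Ne.symm hx0)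
  have hsq : ContinuousOn (fun x => Real.sqrt (chartCoeff (toField g) p x).det) κ.target :=
    (contDiffOn_sqrt_det hφ).continuousOn.congr fun x hx => by rw [chartCoeff_eq _ _ hx]
  have hne : ∀ x ∈ κ.target, Real.sqrt (chartCoeff (toField g) p x).det ≠ 0 := fun x hx => by
    rw [chartCoeff_eq _ _ hx]
    exact (Real.sqrt_pos.2 (hφ.isMetric hx g).det_pos).ne'
  have hkey : (fun x => Real.sqrt (chartCoeff (toField g) p x).det *
      cutDensity (toField h) (toField g) F N χ (κ.symm x)) =ᵐ[volume.restrict κ.target] D := by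
    filter_upwards [hpos, ae_restrict_mem hmt] with x hx0 hx
    exact (key x hx hx0).symm
  -- Measurability of the density is read off from the divergence `D`, which is continuous up to the
  -- boundary.
  have hb : AEStronglyMeasurable (fun x => cutDensity (toField h) (toField g) F N χ (κ.symm x))
      (volume.restrict κ.target) := by
    have h1 : AEStronglyMeasurable (fun x => (Real.sqrt (chartCoeff (toField g) p x).det)⁻¹ * D x)
        (volume.restrict κ.target) :=
      ((hsq.inv₀ hne).mul (hDc.mono hts)).aestronglyMeasurable hmt
    refine h1.congr ?_
    filter_upwards [hkey, ae_restrict_mem hmt] with x hx hxt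
    rw [← hx, ← mul_assoc, inv_mul_cancel₀ (hne x hxt), one_mul]
  have himg : κ '' κ.source = κ.target := κ.image_source_eq_target
  have hI := (isMetricCoord_chart (fieldBilin_toField g) p).integral_eq (fieldBilin_toField g)
    (f := cutDensity (toField h) (toField g) F N χ)
    (b := fun x => cutDensity (toField h) (toField g) F N χ (κ.symm x))
    (by rw [← hκ, himg]; exact hsq) (by rw [← hκ, himg]; exact hb)
    (fun q hq => by rw [κ.left_inv hq])
  rw [← hκ, himg] at hI
  have hzero : ∀ q ∉ κ.source, cutDensity (toField h) (toField g) F N χ q = 0 := fun q hq =>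
    cutDensity_eq_zero fun h => hq (hp h)
  refine ⟨?_, ?_⟩
  · rw [← integrableOn_iff_integrable_of_support_subset
      (s := κ.source) (fun q hq => by_contra fun h => hq (hzero q h)), hI.1]
    exact (hfi.mono_set hts).congr hkey.symm
  · rw [← setIntegral_eq_integral_of_forall_compl_eq_zero hzero, hI.2, integral_congr_ae hkey,
      ← hdiv]
    exact (setIntegral_eq_of_subset_of_forall_sdiff_eq_zero (isClosed_halfSpace n).measurableSet
      hts hD0).symm

end ChartDivergence

/-! ### Hyperplanes in a Euclidean vector space -/

section Hyperplane

variable {n : ℕ}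

/-- `S` is an isometric embedding of `(ℝ^(n-1), B)` in `(ℝ^n, A)` with unit normal `m`. -/
structure IsHyperplane (A : Matrix (Fin n) (Fin n) ℝ) (B : Matrix (Fin (n - 1)) (Fin (n - 1)) ℝ)
    (S : Euc (n - 1) →L[ℝ] Euc n) (m : Euc n) : Prop where
  metric : IsMetric A
  metric_sub : IsMetric B
  isometric : ∀ a b, bil B a b = bil A (S a) (S b)
  unit : bil A m m = 1
  orth : ∀ a, bil A m (S a) = 0

variable [NeZero n] {A : Matrix (Fin n) (Fin n) ℝ} {B : Matrix (Fin (n - 1)) (Fin (n - 1)) ℝ}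
  {S : Euc (n - 1) →L[ℝ] Euc n} {m : Euc n}

namespace IsHyperplane

variable (h : IsHyperplane A B S m)
include h

/-- As for hypersurfaces of the product: the map `(a, r) ↦ S a + r m` is injective between spaces of
equal dimension. -/
theorem exists_decomp (v : Euc n) : ∃ a, v = S a + bil A v m • m := by
  let L : (Euc (n - 1) × ℝ) →ₗ[ℝ] Euc n :=
    { toFun := fun z => S z.1 + z.2 • m
      map_add' := by intro a b; simp [add_smul]; abel
      map_smul' := by intro r a; simp [mul_smul] }
  have orth' : ∀ a, bil A (S a) m = 0 := fun a => by rw [h.metric.bil_comm]; exact h.orth a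
  have hcoef : ∀ a (r : ℝ), bil A (S a + r • m) m = r := fun a r => by
    simp only [map_add, map_smul, add_apply, smul_apply, smul_eq_mul, orth', h.unit]
    ring
  have hinj : Function.Injective L := by
    rw [injective_iff_map_eq_zero]
    rintro ⟨a, r⟩ hv
    simp only [LinearMap.coe_mk, AddHom.coe_mk, L] at hv
    have hr : r = 0 := by rw [← hcoef a r, hv]; simp
    subst hr
    rw [zero_smul, add_zero] at hv
    have : a = 0 := by
      by_contra hne
      have := h.metric_sub.pos a hne
      rw [h.isometric, hv] at this
      simp at this
    simp [this]
  have hdim : Module.finrank ℝ (Euc (n - 1) × ℝ) = Module.finrank ℝ (Euc n) := by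
    have : 1 ≤ n := NeZero.one_le
    simp
    omega
  obtain ⟨⟨a, r⟩, hv⟩ := (LinearMap.injective_iff_surjective_of_finrank_eq_finrank hdim).1 hinj v
  simp only [LinearMap.coe_mk, AddHom.coe_mk, L] at hv
  exact ⟨a, by rw [← hv, hcoef]⟩

theorem eq_normal {v : Euc n} (hv : ∀ a, bil A v (S a) = 0) : v = bil A v m • m := by
  obtain ⟨a, ha⟩ := h.exists_decomp v
  have h0 : a = 0 := by
    by_contra hne
    have e := h.metric_sub.pos a hne
    have e1 := hv a
    rw [ha] at e1
    simp only [map_add, map_smul, add_apply, smul_apply, smul_eq_mul, h.orth, mul_zero,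
      add_zero] at e1
    rw [h.isometric, e1] at e
    exact lt_irrefl _ e
  rw [h0, map_zero, zero_add] at ha
  exact ha

theorem inv_split (i k : Fin n) :
    A⁻¹ i k = (∑ a, ∑ b, B⁻¹ a b * (S (stdVec a) i * S (stdVec b) k)) + m i * m k := by
  let p : Euc n := sharp A fun j => if j = k then 1 else 0
  have hp : ∀ w : Euc n, bil A p w = w k := fun w => by
    have := h.metric.bil_sharp (EuclideanSpace.proj k : Euc n →L[ℝ] ℝ) w
    simp only [PiLp.proj_apply, stdVec_apply] at this
    simp only [p]
    rw [← this]
    congr 3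
    funext j
    simp [eq_comm]
  obtain ⟨v, h1⟩ := h.exists_decomp p
  have hv : v = sharp B fun b => S (stdVec b) k := by
    refine h.metric_sub.eq_of_bil fun c => ?_
    have e := h.metric_sub.bil_sharp ((EuclideanSpace.proj k : Euc n →L[ℝ] ℝ) ∘L S) c
    simp only [ContinuousLinearMap.comp_apply, PiLp.proj_apply] at e
    rw [e, h.isometric, ← hp (S c), h1]
    simp only [map_add, map_smul, add_apply, smul_apply, smul_eq_mul, h.orth]
    ring
  have e := congrArg (fun w : Euc n => w i) h1
  simp only [PiLp.add_apply, PiLp.smul_apply, smul_eq_mul, hp m] at e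
  have e0 : p i = A⁻¹ i k := by simp [p, sharp_apply]
  rw [← e0, e, hv, mul_comm (m k)]
  congr 1
  conv_lhs => rw [eq_sum_stdVec (sharp B _)]
  simp only [map_sum, map_smul, PiLp.smul_apply, smul_eq_mul, WithLp.ofLp_sum, Finset.sum_apply]
  refine Finset.sum_congr rfl fun a _ => ?_
  rw [sharp_apply, Finset.sum_mul]
  exact Finset.sum_congr rfl fun b _ => by ring

end IsHyperplane

/-- The coefficients of `A` on the hyperplane `{x_0 = 0}`. -/
def bdryBlock (A : Matrix (Fin n) (Fin n) ℝ) : Matrix (Fin (n - 1)) (Fin (n - 1)) ℝ :=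
  Matrix.of fun i k => bil A (bdryIncl n (stdVec i)) (bdryIncl n (stdVec k))

theorem bil_bdryBlock (A : Matrix (Fin n) (Fin n) ℝ) (a b : Euc (n - 1)) :
    bil (bdryBlock A) a b = bil A (bdryIncl n a) (bdryIncl n b) :=
  (((IsBilin.clm (bil A)).comp (bdryIncl n)).eq_bil a b).symm

/-- The boundary block is the minor obtained by deleting row and column `0`, and this minor is an
entry of the adjugate. -/
theorem det_bdryBlock (hA : IsMetric A) : (bdryBlock A).det = A.det * A⁻¹ 0 0 := by
  obtain ⟨d, rfl⟩ : ∃ d, n = d + 1 := ⟨n - 1, (Nat.sub_add_cancel (NeZero.one_le)).symm⟩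
  have e : bdryBlock A = A.submatrix Fin.succ Fin.succ := by
    ext i k
    have hs : ∀ i : Fin d, bdryIncl (d + 1) (stdVec i) = stdVec i.succ := by
      intro i
      ext l
      refine Fin.cases ?_ (fun l' => ?_) l
      · simp [bdryIncl, eq_comm]
      · simp [bdryIncl]
    simp only [bdryBlock, Matrix.of_apply, Matrix.submatrix_apply]
    erw [hs i, hs k, bil_stdVec]
  rw [e, Matrix.inv_def, Matrix.smul_apply, Matrix.adjugate_fin_succ_eq_det_submatrix]
  simp only [Fin.succAbove_zero, Fin.val_zero, add_zero, pow_zero, one_mul, smul_eq_mul,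
    Ring.inverse_eq_inv']
  field_simp [hA.det_pos.ne']

end Hyperplane

/-! ### Boundary points and outward vectors in charts -/

section BoundaryChart

variable {d : ℕ} {H : Type*} [TopologicalSpace H] {I : ModelWithCorners ℝ (Euc d) H}
  {M : Type*} [TopologicalSpace M] [ChartedSpace H M] [IsManifold I ∞ M]

theorem tD_eq_fderivWithin_extChartAt {d' : ℕ} {f : M → Euc d'} {q : M}
    (hf : MDifferentiableAt I 𝓘(ℝ, Euc d') f q) :
    HasFDerivWithinAt (f ∘ (extChartAt I q).symm) (tD I 𝓘(ℝ, Euc d') f univ q) (range I)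
      (extChartAt I q q) := by
  rw [tD_univ]
  have := hf.hasMFDerivAt.2
  simpa [writtenInExtChartAt] using! this

theorem tD_extChartAt_self (q : M) :
    tD I 𝓘(ℝ, Euc d) (extChartAt I q) univ q = ContinuousLinearMap.id ℝ _ := by
  have h1 : MDifferentiableAt I 𝓘(ℝ, Euc d) (extChartAt I q) q :=
    (contMDiffAt_extChartAt (n := ∞)).mdifferentiableAt (by simp)
  have h2 := tD_eq_fderivWithin_extChartAt h1
  have h3 : HasFDerivWithinAt (extChartAt I q ∘ (extChartAt I q).symm)
      (ContinuousLinearMap.id ℝ _) (range I) (extChartAt I q q) := by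
    refine HasFDerivWithinAt.congr_of_eventuallyEq (hasFDerivWithinAt_id _ _) ?_
      ((extChartAt I q).right_inv (mem_extChartAt_target q))
    filter_upwards [extChartAt_target_mem_nhdsWithin (I := I) q] with y hy
    exact (extChartAt I q).right_inv hy
  exact UniqueDiffWithinAt.eq (I.uniqueDiffWithinAt_image) h2 h3

/-- Within the range of the model derivatives are unique, so a component that is locally constant
has zero derivative even at a boundary point. -/
theorem tD_eval {d' : ℕ} {f : M → Euc d'} {q : M}
    (hf : MDifferentiableAt I 𝓘(ℝ, Euc d') f q) {k : Fin d'} {c : ℝ}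
    (h0 : ∀ᶠ p in 𝓝 q, f p k = c) (v : Euc d) :
    tD I 𝓘(ℝ, Euc d') f univ q v k = 0 := by
  have h1 := (EuclideanSpace.proj k : Euc d' →L[ℝ] ℝ).hasFDerivAt.comp_hasFDerivWithinAt _
    (tD_eq_fderivWithin_extChartAt hf)
  have h2 : HasFDerivWithinAt ((EuclideanSpace.proj k : Euc d' →L[ℝ] ℝ) ∘
      (f ∘ (extChartAt I q).symm)) (0 : Euc d →L[ℝ] ℝ) (range I) (extChartAt I q q) := by
    refine HasFDerivWithinAt.congr_of_eventuallyEq (hasFDerivWithinAt_const c _ _) ?_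
      (by simpa using h0.self_of_nhds)
    have hc := (continuousAt_extChartAt_symm (I := I) q).continuousWithinAt (s := range I)
    rw [ContinuousWithinAt, extChartAt_to_inv] at hc
    filter_upwards [hc.eventually h0] with y hy
    exact hy
  have h3 := UniqueDiffWithinAt.eq (I.uniqueDiffWithinAt_image) h1 h2
  exact congrArg (fun L => L v) h3

variable {n : ℕ} [NeZero n] {N : Type*} [TopologicalSpace N]
  [ChartedSpace (EuclideanHalfSpace n) N] [IsManifold (𝓡∂ n) ∞ N]

/-- Being a boundary point can be tested in any chart of the atlas; near the point the chart target
coincides with the half-space, whose frontier is `{x_0 = 0}`. -/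
theorem isBoundaryPoint_iff_chart {p q : N} (hq : q ∈ (extChartAt (𝓡∂ n) p).source) :
    (𝓡∂ n).IsBoundaryPoint q ↔ extChartAt (𝓡∂ n) p q 0 = 0 := by
  have ht : extChartAt (𝓡∂ n) p q ∈ (extChartAt (𝓡∂ n) p).target := (extChartAt _ p).map_source hq
  have h1 := chart_target_eventuallyEq p ht
  have h2 : extChartAt (𝓡∂ n) p q ∈ frontier (extChartAt (𝓡∂ n) p).target ↔
      extChartAt (𝓡∂ n) p q ∈ frontier (range (𝓡∂ n)) := by
    have hr := extChartAt_target_subset_range p ht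
    have h3 := not_congr (mem_interior_iff_notMem_frontier ht)
    have h4 := not_congr (mem_interior_iff_notMem_frontier hr)
    rw [not_not] at h3 h4
    rw [← h3, ← h4, mem_interior_iff_mem_nhds, mem_interior_iff_mem_nhds]
    refine not_congr ⟨fun h => ?_, fun h => ?_⟩
    · filter_upwards [h1, h] with z hz hz' using hz.mp hz'
    · filter_upwards [h1, h] with z hz hz' using hz.mpr hz'
  refine ((𝓡∂ n).isBoundaryPoint_iff_of_mem_atlas (n := ∞) (by simp)
    (chart_mem_atlas (EuclideanHalfSpace n) p) (by simpa using hq)).trans (h2.trans ?_)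
  rw [frontier_range_modelWithCornersEuclideanHalfSpace]
  exact ⟨fun h => (show (0 : ℝ) = _ from h).symm, fun h => (show (0 : ℝ) = _ from h.symm)⟩

/-- Vectors that point out of the manifold in the chart at `q` do so in every chart. -/
theorem tD_chart_outward {p q : N} (hq : q ∈ (extChartAt (𝓡∂ n) p).source)
    (hb : (𝓡∂ n).IsBoundaryPoint q) {v : Euc n} (hv : v 0 ≤ 0) :
    tD (𝓡∂ n) 𝓘(ℝ, Euc n) (extChartAt (𝓡∂ n) p) univ q v 0 ≤ 0 := by
  have h1 : MDifferentiableAt (𝓡∂ n) 𝓘(ℝ, Euc n) (extChartAt (𝓡∂ n) p) q :=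
    (contMDiffAt_extChartAt' (n := ∞) (by simpa using hq)).mdifferentiableAt (by simp)
  have h2 := (EuclideanSpace.proj (0 : Fin n) : Euc n →L[ℝ] ℝ).hasFDerivAt.comp_hasFDerivWithinAt _
    (tD_eq_fderivWithin_extChartAt h1)
  have hpos : ∀ z : N, 0 ≤ extChartAt (𝓡∂ n) p z 0 := fun z => by
    have h0 : extChartAt (𝓡∂ n) p z ∈ range (𝓡∂ n) := ⟨_, rfl⟩
    rw [range_halfSpace] at h0
    exact h0
  -- The `0`-th coordinate of the other chart is nonnegative and vanishes at `q`, so it has a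
  -- minimum there; its derivative along the inward vector `-v` is therefore nonnegative.
  have h3 : IsLocalMinOn ((EuclideanSpace.proj (0 : Fin n) : Euc n →L[ℝ] ℝ) ∘
      (extChartAt (𝓡∂ n) p ∘ (extChartAt (𝓡∂ n) q).symm)) (range (𝓡∂ n))
      (extChartAt (𝓡∂ n) q q) := by
    refine Eventually.of_forall fun z => ?_
    simp only [Function.comp_apply, extChartAt_to_inv, PiLp.proj_apply]
    rw [(isBoundaryPoint_iff_chart hq).1 hb]
    exact hpos _
  have hx0 := (isBoundaryPoint_iff_chart (mem_extChartAt_source (I := 𝓡∂ n) q)).1 hb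
  have h4 := h3.hasFDerivWithinAt_nonneg h2 (y := -v) (by
    refine mem_posTangentConeAt_of_segment_subset ?_
    rw [range_halfSpace]
    rintro z hz
    rw [segment_eq_image'] at hz
    obtain ⟨θ, hθ, rfl⟩ := hz
    have : 0 ≤ (extChartAt (𝓡∂ n) q q + θ • (extChartAt (𝓡∂ n) q q + -v
        - extChartAt (𝓡∂ n) q q)) 0 := by
      simp only [PiLp.add_apply, PiLp.smul_apply, PiLp.sub_apply, PiLp.neg_apply, hx0, smul_eq_mul]
      nlinarith [hθ.1]
    exact this)
  simp only [ContinuousLinearMap.comp_apply, map_neg, PiLp.proj_apply] at h4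
  linarith

end BoundaryChart

/-! ### The inner boundary -/

section Horizon

variable {n : ℕ} {E : Type*} [TopologicalSpace E] [ChartedSpace (Euc n) E]
  [NeZero n] {M : Type*} [TopologicalSpace M] [ChartedSpace (EuclideanHalfSpace n) M]
  {Γ : Type*} [TopologicalSpace Γ] [ChartedSpace (Euc (n - 1)) Γ]
  [IsManifold (𝓡 n) ∞ E] [IsManifold (𝓡∂ n) ∞ M] [IsManifold (𝓡 (n - 1)) ∞ Γ]
  {h : SmoothMetric (𝓡 n) E}
  {g : SmoothMetric (𝓡∂ n) M}
  {F : M → E × ℝ} {N : ∀ p : M, TangentSpace ((𝓡 n).prod 𝓘(ℝ, ℝ)) (F p)}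
  {j : Γ → M} {t₀ : ℝ} {Ω : Set E} {μ : ∀ q : Γ, TangentSpace (𝓡 n) (boundaryProj F j q)}
  {p : M} {q : Γ}

theorem toField_eq_bil_chart (e : E) (v w : Euc n) :
    toField h e v w = bil (metricCoeff (toField h) (chartAt (Euc n) e).symm.source
      (chartAt (Euc n) e).symm (chartAt (Euc n) e e)) v w := by
  have h1 := (smoothCoord_chart (n := n) e).bil_metricCoeff (fieldBilin_toField h)
    (e := e) (mem_chart_source _ e) v w
  rw [tD_chart_self] at h1
  exact h1.symm

theorem IsHypersurface.metric_eq (hF : IsHypersurface (toField h) (toField g) F N) (p : M)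
    (v w : Euc n) : toField g p v w =
      toField h (F p).1 (tD (𝓡∂ n) ((𝓡 n).prod 𝓘(ℝ, ℝ)) F univ p v).1
        (tD (𝓡∂ n) ((𝓡 n).prod 𝓘(ℝ, ℝ)) F univ p w).1
      + (tD (𝓡∂ n) ((𝓡 n).prod 𝓘(ℝ, ℝ)) F univ p v).2 *
        (tD (𝓡∂ n) ((𝓡 n).prod 𝓘(ℝ, ℝ)) F univ p w).2 := by
  rw [tD_univ]
  exact hF.isometric p v w

/-- The derivative of the inclusion of the boundary in the chart at `p`. -/
def bdryD (j : Γ → M) (p : M) (q : Γ) : Euc (n - 1) →L[ℝ] Euc n :=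
  tD (𝓡 (n - 1)) 𝓘(ℝ, Euc n) (extChartAt (𝓡∂ n) p ∘ j) univ q

namespace IsHorizon

variable (hΓ : IsHorizon (toField h) (toField g) F N j t₀ Ω μ)
include hΓ

theorem isBoundaryPoint (q : Γ) : (𝓡∂ n).IsBoundaryPoint (j q) := by
  have : j q ∈ (𝓡∂ n).boundary M := hΓ.range_eq ▸ mem_range_self q
  exact this

theorem mdiff (q : Γ) : MDifferentiableAt (𝓡 (n - 1)) (𝓡∂ n) j q :=
  hΓ.smooth.mdifferentiable (by simp) q

theorem mdiff_chart (hq : j q ∈ (extChartAt (𝓡∂ n) p).source) :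
    MDifferentiableAt (𝓡 (n - 1)) 𝓘(ℝ, Euc n) (extChartAt (𝓡∂ n) p ∘ j) q :=
  MDifferentiableAt.comp q
    ((contMDiffAt_extChartAt' (n := ∞) (by simpa using hq)).mdifferentiableAt (by simp)) (hΓ.mdiff q)

theorem bdryD_eq (hq : j q ∈ (extChartAt (𝓡∂ n) p).source) (a : Euc (n - 1)) :
    bdryD j p q a = tD (𝓡∂ n) 𝓘(ℝ, Euc n) (extChartAt (𝓡∂ n) p) univ (j q)
      (tD (𝓡 (n - 1)) (𝓡∂ n) j univ q a) := by
  have h1 : MDifferentiableAt (𝓡∂ n) 𝓘(ℝ, Euc n) (extChartAt (𝓡∂ n) p) (j q) :=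
    (contMDiffAt_extChartAt' (n := ∞) (by simpa using hq)).mdifferentiableAt (by simp)
  have h2 := tD_comp (s := univ) (t := univ) h1.mdifferentiableWithinAt
    (hΓ.mdiff q).mdifferentiableWithinAt (mapsTo_univ _ _) (uniqueMDiffWithinAt_univ _)
  rw [bdryD, h2]
  rfl

theorem eventually_source (hq : j q ∈ (extChartAt (𝓡∂ n) p).source) :
    ∀ᶠ q' in 𝓝 q, j q' ∈ (extChartAt (𝓡∂ n) p).source :=
  hΓ.smooth.continuous.continuousAt.eventually
    ((isOpen_extChartAt_source (I := 𝓡∂ n) p).mem_nhds hq)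

theorem bdryD_zero (hq : j q ∈ (extChartAt (𝓡∂ n) p).source) (a : Euc (n - 1)) :
    bdryD j p q a 0 = 0 := by
  refine tD_eval (hΓ.mdiff_chart hq) (c := 0) ?_ a
  filter_upwards [hΓ.eventually_source hq] with q' hq'
  exact (isBoundaryPoint_iff_chart hq').1 (hΓ.isBoundaryPoint q')

/-- The vertical component is zero because the height equals `t₀` on all of `Γ`. -/
theorem tD_boundary (hF : IsHypersurface (toField h) (toField g) F N) (q : Γ)
    (a : Euc (n - 1)) :
    tD (𝓡∂ n) ((𝓡 n).prod 𝓘(ℝ, ℝ)) F univ (j q) (tD (𝓡 (n - 1)) (𝓡∂ n) j univ q a) =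
      (tD (𝓡 (n - 1)) (𝓡 n) (boundaryProj F j) univ q a, 0) := by
  have hFd := hF.smooth.mdifferentiable (by simp) (j q)
  have h1 := tD_comp (s := univ) (t := univ) hFd.mdifferentiableWithinAt
    (hΓ.mdiff q).mdifferentiableWithinAt (mapsTo_univ _ _) (uniqueMDiffWithinAt_univ _)
  have hFj : MDifferentiableAt (𝓡 (n - 1)) ((𝓡 n).prod 𝓘(ℝ, ℝ)) (F ∘ j) q :=
    hFd.comp q (hΓ.mdiff q)
  have h2 := tD_comp (φ := F ∘ j) (s := univ) (t := univ) (I'' := 𝓡 n)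
    (mdifferentiableAt_fst (I := 𝓡 n) (I' := 𝓘(ℝ, ℝ))
      (x := (F (j q) : E × ℝ))).mdifferentiableWithinAt
    hFj.mdifferentiableWithinAt (mapsTo_univ _ _) (uniqueMDiffWithinAt_univ _)
  have h3 := tD_comp (φ := F ∘ j) (s := univ) (t := univ) (I'' := 𝓘(ℝ, ℝ))
    (mdifferentiableAt_snd (I := 𝓡 n) (I' := 𝓘(ℝ, ℝ))
      (x := (F (j q) : E × ℝ))).mdifferentiableWithinAt
    hFj.mdifferentiableWithinAt (mapsTo_univ _ _) (uniqueMDiffWithinAt_univ _)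
  have hfst : tD ((𝓡 n).prod 𝓘(ℝ, ℝ)) (𝓡 n) (Prod.fst : E × ℝ → E) univ (F (j q)) =
      ContinuousLinearMap.fst ℝ (Euc n) ℝ := by
    rw [tD_univ]; exact mfderiv_fst
  have hsnd := tD_snd (n := n) (F (j q))
  have h0 : tD (𝓡 (n - 1)) 𝓘(ℝ, ℝ) (Prod.snd ∘ (F ∘ j)) univ q = 0 := by
    refine (tD_congr (φ' := fun _ => t₀) (fun q' _ => hΓ.in_slice q') (hΓ.in_slice q)).trans ?_
    rw [tD_univ]
    exact mfderiv_const
  rw [← ContinuousLinearMap.comp_apply, ← h1]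
  refine Prod.ext ?_ ?_
  · have := congrArg (fun L => L a) h2
    exact (this.trans (congrArg (fun L : Euc n × ℝ →L[ℝ] Euc n =>
      L (tD (𝓡 (n - 1)) ((𝓡 n).prod 𝓘(ℝ, ℝ)) (F ∘ j) univ q a)) hfst)).symm
  · have := congrArg (fun L => L a) (h0.symm.trans h3)
    exact (this.trans (congrArg (fun L : Euc n × ℝ →L[ℝ] ℝ =>
      L (tD (𝓡 (n - 1)) ((𝓡 n).prod 𝓘(ℝ, ℝ)) (F ∘ j) univ q a)) hsnd)).symm

/-- As the derivatives along `Γ` are horizontal, the metric induced from the slice is the one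
induced from `M`. -/
theorem pullback_eq (hF : IsHypersurface (toField h) (toField g) F N) (q : Γ)
    (a b : Euc (n - 1)) :
    pullbackMetric (𝓡 (n - 1)) (toField h) (boundaryProj F j) q a b =
      toField g (j q) (tD (𝓡 (n - 1)) (𝓡∂ n) j univ q a)
        (tD (𝓡 (n - 1)) (𝓡∂ n) j univ q b) := by
  rw [hF.metric_eq, hΓ.tD_boundary hF, hΓ.tD_boundary hF, mul_zero, add_zero, tD_univ]
  rfl

theorem fieldBilin_pullback (hF : IsHypersurface (toField h) (toField g) F N) :
    FieldBilin (pullbackMetric (𝓡 (n - 1)) (toField h) (boundaryProj F j)) := by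
  intro q
  have := (fieldBilin_toField g (j q)).comp (tD (𝓡 (n - 1)) (𝓡∂ n) j univ q)
  have e : (fun a b : Euc (n - 1) =>
      toField g (j q) (tD (𝓡 (n - 1)) (𝓡∂ n) j univ q a) (tD (𝓡 (n - 1)) (𝓡∂ n) j univ q b)) =
      pullbackMetric (𝓡 (n - 1)) (toField h) (boundaryProj F j) q := by
    funext a b
    exact (hΓ.pullback_eq hF q a b).symm
  rw [e] at this
  exact this

/-- The conormal is `-∇x_0 / |∇x_0|` in the chart at `j q`; here `|∇x_0|² = v 0`. The orientation
condition is stated for every conormal, so one must be exhibited before it can be used. -/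
theorem exists_conormal (q : Γ) :
    ∃ η : Euc n, IsExteriorConormal (toField g) j q η := by
  set κ := extChartAt (𝓡∂ n) (j q) with hκ
  have hs : j q ∈ κ.source := mem_extChartAt_source _
  set G := chartCoeff (toField g) (j q) (κ (j q)) with hG
  have hGm : IsMetric G := by
    rw [hG, chartCoeff_eq _ _ (κ.map_source hs)]
    exact (isParam_chart (j q)).isMetric (κ.map_source hs) g
  have hg : ∀ v w : Euc n, toField g (j q) v w = bil G v w := by
    intro v w
    have := (fieldBilin_toField g).bil_chartCoeff (j q) hs v w
    rwa [tD_extChartAt_self] at this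
  set v := sharp G fun i => if i = 0 then 1 else 0 with hv
  have hvw : ∀ w, bil G v w = w 0 := fun w => by
    have := hGm.bil_sharp (EuclideanSpace.proj (0 : Fin n) : Euc n →L[ℝ] ℝ) w
    simp only [PiLp.proj_apply, stdVec_apply] at this
    rw [← this, hv]
    congr 3
    funext i
    simp [eq_comm]
  have hv0 : 0 < v 0 := by
    rw [← hvw v]
    refine hGm.pos v fun h0 => ?_
    have := hvw (stdVec 0)
    rw [h0] at this
    simp at this
  set r := Real.sqrt (v 0) with hr
  have hr0 : 0 < r := Real.sqrt_pos.2 hv0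
  have hr2 : r * r = v 0 := Real.mul_self_sqrt hv0.le
  refine ⟨-(r⁻¹ • v), ?_, fun w => ?_, ?_⟩
  · refine (hg _ _).trans ?_
    simp only [map_neg, neg_apply, map_smul, smul_apply, smul_eq_mul, hvw, ← hr2]
    field_simp
  · have h1 := hΓ.bdryD_zero hs w
    rw [hΓ.bdryD_eq hs w, tD_extChartAt_self] at h1
    have h2 : toField g (j q) (-(r⁻¹ • v)) (tD (𝓡 (n - 1)) (𝓡∂ n) j univ q w) = 0 := by
      refine (hg _ _).trans ?_
      simp only [map_neg, neg_apply, map_smul, smul_apply, smul_eq_mul, hvw]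
      rw [ContinuousLinearMap.id_apply] at h1
      rw [h1]
      simp
    rw [tD_univ] at h2
    exact h2
  · have : (-(r⁻¹ • v) : Euc n) 0 = -(r⁻¹ * v 0) := by simp
    have h1 : 0 < r⁻¹ * v 0 := mul_pos (inv_pos.2 hr0) hv0
    exact (this.trans_lt (neg_lt_zero.2 h1))

end IsHorizon
end Horizon

/-! ### The mean curvature of the inner boundary -/

section MeanCurvature

variable {n : ℕ} {E : Type*} [TopologicalSpace E] [ChartedSpace (Euc n) E]
  [NeZero n] {M : Type*} [TopologicalSpace M] [ChartedSpace (EuclideanHalfSpace n) M]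
  {Γ : Type*} [TopologicalSpace Γ] [ChartedSpace (Euc (n - 1)) Γ]
  [IsManifold (𝓡 n) ∞ E] [IsManifold (𝓡∂ n) ∞ M] [IsManifold (𝓡 (n - 1)) ∞ Γ]
  {h : SmoothMetric (𝓡 n) E}
  {g : SmoothMetric (𝓡∂ n) M}
  {F : M → E × ℝ} {N : ∀ p : M, TangentSpace ((𝓡 n).prod 𝓘(ℝ, ℝ)) (F p)}
  {j : Γ → M} {t₀ : ℝ} {Ω : Set E} {μ : ∀ q : Γ, TangentSpace (𝓡 n) (boundaryProj F j q)}
  {p : M} {q : Γ}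

/-- The covariant Hessian as a second fundamental form. -/
theorem toField_covariantHessian {γ : Γ → E} {q : Γ}
    (hγ : ContMDiff (𝓡 (n - 1)) (𝓡 n) ∞ γ) (ν : Euc n) (c θ : ℝ) (a b : Fin (n - 1)) :
    toField h (γ q) (covariantHessian (𝓡 (n - 1)) (toField h) γ q a b) ν =
      secondForm univ (metricCoeff (toField h) (chartAt (Euc n) (γ q)).symm.source
        (chartAt (Euc n) (γ q)).symm)
        (fun x => chartAt (Euc n) (γ q) (γ ((extChartAt (𝓡 (n - 1)) q).symm x))) (fun _ => c) ν θ
        (extChartAt (𝓡 (n - 1)) q q) (stdVec a) (stdVec b) := by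
  set κ := extChartAt (𝓡 (n - 1)) q with hκ
  set e := γ q with he
  set ψ := (chartAt (Euc n) e).symm with hψ
  set H := metricCoeff (toField h) ψ.source ψ with hH
  set f : Euc (n - 1) → Euc n := fun x => chartAt (Euc n) e (γ (κ.symm x)) with hf
  have hx0 : f (κ q) = chartAt (Euc n) e e := by simp [hf, hκ, he]
  have hr : range (𝓡 (n - 1)) = univ := by simp
  have hfs : ContDiffAt ℝ ∞ f (κ q) := by
    have h1 : ContMDiffAt 𝓘(ℝ, Euc (n - 1)) (𝓡 (n - 1)) ∞ κ.symm (κ q) :=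
      ((isParam_chart (I := 𝓡 (n - 1)) q).smooth _ (mem_extChartAt_target q)).contMDiffAt
        ((isOpen_extChartAt_target q).mem_nhds (mem_extChartAt_target q))
    have h2 : ContMDiffAt 𝓘(ℝ, Euc (n - 1)) (𝓡 n) ∞ (γ ∘ κ.symm) (κ q) :=
      hγ.contMDiffAt.comp _ h1
    have h3 : ContMDiffAt (𝓡 n) 𝓘(ℝ, Euc n) ∞ (chartAt (Euc n) e) ((γ ∘ κ.symm) (κ q)) := by
      refine ((smoothCoord_chart (n := n) e).smooth_symm _ ?_).contMDiffAt
        ((chartAt (Euc n) e).open_source.mem_nhds ?_)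
      all_goals
        simp only [Function.comp_apply, hκ, extChartAt_to_inv]
        exact mem_chart_source _ _
    exact contMDiffAt_iff_contDiffAt.1 (h3.comp _ h2)
  have hd1 : DifferentiableAt ℝ f (κ q) := hfs.differentiableAt (by simp)
  have hcomp : ∀ᶠ x in 𝓝 (κ q), ∀ (k : Fin n) (v : Euc (n - 1)),
      fderiv ℝ (fun y => f y k) x v = fderiv ℝ f x v k := by
    have h2 : ∀ᶠ x in 𝓝 (κ q), ContDiffAt ℝ 1 f x :=
      (hfs.of_le (m := 1) (by simp)).eventually (by simp)
    filter_upwards [h2] with x hx k v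
    have h5 := (EuclideanSpace.proj k : Euc n →L[ℝ] ℝ).hasFDerivAt.comp x
      (hx.differentiableAt (by simp)).hasFDerivAt
    exact congrArg (fun L => L v) h5.fderiv
  have hd2 : DifferentiableAt ℝ (fderiv ℝ f) (κ q) :=
    (hfs.fderiv_right (m := 1) one_add_one_le_smooth).differentiableAt (by simp)
  have hsnd : ∀ (k : Fin n), fderiv ℝ (fun x => fderiv ℝ (fun y => f y k) x (stdVec b)) (κ q)
      (stdVec a) = fderiv ℝ (fderiv ℝ f) (κ q) (stdVec a) (stdVec b) k := by
    intro k
    have h1 : (fun x => fderiv ℝ (fun y => f y k) x (stdVec b)) =ᶠ[𝓝 (κ q)]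
        fun x => fderiv ℝ f x (stdVec b) k := by
      filter_upwards [hcomp] with x hx
      exact hx k _
    rw [h1.fderiv_eq]
    have h2 := hd2.hasFDerivAt.clm_apply (hasFDerivAt_const (stdVec b : Euc (n - 1)) (κ q))
    have h5 := (EuclideanSpace.proj k : Euc n →L[ℝ] ℝ).hasFDerivAt.comp (κ q) h2
    refine (congrArg (fun L => L (stdVec a)) h5.fderiv).trans ?_
    simp
  have hchr : ∀ k i l, christoffel (range (𝓡 n)) (chartCoeff (toField h) e) k i l
      (extChartAt (𝓡 n) e e) = christoffel univ H k i l (f (κ q)) := by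
    intro k i l
    rw [hx0]
    refine christoffel_congr (by simp) ?_ k i l
    filter_upwards [(chartAt (Euc n) e).open_target.mem_nhds (mem_chart_target _ e)] with y hy
    refine (metricCoeff_congr_set (toField h) (φ := (chartAt (Euc n) e).symm) ?_)
    filter_upwards [(chartAt (Euc n) e).open_target.mem_nhds hy] with z hz
    exact propext ⟨fun _ => hz, fun _ => ⟨z, rfl⟩⟩
  refine (toField_eq_bil_chart e _ ν).trans ?_
  simp only [secondForm, fderivWithin_univ]
  have hc0 : fderiv ℝ (fderiv ℝ fun _ : Euc (n - 1) => c) (κ q) = 0 := by simp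
  rw [hc0, hx0]
  simp only [zero_apply, zero_mul, add_zero]
  have hvec : (show Euc n from covariantHessian (𝓡 (n - 1)) (toField h) γ q a b) =
      fderiv ℝ (fderiv ℝ f) (κ q) (stdVec a) (stdVec b) +
        chr H (f (κ q)) (fderiv ℝ f (κ q) (stdVec a)) (fderiv ℝ f (κ q) (stdVec b)) := by
    ext k
    have hl : ∀ k, localComp (𝓡 (n - 1)) (𝓡 n) γ q k = fun x => f x k := fun k => by
      funext x
      simp [localComp, hf, hκ, he]
    simp only [covariantHessian, hl, hr, partialD, fderivWithin_univ, PiLp.add_apply, chr_apply]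
    rw [hsnd k]
    congr 1
    refine Finset.sum_congr rfl fun i _ => Finset.sum_congr rfl fun l _ => ?_
    rw [hchr, hcomp.self_of_nhds, hcomp.self_of_nhds, mul_assoc]
  rw [hx0] at hvec
  exact congrArg (fun v => bil (H (chartAt (Euc n) e e)) v ν) hvec

namespace IsHorizon

variable (hΓ : IsHorizon (toField h) (toField g) F N j t₀ Ω μ)
  (hF : IsHypersurface (toField h) (toField g) F N)
include hΓ hF

theorem contMDiff_boundaryProj : ContMDiff (𝓡 (n - 1)) (𝓡 n) ∞ (boundaryProj F j) :=
  contMDiff_fst.comp (hF.smooth.comp hΓ.smooth)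

/-- Restriction to `Γ` is a composition of parameters, and `secondForm_comp` holds for maps between
different dimensions. Along `Γ` the height is constant, so only the second fundamental form inside
the slice survives. -/
theorem secondForm_boundary (hq : j q ∈ (extChartAt (𝓡∂ n) p).source) (a b : Fin (n - 1)) :
    secondForm (extChartAt (𝓡∂ n) p).target
      (metricCoeff (toField h) (chartAt (Euc n) (boundaryProj F j q)).symm.source
        (chartAt (Euc n) (boundaryProj F j q)).symm)
      (coordProj (chartAt (Euc n) (boundaryProj F j q)).symm F (extChartAt (𝓡∂ n) p).symm)
      (coordHeight F (extChartAt (𝓡∂ n) p).symm) (show Euc n × ℝ from N (j q)).1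
      (show Euc n × ℝ from N (j q)).2 (extChartAt (𝓡∂ n) p (j q))
      (bdryD j p q (stdVec a)) (bdryD j p q (stdVec b)) =
    toField h (boundaryProj F j q)
      (covariantHessian (𝓡 (n - 1)) (toField h) (boundaryProj F j) q a b)
      (show Euc n × ℝ from N (j q)).1 := by
  set κ := extChartAt (𝓡∂ n) p with hκ
  set ψ := (chartAt (Euc n) (boundaryProj F j q)).symm with hψdef
  set κ' := extChartAt (𝓡 (n - 1)) q with hκ'
  have hψ : SmoothCoord ψ := smoothCoord_chart _
  have hγ := hΓ.contMDiff_boundaryProj hF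
  have hφ := isParam_chart (I := 𝓡∂ n) p
  obtain ⟨u, hu, hus⟩ := hF.exists_open_maps hφ ψ.open_target
  have hm : ∀ z ∈ κ.target ∩ u, (F (κ.symm z)).1 ∈ ψ.target := fun z hz => (hus z hz.1).1 hz.2
  have A := hF.isHypWithin hψ (hφ.inter_open hu) hm
  have hxt : κ (j q) ∈ κ.target := κ.map_source hq
  have hqψ : (F (j q)).1 ∈ ψ.target := mem_chart_source (Euc n) (boundaryProj F j q)
  have hxu : κ (j q) ∈ u := (hus _ hxt).2 (by rw [κ.left_inv hq]; exact hqψ)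
  have hst : κ.target =ᶠ[𝓝 (κ (j q))] (κ.target ∩ u : Set (Euc n)) := by
    filter_upwards [hu.mem_nhds hxu] with z hz
    exact propext ⟨fun h => ⟨h, hz⟩, fun h => h.1⟩
  have hpar := isParam_chart (I := 𝓡 (n - 1)) q
  set O : Set Γ := j ⁻¹' κ.source ∩ boundaryProj F j ⁻¹' ψ.target with hO
  have hOo : IsOpen O := ((isOpen_extChartAt_source p).preimage hΓ.smooth.continuous).inter
    (ψ.open_target.preimage hγ.continuous)
  set s := κ'.target ∩ κ'.symm ⁻¹' O with hs
  have hso : IsOpen s := hpar.smooth.continuousOn.isOpen_inter_preimage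
    (isOpen_extChartAt_target q) hOo
  have hqs : q ∈ κ'.source := mem_extChartAt_source q
  have hxs : κ' q ∈ s := ⟨κ'.map_source hqs, by
    rw [mem_preimage, κ'.left_inv hqs]; exact ⟨hq, hqψ⟩⟩
  set T : Euc (n - 1) → Euc n := (κ ∘ j) ∘ κ'.symm with hT
  have hTx : T (κ' q) = κ (j q) := by simp [hT, hκ']
  have hTs : ContDiffOn ℝ ∞ T s := by
    refine contMDiffOn_iff_contDiffOn.1 ((contMDiffOn_extChartAt (n := ∞)).comp
      (hΓ.smooth.comp_contMDiffOn (hpar.smooth.mono inter_subset_left)) fun z hz => ?_)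
    have := hz.2.1
    simpa [hκ] using! this
  have hmap : MapsTo T s (κ.target ∩ u) := fun z hz => by
    have h1 : T z ∈ κ.target := κ.map_source hz.2.1
    refine ⟨h1, (hus _ h1).2 ?_⟩
    have : κ.symm (T z) = j (κ'.symm z) := κ.left_inv hz.2.1
    rw [this]
    exact hz.2.2
  have hTD : fderivWithin ℝ T s (κ' q) = bdryD j p q := by
    have h1 := tD_eq_fderivWithin_extChartAt (hΓ.mdiff_chart hq)
    have hr : range (𝓡 (n - 1)) = univ := by simp
    rw [hr] at h1
    exact (h1.mono (subset_univ _)).fderivWithin (hso.uniqueDiffWithinAt hxs)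
  have hν : coordNormal ψ F N κ.symm (κ (j q)) = (show Euc n × ℝ from N (j q)).1 := by
    rw [coordNormal, κ.left_inv hq]
    have := tD_chart_self (n := n) (boundaryProj F j q)
    exact congrArg (fun L => L (show Euc n × ℝ from N (j q)).1) this
  have hθ : coordAngle F N κ.symm (κ (j q)) = (show Euc n × ℝ from N (j q)).2 := by
    rw [coordAngle, κ.left_inv hq]
  have hpt := A.point _ ⟨hxt, hxu⟩
  rw [hν, hθ] at hpt
  rw [secondForm_congr_set hst, ← hTD, ← hTx, ← secondForm_comp
    (A.smooth_π.of_le two_le_smooth) (A.smooth_u.of_le two_le_smooth) (hTs.of_le two_le_smooth)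
    hso.uniqueDiffOn A.uniq hmap hxs (by rw [hTx]; exact hpt.orth) (by rw [hTx]; exact hpt.metricH),
    secondForm_congr_set (t := univ) (eventuallyEq_univ.2 (hso.mem_nhds hxs)),
    toField_covariantHessian hγ _ t₀ (show Euc n × ℝ from N (j q)).2 a b]
  have hkey : ∀ z ∈ s, κ.symm (T z) = j (κ'.symm z) := fun z hz => κ.left_inv hz.2.1
  refine secondForm_congr ?_ ?_ (mem_univ _) _ _
  · rw [nhdsWithin_univ]
    filter_upwards [hso.mem_nhds hxs] with z hz
    exact congrArg (fun w => ψ.symm (F w).1) (hkey z hz)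
  · rw [nhdsWithin_univ]
    filter_upwards [hso.mem_nhds hxs] with z hz
    exact (congrArg (fun w => (F w).2) (hkey z hz)).trans (hΓ.in_slice _)

end IsHorizon
end MeanCurvature

/-! ### The flux through the inner boundary -/

section BoundaryFlux

variable {n : ℕ} {E : Type*} [TopologicalSpace E] [ChartedSpace (Euc n) E]
  [NeZero n] {M : Type*} [TopologicalSpace M] [ChartedSpace (EuclideanHalfSpace n) M]
  {Γ : Type*} [TopologicalSpace Γ] [ChartedSpace (Euc (n - 1)) Γ]
  [IsManifold (𝓡 n) ∞ E] [IsManifold (𝓡∂ n) ∞ M] [IsManifold (𝓡 (n - 1)) ∞ Γ]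
  {h : SmoothMetric (𝓡 n) E}
  {g : SmoothMetric (𝓡∂ n) M}
  {F : M → E × ℝ} {N : ∀ p : M, TangentSpace ((𝓡 n).prod 𝓘(ℝ, ℝ)) (F p)}
  {j : Γ → M} {t₀ : ℝ} {Ω : Set E} {μ : ∀ q : Γ, TangentSpace (𝓡 n) (boundaryProj F j q)}
  {p : M} {q : Γ}

theorem IsHypersurface.height_chart (hF : IsHypersurface (toField h) (toField g) F N) {p p' : M}
    (hp : p' ∈ (extChartAt (𝓡∂ n) p).source) (v : Euc n) :
    fderivWithin ℝ (coordHeight F (extChartAt (𝓡∂ n) p).symm) (extChartAt (𝓡∂ n) p).target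
      (extChartAt (𝓡∂ n) p p') (tD (𝓡∂ n) 𝓘(ℝ, Euc n) (extChartAt (𝓡∂ n) p) univ p' v) =
    (tD (𝓡∂ n) ((𝓡 n).prod 𝓘(ℝ, ℝ)) F univ p' v).2 := by
  set κ := extChartAt (𝓡∂ n) p with hκ
  have hO := isOpen_extChartAt_source (I := 𝓡∂ n) p
  have hc := isParam_chart (I := 𝓡∂ n) p
  have hu : UniqueMDiffWithinAt (𝓡∂ n) κ.source p' := hO.uniqueMDiffWithinAt hp
  have h1 : MDifferentiableAt (𝓡∂ n) 𝓘(ℝ, Euc n) κ p' :=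
    (contMDiffAt_extChartAt' (n := ∞) (by simpa [hκ] using hp)).mdifferentiableAt (by simp)
  have h2 : MDifferentiableWithinAt 𝓘(ℝ, Euc n) 𝓘(ℝ, ℝ) (coordHeight F κ.symm) κ.target (κ p') :=
    mdifferentiableWithinAt_iff_differentiableWithinAt.2
      ((hF.contDiffOn_coordHeight hc).differentiableOn (by simp) _ (κ.map_source hp))
  have h3 := tD_comp h2 h1.mdifferentiableWithinAt (fun z hz => κ.map_source hz) hu
  have h4 := tD_comp (s := κ.source) (t := univ) (I'' := 𝓘(ℝ, ℝ))
    (mdifferentiableAt_snd (I := 𝓡 n) (I' := 𝓘(ℝ, ℝ))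
      (x := (F p' : E × ℝ))).mdifferentiableWithinAt
    (hF.smooth.mdifferentiable (by simp) p').mdifferentiableWithinAt (mapsTo_univ _ _) hu
  have h5 : tD (𝓡∂ n) 𝓘(ℝ, ℝ) (coordHeight F κ.symm ∘ κ) κ.source p' =
      tD (𝓡∂ n) 𝓘(ℝ, ℝ) (Prod.snd ∘ F) κ.source p' :=
    tD_congr (fun z hz => congrArg (fun w => (F w).2) (κ.left_inv hz))
      (congrArg (fun w => (F w).2) (κ.left_inv hp))
  rw [h3, h4, tD_vectorSpace, tD_of_mem_nhds (φ := κ) (hO.mem_nhds hp),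
    tD_of_mem_nhds (φ := F) (hO.mem_nhds hp), tD_snd] at h5
  exact congrArg (fun L => L v) h5

namespace IsHorizon

variable (hΓ : IsHorizon (toField h) (toField g) F N j t₀ Ω μ)
  (hF : IsHypersurface (toField h) (toField g) F N)
include hΓ hF

theorem pullback_chart (q : Γ) (a b : Euc (n - 1)) :
    bil (chartCoeff (pullbackMetric (𝓡 (n - 1)) (toField h) (boundaryProj F j)) q
      (extChartAt (𝓡 (n - 1)) q q)) a b =
    pullbackMetric (𝓡 (n - 1)) (toField h) (boundaryProj F j) q a b := by
  have := (hΓ.fieldBilin_pullback hF).bil_chartCoeff q (mem_extChartAt_source q) a b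
  rw [tD_extChartAt_self] at this
  exact this.symm

theorem isMetric_pullback (q : Γ) :
    IsMetric (chartCoeff (pullbackMetric (𝓡 (n - 1)) (toField h) (boundaryProj F j)) q
      (extChartAt (𝓡 (n - 1)) q q)) := by
  constructor
  · refine Matrix.IsSymm.ext fun i k => ?_
    refine (bil_stdVec _ k i).symm.trans (Eq.trans ?_ (bil_stdVec _ i k))
    rw [hΓ.pullback_chart hF, hΓ.pullback_chart hF, hΓ.pullback_eq hF, hΓ.pullback_eq hF]
    exact g.symm _ _ _
  · intro v hv
    rw [hΓ.pullback_chart hF, hΓ.pullback_eq hF]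
    refine g.pos _ _ fun h0 => hv (hΓ.injective_mfderiv q ?_)
    rw [tD_univ] at h0
    exact h0.trans (map_zero (mfderiv (𝓡 (n - 1)) (𝓡∂ n) j q)).symm

theorem isHyperplane_boundary (hq : j q ∈ (extChartAt (𝓡∂ n) p).source) {η : Euc n}
    (hη : IsExteriorConormal (toField g) j q η) :
    IsHyperplane (chartCoeff (toField g) p (extChartAt (𝓡∂ n) p (j q)))
      (chartCoeff (pullbackMetric (𝓡 (n - 1)) (toField h) (boundaryProj F j)) q
        (extChartAt (𝓡 (n - 1)) q q)) (bdryD j p q)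
      (tD (𝓡∂ n) 𝓘(ℝ, Euc n) (extChartAt (𝓡∂ n) p) univ (j q) η) where
  metric := by
    rw [chartCoeff_eq _ _ ((extChartAt (𝓡∂ n) p).map_source hq)]
    exact (isParam_chart p).isMetric ((extChartAt (𝓡∂ n) p).map_source hq) g
  metric_sub := hΓ.isMetric_pullback hF q
  isometric := fun a b => by
    rw [hΓ.pullback_chart hF, hΓ.pullback_eq hF, hΓ.bdryD_eq hq, hΓ.bdryD_eq hq,
      (fieldBilin_toField g).bil_chartCoeff p hq]
  unit := ((fieldBilin_toField g).bil_chartCoeff p hq η η).symm.trans hη.unit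
  orth := fun a => by
    rw [hΓ.bdryD_eq hq]
    refine ((fieldBilin_toField g).bil_chartCoeff p hq η _).symm.trans ?_
    rw [tD_univ]
    exact hη.orthogonal a

/-- The relation between the conormal, the normal and `μ`. -/
theorem normal_relations {η : Euc n} (hη : IsExteriorConormal (toField g) j q η) :
    ∃ c ε : ℝ, (tD (𝓡∂ n) ((𝓡 n).prod 𝓘(ℝ, ℝ)) F univ (j q) η).2 = ε ∧
      (show Euc n from μ q) = c • (show Euc n × ℝ from N (j q)).1 ∧ c = -ε := by
  set e := boundaryProj F j q with he
  set H := metricCoeff (toField h) (chartAt (Euc n) e).symm.source (chartAt (Euc n) e).symm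
    (chartAt (Euc n) e e) with hHdef
  have hH : ∀ v w : Euc n, toField h e v w = bil H v w := toField_eq_bil_chart e
  set ν : Euc n := (show Euc n × ℝ from N (j q)).1 with hν
  set θ : ℝ := (show Euc n × ℝ from N (j q)).2 with hθ
  set dF := tD (𝓡∂ n) ((𝓡 n).prod 𝓘(ℝ, ℝ)) F univ (j q) with hdF
  set dγ := tD (𝓡 (n - 1)) (𝓡 n) (boundaryProj F j) univ q with hdγ
  have hHm : IsMetric H := (smoothCoord_chart (n := n) e).isParam.isMetric
    (mem_chart_target (Euc n) e) h
  have hθ0 : θ = 0 := by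
    have h1 : toField h e ν (0 : Euc n) + θ * 1 = 0 := hΓ.orthogonal q
    rw [hH, map_zero, zero_add, mul_one] at h1
    exact h1
  have horth : ∀ v, bil H ν (dF v).1 = 0 := fun v => by
    have h1 : toField h e ν (dF v).1 + θ * (dF v).2 = 0 := by
      rw [hdF, tD_univ]
      exact hF.normal_orthogonal (j q) v
    rw [hH, hθ0, zero_mul, add_zero] at h1
    exact h1
  have hunit : bil H ν ν = 1 := by
    have h1 : toField h e ν ν + θ * θ = 1 := hF.normal_unit (j q)
    rw [hH, hθ0, zero_mul, add_zero] at h1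
    exact h1
  have hdj : ∀ a, dF (tD (𝓡 (n - 1)) (𝓡∂ n) j univ q a) = (dγ a, 0) := hΓ.tD_boundary hF q
  have hpl : IsHyperplane H (chartCoeff (pullbackMetric (𝓡 (n - 1)) (toField h)
      (boundaryProj F j)) q (extChartAt (𝓡 (n - 1)) q q)) dγ ν :=
    ⟨hHm, hΓ.isMetric_pullback hF q, fun a b => by
      rw [hΓ.pullback_chart hF, ← hH, hdγ, tD_univ]; rfl, hunit, fun a => by
      have := horth (tD (𝓡 (n - 1)) (𝓡∂ n) j univ q a)
      rwa [hdj] at this⟩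
  set ε := (dF η).2 with hε
  -- The horizontal part of the conormal is orthogonal to `Γ`, hence a multiple of `ν`; it is also
  -- orthogonal to `ν`, so the conormal is vertical and `ε = ±1`.
  have hη1 : (dF η).1 = 0 := by
    have h1 := hpl.eq_normal (v := (dF η).1) fun a => by
      have h2 : toField g (j q) η (tD (𝓡 (n - 1)) (𝓡∂ n) j univ q a) = 0 := by
        rw [tD_univ]; exact hη.orthogonal a
      have h3 := (hF.metric_eq (j q) η (tD (𝓡 (n - 1)) (𝓡∂ n) j univ q a)).symm.trans h2
      rw [← hdF, hdj, mul_zero, add_zero] at h3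
      exact (hH _ _).symm.trans h3
    rw [hHm.bil_comm, horth η, zero_smul] at h1
    exact h1
  have hε2 : ε * ε = 1 := by
    have h1 := (hF.metric_eq (j q) η η).symm.trans hη.unit
    rw [← hdF, hη1] at h1
    have h2 : toField h (F (j q)).1 (0 : Euc n) (0 : Euc n) = 0 :=
      (hH 0 0).trans (by simp)
    rw [h2, zero_add] at h1
    exact h1
  set m : Euc n := μ q with hm
  set c := bil H m ν with hc
  have hmc : m = c • ν := hpl.eq_normal fun a => by
    have h1 := (hΓ.inward_normal q).orthogonal a
    rw [← tD_univ] at h1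
    exact (hH _ _).symm.trans h1
  have hc2 : c * c = 1 := by
    have h1 : bil H m m = 1 := (hH _ _).symm.trans (hΓ.inward_normal q).unit
    rw [hmc] at h1
    simp only [map_smul, smul_apply, smul_eq_mul, hunit, mul_one] at h1
    exact h1
  -- `N` has no vertical part and the conormal no horizontal part, so the orientation determinant
  -- reduces to `-c ε`. As `c` and `ε` are signs, they are opposite.
  have hor : 0 < -(c * ε) := by
    have h1 := hΓ.orientation q η hη
    have e1 : prodMetric (toField h) (F (j q)) (N (j q)) (vertical (F (j q))) = 0 :=
      hΓ.orthogonal q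
    have e2 : prodMetric (toField h) (F (j q)) (N (j q)) (horizontal (F (j q)) (μ q)) = c := by
      have h2 : toField h e ν m + θ * 0 = c := by
        rw [mul_zero, add_zero, hH, hHm.bil_comm]
      exact h2
    have e3 : prodMetric (toField h) (F (j q)) (dImm F (j q) η) (vertical (F (j q))) = ε := by
      have h2 : toField h e (dF η).1 (0 : Euc n) + (dF η).2 * 1 = ε := by
        rw [mul_one, hH, map_zero, zero_add]
      rw [hdF, tD_univ] at h2
      exact h2
    rw [e1, e2, e3, zero_mul, zero_sub] at h1
    exact h1
  refine ⟨c, ε, rfl, hmc, ?_⟩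
  have h1 : (c * ε) * (c * ε) = 1 := by linear_combination ε * ε * hc2 + hε2
  have h2 : c * ε = -1 := by
    rcases mul_self_eq_one_iff.1 h1 with h | h
    · rw [h] at hor; linarith
    · exact h
  linear_combination ε * h2 - c * hε2

/-- This converts the coordinate flux of `W` through `{x_0 = 0}` into mean curvature times the area
density of `Γ`. Both sides equal `-ε` times the trace of `A` over `Γ`, times `√det G · (-m 0)`,
where `m` is the conormal in the chart. -/
theorem meanCurvature_mul_sqrt_det (hq : j q ∈ (extChartAt (𝓡∂ n) p).source) :
    meanCurvature (𝓡 (n - 1)) (toField h) (boundaryProj F j) q (μ q) *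
      Real.sqrt (bdryBlock (chartCoeff (toField g) p (extChartAt (𝓡∂ n) p (j q)))).det =
    fluxDensity (toField h) (toField g) F N (extChartAt (𝓡∂ n) p).symm
      (extChartAt (𝓡∂ n) p).target (extChartAt (𝓡∂ n) p (j q)) 0 := by
  obtain ⟨η, hη⟩ := hΓ.exists_conormal q
  obtain ⟨c, ε, hε, hc, hcε⟩ := hΓ.normal_relations hF hη
  have hpl := hΓ.isHyperplane_boundary hF hq hη
  set κ := extChartAt (𝓡∂ n) p with hκ
  set x := κ (j q) with hx
  have hxt : x ∈ κ.target := κ.map_source hq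
  set G := chartCoeff (toField g) p x with hG
  set B := chartCoeff (pullbackMetric (𝓡 (n - 1)) (toField h) (boundaryProj F j)) q
        (extChartAt (𝓡 (n - 1)) q q) with hB
  set S : Euc (n - 1) →L[ℝ] Euc n := bdryD j p q with hS
  set m := tD (𝓡∂ n) 𝓘(ℝ, Euc n) κ univ (j q) η with hm
  have hm0 : m 0 ≤ 0 := tD_chart_outward hq (hΓ.isBoundaryPoint q)
    (le_of_lt (show (show Euc n from η) 0 < 0 from hη.outward))
  have hS0 : ∀ a, S a 0 = 0 := hΓ.bdryD_zero hq
  -- Vectors tangent to `Γ` have no `0`-th component, so only the conormal contributes. With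
  -- `det_bdryBlock` this relates the densities of `Γ` and `M`; the sign of `m 0` is negative
  -- because `m` points outwards.
  have hinv : G⁻¹ 0 0 = m 0 * m 0 := by
    rw [hpl.inv_split 0 0]
    simp [hS0]
  have hdet : Real.sqrt (bdryBlock G).det = Real.sqrt G.det * (-(m 0)) := by
    rw [det_bdryBlock hpl.metric, hinv, Real.sqrt_mul hpl.metric.det_pos.le,
      Real.sqrt_mul_self_eq_abs, abs_of_nonpos hm0]
  set ψ := (chartAt (Euc n) (boundaryProj F j q)).symm with hψdef
  have hφ := isParam_chart (I := 𝓡∂ n) p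
  have hqψ : (F (κ.symm x)).1 ∈ ψ.target := by
    rw [hx, κ.left_inv hq]
    exact mem_chart_source (Euc n) (boundaryProj F j q)
  have hGe : metricCoeff (toField g) κ.target κ.symm x = G := (chartCoeff_eq _ _ hxt).symm
  have hν : coordNormal ψ F N κ.symm x = (show Euc n × ℝ from N (j q)).1 := by
    rw [coordNormal, hx, κ.left_inv hq]
    have := tD_chart_self (n := n) (boundaryProj F j q)
    exact congrArg (fun L => L (show Euc n × ℝ from N (j q)).1) this
  have hθ : coordAngle F N κ.symm x = (show Euc n × ℝ from N (j q)).2 := by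
    rw [coordAngle, hx, κ.left_inv hq]
  set du := fderivWithin ℝ (coordHeight F κ.symm) κ.target x with hdu
  set A := sffMatrix κ.target (metricCoeff (toField h) ψ.source ψ) (coordProj ψ F κ.symm)
    (coordHeight F κ.symm) (show Euc n × ℝ from N (j q)).1 (show Euc n × ℝ from N (j q)).2 x with hA
  have hW : paramFlux (toField h) (toField g) F N κ.symm κ.target x =
      newtonField G A fun i => du (stdVec i) := by
    rw [hF.paramFlux_eq (smoothCoord_chart _) hφ hxt hqψ, coordFlux, fluxField, hν, hθ, hGe]
  set W := newtonField G A fun i => du (stdVec i) with hWdef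
  have hdum : du m = ε := (hF.height_chart hq η).trans hε
  have hduS : ∀ a, du (S a) = 0 := fun a => by
    rw [hS, hΓ.bdryD_eq hq]
    refine (hF.height_chart hq _).trans ?_
    rw [hΓ.tD_boundary hF]
  -- The height is constant along `Γ`, so its gradient is normal to `Γ` in `M`.
  have hgrad : (sharp G fun i => du (stdVec i)) = ε • m := by
    have h1 := hpl.eq_normal (v := sharp G fun i => du (stdVec i)) fun a => by
      rw [hpl.metric.bil_sharp, hduS]
    rw [hpl.metric.bil_sharp, hdum] at h1
    exact h1
  set K := trB B⁻¹ fun a b => bil A (S a) (S b) with hK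
  have htr : trB G⁻¹ (fun a b => bil A a b) = K + bil A m m :=
    trB_split S m hpl.inv_split (IsBilin.clm (bil A))
  -- The normal-normal component of `A` cancels between `(tr A) ∇u` and `A ∇u`; only the trace over
  -- `Γ` remains.
  have hWm : bil G W m = ε * K := by
    rw [hWdef, hpl.metric.bil_newtonField, htr, hdum, hgrad]
    simp only [map_smul, smul_eq_mul]
    ring
  have hW0 : W 0 = ε * K * m 0 := by
    obtain ⟨a, ha⟩ := hpl.exists_decomp W
    have := congrArg (fun w : Euc n => w 0) ha
    simpa [hS0, hWm] using this
  have hmc : meanCurvature (𝓡 (n - 1)) (toField h) (boundaryProj F j) q (μ q) = c * K := by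
    simp only [meanCurvature, hK, trB, Finset.mul_sum]
    refine Finset.sum_congr rfl fun a _ => Finset.sum_congr rfl fun b _ => ?_
    rw [hA, bil_sffMatrix, hΓ.secondForm_boundary hF hq]
    have h1 : toField h (boundaryProj F j q)
        (covariantHessian (𝓡 (n - 1)) (toField h) (boundaryProj F j) q a b) (μ q) =
        c * toField h (boundaryProj F j q)
        (covariantHessian (𝓡 (n - 1)) (toField h) (boundaryProj F j) q a b)
        (show Euc n × ℝ from N (j q)).1 := by
      exact (congrArg (toField h (boundaryProj F j q)
        (covariantHessian (𝓡 (n - 1)) (toField h) (boundaryProj F j) q a b)) hc).trans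
        ((fieldBilin_toField h _).smul_right _ _ _)
    rw [h1]
    ring
  have hfd : fluxDensity (toField h) (toField g) F N κ.symm κ.target x 0 =
      Real.sqrt G.det * W 0 := by
    rw [fluxDensity, hW, hGe]
    rfl
  rw [hfd, hmc, hdet, hW0, hcε]
  ring

end IsHorizon
end BoundaryFlux

/-! ### The divergence theorem on the hypersurface -/

theorem isMetric_bdryBlock {n : ℕ} [NeZero n] {A : Matrix (Fin n) (Fin n) ℝ} (hA : IsMetric A) :
    IsMetric (bdryBlock A) := by
  constructor
  · refine Matrix.IsSymm.ext fun i k => ?_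
    exact hA.bil_comm _ _
  · intro v hv
    rw [bil_bdryBlock]
    refine hA.pos _ fun h0 => hv ?_
    rw [← bdryProj_incl (n := n) v, h0, map_zero]

section GlobalDivergence

variable {n : ℕ} {E : Type*} [TopologicalSpace E] [ChartedSpace (Euc n) E]
  [NeZero n] {M : Type*} [TopologicalSpace M] [ChartedSpace (EuclideanHalfSpace n) M]
  {Γ : Type*} [TopologicalSpace Γ] [ChartedSpace (Euc (n - 1)) Γ]
  [IsManifold (𝓡 n) ∞ E] [IsManifold (𝓡∂ n) ∞ M] [IsManifold (𝓡 (n - 1)) ∞ Γ]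
  {h : SmoothMetric (𝓡 n) E}
  {g : SmoothMetric (𝓡∂ n) M}
  {F : M → E × ℝ} {N : ∀ p : M, TangentSpace ((𝓡 n).prod 𝓘(ℝ, ℝ)) (F p)}
  {j : Γ → M} {t₀ : ℝ} {Ω : Set E} {μ : ∀ q : Γ, TangentSpace (𝓡 n) (boundaryProj F j q)}
  {p : M} {χ : M → ℝ}

theorem cutDensity_sum {ι : Type*} (s : Finset ι) {χ : ι → M → ℝ}
    (hχ : ∀ i ∈ s, MDifferentiable (𝓡∂ n) 𝓘(ℝ, ℝ) (χ i)) (p : M) :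
    cutDensity (toField h) (toField g) F N (fun q => ∑ i ∈ s, χ i q) p =
      ∑ i ∈ s, cutDensity (toField h) (toField g) F N (χ i) p := by
  have key : MDifferentiable (𝓡∂ n) 𝓘(ℝ, ℝ) (fun q => ∑ i ∈ s, χ i q) ∧
      tD (𝓡∂ n) 𝓘(ℝ, ℝ) (fun q => ∑ i ∈ s, χ i q) univ p =
        ∑ i ∈ s, tD (𝓡∂ n) 𝓘(ℝ, ℝ) (χ i) univ p := by
    classical
    induction s using Finset.induction_on with
    | empty =>
      simp only [Finset.sum_empty, tD_univ]
      exact ⟨mdifferentiable_const, mfderiv_const⟩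
    | insert a s ha ih =>
      obtain ⟨i1, i2⟩ := ih fun i hi => hχ i (Finset.mem_insert_of_mem hi)
      have h0 := hχ a (Finset.mem_insert_self _ _)
      simp only [Finset.sum_insert ha]
      refine ⟨h0.add i1, ?_⟩
      rw [← i2, tD_univ, tD_univ, tD_univ]
      exact mfderiv_add (h0 p) (i1 p)
  simp only [cutDensity, key.2, Finset.sum_mul, Finset.sum_add_distrib]
  simp

namespace IsHorizon

variable (hΓ : IsHorizon (toField h) (toField g) F N j t₀ Ω μ)
  (hF : IsHypersurface (toField h) (toField g) F N)
include hΓ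

theorem bdryIncl_chart {q : Γ} (hq : j q ∈ (extChartAt (𝓡∂ n) p).source) :
    bdryIncl n (bdryProj n (extChartAt (𝓡∂ n) p (j q))) = extChartAt (𝓡∂ n) p (j q) :=
  bdryIncl_proj ((isBoundaryPoint_iff_chart hq).1 (hΓ.isBoundaryPoint q))

/-- Every point of the target on `{x_0 = 0}` is a boundary point of `M`, hence lies in the range of
`j`. So a boundary chart of `M` gives full coordinates on the part of `Γ` in its domain. -/
theorem image_boundary_chart (p : M) :
    (fun q => bdryProj n (extChartAt (𝓡∂ n) p (j q))) '' (j ⁻¹' (extChartAt (𝓡∂ n) p).source) =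
      bdryIncl n ⁻¹' (extChartAt (𝓡∂ n) p).target := by
  set κ := extChartAt (𝓡∂ n) p with hκ
  ext y
  constructor
  · rintro ⟨q, hq, rfl⟩
    rw [mem_preimage, hΓ.bdryIncl_chart hq]
    exact κ.map_source hq
  · intro hy
    have hs : κ.symm (bdryIncl n y) ∈ κ.source := κ.map_target hy
    have hb : (𝓡∂ n).IsBoundaryPoint (κ.symm (bdryIncl n y)) :=
      (isBoundaryPoint_iff_chart hs).2 (by rw [κ.right_inv hy, bdryIncl_zero])
    have hr : κ.symm (bdryIncl n y) ∈ range j := by rw [hΓ.range_eq]; exact hb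
    obtain ⟨q, hq⟩ := hr
    refine ⟨q, by rw [mem_preimage, hq]; exact hs, ?_⟩
    simp only [hq]
    rw [κ.right_inv hy, bdryProj_incl]

include hF

variable [SecondCountableTopology Γ] [MeasurableSpace Γ] [BorelSpace Γ]

theorem isMetricCoord_boundary (p : M) :
    IsMetricCoord (𝓡 (n - 1)) (pullbackMetric (𝓡 (n - 1)) (toField h) (boundaryProj F j))
      (j ⁻¹' (extChartAt (𝓡∂ n) p).source)
      (fun q => bdryProj n (extChartAt (𝓡∂ n) p (j q)))
      (fun y => bdryBlock (chartCoeff (toField g) p (bdryIncl n y))) := by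
  have hdiff : ∀ q ∈ j ⁻¹' (extChartAt (𝓡∂ n) p).source,
      MDifferentiableAt 𝓘(ℝ, Euc n) 𝓘(ℝ, Euc (n - 1)) (bdryProj n) ((extChartAt (𝓡∂ n) p ∘ j) q) :=
    fun q _ => mdifferentiableAt_iff_differentiableAt.2 (bdryProj n).differentiableAt
  refine ⟨((isOpen_extChartAt_source p).preimage hΓ.smooth.continuous).measurableSet, ?_, ?_, ?_⟩
  · intro q hq q' hq' he
    have h1 := congrArg (bdryIncl n) he
    simp only [hΓ.bdryIncl_chart hq, hΓ.bdryIncl_chart hq'] at h1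
    exact hΓ.injective ((extChartAt (𝓡∂ n) p).injOn hq hq' h1)
  · intro q hq
    exact (hdiff q hq).comp q (hΓ.mdiff_chart hq)
  · intro q hq a b
    have h1 := tD_comp (s := univ) (t := univ) (hdiff q hq).mdifferentiableWithinAt
      (hΓ.mdiff_chart hq).mdifferentiableWithinAt (mapsTo_univ _ _) (uniqueMDiffWithinAt_univ _)
    rw [tD_vectorSpace, fderivWithin_univ, ContinuousLinearMap.fderiv] at h1
    have h2 : ∀ a, bdryIncl n (tD (𝓡 (n - 1)) 𝓘(ℝ, Euc (n - 1))
        (fun q => bdryProj n (extChartAt (𝓡∂ n) p (j q))) univ q a) = bdryD j p q a := by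
      intro a
      have h3 := congrArg (fun L => bdryIncl n (L a)) h1
      refine h3.trans ?_
      exact bdryIncl_proj (hΓ.bdryD_zero hq a)
    rw [bil_bdryBlock, h2, h2, hΓ.bdryIncl_chart hq, hΓ.pullback_eq hF,
      (fieldBilin_toField g).bil_chartCoeff p hq, hΓ.bdryD_eq hq, hΓ.bdryD_eq hq]

variable [T2Space M] [SecondCountableTopology M] [MeasurableSpace M] [BorelSpace M]

/-- The boundary term of the half-space theorem is rewritten as an integral over `Γ` by means of
`meanCurvature_mul_sqrt_det`; the area density cancels against its inverse in `b`. -/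
theorem integral_meanCurvature_chart (hχ : ContMDiff (𝓡∂ n) 𝓘(ℝ, ℝ) ∞ χ)
    (hK : HasCompactSupport χ) (p : M) (hp : tsupport χ ⊆ (extChartAt (𝓡∂ n) p).source) :
    Integrable (fun q => χ (j q) *
        meanCurvature (𝓡 (n - 1)) (toField h) (boundaryProj F j) q (μ q))
      (riemannianVolume (pullbackMetric (𝓡 (n - 1)) (toField h) (boundaryProj F j))) ∧
    ∫ q, χ (j q) * meanCurvature (𝓡 (n - 1)) (toField h) (boundaryProj F j) q (μ q)
      ∂(riemannianVolume (pullbackMetric (𝓡 (n - 1)) (toField h) (boundaryProj F j))) =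
      ∫ y : Euc (n - 1), cutFlux (toField h) (toField g) F N χ p (bdryIncl n y) 0 := by
  have hc := hΓ.isMetricCoord_boundary hF p
  have himg := hΓ.image_boundary_chart p
  set κ := extChartAt (𝓡∂ n) p with hκ
  have hφ := isParam_chart (I := 𝓡∂ n) p
  have hmeas : MeasurableSet (bdryIncl n ⁻¹' κ.target) :=
    (bdryIncl n).continuous.measurable (measurableSet_extChartAt_target p)
  set R : Euc (n - 1) → ℝ := fun y =>
    Real.sqrt (bdryBlock (chartCoeff (toField g) p (bdryIncl n y))).det with hR
  have hmaps : MapsTo (bdryIncl n) (bdryIncl n ⁻¹' κ.target) κ.target := fun _ h => h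
  have hRc : ContinuousOn R (bdryIncl n ⁻¹' κ.target) := by
    refine Real.continuous_sqrt.comp_continuousOn ?_
    refine (continuous_id.matrix_det).comp_continuousOn ?_
    refine continuousOn_pi.2 fun i => continuousOn_pi.2 fun k => ?_
    simp only [Matrix.of_apply, bil_apply]
    refine continuousOn_finsetSum _ fun a _ => continuousOn_finsetSum _ fun b _ => ?_
    have h1 : ContinuousOn (fun x => chartCoeff (toField g) p x a b) κ.target :=
      (hφ.contDiffOn_metricCoeff g a b).continuousOn.congr fun x hx => by
        rw [chartCoeff_eq _ _ hx]
    have h2 := h1.comp (bdryIncl n).continuous.continuousOn hmaps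
    have h3 := (h2.mul (continuousOn_const (c := bdryIncl n (stdVec i) a))).mul
      (continuousOn_const (c := bdryIncl n (stdVec k) b))
    refine h3.congr fun y _ => ?_
    simp only [Function.comp_apply, Pi.mul_apply]
    ring
  have hRpos : ∀ y ∈ bdryIncl n ⁻¹' κ.target, 0 < R y := fun y hy => by
    refine Real.sqrt_pos.2 (isMetric_bdryBlock ?_).det_pos
    rw [chartCoeff_eq _ _ hy]
    exact hφ.isMetric hy g
  set fd : Euc n → ℝ := fun x =>
    fluxDensity (toField h) (toField g) F N κ.symm κ.target x 0 with hfd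
  have hfc : ContinuousOn fd κ.target :=
    (contDiffOn_euclidean.1 (hF.contDiffOn_fluxDensity hφ) 0).continuousOn
  -- The mean curvature expressed by the flux density. No regularity in `q` is assumed of `μ`, so
  -- continuity and measurability have to come from this side.
  set b : Euc (n - 1) → ℝ := fun y =>
    χ (κ.symm (bdryIncl n y)) * (fd (bdryIncl n y) * (R y)⁻¹) with hb
  have hbc : ContinuousOn b (bdryIncl n ⁻¹' κ.target) :=
    ((hχ.continuous.comp_continuousOn hφ.smooth.continuousOn).comp
      (bdryIncl n).continuous.continuousOn hmaps).mul
      ((hfc.comp (bdryIncl n).continuous.continuousOn hmaps).mul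
        (hRc.inv₀ fun y hy => (hRpos y hy).ne'))
  have hI := hc.integral_eq (hΓ.fieldBilin_pullback hF) (f := fun q => χ (j q) *
      meanCurvature (𝓡 (n - 1)) (toField h) (boundaryProj F j) q (μ q)) (b := b)
    (by rw [himg]; exact hRc) (by rw [himg]; exact hbc.aestronglyMeasurable hmeas) fun q hq => by
      have h1 := hΓ.meanCurvature_mul_sqrt_det hF hq
      have h2 : bdryProj n (κ (j q)) ∈ bdryIncl n ⁻¹' κ.target := by
        rw [mem_preimage, hΓ.bdryIncl_chart hq]; exact κ.map_source hq
      have h3 := (hRpos _ h2).ne'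
      simp only [hb, hR] at h3 ⊢
      rw [hΓ.bdryIncl_chart hq] at h3 ⊢
      rw [κ.left_inv hq]
      simp only [hfd]
      rw [← h1, mul_inv_cancel_right₀ h3]
  rw [himg] at hI
  have heq : ∀ y ∈ bdryIncl n ⁻¹' κ.target, R y * b y =
      cutFlux (toField h) (toField g) F N χ p (bdryIncl n y) 0 := by
    intro y hy
    have h1 : cutFlux (toField h) (toField g) F N χ p (bdryIncl n y) =
        χ (κ.symm (bdryIncl n y)) • fluxDensity (toField h) (toField g) F N κ.symm κ.target
          (bdryIncl n y) := indicator_of_mem (mem_preimage.1 hy) _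
    rw [h1]
    simp only [hb, PiLp.smul_apply, smul_eq_mul]
    have := (hRpos y hy).ne'
    field_simp
    rfl
  have hzero : ∀ y ∉ bdryIncl n ⁻¹' κ.target,
      cutFlux (toField h) (toField g) F N χ p (bdryIncl n y) 0 = 0 := fun y hy => by
    have h1 : cutFlux (toField h) (toField g) F N χ p (bdryIncl n y) = 0 :=
      indicator_of_notMem (s := κ.target) hy _
    rw [h1]
    rfl
  have hfi : Integrable fun y : Euc (n - 1) =>
      cutFlux (toField h) (toField g) F N χ p (bdryIncl n y) 0 := by
    refine Continuous.integrable_of_hasCompactSupport ?_ ?_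
    · have h1 := (contDiffOn_euclidean.1 (hF.contDiffOn_cutFlux hχ hK hp) 0).continuousOn
      exact h1.comp_continuous (bdryIncl n).continuous fun y =>
        (show (0 : ℝ) ≤ bdryIncl n y 0 from (bdryIncl_zero y).ge)
    · refine HasCompactSupport.intro
        ((isCompact_image_chart hK hp).image (bdryProj n).continuous) fun y hy => ?_
      have h1 : cutFlux (toField h) (toField g) F N χ p (bdryIncl n y) = 0 :=
        cutFlux_eq_zero fun hm => hy ⟨_, hm, bdryProj_incl y⟩
      rw [h1]
      rfl
  have hz : ∀ q ∉ j ⁻¹' κ.source, χ (j q) *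
      meanCurvature (𝓡 (n - 1)) (toField h) (boundaryProj F j) q (μ q) = 0 := fun q hq => by
    rw [image_eq_zero_of_notMem_tsupport fun hm => hq (hp hm), zero_mul]
  refine ⟨?_, ?_⟩
  · rw [← integrableOn_iff_integrable_of_support_subset
      (s := j ⁻¹' κ.source) (fun q hq => by_contra fun h => hq (hz q h)), hI.1]
    exact hfi.integrableOn.congr_fun (fun y hy => (heq y hy).symm) hmeas
  · rw [← setIntegral_eq_integral_of_forall_compl_eq_zero hz, hI.2,
      setIntegral_congr_fun hmeas heq, setIntegral_eq_integral_of_forall_compl_eq_zero hzero]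

/-- The divergence theorem for the flux field multiplied by a cut-off function. -/
theorem integral_cutDensity (hχ : ContMDiff (𝓡∂ n) 𝓘(ℝ, ℝ) ∞ χ) (hK : HasCompactSupport χ) :
    Integrable (cutDensity (toField h) (toField g) F N χ) (riemannianVolume (toField g)) ∧
    Integrable (fun q => χ (j q) *
        meanCurvature (𝓡 (n - 1)) (toField h) (boundaryProj F j) q (μ q))
      (riemannianVolume (pullbackMetric (𝓡 (n - 1)) (toField h) (boundaryProj F j))) ∧
    ∫ q, cutDensity (toField h) (toField g) F N χ q ∂(riemannianVolume (toField g)) =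
      - ∫ q, χ (j q) * meanCurvature (𝓡 (n - 1)) (toField h) (boundaryProj F j) q (μ q)
        ∂(riemannianVolume (pullbackMetric (𝓡 (n - 1)) (toField h) (boundaryProj F j))) := by
  have : LocallyCompactSpace M := Manifold.locallyCompact_of_finiteDimensional (𝓡∂ n)
  -- A finite cover of the compact support makes the partition of unity a finite sum, so both sides
  -- of the chart identities can be added.
  obtain ⟨t, ht⟩ := hK.isCompact.elim_finite_subcover (fun p : M => (extChartAt (𝓡∂ n) p).source)
    (fun p => isOpen_extChartAt_source p) fun p _ => mem_iUnion.2 ⟨p, mem_extChartAt_source p⟩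
  obtain ⟨f, hf⟩ := SmoothPartitionOfUnity.exists_isSubordinate (𝓡∂ n) (isClosed_tsupport χ)
    (fun i : t => (extChartAt (𝓡∂ n) (i : M)).source) (fun i => isOpen_extChartAt_source _)
    (fun p hp => by
      obtain ⟨i, hi, hpi⟩ := mem_iUnion₂.1 (ht hp)
      exact mem_iUnion.2 ⟨⟨i, hi⟩, hpi⟩)
  set c : t → M → ℝ := fun i p => f i p * χ p with hc
  have hcs : ∀ i, ContMDiff (𝓡∂ n) 𝓘(ℝ, ℝ) ∞ (c i) := fun i => (f i).contMDiff.mul hχ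
  have hsup : ∀ i, tsupport (c i) ⊆ (extChartAt (𝓡∂ n) (i : M)).source := fun i =>
    (closure_mono (Function.support_mul_subset_left _ _)).trans (hf i)
  have hcK : ∀ i, HasCompactSupport (c i) := fun i => hK.mul_left
  have hsum : χ = fun p => ∑ i, c i p := by
    funext p
    simp only [hc]
    rw [← Finset.sum_mul]
    by_cases hp : p ∈ tsupport χ
    · have h1 := f.sum_eq_one hp
      rw [finsum_eq_sum_of_fintype] at h1
      rw [h1, one_mul]
    · rw [image_eq_zero_of_notMem_tsupport hp, mul_zero]
  have h1 := fun i => hF.integral_cutDensity_chart (hcs i) (hcK i) i (hsup i)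
  have h2 := fun i => hΓ.integral_meanCurvature_chart hF (hcs i) (hcK i) i (hsup i)
  have e1 : cutDensity (toField h) (toField g) F N χ =
      fun p => ∑ i, cutDensity (toField h) (toField g) F N (c i) p := by
    funext p
    conv_lhs => rw [hsum]
    exact cutDensity_sum _ (fun i _ => (hcs i).mdifferentiable (by simp)) p
  have e2 : (fun q => χ (j q) *
        meanCurvature (𝓡 (n - 1)) (toField h) (boundaryProj F j) q (μ q)) =
      fun q => ∑ i, c i (j q) *
        meanCurvature (𝓡 (n - 1)) (toField h) (boundaryProj F j) q (μ q) := by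
    funext q
    conv_lhs => rw [hsum]
    rw [Finset.sum_mul]
  rw [e1, e2]
  refine ⟨integrable_finsetSum _ fun i _ => (h1 i).1, integrable_finsetSum _ fun i _ => (h2 i).1, ?_⟩
  rw [integral_finsetSum _ fun i _ => (h1 i).1, integral_finsetSum _ fun i _ => (h2 i).1,
    ← Finset.sum_neg_distrib]
  exact Finset.sum_congr rfl fun i _ => by rw [(h1 i).2, (h2 i).2]

end IsHorizon
end GlobalDivergence

/-! ### Functions decaying at infinity -/

section Decay

variable {n : ℕ} {p q : ℝ} {u v : Euc n → ℝ}

/-- `u = O(|x|^{-q})` at infinity. -/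
def Dec (q : ℝ) (u : Euc n → ℝ) : Prop := u =O[cobounded (Euc n)] fun x => ‖x‖ ^ (-q)

theorem eventually_lt_norm (R : ℝ) : ∀ᶠ x in cobounded (Euc n), R < ‖x‖ :=
  tendsto_norm_cobounded_atTop.eventually (eventually_gt_atTop R)

namespace Dec

theorem congr (h : Dec q u) (huv : u =ᶠ[cobounded (Euc n)] v) : Dec q v :=
  h.congr' huv EventuallyEq.rfl

theorem add (hu : Dec q u) (hv : Dec q v) : Dec q fun x => u x + v x := Asymptotics.IsBigO.add hu hv

theorem sub (hu : Dec q u) (hv : Dec q v) : Dec q fun x => u x - v x := Asymptotics.IsBigO.sub hu hv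

theorem neg (hu : Dec q u) : Dec q fun x => -u x := Asymptotics.IsBigO.neg_left hu

theorem const_mul (hu : Dec q u) (c : ℝ) : Dec q fun x => c * u x :=
  Asymptotics.IsBigO.const_mul_left hu c

theorem sum {ι : Type*} {s : Finset ι} {u : ι → Euc n → ℝ} (h : ∀ i ∈ s, Dec q (u i)) :
    Dec q fun x => ∑ i ∈ s, u i x :=
  (Asymptotics.IsBigO.sum h).congr_left fun x => Finset.sum_apply x s u

theorem mono (hu : Dec q u) (h : p ≤ q) : Dec p u := by
  refine Asymptotics.IsBigO.trans hu (Asymptotics.IsBigO.of_bound 1 ?_)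
  filter_upwards [eventually_lt_norm 1] with x hx
  rw [Real.norm_of_nonneg (by positivity), Real.norm_of_nonneg (by positivity), one_mul]
  exact Real.rpow_le_rpow_of_exponent_le hx.le (by linarith)

theorem mul (hu : Dec p u) (hv : Dec q v) : Dec (p + q) fun x => u x * v x := by
  refine (Asymptotics.IsBigO.mul hu hv).congr' EventuallyEq.rfl ?_
  filter_upwards [eventually_lt_norm 0] with x hx
  rw [← Real.rpow_add hx, neg_add]

theorem const (c : ℝ) : Dec 0 fun _ : Euc n => c := by
  simp only [Dec, neg_zero, Real.rpow_zero]
  exact Asymptotics.isBigO_const_const c one_ne_zero _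

theorem tendsto (hu : Dec q u) (hq : 0 < q) : Tendsto u (cobounded (Euc n)) (𝓝 0) :=
  Asymptotics.IsBigO.trans_tendsto hu
    ((tendsto_rpow_neg_atTop hq).comp tendsto_norm_cobounded_atTop)

theorem of_tendsto {c : ℝ} (hu : Tendsto u (cobounded (Euc n)) (𝓝 c)) : Dec 0 u := by
  simp only [Dec, neg_zero, Real.rpow_zero]
  exact hu.isBigO_one ℝ

theorem bound (hu : Dec q u) : ∃ C R : ℝ, 0 ≤ C ∧ 1 ≤ R ∧ ∀ x, R ≤ ‖x‖ → |u x| ≤ C * ‖x‖ ^ (-q) := by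
  obtain ⟨C, hC, h⟩ := Asymptotics.IsBigO.exists_nonneg hu
  have h1 := h.bound
  rw [← comap_norm_atTop, eventually_comap, eventually_atTop] at h1
  obtain ⟨R, hR⟩ := h1
  refine ⟨C, max R 1, hC, le_max_right _ _, fun x hx => ?_⟩
  have := hR ‖x‖ ((le_max_left _ _).trans hx) x rfl
  rwa [Real.norm_eq_abs, Real.norm_of_nonneg (by positivity)] at this

end Dec

/-- `G = δ + O(|x|^{-τ})` with `∂G = O(|x|^{-τ-1})`. -/
structure IsAFDecay (G : Euc n → Matrix (Fin n) (Fin n) ℝ) (τ : ℝ) : Prop where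
  coeff : ∀ i j, Dec τ fun x => G x i j - (1 : Matrix (Fin n) (Fin n) ℝ) i j
  deriv : ∀ i j k, Dec (τ + 1) (partialD univ (fun y => G y i j) k)

variable {G : Euc n → Matrix (Fin n) (Fin n) ℝ} {τ : ℝ}

theorem IsAFDecay.mono (h : IsAFDecay G τ) {σ : ℝ} (hσ : σ ≤ τ) : IsAFDecay G σ :=
  ⟨fun i j => (h.coeff i j).mono hσ, fun i j k => (h.deriv i j k).mono (by linarith)⟩

/-- Near infinity the coefficients are so close to the identity that the metric is at least half the
Euclidean one. -/
theorem IsAFDecay.elliptic (h : IsAFDecay G τ) (hτ : 0 < τ) :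
    ∃ R, ∀ x, R < ‖x‖ → ∀ w, ‖w‖ ^ 2 ≤ 2 * bil (G x) w w := by
  -- There are `n²` coefficients, each off by less than `ε`, and `n² ε ≤ 1/2`; the `+ 1` avoids
  -- division by zero.
  set ε : ℝ := 1 / (2 * ((n : ℝ) ^ 2 + 1))
  have hε : 0 < ε := by positivity
  have hnε : (n : ℝ) * (n * ε) ≤ 1 / 2 := by
    have : (n : ℝ) * (n * ε) = n ^ 2 / (n ^ 2 + 1) * (1 / 2) := by
      simp only [ε]; field_simp
    rw [this]
    have : (n : ℝ) ^ 2 / (n ^ 2 + 1) ≤ 1 := div_le_one_of_le₀ (by linarith) (by positivity)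
    linarith
  have h1 : ∀ᶠ x in cobounded (Euc n), ∀ i j,
      |G x i j - (1 : Matrix (Fin n) (Fin n) ℝ) i j| < ε := by
    refine eventually_all.2 fun i => eventually_all.2 fun j => ?_
    have := ((h.coeff i j).tendsto hτ).abs
    rw [abs_zero] at this
    exact this.eventually (gt_mem_nhds hε)
  rw [← comap_norm_atTop, eventually_comap, eventually_atTop] at h1
  obtain ⟨R, hR⟩ := h1
  refine ⟨R, fun x hx w => ?_⟩
  have hG := hR ‖x‖ hx.le x rfl
  have e : bil (G x) w w = ‖w‖ ^ 2 +
      ∑ i, ∑ j, (G x i j - (1 : Matrix (Fin n) (Fin n) ℝ) i j) * (w i * w j) := by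
    rw [EuclideanSpace.norm_sq_eq, bil_apply, ← Finset.sum_add_distrib]
    refine Finset.sum_congr rfl fun i _ => ?_
    simp only [sub_mul, Finset.sum_sub_distrib, Matrix.one_apply, ite_mul, one_mul, zero_mul,
      Finset.sum_ite_eq, Finset.mem_univ, if_true, Real.norm_eq_abs, sq_abs]
    have : ∑ j, G x i j * (w i * w j) = ∑ j, G x i j * w i * w j :=
      Finset.sum_congr rfl fun j _ => by ring
    rw [this]
    ring
  have b : |∑ i, ∑ j, (G x i j - (1 : Matrix (Fin n) (Fin n) ℝ) i j) * (w i * w j)| ≤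
      (n : ℝ) * (n * ε) * ‖w‖ ^ 2 := by
    calc _ ≤ ∑ _i : Fin n, ∑ _j : Fin n, ε * ‖w‖ ^ 2 := by
          refine (Finset.abs_sum_le_sum_abs _ _).trans (Finset.sum_le_sum fun i _ =>
            (Finset.abs_sum_le_sum_abs _ _).trans (Finset.sum_le_sum fun j _ => ?_))
          rw [abs_mul, abs_mul, sq]
          have a1 := PiLp.norm_apply_le w i
          have a2 := PiLp.norm_apply_le w j
          rw [Real.norm_eq_abs] at a1 a2
          have := (hG i j).le
          gcongr
      _ = _ := by simp; ring
  have := abs_le.1 b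
  nlinarith [sq_nonneg ‖w‖]

end Decay

/-! ### The end of the ambient manifold is closed -/

section End

variable {n : ℕ} {E : Type*} [TopologicalSpace E] [T2Space E] [ChartedSpace (Euc n) E]
  [IsManifold (𝓡 n) ∞ E]
  {h : SmoothMetric (𝓡 n) E}
  {Ψ : OpenPartialHomeomorph (Euc n) E}

theorem exists_bil_le {G : Euc n → Matrix (Fin n) (Fin n) ℝ} {s : Set (Euc n)} {z : Euc n}
    (hG : SmoothMetricOn G s) (hz : z ∈ s) :
    ∃ C, 0 ≤ C ∧ ∀ᶠ y in 𝓝 z, y ∈ s ∧ ∀ w, bil (G y) w w ≤ C * ‖w‖ ^ 2 := by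
  have c : ContinuousAt (fun y => ‖bil (G y)‖) z := (hG.contDiffAt_bil hz).continuousAt.norm
  refine ⟨‖bil (G z)‖ + 1, by positivity, ?_⟩
  filter_upwards [c.eventually (gt_mem_nhds (lt_add_one _)), hG.isOpen.mem_nhds hz] with y hy hys
  refine ⟨hys, fun w => (le_abs_self _).trans (((bil (G y)).le_opNorm₂ w w).trans ?_)⟩
  rw [mul_assoc, ← sq]
  gcongr

/-- Points of `E` are not limits of points of the end whose coordinates tend to infinity: a bump
function of the radius is Lipschitz, uniformly with respect to the position of the bump. -/
theorem SmoothCoord.exists_nhds_disjoint_end (hΨ : SmoothCoord Ψ) (hs : Ψ.source = exterior n 1)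
    {R₀ : ℝ} (hR₀ : ∀ x, R₀ < ‖x‖ → ∀ w,
      ‖w‖ ^ 2 ≤ 2 * bil (metricCoeff (toField h) Ψ.source Ψ x) w w) (e : E) :
    ∃ U ∈ 𝓝 e, ∃ R, ∀ x, R < ‖x‖ → Ψ x ∉ U := by
  -- A profile in the radial variable, of width independent of the radius at which it will be
  -- centred.
  let β : ContDiffBump (0 : ℝ) := ⟨1 / 2, 1, by norm_num, by norm_num⟩
  have hβ : ContDiff ℝ ∞ β := β.contDiff
  obtain ⟨L, hL⟩ := (β.hasCompactSupport.deriv (𝕜 := ℝ)).exists_bound_of_continuous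
    (hβ.continuous_deriv (by simp))
  set κ := chartAt (Euc n) e
  have hκ : SmoothCoord κ.symm := smoothCoord_chart e
  obtain ⟨C, hC, hev⟩ := exists_bil_le (hκ.isParam.smoothMetricOn κ.symm.open_source h)
    (mem_chart_target (Euc n) e)
  obtain ⟨δ₀, hδ₀, hball⟩ := Metric.eventually_nhds_iff_ball.1 hev
  have hL0 : 0 ≤ L := (norm_nonneg _).trans (hL 0)
  -- A Lipschitz bound in the chart at `e`: `L` bounds the slope of the profile, and `√(2C)` bounds
  -- the change of coordinates, since `|T w|² ≤ 2 h(Tw, Tw) = 2 h(w, w) ≤ 2C |w|²`. It does not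
  -- depend on the position of the bump.
  set K := L * Real.sqrt (2 * C)
  have hK : 0 ≤ K := by positivity
  set δ := min δ₀ (1 / (K + 1))
  have hδ : 0 < δ := lt_min hδ₀ (by positivity)
  have hsub : Metric.ball (κ e) δ ⊆ Metric.ball (κ e) δ₀ := Metric.ball_subset_ball (min_le_left _ _)
  refine ⟨κ.source ∩ κ ⁻¹' Metric.ball (κ e) δ, (κ.continuousOn.isOpen_inter_preimage κ.open_source
    Metric.isOpen_ball).mem_nhds ⟨mem_chart_source _ _, Metric.mem_ball_self hδ⟩,
    max (max R₀ 1) ‖Ψ.symm e‖ + 1, fun x hx hxU => ?_⟩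
  set s := ‖x‖
  -- The radius `s` is so large that the bump lives where the metric is elliptic and vanishes at
  -- `e`. If `e` is not on the end, `Ψ.symm e` is a meaningless value and the bound on it is
  -- harmless.
  have hs1 : max R₀ 1 < s - 1 := by linarith [le_max_left (max R₀ 1) ‖Ψ.symm e‖]
  have hs2 : ‖Ψ.symm e‖ < s - 1 := by linarith [le_max_right (max R₀ 1) ‖Ψ.symm e‖]
  have hs3 : R₀ < s - 1 := (le_max_left _ _).trans_lt hs1
  have hs4 : 1 < s - 1 := (le_max_right _ _).trans_lt hs1
  classical
  let b : E → ℝ := fun p => if p ∈ Ψ.target then β (‖Ψ.symm p‖ - s) else 0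
  let A : Set (Euc n) := {y | s - 1 ≤ ‖y‖ ∧ ‖y‖ ≤ s + 1}
  have hA : IsCompact A := by
    refine (isCompact_closedBall (0 : Euc n) (s + 1)).of_isClosed_subset
      ((isClosed_le continuous_const continuous_norm).inter
        (isClosed_le continuous_norm continuous_const)) fun y hy => ?_
    simpa using hy.2
  have hAs : A ⊆ Ψ.source := fun y hy => by rw [hs]; exact hs4.trans_le hy.1
  -- The support lies in the image of a compact annulus, closed in the Hausdorff space `E`; hence
  -- the extension of the bump by zero is differentiable throughout the chart ball.
  have hΨA : IsClosed (Ψ '' A) := (hA.image_of_continuousOn (Ψ.continuousOn.mono hAs)).isClosed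
  have hb0 : ∀ p ∉ Ψ '' A, b p = 0 := by
    intro p hp
    by_cases ht : p ∈ Ψ.target
    · simp only [b, if_pos ht]
      refine β.zero_of_le_dist ?_
      by_contra hlt
      rw [not_le, Real.dist_eq, sub_zero, abs_lt] at hlt
      change -1 < _ ∧ _ < 1 at hlt
      exact hp ⟨Ψ.symm p, ⟨by linarith [hlt.1], by linarith [hlt.2]⟩, Ψ.right_inv ht⟩
    · simp only [b, if_neg ht]
  have hxs : x ∈ Ψ.source := by rw [hs]; exact show 1 < s by linarith
  have hbx : b (Ψ x) = 1 := by
    simp only [b, if_pos (Ψ.map_source hxs), Ψ.left_inv hxs]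
    refine β.one_of_mem_closedBall ?_
    simp [s, β]
  have hbe : b e = 0 := by
    refine hb0 e ?_
    rintro ⟨y, hy, rfl⟩
    rw [Ψ.left_inv (hAs hy)] at hs2
    exact absurd hy.1 (not_le.2 hs2)
  have key : ∀ z ∈ Metric.ball (κ e) δ, DifferentiableAt ℝ (b ∘ κ.symm) z ∧
      ‖fderiv ℝ (b ∘ κ.symm) z‖ ≤ K := by
    intro z hz
    obtain ⟨hzt, hzC⟩ := hball z (hsub hz)
    replace hzt : z ∈ κ.target := hzt
    by_cases hzA : κ.symm z ∈ Ψ '' A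
    · obtain ⟨y, hy, hyz⟩ := hzA
      have hys := hAs hy
      have hzΨ : κ.symm z ∈ Ψ.target := hyz ▸ Ψ.map_source hys
      have hyz' : Ψ.symm (κ.symm z) = y := by rw [← hyz, Ψ.left_inv hys]
      have hy0 : y ≠ 0 := by
        rintro rfl
        have := hy.1
        rw [norm_zero] at this
        linarith
      have hopen : κ.target ∩ κ.symm ⁻¹' Ψ.target ∈ 𝓝 z :=
        (κ.symm.continuousOn.isOpen_inter_preimage κ.open_target Ψ.open_target).mem_nhds ⟨hzt, hzΨ⟩
      have d1 : DifferentiableAt ℝ (Ψ.symm ∘ κ.symm) z :=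
        ((hκ.contDiffOn_change hΨ).contDiffAt hopen).differentiableAt (by simp)
      have hch := hκ.metricCoeff_change hΨ (fieldBilin_toField h) (z := z) hzt hzΨ
      set T := fderiv ℝ (Ψ.symm ∘ κ.symm) z
      have hTn : ∀ w, ‖T w‖ ≤ Real.sqrt (2 * C) * ‖w‖ := by
        intro w
        have h1 := hR₀ y (hs3.trans_le hy.1) (T w)
        have h2 := (hch w w).2
        rw [hyz'] at h2
        rw [← h2] at h1
        refine abs_le_of_sq_le_sq' ?_ (by positivity) |>.2
        rw [mul_pow, Real.sq_sqrt (by positivity)]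
        linarith [hzC w]
      have d2 : DifferentiableAt ℝ (fun y : Euc n => ‖y‖) y := (contDiffAt_norm ℝ hy0).differentiableAt
        (n := ∞) (by simp)
      have d3 : HasFDerivAt (fun z => β (‖Ψ.symm (κ.symm z)‖ - s))
          (deriv β (‖y‖ - s) • (fderiv ℝ (fun y : Euc n => ‖y‖) y).comp T) z := by
        have a1 : HasFDerivAt (fun z => ‖(Ψ.symm ∘ κ.symm) z‖ - s)
            ((fderiv ℝ (fun y : Euc n => ‖y‖) y).comp T) z := by
          have d2' := d2.hasFDerivAt
          rw [← hyz'] at d2'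
          have := (HasFDerivAt.comp z (g := fun y : Euc n => ‖y‖) d2' d1.hasFDerivAt).sub_const s
          rwa [hyz'] at this
        have a2 : HasDerivAt β (deriv β (‖y‖ - s)) (‖(Ψ.symm ∘ κ.symm) z‖ - s) := by
          have := ((hβ.differentiable (by simp)) (‖y‖ - s)).hasDerivAt
          simp only [Function.comp_apply, hyz']
          exact this
        exact HasDerivAt.comp_hasFDerivAt (h₂ := β) z a2 a1
      have d4 : HasFDerivAt (b ∘ κ.symm)
          (deriv β (‖y‖ - s) • (fderiv ℝ (fun y : Euc n => ‖y‖) y).comp T) z := by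
        refine d3.congr_of_eventuallyEq ?_
        filter_upwards [hopen] with w hw
        exact if_pos hw.2
      refine ⟨d4.differentiableAt, ?_⟩
      rw [d4.fderiv]
      refine ContinuousLinearMap.opNorm_le_bound _ hK fun w => ?_
      rw [smul_apply, norm_smul, ContinuousLinearMap.comp_apply, mul_assoc]
      refine mul_le_mul (hL _) ?_ (norm_nonneg _) hL0
      refine ((ContinuousLinearMap.le_opNorm _ _).trans ?_).trans (hTn w)
      have : ‖fderiv ℝ (fun y : Euc n => ‖y‖) y‖ ≤ 1 := by
        simpa using norm_fderiv_le_of_lipschitz ℝ (x₀ := y) (lipschitzWith_one_norm (E := Euc n))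
      nlinarith [norm_nonneg (T w)]
    · have h0 : b ∘ κ.symm =ᶠ[𝓝 z] fun _ => 0 := by
        filter_upwards [(κ.symm.continuousOn.isOpen_inter_preimage κ.open_target
          hΨA.isOpen_compl).mem_nhds ⟨hzt, hzA⟩] with w hw
        exact hb0 _ hw.2
      refine ⟨(differentiableAt_const 0).congr_of_eventuallyEq h0, ?_⟩
      rw [h0.fderiv_eq]
      simpa using hK
  -- The bump rises from `0` at `e` to `1` at `Ψ x` over a distance less than `1 / (K + 1)`,
  -- contradicting the Lipschitz constant `K`.
  have mv := (convex_ball (κ e) δ).norm_image_sub_le_of_norm_fderiv_le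
    (fun z hz => (key z hz).1) (fun z hz => (key z hz).2) (Metric.mem_ball_self hδ) hxU.2
  rw [Function.comp_apply, Function.comp_apply, κ.left_inv hxU.1, κ.left_inv (mem_chart_source _ _),
    hbx, hbe, sub_zero, norm_one] at mv
  have h1 : dist (κ (Ψ x)) (κ e) < 1 / (K + 1) := (Metric.mem_ball.1 hxU.2).trans_le (min_le_right _ _)
  rw [lt_div_iff₀ (by positivity)] at h1
  rw [dist_eq_norm] at h1
  nlinarith [norm_nonneg (κ (Ψ x) - κ e)]

end End

/-! ### The end of the hypersurface -/

section HypersurfaceEnd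

variable {n : ℕ} {E : Type*} [TopologicalSpace E] [ChartedSpace (Euc n) E]
  [IsManifold (𝓡 n) ∞ E] [MeasurableSpace E]
  {h : SmoothMetric (𝓡 n) E}
  {Ψ : OpenPartialHomeomorph (Euc n) E}

namespace IsAsymptoticallyFlat

variable (hE : IsAsymptoticallyFlat (toField h) Ψ)
include hE

theorem smoothCoord : SmoothCoord Ψ := ⟨hE.smooth, hE.smooth_symm⟩

theorem exists_isAFDecay : ∃ τ : ℝ, ((n : ℝ) - 2) / 2 < τ ∧
    IsAFDecay (metricCoeff (toField h) (exterior n 1) Ψ) τ := by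
  obtain ⟨τ, hτ, h1, h2⟩ := hE.decay
  refine ⟨τ, hτ, h1, fun i j k => ?_⟩
  have := h2 i j k
  rwa [show -τ - 1 = -(τ + 1) by ring] at this

theorem exists_nhds_disjoint_end [T2Space E] (hn : 3 ≤ n) (e : E) :
    ∃ U ∈ 𝓝 e, ∃ R, ∀ x, R < ‖x‖ → Ψ x ∉ U := by
  obtain ⟨τ, hτ, h1⟩ := hE.exists_isAFDecay
  have : (3 : ℝ) ≤ n := by exact_mod_cast hn
  obtain ⟨R, hR⟩ := h1.elliptic (by linarith)
  rw [← hE.source_eq] at hR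
  exact hE.smoothCoord.exists_nhds_disjoint_end hE.source_eq hR e

end IsAsymptoticallyFlat

variable [NeZero n] {M : Type*} [TopologicalSpace M] [T2Space M]
  [ChartedSpace (EuclideanHalfSpace n) M] [IsManifold (𝓡∂ n) ∞ M] [MeasurableSpace M]
  {g : SmoothMetric (𝓡∂ n) M}
  {F : M → E × ℝ} {N : ∀ p : M, TangentSpace ((𝓡 n).prod 𝓘(ℝ, ℝ)) (F p)}
  {Iv : Set ℝ} {ρ : ℝ} {Φ : Euc n → M} {f : Euc n → ℝ}

theorem sphereFlux_congr {V W : Euc n → Euc n} {r : ℝ} (hr : 0 ≤ r)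
    (hVW : ∀ x, ‖x‖ = r → V x = W x) : sphereFlux V r = sphereFlux W r := by
  simp only [sphereFlux]
  congr 2
  funext u
  rw [hVW _ (by rw [norm_smul, norm_eq_of_mem_sphere, mul_one, Real.norm_of_nonneg hr])]

/-- The position of the projection to `E` in the coordinates at infinity. -/
def endCoord (Ψ : OpenPartialHomeomorph (Euc n) E) (F : M → E × ℝ) (p : M) : Euc n := Ψ.symm (F p).1

namespace IsAFHypersurface

variable (hM : IsAFHypersurface (toField h) Ψ Iv (toField g) F N ρ Φ f)
include hM

/-- Compact cores are closed, which settles radii above `ρ`. The image of `exterior n r` is the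
union of those of larger radii, and this includes `r = ρ`. -/
theorem isOpen_image {r : ℝ} (hr : ρ ≤ r) : IsOpen (Φ '' exterior n r) := by
  have h1 : ∀ s, r < s → IsOpen (Φ '' exterior n s) := fun s hs => by
    simpa using (hM.isCompact_core s (hr.trans_lt hs)).isClosed.isOpen_compl
  have h2 : Φ '' exterior n r = ⋃ s ∈ Ioi r, Φ '' exterior n s := by
    rw [← image_iUnion₂]
    congr 1
    ext x
    simp only [mem_iUnion, exterior, mem_ofPred_eq, mem_Ioi, exists_prop]
    exact ⟨fun hx => exists_between hx, fun ⟨s, hs, hx⟩ => hs.trans hx⟩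
  rw [h2]
  exact isOpen_biUnion h1

variable (hE : IsAsymptoticallyFlat (toField h) Ψ)
include hE

theorem source_of_mem {x : Euc n} (hx : x ∈ exterior n ρ) : x ∈ Ψ.source := by
  rw [hE.source_eq]
  exact hM.one_le_radius.trans_lt hx

theorem fst_mem_target {x : Euc n} (hx : x ∈ exterior n ρ) : (F (Φ x)).1 ∈ Ψ.target := by
  rw [hM.graph x hx]
  exact Ψ.map_source (hM.source_of_mem hE hx)

theorem endCoord_apply {x : Euc n} (hx : x ∈ exterior n ρ) : endCoord Ψ F (Φ x) = x := by
  rw [endCoord, hM.graph x hx]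
  exact Ψ.left_inv (hM.source_of_mem hE hx)

theorem mem_core {p : M} {r : ℝ} (hr : ρ ≤ r) (hp : ‖endCoord Ψ F p‖ ≤ r) :
    p ∈ (Φ '' exterior n r)ᶜ := by
  rintro ⟨x, hx, rfl⟩
  rw [hM.endCoord_apply hE (hr.trans_lt hx)] at hp
  exact absurd hx (not_lt.2 hp)

theorem contMDiffOn_endCoord :
    ContMDiffOn (𝓡∂ n) 𝓘(ℝ, Euc n) ∞ (endCoord Ψ F) (Φ '' exterior n ρ) := by
  refine (contMDiffOn_coord_fst hE.smoothCoord).comp hM.smooth.contMDiffOn ?_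
  rintro _ ⟨x, hx, rfl⟩
  exact hM.fst_mem_target hE hx

theorem mdiff_endCoord {x : Euc n} (hx : x ∈ exterior n ρ) :
    MDifferentiableAt (𝓡∂ n) 𝓘(ℝ, Euc n) (endCoord Ψ F) (Φ x) :=
  ((hM.contMDiffOn_endCoord hE).contMDiffAt
    ((hM.isOpen_image le_rfl).mem_nhds (mem_image_of_mem Φ hx))).mdifferentiableAt (by simp)

theorem tD_endCoord_comp {x : Euc n} (hx : x ∈ exterior n ρ) :
    (tD (𝓡∂ n) 𝓘(ℝ, Euc n) (endCoord Ψ F) univ (Φ x)).comp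
      (tD 𝓘(ℝ, Euc n) (𝓡∂ n) Φ (exterior n ρ) x) = ContinuousLinearMap.id ℝ _ := by
  have hu : UniqueMDiffWithinAt 𝓘(ℝ, Euc n) (exterior n ρ) x :=
    (isOpen_exterior ρ).uniqueMDiffWithinAt hx
  rw [← tD_comp (hM.mdiff_endCoord hE hx).mdifferentiableWithinAt
    ((hM.smooth_end x hx).mdifferentiableWithinAt (by simp)) (mapsTo_univ _ _) hu,
    tD_congr (φ := endCoord Ψ F ∘ Φ) (φ' := id) (fun y hy => hM.endCoord_apply hE hy) (hM.endCoord_apply hE hx), tD_id hu]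

/-- `Φ` is not assumed to be an immersion; it is one because on a graph the projection to `E` in the
coordinates `Ψ` is a left inverse. -/
theorem isParam : IsParam (𝓡∂ n) Φ (exterior n ρ) := by
  refine ⟨(isOpen_exterior ρ).uniqueDiffOn, hM.smooth_end, fun x hx a b hab => ?_⟩
  have h1 := hM.tD_endCoord_comp hE hx
  have := congrArg (tD (𝓡∂ n) 𝓘(ℝ, Euc n) (endCoord Ψ F) univ (Φ x)) hab
  simpa using ((congrArg (fun L => L a) h1).symm.trans this).trans (congrArg (fun L => L b) h1)

theorem image_endCoord {r : ℝ} (hr : ρ ≤ r) : endCoord Ψ F '' (Φ '' exterior n r) = exterior n r := by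
  rw [image_image]
  refine (image_congr fun x hx => hM.endCoord_apply hE (hr.trans_lt hx)).trans (image_id _)

theorem isMetricCoord_end [BorelSpace M] {r : ℝ} (hr : ρ ≤ r) :
    IsMetricCoord (𝓡∂ n) (toField g) (Φ '' exterior n r) (endCoord Ψ F)
      (metricCoeff (toField g) (exterior n ρ) Φ) where
  meas := (hM.isOpen_image hr).measurableSet
  inj := by
    rintro _ ⟨x, hx, rfl⟩ _ ⟨y, hy, rfl⟩ hxy
    rw [hM.endCoord_apply hE (hr.trans_lt hx), hM.endCoord_apply hE (hr.trans_lt hy)] at hxy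
    rw [hxy]
  diff := by
    rintro _ ⟨x, hx, rfl⟩
    exact hM.mdiff_endCoord hE (hr.trans_lt hx)
  metric := by
    rintro _ ⟨x, hx, rfl⟩ a b
    have hx' : x ∈ exterior n ρ := hr.trans_lt hx
    have h1 := hM.tD_endCoord_comp hE hx'
    have hsurj := surjective_of_injective_euc _ ((hM.isParam hE).inj x hx')
    obtain ⟨a, rfl⟩ := hsurj a
    obtain ⟨b, rfl⟩ := hsurj b
    have h2 : ∀ c, tD (𝓡∂ n) 𝓘(ℝ, Euc n) (endCoord Ψ F) univ (Φ x)
        (tD 𝓘(ℝ, Euc n) (𝓡∂ n) Φ (exterior n ρ) x c) = c := fun c => congrArg (fun L => L c) h1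
    rw [h2 a, h2 b, hM.endCoord_apply hE hx', (fieldBilin_toField g).bil_metricCoeff]

variable [T2Space E]

/-- A limit point cannot be approached with `|x| → ∞`, because its projection to `E` has a
neighbourhood free of far points of the end. So it is a limit of points from a compact annulus,
whose image is closed. -/
theorem isClosed_image (hn : 3 ≤ n) {r : ℝ} (hr : ρ < r) : IsClosed (Φ '' {x | r ≤ ‖x‖}) := by
  refine isClosed_of_closure_subset fun p hp => ?_
  obtain ⟨U, hU, R, hR⟩ := hE.exists_nhds_disjoint_end hn (F p).1
  have hW : (fun q => (F q).1) ⁻¹' U ∈ 𝓝 p :=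
    (continuous_fst.comp hM.smooth.continuous).continuousAt.preimage_mem_nhds hU
  let A : Set (Euc n) := {x | r ≤ ‖x‖ ∧ ‖x‖ ≤ R}
  have hA : IsCompact A := by
    refine (isCompact_closedBall (0 : Euc n) R).of_isClosed_subset
      ((isClosed_le continuous_const continuous_norm).inter
        (isClosed_le continuous_norm continuous_const)) fun y hy => ?_
    simpa using hy.2
  have hΦA : IsClosed (Φ '' A) := (hA.image_of_continuousOn
    (hM.smooth_end.continuousOn.mono fun x hx => lt_of_lt_of_le hr hx.1)).isClosed
  have : p ∈ closure (Φ '' A) := by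
    rw [mem_closure_iff_nhds] at hp ⊢
    intro t ht
    obtain ⟨_, ⟨hqt, hqU⟩, x, hx, rfl⟩ := hp _ (inter_mem ht hW)
    refine ⟨_, hqt, x, ⟨hx, not_lt.1 fun hlt => hR x hlt ?_⟩, rfl⟩
    have := hM.graph x (lt_of_lt_of_le hr hx)
    rw [mem_preimage, this] at hqU
    exact hqU
  rw [hΦA.closure_eq] at this
  obtain ⟨x, hx, rfl⟩ := this
  exact ⟨x, hx.1, rfl⟩

/-- A cut-off function on the hypersurface. -/
theorem exists_cutoff (hn : 3 ≤ n) {r : ℝ} (hr : ρ < r) :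
    ∃ χ : M → ℝ, ContMDiff (𝓡∂ n) 𝓘(ℝ, ℝ) ∞ χ ∧ HasCompactSupport χ ∧
      (∀ p ∉ Φ '' exterior n ρ, χ p = 1) ∧ (∀ p ∉ Φ '' exterior n r, χ =ᶠ[𝓝 p] fun _ => 1) ∧
      (∀ x, ‖x‖ = r → χ (Φ x) = 1) ∧ ∀ x, r + 2 ≤ ‖x‖ → χ (Φ x) = 0 := by
  classical
  set O := Φ '' exterior n ρ
  have hO : IsOpen O := hM.isOpen_image le_rfl
  -- On the end the function is `1` for `|x| ≤ r + 1` and `0` for `|x| ≥ r + 2`; it is `1` on the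
  -- rest of `M`.
  let χ : M → ℝ := fun p => if p ∈ O then Real.smoothTransition (r + 2 - ‖endCoord Ψ F p‖) else 1
  have hχΦ : ∀ x ∈ exterior n ρ, χ (Φ x) = Real.smoothTransition (r + 2 - ‖x‖) := fun x hx => by
    simp only [χ, O, if_pos (mem_image_of_mem Φ hx), hM.endCoord_apply hE hx]
  have h1 : ∀ p ∉ Φ '' {x | r + 1 ≤ ‖x‖}, χ p = 1 := by
    intro p hp
    by_cases hpO : p ∈ O
    · obtain ⟨x, hx, rfl⟩ := hpO
      rw [hχΦ x hx]
      refine Real.smoothTransition.one_of_one_le ?_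
      have : ¬ r + 1 ≤ ‖x‖ := fun h => hp ⟨x, h, rfl⟩
      linarith
    · simp only [χ, if_neg hpO]
  -- Closedness of the far end is what makes the two definitions glue smoothly: the function is
  -- constantly `1` on this open set, which together with the end covers `M`.
  have hC : IsOpen (Φ '' {x | r + 1 ≤ ‖x‖})ᶜ :=
    (hM.isClosed_image hE hn (hr.trans (lt_add_one r))).isOpen_compl
  have h0 : ∀ x, r + 2 ≤ ‖x‖ → χ (Φ x) = 0 := fun x hx => by
    rw [hχΦ x (show ρ < ‖x‖ by linarith)]
    exact Real.smoothTransition.zero_of_nonpos (by linarith)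
  refine ⟨χ, ?_, ?_, fun p hp => ?_, fun p hp => ?_, fun x hx => ?_, h0⟩
  · refine contMDiff_of_contMDiffOn_union_of_isOpen (s := O) (t := (Φ '' {x | r + 1 ≤ ‖x‖})ᶜ)
      ?_ ?_ ?_ hO hC
    · have h2 : ContDiffOn ℝ ∞ (fun x : Euc n => Real.smoothTransition (r + 2 - ‖x‖))
          (exterior n ρ) := by
        refine Real.smoothTransition.contDiff.comp_contDiffOn (contDiffOn_const.sub fun x hx => ?_)
        refine (contDiffAt_norm ℝ ?_).contDiffWithinAt
        rintro rfl
        have hx' : ρ < ‖(0 : Euc n)‖ := hx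
        rw [norm_zero] at hx'
        linarith [hM.one_le_radius]
      refine (h2.contMDiffOn.comp (hM.contMDiffOn_endCoord hE) ?_).congr fun p hp => if_pos hp
      rintro _ ⟨x, hx, rfl⟩
      rw [mem_preimage, hM.endCoord_apply hE hx]
      exact hx
    · exact contMDiffOn_const.congr h1
    · refine eq_univ_of_forall fun p => ?_
      by_cases hp : p ∈ Φ '' {x | r + 1 ≤ ‖x‖}
      · obtain ⟨x, hx, rfl⟩ := hp
        exact Or.inl ⟨x, show ρ < ‖x‖ from lt_of_lt_of_le (by linarith) hx, rfl⟩
      · exact Or.inr hp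
  · refine HasCompactSupport.intro (hM.isCompact_core (r + 2) (by linarith)) fun p hp => ?_
    rw [mem_compl_iff, not_not] at hp
    obtain ⟨x, hx, rfl⟩ := hp
    exact h0 x (le_of_lt hx)
  · exact if_neg hp
  · filter_upwards [hC.mem_nhds fun ⟨x, hx, hxp⟩ => hp ⟨x, lt_of_lt_of_le (lt_add_one r) hx, hxp⟩]
      with q hq using h1 q hq
  · rw [hχΦ x (show ρ < ‖x‖ by rw [hx]; exact hr)]
    exact Real.smoothTransition.one_of_one_le (by rw [hx]; linarith)

variable [SecondCountableTopology M] [BorelSpace M]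
  {Γ : Type*} [TopologicalSpace Γ] [T2Space Γ] [SecondCountableTopology Γ] [CompactSpace Γ]
  [ChartedSpace (Euc (n - 1)) Γ] [IsManifold (𝓡 (n - 1)) ∞ Γ]
  [MeasurableSpace Γ] [BorelSpace Γ]
  {j : Γ → M} {t₀ : ℝ} {Ω : Set E} {μ : ∀ q : Γ, TangentSpace (𝓡 n) (boundaryProj F j q)}

/-- The integral of the mass density over the core of the hypersurface. -/
theorem integral_core (hΓ : IsHorizon (toField h) (toField g) F N j t₀ Ω μ) (hn : 3 ≤ n) {r : ℝ}
    (hr : ρ < r) :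
    Integrable (fun q => meanCurvature (𝓡 (n - 1)) (toField h) (boundaryProj F j) q (μ q))
      (riemannianVolume (pullbackMetric (𝓡 (n - 1)) (toField h) (boundaryProj F j))) ∧
    IntegrableOn (massDensity (toField h) (toField g) F N) (Φ '' exterior n r)ᶜ
      (riemannianVolume (toField g)) ∧
    ∫ p in (Φ '' exterior n r)ᶜ, massDensity (toField h) (toField g) F N p
        ∂(riemannianVolume (toField g)) =
      sphereFlux (fluxDensity (toField h) (toField g) F N Φ (exterior n ρ)) r -
      ∫ q, meanCurvature (𝓡 (n - 1)) (toField h) (boundaryProj F j) q (μ q)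
        ∂(riemannianVolume (pullbackMetric (𝓡 (n - 1)) (toField h) (boundaryProj F j))) := by
  have hF := hM.isHypersurface
  have hφ := hM.isParam hE
  have hρ0 : 0 ≤ ρ := by linarith [hM.one_le_radius]
  obtain ⟨χ, hχ, hK, hχ1, hχr, hχs, hχ0⟩ := hM.exists_cutoff hE hn hr
  obtain ⟨i1, i2, i3⟩ := hΓ.integral_cutDensity hF hχ hK
  -- The end consists of interior points of `M`, so `Γ` lies where the cut-off function is `1`.
  have hj : ∀ q, χ (j q) = 1 := fun q => hχ1 _ fun ⟨x, hx, hxq⟩ => by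
    have h1 := hφ.isInteriorPoint (isOpen_exterior ρ) hx
    rw [hxq, ModelWithCorners.isInteriorPoint_iff_not_isBoundaryPoint] at h1
    exact h1 (hΓ.isBoundaryPoint q)
  simp only [hj, one_mul] at i2 i3
  have hm : MeasurableSet (Φ '' exterior n r) := (hM.isOpen_image hr.le).measurableSet
  have hcore : ∀ p ∈ (Φ '' exterior n r)ᶜ, cutDensity (toField h) (toField g) F N χ p =
      massDensity (toField h) (toField g) F N p := by
    intro p hp
    have h2 : tD (𝓡∂ n) 𝓘(ℝ, ℝ) χ univ p = 0 := by
      rw [tD_congr_nhds (φ' := fun _ => 1) (by rw [nhdsWithin_univ]; exact hχr p hp)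
        (hχr p hp).self_of_nhds, tD_univ]
      exact mfderiv_const
    rw [cutDensity, h2, (hχr p hp).self_of_nhds]
    simp
  set V := fluxDensity (toField h) (toField g) F N Φ (exterior n ρ) with hV
  set W : Euc n → Euc n := fun x => χ (Φ x) • V x with hW
  have hWs : ContDiffOn ℝ 1 W (exterior n ρ) := by
    have h1 : ContDiffOn ℝ ∞ (fun x => χ (Φ x)) (exterior n ρ) :=
      contMDiffOn_iff_contDiffOn.1 (hχ.comp_contMDiffOn hM.smooth_end)
    exact (h1.smul (hF.contDiffOn_fluxDensity hφ)).of_le (by simp)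
  have hdiv : ∀ x ∈ exterior n ρ, diverg W x =
      Real.sqrt (metricCoeff (toField g) (exterior n ρ) Φ x).det *
        cutDensity (toField h) (toField g) F N χ (Φ x) := fun x hx =>
    hF.diverg_cut hφ (isOpen_exterior ρ) hx (hχ.mdifferentiable (by simp))
  have hsub : exterior n r ⊆ exterior n ρ := fun x hx => hr.trans hx
  have hdetc : ContinuousOn (fun x => Real.sqrt (metricCoeff (toField g) (exterior n ρ) Φ x).det)
      (exterior n ρ) := (contDiffOn_sqrt_det hφ).continuousOn
  have hcc : ContinuousOn (fun x => cutDensity (toField h) (toField g) F N χ (Φ x))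
      (exterior n ρ) := by
    refine ((continuousOn_diverg hWs).div hdetc fun x hx => ?_).congr fun x hx => ?_
    · exact (Real.sqrt_pos.2 (hφ.isMetric hx g).det_pos).ne'
    · rw [Pi.div_apply, hdiv x hx, mul_div_cancel_left₀]
      exact (Real.sqrt_pos.2 (hφ.isMetric hx g).det_pos).ne'
  have hI := (hM.isMetricCoord_end hE hr.le).integral_eq (fieldBilin_toField g)
    (by rw [hM.image_endCoord hE hr.le]; exact hdetc.mono hsub)
    (f := cutDensity (toField h) (toField g) F N χ)
    (b := fun x => cutDensity (toField h) (toField g) F N χ (Φ x))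
    (by
      rw [hM.image_endCoord hE hr.le]
      exact (hcc.mono hsub).aestronglyMeasurable (isOpen_exterior r).measurableSet)
    (by
      rintro _ ⟨x, hx, rfl⟩
      rw [hM.endCoord_apply hE (hsub hx)])
  -- The divergence theorem between the radii `r`, where `χ = 1`, and `r + 3`, where `χ` vanishes.
  -- Subtracting this from the integral over `M` leaves the core.
  have hend : ∫ p in Φ '' exterior n r, cutDensity (toField h) (toField g) F N χ p
      ∂(riemannianVolume (toField g)) = - sphereFlux V r := by
    rw [hI.2, hM.image_endCoord hE hr.le,
      setIntegral_congr_fun (isOpen_exterior r).measurableSet fun x hx => (hdiv x (hsub hx)).symm]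
    have h1 := (sphereFlux_sub hρ0 hWs hr (show r ≤ r + 3 by linarith)).2
    rw [setIntegral_eq_of_subset_of_forall_sdiff_eq_zero (isOpen_exterior r).measurableSet
      (s := {x : Euc n | r < ‖x‖ ∧ ‖x‖ ≤ r + 3}) (fun x hx => hx.1) fun x hx => ?_, ← h1,
      sphereFlux_congr (W := fun _ => 0) (by linarith) fun x hx => ?_,
      sphereFlux_congr (V := W) (W := V) (by linarith) fun x hx => ?_]
    · simp [sphereFlux]
    · simp only [hW, hχs x hx, one_smul]
    · simp only [hW, hχ0 x (by linarith), zero_smul]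
    · have hx3 : r + 2 < ‖x‖ := by
        have : ¬ ‖x‖ ≤ r + 3 := fun hle => hx.2 ⟨hx.1, hle⟩
        linarith
      have h0 : ∀ i, (fun y => W y i) =ᶠ[𝓝 x] fun _ => 0 := fun i => by
        filter_upwards [(isOpen_exterior (n := n) (r + 2)).mem_nhds hx3] with y hy
        have hy' : r + 2 < ‖y‖ := hy
        simp [hW, hχ0 y hy'.le]
      refine Finset.sum_eq_zero fun i _ => ?_
      rw [partialD, fderivWithin_univ, (h0 i).fderiv_eq]
      simp
  refine ⟨i2, (i1.integrableOn.congr_fun hcore hm.compl), ?_⟩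
  rw [← setIntegral_congr_fun hm.compl hcore]
  have := integral_add_compl hm i1
  rw [hend, i3] at this
  linarith

end IsAFHypersurface
end HypersurfaceEnd

/-! ### Existence of the ADM mass -/

section ADM

variable {n : ℕ} {τ q : ℝ} {G : Euc n → Matrix (Fin n) (Fin n) ℝ} {ρ : ℝ} {x : Euc n}

theorem Dec.bdd_mul {u v : Euc n → ℝ} (hu : Dec 0 u) (hv : Dec q v) : Dec q fun x => u x * v x := by
  simpa only [zero_add] using hu.mul hv

theorem Dec.mul_bdd {u v : Euc n → ℝ} (hu : Dec q u) (hv : Dec 0 v) : Dec q fun x => u x * v x := by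
  simpa only [add_zero] using hu.mul hv

theorem exterior_subset {r s : ℝ} (h : r ≤ s) : exterior n s ⊆ exterior n r := fun _ hx =>
  h.trans_lt hx

/-- A vector field decaying faster than `|x|^{1-n}` has no flux at infinity. -/
theorem tendsto_sphereFlux_zero (hn : 1 ≤ n) {U : Euc n → Euc n} (hU : ∀ i, Dec q fun x => U x i)
    (hq : (n : ℝ) - 1 < q) : Tendsto (sphereFlux U) atTop (𝓝 0) := by
  choose C R hC hR hb using fun i => (hU i).bound
  set area := (volume : Measure (Euc n)).toSphere.real univ
  have h1 : ∀ r : ℝ, (∀ i, R i ≤ r) → 1 ≤ r →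
      ‖sphereFlux U r‖ ≤ ((∑ i, C i) * area) * r ^ (-(q - ((n : ℝ) - 1))) := by
    intro r hr hr1
    have hr0 : 0 < r := by linarith
    have h2 : ‖∫ u : Metric.sphere (0 : Euc n) 1, (∑ i, U (r • (u : Euc n)) i * (u : Euc n) i)
        ∂(volume : Measure (Euc n)).toSphere‖ ≤ ((∑ i, C i) * r ^ (-q)) * area := by
      refine norm_integral_le_of_norm_le_const (Eventually.of_forall fun u => ?_)
      have hu : ‖(u : Euc n)‖ = 1 := norm_eq_of_mem_sphere u
      have hru : ‖r • (u : Euc n)‖ = r := by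
        rw [norm_smul, hu, mul_one, Real.norm_of_nonneg hr0.le]
      rw [Finset.sum_mul]
      refine (norm_sum_le _ _).trans (Finset.sum_le_sum fun i _ => ?_)
      rw [norm_mul, Real.norm_eq_abs]
      have a1 := hb i (r • (u : Euc n)) (by rw [hru]; exact hr i)
      rw [hru] at a1
      have a2 := PiLp.norm_apply_le (u : Euc n) i
      rw [hu] at a2
      calc _ ≤ (C i * r ^ (-q)) * 1 := mul_le_mul a1 a2 (norm_nonneg _)
            (mul_nonneg (hC i) (by positivity))
        _ = _ := mul_one _
    rw [sphereFlux, norm_mul, Real.norm_of_nonneg (by positivity)]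
    refine (mul_le_mul_of_nonneg_left h2 (by positivity)).trans (le_of_eq ?_)
    -- The area of the sphere grows like `r^(n-1)`, which is why the threshold for `q` is `n - 1`.
    have e : r ^ (-(q - ((n : ℝ) - 1))) = r ^ (n - 1) * r ^ (-q) := by
      rw [← Real.rpow_natCast, ← Real.rpow_add hr0, Nat.cast_sub hn]
      congr 1
      push_cast
      ring
    rw [e]
    ring
  refine squeeze_zero_norm' ?_ (?_ : Tendsto
    (fun r : ℝ => ((∑ i, C i) * area) * r ^ (-(q - ((n : ℝ) - 1)))) atTop (𝓝 0))
  · filter_upwards [eventually_all.2 fun i => eventually_ge_atTop (R i), eventually_ge_atTop 1]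
      with r hr hr1 using h1 r hr hr1
  · simpa using (tendsto_rpow_neg_atTop (y := q - ((n : ℝ) - 1)) (by linarith)).const_mul
      ((∑ i, C i) * area)

theorem integrable_sphere {U : Euc n → Euc n} (hρ : 0 ≤ ρ) (hU : ContinuousOn U (exterior n ρ))
    {r : ℝ} (hr : ρ < r) : Integrable (fun u : Metric.sphere (0 : Euc n) 1 =>
      ∑ i, U (r • (u : Euc n)) i * (u : Euc n) i) (volume : Measure (Euc n)).toSphere := by
  have h1 : Continuous fun u : Metric.sphere (0 : Euc n) 1 => U (r • (u : Euc n)) := by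
    refine hU.comp_continuous (by fun_prop) fun u => ?_
    rw [exterior, mem_ofPred_eq, norm_smul, norm_eq_of_mem_sphere, mul_one,
      Real.norm_of_nonneg (hρ.trans hr.le)]
    exact hr
  have h2 : Continuous fun u : Metric.sphere (0 : Euc n) 1 =>
      ∑ i, U (r • (u : Euc n)) i * (u : Euc n) i :=
    continuous_finsetSum _ fun i _ => ((EuclideanSpace.proj (𝕜 := ℝ) i).continuous.comp h1).mul
      ((EuclideanSpace.proj (𝕜 := ℝ) i).continuous.comp continuous_subtype_val)
  exact h2.integrable_of_hasCompactSupport (HasCompactSupport.of_compactSpace _)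

theorem sphereFlux_sub_fields {U V : Euc n → Euc n} (hρ : 0 ≤ ρ)
    (hU : ContinuousOn U (exterior n ρ)) (hV : ContinuousOn V (exterior n ρ)) {r : ℝ} (hr : ρ < r) :
    sphereFlux (fun x => U x - V x) r = sphereFlux U r - sphereFlux V r := by
  rw [sphereFlux, sphereFlux, sphereFlux, ← mul_sub,
    ← integral_sub (integrable_sphere hρ hU hr) (integrable_sphere hρ hV hr)]
  simp only [PiLp.sub_apply, sub_mul, Finset.sum_sub_distrib]

/-- Functions decaying faster than `|x|^{-n}` are integrable at infinity. -/
theorem Dec.integrableOn {u : Euc n → ℝ} (hu : Dec q u) (hq : (n : ℝ) < q) {r : ℝ}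
    (hm : AEStronglyMeasurable u (volume.restrict (exterior n r))) :
    ∃ R, r ≤ R ∧ IntegrableOn u (exterior n R) := by
  obtain ⟨C, R, hC, hR, hb⟩ := hu.bound
  refine ⟨max r R, le_max_left _ _, ?_⟩
  have hs : exterior n (max r R) ⊆ exterior n r := exterior_subset (le_max_left r R)
  have h1 : Integrable (fun x : Euc n => C * 2 ^ q * (1 + ‖x‖) ^ (-q)) :=
    (integrable_one_add_norm (by simpa using hq)).const_mul _
  refine Integrable.mono' h1.integrableOn (hm.mono_measure (Measure.restrict_mono hs le_rfl)) ?_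
  filter_upwards [ae_restrict_mem (isOpen_exterior (n := n) _).measurableSet] with x hx
  have hRx : R ≤ ‖x‖ := ((le_max_right _ _).trans_lt hx).le
  have hx1 : 1 ≤ ‖x‖ := hR.trans hRx
  have hq0 : 0 ≤ q := (Nat.cast_nonneg n).trans hq.le
  refine (hb x hRx).trans ?_
  rw [mul_assoc]
  refine mul_le_mul_of_nonneg_left ?_ hC
  have e : (2 : ℝ) ^ q * (1 + ‖x‖) ^ (-q) = ((1 + ‖x‖) / 2) ^ (-q) := by
    rw [Real.div_rpow (by positivity) (by norm_num), Real.rpow_neg (by norm_num : (0 : ℝ) ≤ 2),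
      div_inv_eq_mul, mul_comm]
  rw [e]
  exact Real.rpow_le_rpow_of_nonpos (by positivity) (by linarith) (by linarith)

namespace IsAFDecay

variable (hd : IsAFDecay G τ) (hτ : 0 < τ)
include hd hτ

/-- A function differentiable at the identity matrix is Lipschitz at that point, so smooth
expressions in the coefficients approach their flat values at the same rate. -/
theorem comp_sub {φ : (Fin n → Fin n → ℝ) → ℝ}
    (hφ : ContDiffWithinAt ℝ 1 φ univ fun i j => (1 : Matrix (Fin n) (Fin n) ℝ) i j) :
    Dec τ fun x => φ (fun i j => G x i j) - φ fun i j => (1 : Matrix (Fin n) (Fin n) ℝ) i j := by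
  have h1 : (fun x => (fun i j => G x i j) - fun i j => (1 : Matrix (Fin n) (Fin n) ℝ) i j)
      =O[cobounded (Euc n)] fun x => ‖x‖ ^ (-τ) :=
    Asymptotics.isBigO_pi.2 fun i => Asymptotics.isBigO_pi.2 fun j => hd.coeff i j
  have h2 : Tendsto (fun x i j => G x i j) (cobounded (Euc n))
      (𝓝 fun i j => (1 : Matrix (Fin n) (Fin n) ℝ) i j) := by
    refine tendsto_pi_nhds.2 fun i => tendsto_pi_nhds.2 fun j => ?_
    exact tendsto_sub_nhds_zero_iff.1 ((hd.coeff i j).tendsto hτ)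
  have h3 := ((contDiffWithinAt_univ.1 hφ).differentiableAt one_ne_zero).hasFDerivAt
  exact (h3.isBigO_sub.comp_tendsto h2).trans h1

theorem inv_sub (i j : Fin n) :
    Dec τ fun x => (G x)⁻¹ i j - (1 : Matrix (Fin n) (Fin n) ℝ) i j := by
  have h := hd.comp_sub hτ (φ := fun A => (Matrix.of A)⁻¹ i j)
    (contDiffWithinAt_inv (A := fun A => Matrix.of A)
      (fun a b => (contDiff_apply_apply ℝ ℝ a b).contDiffWithinAt)
      (by simp : (1 : Matrix (Fin n) (Fin n) ℝ).det ≠ 0) i j)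
  have e : (1 : Matrix (Fin n) (Fin n) ℝ)⁻¹ i j = (1 : Matrix (Fin n) (Fin n) ℝ) i j := by
    rw [inv_one]
  refine h.congr (Eventually.of_forall fun x => ?_)
  rw [← e]
  rfl

theorem sqrt_det_sub : Dec τ fun x => Real.sqrt (G x).det - 1 := by
  have h0 : (1 : Matrix (Fin n) (Fin n) ℝ).det ≠ 0 := by simp
  have h := hd.comp_sub hτ (φ := fun A => Real.sqrt (Matrix.of A).det)
    ((contDiffWithinAt_det (A := fun A => Matrix.of A)
      (fun a b => (contDiff_apply_apply ℝ ℝ a b).contDiffWithinAt)).sqrt h0)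
  have e : Real.sqrt (1 : Matrix (Fin n) (Fin n) ℝ).det = 1 := by simp
  refine h.congr (Eventually.of_forall fun x => ?_)
  rw [← e]
  rfl

theorem inv_bdd (i j : Fin n) : Dec 0 fun x => (G x)⁻¹ i j := by
  refine (((hd.inv_sub hτ i j).mono hτ.le).add (Dec.const ((1 : Matrix (Fin n) (Fin n) ℝ) i j))).congr
    (Eventually.of_forall fun x => ?_)
  simp only [sub_add_cancel]

theorem christoffel_dec (k i j : Fin n) : Dec (τ + 1) (christoffel univ G k i j) :=
  (Dec.sum fun l _ => (hd.inv_bdd hτ k l).bdd_mul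
    (((hd.deriv j l i).add (hd.deriv i l j)).sub (hd.deriv i j l))).const_mul _

/-- Replacing the inverse metric by the identity costs a factor `O(|x|^{-τ})` on terms that are
already `O(|x|^{-τ-1})`. -/
theorem christoffel_sub (k i j : Fin n) : Dec (2 * τ + 1) fun x => christoffel univ G k i j x -
    (1 / 2 : ℝ) * (partialD univ (fun y => G y j k) i x + partialD univ (fun y => G y i k) j x
      - partialD univ (fun y => G y i j) k x) := by
  have h := (Dec.sum fun l (_ : l ∈ Finset.univ) => (hd.inv_sub hτ k l).mul
    (((hd.deriv j l i).add (hd.deriv i l j)).sub (hd.deriv i j l))).const_mul (1 / 2 : ℝ)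
  rw [show τ + (τ + 1) = 2 * τ + 1 by ring] at h
  refine h.congr (Eventually.of_forall fun x => ?_)
  simp only [christoffel, sub_mul, Finset.sum_sub_distrib, Matrix.one_apply, ite_mul, one_mul,
    zero_mul, Finset.sum_ite_eq, Finset.mem_univ, if_true]
  ring

omit hτ in
theorem deriv_inv (hτ : 0 < τ) (hG : SmoothMetricOn G (exterior n ρ)) (i j k : Fin n) :
    Dec (τ + 1) (partialD univ (fun y => (G y)⁻¹ i j) k) := by
  have h := (Dec.sum fun b (_ : b ∈ Finset.univ) => (Dec.sum fun a (_ : a ∈ Finset.univ) =>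
    (hd.inv_bdd hτ i a).bdd_mul (hd.deriv a b k)).mul_bdd (hd.inv_bdd hτ b j)).neg
  refine h.congr ?_
  filter_upwards [eventually_lt_norm ρ] with x hx
  have := fderiv_inv_apply (A := G) (x := x) (fun i j => (hG.contDiffAt hx i j).of_le (by simp))
    (hG.metric x hx).det_pos.ne' (stdVec k) i j
  simp only [partialD, fderivWithin_univ, this, Matrix.mul_apply, Matrix.of_apply]

end IsAFDecay

/-- The vector field `∂_j G_{ij} - ∂_i G_{jj}`. -/
def admVec (G : Euc n → Matrix (Fin n) (Fin n) ℝ) (x : Euc n) : Euc n :=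
  WithLp.toLp 2 fun i => ∑ j, (partialD univ (fun y => G y i j) j x
      - partialD univ (fun y => G y j j) i x)

theorem admFlux_eq (r : ℝ) : admFlux G r = admConst n * sphereFlux (admVec G) r := by
  simp only [admFlux, sphereFlux, admVec, Finset.sum_mul]

/-- The vector field `G^{jk} Γ^i_{jk} - G^{ik} Γ^j_{jk}`. -/
def curvVec (G : Euc n → Matrix (Fin n) (Fin n) ℝ) (x : Euc n) : Euc n :=
  WithLp.toLp 2 fun i => ∑ j, ∑ k, ((G x)⁻¹ j k * christoffel univ G i j k x
    - (G x)⁻¹ i k * christoffel univ G j j k x)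

theorem SmoothMetricOn.contDiffOn_admVec (hG : SmoothMetricOn G (exterior n ρ)) :
    ContDiffOn ℝ ∞ (admVec G) (exterior n ρ) := by
  have h1 : ∀ i j k, ContDiffOn ℝ ∞ (partialD univ (fun y => G y i j) k) (exterior n ρ) := by
    intro i j k
    refine (((hG.smooth i j).fderiv_of_isOpen hG.isOpen (m := ∞) (by simp)).clm_apply
      (contDiffOn_const (c := stdVec k))).congr fun x _ => ?_
    rw [partialD, fderivWithin_univ]
  have h2 : ∀ i, ContDiffOn ℝ ∞ (fun x => ∑ j, (partialD univ (fun y => G y i j) j x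
      - partialD univ (fun y => G y j j) i x)) (exterior n ρ) := fun i =>
    ContDiffOn.sum fun j _ => (h1 i j j).sub (h1 j j i)
  exact contDiffOn_euclidean.2 h2

theorem SmoothMetricOn.contDiffOn_curvVec (hG : SmoothMetricOn G (exterior n ρ)) :
    ContDiffOn ℝ ∞ (curvVec G) (exterior n ρ) := by
  have h2 : ∀ i, ContDiffOn ℝ ∞ (fun x => ∑ j, ∑ k, ((G x)⁻¹ j k * christoffel univ G i j k x
    - (G x)⁻¹ i k * christoffel univ G j j k x)) (exterior n ρ) := fun i => ContDiffOn.sum fun j _ => ContDiffOn.sum fun k _ => fun x hx =>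
    (((hG.contDiffAt_inv hx j k).mul (hG.contDiffAt_christoffel hx i j k)).sub
      ((hG.contDiffAt_inv hx i k).mul (hG.contDiffAt_christoffel hx j j k))).contDiffWithinAt
  exact contDiffOn_euclidean.2 h2

/-- Index bookkeeping for `R - div`: here `a` and `γ` stand for the inverse metric and the
Christoffel symbols, `a'` and `γ'` for their derivatives, and `c` for the quadratic part of the
Ricci tensor. All terms with `γ'` cancel. -/
theorem sum_curvature_identity {ι : Type*} [Fintype ι] (a : ι → ι → ℝ) (a' γ c : ι → ι → ι → ℝ)
    (γ' : ι → ι → ι → ι → ℝ) :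
    ∑ j, ∑ k, a j k * ∑ i, (γ' i i j k - γ' j i i k + c i j k) -
      ∑ i, ∑ j, ∑ k, (a j k * γ' i i j k + γ i j k * a' i j k -
        (a i k * γ' i j j k + γ j j k * a' i i k)) =
    ∑ i, ∑ j, ∑ k, (a j k * c i j k - γ i j k * a' i j k + γ j j k * a' i i k) := by
  have e1 : ∑ j, ∑ k, ∑ i, a j k * γ' i i j k = ∑ i, ∑ j, ∑ k, a j k * γ' i i j k :=
    (Finset.sum_congr rfl fun j _ => Finset.sum_comm).trans Finset.sum_comm
  have e2 : ∑ j, ∑ k, ∑ i, a j k * γ' j i i k = ∑ i, ∑ j, ∑ k, a i k * γ' i j j k :=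
    Finset.sum_congr rfl fun j _ => Finset.sum_comm
  have e3 : ∑ j, ∑ k, ∑ i, a j k * c i j k = ∑ i, ∑ j, ∑ k, a j k * c i j k :=
    (Finset.sum_congr rfl fun j _ => Finset.sum_comm).trans Finset.sum_comm
  simp only [Finset.mul_sum, mul_add, mul_sub, Finset.sum_add_distrib, Finset.sum_sub_distrib,
    e1, e2, e3]
  ring

theorem SmoothMetricOn.diverg_curvVec (hG : SmoothMetricOn G (exterior n ρ))
    (hx : x ∈ exterior n ρ) :
    diverg (curvVec G) x = ∑ i, ∑ j, ∑ k,
      ((G x)⁻¹ j k * partialD univ (christoffel univ G i j k) i x +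
        christoffel univ G i j k x * partialD univ (fun y => (G y)⁻¹ j k) i x -
      ((G x)⁻¹ i k * partialD univ (christoffel univ G j j k) i x +
        christoffel univ G j j k x * partialD univ (fun y => (G y)⁻¹ i k) i x)) := by
  have ha : ∀ j k, HasFDerivAt (fun y => (G y)⁻¹ j k) (fderiv ℝ (fun y => (G y)⁻¹ j k) x) x :=
    fun j k => ((hG.contDiffAt_inv hx j k).differentiableAt (by simp)).hasFDerivAt
  have hb : ∀ i j k, HasFDerivAt (christoffel univ G i j k)
      (fderiv ℝ (christoffel univ G i j k) x) x :=
    fun i j k => ((hG.contDiffAt_christoffel hx i j k).differentiableAt (by simp)).hasFDerivAt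
  refine Finset.sum_congr rfl fun i _ => ?_
  have := HasFDerivAt.fun_sum fun j (_ : j ∈ Finset.univ) => HasFDerivAt.fun_sum
    fun k (_ : k ∈ Finset.univ) => ((ha j k).mul (hb i j k)).sub ((ha i k).mul (hb j j k))
  rw [partialD, fderivWithin_univ]
  refine (congrArg (fun L : Euc n →L[ℝ] ℝ => L (stdVec i)) this.fderiv).trans ?_
  simp [partialD, fderivWithin_univ]

section

variable (hd : IsAFDecay G τ) (hτ : 0 < τ) (hG : SmoothMetricOn G (exterior n ρ))
include hd hτ hG

/-- The second-order part of the scalar curvature is a divergence; what is left is quadratic in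
first derivatives of the metric, each of order `τ + 1`. -/
theorem IsAFDecay.scalarCoeff_sub_diverg :
    Dec (2 * τ + 2) fun x => scalarCoeff univ G x - diverg (curvVec G) x := by
  have hΓ := hd.christoffel_dec hτ
  have hQ : Dec (τ + 1 + (τ + 1)) fun x => ∑ i, ∑ j, ∑ k, ((G x)⁻¹ j k *
      (∑ p, (christoffel univ G i i p x * christoffel univ G p j k x
        - christoffel univ G i j p x * christoffel univ G p i k x))
      - christoffel univ G i j k x * partialD univ (fun y => (G y)⁻¹ j k) i x
      + christoffel univ G j j k x * partialD univ (fun y => (G y)⁻¹ i k) i x) :=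
    Dec.sum fun i _ => Dec.sum fun j _ => Dec.sum fun k _ =>
      (((hd.inv_bdd hτ j k).bdd_mul (Dec.sum fun p _ => ((hΓ i i p).mul (hΓ p j k)).sub
        ((hΓ i j p).mul (hΓ p i k)))).sub ((hΓ i j k).mul (hd.deriv_inv hτ hG j k i))).add
        ((hΓ j j k).mul (hd.deriv_inv hτ hG i k i))
  rw [show τ + 1 + (τ + 1) = 2 * τ + 2 by ring] at hQ
  refine hQ.congr ?_
  filter_upwards [eventually_lt_norm ρ] with x hx
  rw [hG.diverg_curvVec hx]
  exact (sum_curvature_identity (fun j k => (G x)⁻¹ j k)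
    (fun i j k => partialD univ (fun y => (G y)⁻¹ j k) i x)
    (fun i j k => christoffel univ G i j k x) _
    (fun l i j k => partialD univ (christoffel univ G i j k) l x)).symm

/-- To leading order the inverse metric is the identity and the Christoffel symbols are the linear
Koszul expressions, for which the two fields coincide. -/
theorem IsAFDecay.curvVec_sub (i : Fin n) :
    Dec (2 * τ + 1) fun x => (curvVec G x - admVec G x) i := by
  have hΓ := hd.christoffel_dec hτ
  have h1 : Dec (τ + (τ + 1)) fun x => ∑ j, ∑ k,
      (((G x)⁻¹ j k - (1 : Matrix (Fin n) (Fin n) ℝ) j k) * christoffel univ G i j k x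
      - ((G x)⁻¹ i k - (1 : Matrix (Fin n) (Fin n) ℝ) i k) * christoffel univ G j j k x) :=
    Dec.sum fun j _ => Dec.sum fun k _ => ((hd.inv_sub hτ j k).mul (hΓ i j k)).sub
      ((hd.inv_sub hτ i k).mul (hΓ j j k))
  rw [show τ + (τ + 1) = 2 * τ + 1 by ring] at h1
  have h2 := Dec.sum fun j (_ : j ∈ Finset.univ) =>
    (hd.christoffel_sub hτ i j j).sub (hd.christoffel_sub hτ j j i)
  refine (h1.add h2).congr ?_
  filter_upwards [eventually_lt_norm ρ] with x hx
  have hs : ∀ j k, partialD univ (fun y => G y j i) k x = partialD univ (fun y => G y i j) k x :=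
    fun j k => hG.partialD_symm hx j i k
  simp only [curvVec, admVec, PiLp.sub_apply]
  rw [← Finset.sum_add_distrib, ← Finset.sum_sub_distrib]
  refine Finset.sum_congr rfl fun j _ => ?_
  simp only [sub_mul, Finset.sum_sub_distrib, Matrix.one_apply, ite_mul, one_mul,
    zero_mul, Finset.sum_ite_eq, Finset.mem_univ, if_true, hs]
  ring

/-- The ADM mass of an asymptotically flat metric with integrable scalar curvature exists. -/
theorem IsAFDecay.exists_hasADMMass [NeZero n] (hρ : 0 ≤ ρ) (hτn : ((n : ℝ) - 2) / 2 < τ) {r : ℝ}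
    (hr : ρ ≤ r)
    (hR : IntegrableOn (fun x => Real.sqrt (G x).det * scalarCoeff univ G x) (exterior n r)) :
    ∃ m, Tendsto (sphereFlux (admVec G)) atTop (𝓝 m) := by
  have hdetc : ContinuousOn (fun x => Real.sqrt (G x).det) (exterior n ρ) := fun x hx => by
    have := contDiffWithinAt_det fun i j => (hG.contDiffAt hx i j).contDiffWithinAt (s := univ)
    exact (this.sqrt (hG.metric x hx).det_pos.ne').continuousWithinAt.mono (subset_univ _)
  have hpos : ∀ x ∈ exterior n ρ, Real.sqrt (G x).det ≠ 0 := fun x hx =>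
    (Real.sqrt_pos.2 (hG.metric x hx).det_pos).ne'
  have hU := hG.contDiffOn_curvVec
  have hU1 : ContDiffOn ℝ 1 (curvVec G) (exterior n ρ) := hU.of_le (by simp)
  have hdivc := continuousOn_diverg hU1
  -- The volume density tends to `1`, so far out it is bounded below and integrability for the
  -- Riemannian measure passes to Lebesgue measure.
  obtain ⟨R₁, hR₁⟩ : ∃ R₁, ∀ x : Euc n, R₁ ≤ ‖x‖ → 1 / 2 < Real.sqrt (G x).det := by
    have h1 : Tendsto (fun x => Real.sqrt (G x).det) (cobounded (Euc n)) (𝓝 1) :=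
      tendsto_sub_nhds_zero_iff.1 ((hd.sqrt_det_sub hτ).tendsto hτ)
    have h2 := h1.eventually (lt_mem_nhds (show (1 / 2 : ℝ) < 1 by norm_num))
    rw [← comap_norm_atTop, eventually_comap, eventually_atTop] at h2
    obtain ⟨R, hR⟩ := h2
    exact ⟨R, fun x hx => hR _ hx x rfl⟩
  set r₁ := max r R₁
  have hs1 : exterior n r₁ ⊆ exterior n r := exterior_subset (le_max_left r R₁)
  have hs2 : exterior n r₁ ⊆ exterior n ρ := fun x hx => hr.trans_lt (hs1 hx)
  have hm1 := (isOpen_exterior (n := n) r₁).measurableSet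
  have hscal : IntegrableOn (scalarCoeff univ G) (exterior n r₁) := by
    have hc : AEStronglyMeasurable (fun x => (Real.sqrt (G x).det)⁻¹)
        (volume.restrict (exterior n r₁)) :=
      ((hdetc.mono hs2).inv₀ fun x hx => hpos x (hs2 hx)).aestronglyMeasurable hm1
    have := Integrable.bdd_mul (c := 2) (hR.mono_set hs1) hc (by
      filter_upwards [ae_restrict_mem hm1] with x hx
      have := hR₁ x ((le_max_right _ _).trans_lt hx).le
      rw [Real.norm_of_nonneg (by positivity), inv_le_comm₀ (by linarith) (by norm_num)]
      linarith)
    refine IntegrableOn.congr_fun this (fun x hx => ?_) hm1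
    rw [inv_mul_cancel_left₀ (hpos x (hs2 hx))]
  -- Here `τ > (n - 2) / 2` enters as `2τ + 2 > n`. The divergence is then integrable, so the fluxes
  -- converge.
  obtain ⟨R₂, hR₂, hQ⟩ := (hd.scalarCoeff_sub_diverg hτ hG).integrableOn (by linarith) (r := r₁)
    (hscal.aestronglyMeasurable.sub ((hdivc.mono hs2).aestronglyMeasurable hm1))
  have hs3 : exterior n R₂ ⊆ exterior n r₁ := fun x hx => hR₂.trans_lt hx
  have hdiv : IntegrableOn (diverg (curvVec G)) (exterior n R₂) := by
    refine ((hscal.mono_set hs3).sub hQ).congr (Eventually.of_forall fun x => ?_)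
    simp only [Pi.sub_apply, sub_sub_cancel]
  have hlim : Tendsto (fun b => ∫ x in {x : Euc n | R₂ + 1 < ‖x‖ ∧ ‖x‖ ≤ b},
      diverg (curvVec G) x) atTop (𝓝 (∫ x in ⋃ b : ℝ, {x : Euc n | R₂ + 1 < ‖x‖ ∧ ‖x‖ ≤ b},
      diverg (curvVec G) x)) := by
    refine tendsto_setIntegral_of_monotone (fun b => ?_) (fun b c hbc x hx => ⟨hx.1, hx.2.trans hbc⟩)
      (hdiv.mono_set ?_)
    · exact (measurableSet_lt measurable_const measurable_norm).inter
        (measurableSet_le measurable_norm measurable_const)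
    · exact iUnion_subset fun b x hx => (lt_add_one _).trans hx.1
  have hρ2 : ρ < R₂ + 1 := by
    have : r ≤ r₁ := le_max_left _ _
    linarith
  set l := ∫ x in ⋃ b : ℝ, {x : Euc n | R₂ + 1 < ‖x‖ ∧ ‖x‖ ≤ b}, diverg (curvVec G) x
  have hUlim : Tendsto (sphereFlux (curvVec G)) atTop
      (𝓝 (l + sphereFlux (curvVec G) (R₂ + 1))) := by
    refine (hlim.add_const _).congr' ?_
    filter_upwards [eventually_ge_atTop (R₂ + 1)] with b hb
    rw [← (sphereFlux_sub hρ hU1 hρ2 hb).2]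
    ring
  -- The same bound in the form `2τ + 1 > n - 1`.
  have hzero := tendsto_sphereFlux_zero (NeZero.one_le (n := n)) (hd.curvVec_sub hτ hG) (by linarith)
  refine ⟨_, (hUlim.sub hzero).congr' ?_⟩
  filter_upwards [eventually_gt_atTop ρ] with b hb
  rw [sphereFlux_sub_fields hρ hU.continuousOn hG.contDiffOn_admVec.continuousOn hb]
  ring

end

end ADM

/-! ### The flux field at infinity -/

section GraphEnd

variable {n : ℕ} {τ ρ : ℝ} {G H : Euc n → Matrix (Fin n) (Fin n) ℝ} {U' : Set (Euc n)}
  {π ν : Euc n → Euc n} {u θ : Euc n → ℝ} {x : Euc n}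

/-- The hypersurface `(π, u)` is the graph of `u` over `{|x| > ρ}`, with the decay conditions. -/
structure IsGraphEnd (τ ρ : ℝ) (G H : Euc n → Matrix (Fin n) (Fin n) ℝ) (U' : Set (Euc n))
    (π : Euc n → Euc n) (u : Euc n → ℝ) (ν : Euc n → Euc n) (θ : Euc n → ℝ) : Prop where
  hyp : IsHypWithin G H (exterior n ρ) U' π u ν θ
  proj : ∀ x ∈ exterior n ρ, π x = x
  pos : 0 < τ
  decay : IsAFDecay H τ
  first : ∀ i, Dec (τ / 2) (partialD univ u i)
  second : ∀ i j, Dec (τ / 2 + 1) (partialD univ (partialD univ u i) j)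
  angle : Tendsto θ (cobounded (Euc n)) (𝓝 1)

namespace IsGraphEnd

variable (A : IsGraphEnd τ ρ G H U' π u ν θ)
include A

theorem fderivWithin_proj (hx : x ∈ exterior n ρ) :
    fderivWithin ℝ π (exterior n ρ) x = ContinuousLinearMap.id ℝ _ := by
  rw [fderivWithin_congr A.proj (A.proj x hx)]
  exact fderivWithin_fun_id (A.hyp.uniq x hx)

theorem fderivWithin_height (hx : x ∈ exterior n ρ) (i : Fin n) :
    fderivWithin ℝ u (exterior n ρ) x (stdVec i) = partialD univ u i x := by
  rw [partialD, fderivWithin_univ, fderivWithin_of_isOpen (isOpen_exterior ρ) hx]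

theorem contDiffAt_height (hx : x ∈ exterior n ρ) : ContDiffAt ℝ ∞ u x :=
  (A.hyp.smooth_u).contDiffAt ((isOpen_exterior ρ).mem_nhds hx)

theorem snd_height (hx : x ∈ exterior n ρ) (i j : Fin n) :
    partialD univ (partialD univ u i) j x = fderiv ℝ (fderiv ℝ u) x (stdVec j) (stdVec i) := by
  have h1 : DifferentiableAt ℝ (fderiv ℝ u) x :=
    ((A.contDiffAt_height hx).fderiv_right (m := 1) one_add_one_le_smooth).differentiableAt (by simp)
  have e : partialD univ u i = fun y => fderiv ℝ u y (stdVec i) := by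
    funext y; rw [partialD, fderivWithin_univ]
  rw [e, partialD, fderivWithin_univ, fderiv_clm_apply h1 (differentiableAt_const _)]
  simp

theorem snd_height_symm (hx : x ∈ exterior n ρ) (i j : Fin n) :
    partialD univ (partialD univ u i) j x = partialD univ (partialD univ u j) i x := by
  rw [A.snd_height hx, A.snd_height hx,
    (isSymmSndFDerivAt_of_two ((A.contDiffAt_height hx).of_le two_le_smooth)).eq]

theorem mem_target (hx : x ∈ exterior n ρ) : x ∈ U' := A.proj x hx ▸ A.hyp.maps hx

theorem metric_eq (hx : x ∈ exterior n ρ) (i j : Fin n) :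
    G x i j = H x i j + partialD univ u i x * partialD univ u j x := by
  have h1 := (A.hyp.point x hx).isometric (stdVec i) (stdVec j)
  rw [A.fderivWithin_proj hx, A.fderivWithin_height hx, A.fderivWithin_height hx,
    A.proj x hx] at h1
  simpa using h1

theorem partialD_metric (hx : x ∈ exterior n ρ) (i j k : Fin n) :
    partialD univ (fun y => G y i j) k x = partialD univ (fun y => H y i j) k x +
      (partialD univ u i x * partialD univ (partialD univ u j) k x +
        partialD univ u j x * partialD univ (partialD univ u i) k x) := by
  have hu : ∀ i, DifferentiableAt ℝ (partialD univ u i) x := fun i => by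
    have e : partialD univ u i = fun y => fderiv ℝ u y (stdVec i) := by
      funext y; rw [partialD, fderivWithin_univ]
    rw [e]
    exact (((A.contDiffAt_height hx).fderiv_right (m := 1) one_add_one_le_smooth).differentiableAt
      (by simp)).clm_apply (differentiableAt_const _)
  have hH := (A.hyp.smoothH.contDiffAt (A.mem_target hx) i j).differentiableAt (by simp)
  have e : (fun y => G y i j) =ᶠ[𝓝 x]
      fun y => H y i j + partialD univ u i y * partialD univ u j y := by
    filter_upwards [(isOpen_exterior ρ).mem_nhds hx] with y hy using A.metric_eq hy i j
  have h1 := e.fderiv_eq.trans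
    (hH.hasFDerivAt.add ((hu i).hasFDerivAt.mul (hu j).hasFDerivAt)).fderiv
  rw [partialD, fderivWithin_univ, h1]
  simp only [add_apply, smul_apply, smul_eq_mul]
  simp only [partialD, fderivWithin_univ]

/-- The metric of the graph is `h + df ⊗ df`; a product of two derivatives of order `τ / 2` has
order `τ`, which explains the decay imposed on `f`. -/
theorem isAFDecay : IsAFDecay G τ := by
  constructor
  · intro i j
    have h1 := (A.first i).mul (A.first j)
    rw [add_halves] at h1
    refine ((A.decay.coeff i j).add h1).congr ?_
    filter_upwards [eventually_lt_norm ρ] with x hx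
    rw [A.metric_eq hx]
    ring
  · intro i j k
    have h1 := ((A.first i).mul (A.second j k)).add ((A.first j).mul (A.second i k))
    rw [show τ / 2 + (τ / 2 + 1) = τ + 1 by ring] at h1
    refine ((A.decay.deriv i j k).add h1).congr ?_
    filter_upwards [eventually_lt_norm ρ] with x hx using (A.partialD_metric hx i j k).symm

/-- `|∇u|² = 1 - θ²` has order `τ`. Since `θ → 1`, the factor `1 + θ` stays away from zero and can
be divided out. -/
theorem angle_sub : Dec τ fun x => θ x - 1 := by
  have h1 : Dec (0 + (τ / 2 + τ / 2)) fun x => ∑ i, ∑ j,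
      (G x)⁻¹ i j * (partialD univ u j x * partialD univ u i x) :=
    Dec.sum fun i _ => Dec.sum fun j _ => (A.isAFDecay.inv_bdd A.pos i j).mul
      ((A.first j).mul (A.first i))
  rw [add_halves, zero_add] at h1
  have h2 : Tendsto (fun x => (1 + θ x)⁻¹) (cobounded (Euc n)) (𝓝 (1 + 1)⁻¹) :=
    (A.angle.const_add 1).inv₀ (by norm_num)
  refine (h1.mul_bdd (Dec.of_tendsto h2)).neg.congr ?_
  filter_upwards [eventually_lt_norm ρ, A.angle.eventually (lt_mem_nhds zero_lt_one)] with x hx hθ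
  have h3 := (A.hyp.point x hx).vertical_split.2
  simp only [A.fderivWithin_height hx] at h3
  have h4 : ∑ i, ∑ j, (G x)⁻¹ i j * (partialD univ u j x * partialD univ u i x) =
      1 - θ x * θ x := by
    rw [← h3]
    conv_rhs => rw [eq_sum_stdVec (sharp (G x) fun i => partialD univ u i x)]
    simp only [map_sum, map_smul, smul_eq_mul, A.fderivWithin_height hx, sharp_apply,
      Finset.sum_mul, mul_assoc]
  rw [h4]
  have : 1 + θ x ≠ 0 := by linarith
  field_simp
  ring

/-- With the projection equal to the identity, orthogonality gives `-θ du` as the covector of the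
horizontal part of the normal; hence the second fundamental form is `θ` times the `h`-Hessian of the
height. -/
theorem sffMatrix_eq (hx : x ∈ exterior n ρ) (i j : Fin n) :
    sffMatrix (exterior n ρ) H π u (ν x) (θ x) x i j =
      θ x * (partialD univ (partialD univ u i) j x -
        ∑ k, christoffel univ H k i j x * partialD univ u k x) := by
  have ho := isOpen_exterior (n := n) ρ
  have h1 : fderivWithin ℝ (fderivWithin ℝ π (exterior n ρ)) (exterior n ρ) x = 0 := by
    rw [fderivWithin_congr (fun y hy => A.fderivWithin_proj hy) (A.fderivWithin_proj hx)]
    exact congrFun (fderivWithin_const _) x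
  have h2 : fderivWithin ℝ (fderivWithin ℝ u (exterior n ρ)) (exterior n ρ) x (stdVec i)
      (stdVec j) = partialD univ (partialD univ u i) j x := by
    rw [fderivWithin_congr (fun y hy => fderivWithin_of_isOpen ho hy) (fderivWithin_of_isOpen ho hx),
      fderivWithin_of_isOpen ho hx, A.snd_height_symm hx, A.snd_height hx]
  have hp := A.hyp.point x hx
  have h3 : ∀ k, bil (H x) (stdVec k) (ν x) = - (θ x * partialD univ u k x) := fun k => by
    have := hp.orth (stdVec k)
    rw [A.fderivWithin_proj hx, A.fderivWithin_height hx, A.proj x hx] at this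
    have hs := hp.metricH.bil_comm (ν x) (stdVec k)
    rw [A.proj x hx] at hs
    rw [← hs]
    simp only [ContinuousLinearMap.id_apply] at this
    linarith
  rw [sffMatrix, Matrix.of_apply, secondForm, h1, h2, A.fderivWithin_proj hx, A.proj x hx,
    eq_sum_stdVec (chr H x (ContinuousLinearMap.id ℝ _ (stdVec i))
      (ContinuousLinearMap.id ℝ _ (stdVec j)))]
  simp only [zero_apply, zero_add, ContinuousLinearMap.id_apply, chr_stdVec, map_sum, map_smul,
    sum_apply, smul_apply, smul_eq_mul, h3]
  rw [mul_sub, Finset.mul_sum, sub_eq_add_neg, ← Finset.sum_neg_distrib, add_comm]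
  congr 1
  · ring
  · exact Finset.sum_congr rfl fun k _ => by ring

/-- Both corrections to the Euclidean Hessian, the angle and the Christoffel terms, are smaller by a
factor of order `τ`. -/
theorem sff_sub (i j : Fin n) :
    Dec (τ + (τ / 2 + 1)) fun x => sffMatrix (exterior n ρ) H π u (ν x) (θ x) x i j -
      partialD univ (partialD univ u i) j x := by
  have h1 := A.angle_sub.mul (A.second i j)
  have h2 := Dec.sum fun k (_ : k ∈ Finset.univ) =>
    (A.decay.christoffel_dec A.pos k i j).mul (A.first k)
  rw [show τ + 1 + τ / 2 = τ + (τ / 2 + 1) by ring] at h2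
  refine (h1.sub ((Dec.of_tendsto A.angle).bdd_mul h2)).congr ?_
  filter_upwards [eventually_lt_norm ρ] with x hx
  rw [A.sffMatrix_eq hx]
  ring

theorem sff_dec (i j : Fin n) :
    Dec (τ / 2 + 1) fun x => sffMatrix (exterior n ρ) H π u (ν x) (θ x) x i j := by
  refine (((A.sff_sub i j).mono (by linarith [A.pos])).add (A.second i j)).congr
    (Eventually.of_forall fun x => ?_)
  simp only [sub_add_cancel]

-- Written as a triple sum in which the components of the form and of `du` occur antisymmetrically,
-- so that it can be compared term by term with the ADM integrand.
omit A in
theorem newtonField_apply (P B : Matrix (Fin n) (Fin n) ℝ) (w : Fin n → ℝ) (i : Fin n) :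
    newtonField P B w i = ∑ k, ∑ j, ∑ l, P⁻¹ i k * P⁻¹ j l * (B j l * w k - B k j * w l) := by
  simp only [newtonField, sharp_apply, trB, bil_stdVec]
  simp only [sharp_apply, bil_stdVec_left, Finset.sum_mul,
    Finset.mul_sum, ← Finset.sum_sub_distrib]
  refine Finset.sum_congr rfl fun k _ => Finset.sum_congr rfl fun j _ =>
    Finset.sum_congr rfl fun l _ => ?_
  ring

/-- The flux field is asymptotic to the difference of the ADM integrands. -/
theorem flux_sub (i : Fin n) :
    Dec (2 * τ + 1) fun x => (Real.sqrt (G x).det •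
      fluxField G H (exterior n ρ) π u ν θ x - (admVec G x - admVec H x)) i := by
  have hG := A.isAFDecay
  set B : Fin n → Fin n → Euc n → ℝ := fun i j x =>
    sffMatrix (exterior n ρ) H π u (ν x) (θ x) x i j with hB
  set D : Fin n → Fin n → Euc n → ℝ := fun i j => partialD univ (partialD univ u i) j with hD
  set w : Fin n → Euc n → ℝ := fun i => partialD univ u i with hw
  let δ : Fin n → Fin n → ℝ := fun i j => (1 : Matrix (Fin n) (Fin n) ℝ) i j
  have hX : ∀ k j l, Dec (τ + 1) fun x => B j l x * w k x - B k j x * w l x := fun k j l => by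
    have := ((A.sff_dec j l).mul (A.first k)).sub ((A.sff_dec k j).mul (A.first l))
    rwa [show τ / 2 + 1 + τ / 2 = τ + 1 by ring] at this
  have hX0 : ∀ k j l, Dec (2 * τ + 1) fun x => (B j l x * w k x - B k j x * w l x) -
      (D j l x * w k x - D k j x * w l x) := fun k j l => by
    have := ((A.sff_sub j l).mul (A.first k)).sub ((A.sff_sub k j).mul (A.first l))
    rw [show τ + (τ / 2 + 1) + τ / 2 = 2 * τ + 1 by ring] at this
    refine this.congr (Eventually.of_forall fun x => ?_)
    simp only [hB, hD, hw]
    ring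
  -- The coefficients `√det G · G^{ik} G^{jl}` are replaced by their flat values, at the cost of one
  -- more factor of order `τ`.
  have hc : ∀ k j l, Dec τ fun x =>
      Real.sqrt (G x).det * ((G x)⁻¹ i k * (G x)⁻¹ j l) - δ i k * δ j l := fun k j l => by
    refine (((hG.sqrt_det_sub A.pos).mul_bdd ((hG.inv_bdd A.pos i k).bdd_mul
      (hG.inv_bdd A.pos j l))).add (((hG.inv_sub A.pos i k).mul_bdd (hG.inv_bdd A.pos j l)).add
      ((hG.inv_sub A.pos j l).const_mul (δ i k)))).congr (Eventually.of_forall fun x => ?_)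
    simp only [δ]
    ring
  have h1 : Dec (τ + (τ + 1)) fun x => ∑ k, ∑ j, ∑ l,
      (Real.sqrt (G x).det * ((G x)⁻¹ i k * (G x)⁻¹ j l) - δ i k * δ j l) *
        (B j l x * w k x - B k j x * w l x) :=
    Dec.sum fun k _ => Dec.sum fun j _ => Dec.sum fun l _ => (hc k j l).mul (hX k j l)
  rw [show τ + (τ + 1) = 2 * τ + 1 by ring] at h1
  have h2 : Dec (2 * τ + 1) fun x => ∑ k, ∑ j, ∑ l, (δ i k * δ j l) *
      ((B j l x * w k x - B k j x * w l x) - (D j l x * w k x - D k j x * w l x)) :=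
    Dec.sum fun k _ => Dec.sum fun j _ => Dec.sum fun l _ => (hX0 k j l).const_mul _
  refine (h1.add h2).congr ?_
  filter_upwards [eventually_lt_norm ρ] with x hx
  have e1 : Real.sqrt (G x).det * fluxField G H (exterior n ρ) π u ν θ x i =
      ∑ k, ∑ j, ∑ l, Real.sqrt (G x).det * ((G x)⁻¹ i k * (G x)⁻¹ j l) *
        (B j l x * w k x - B k j x * w l x) := by
    simp only [fluxField, newtonField_apply, A.fderivWithin_height hx, Finset.mul_sum, hB, hw,
      mul_assoc]
  -- This holds exactly, with no error term: `∂_j(u_i u_j) - ∂_i(u_j u_j) = u_{jj} u_i - u_{ij}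
  -- u_j`, which is the Euclidean flux field of the height.
  have e2 : (admVec G x - admVec H x) i =
      ∑ k, ∑ j, ∑ l, (δ i k * δ j l) * (D j l x * w k x - D k j x * w l x) := by
    simp only [δ, Matrix.one_apply, ite_mul, one_mul, zero_mul, Finset.sum_ite_eq,
      Finset.mem_univ, if_true, mul_ite, mul_one, mul_zero, Finset.sum_ite_irrel,
      Finset.sum_const_zero, admVec, PiLp.sub_apply]
    rw [← Finset.sum_sub_distrib]
    refine Finset.sum_congr rfl fun j _ => ?_
    rw [A.partialD_metric hx, A.partialD_metric hx, A.snd_height_symm hx j i]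
    simp only [hD, hw]
    ring
  rw [PiLp.sub_apply, PiLp.smul_apply, smul_eq_mul, e1, e2, ← Finset.sum_add_distrib,
    ← Finset.sum_sub_distrib]
  refine Finset.sum_congr rfl fun k _ => ?_
  rw [← Finset.sum_add_distrib, ← Finset.sum_sub_distrib]
  refine Finset.sum_congr rfl fun j _ => ?_
  rw [← Finset.sum_add_distrib, ← Finset.sum_sub_distrib]
  refine Finset.sum_congr rfl fun l _ => ?_
  ring

end IsGraphEnd

end GraphEnd

/-! ### The mass formula -/

section MassFormula

theorem SmoothMetricOn.continuousOn_scalarCoeff {d : ℕ} {G : Euc d → Matrix (Fin d) (Fin d) ℝ}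
    {s : Set (Euc d)} (hG : SmoothMetricOn G s) : ContinuousOn (scalarCoeff univ G) s := by
  have hΓ : ∀ k i j, ContDiffOn ℝ ∞ (christoffel univ G k i j) s := fun k i j x hx =>
    (hG.contDiffAt_christoffel hx k i j).contDiffWithinAt
  have hc := fun k i j => (hΓ k i j).continuousOn
  have hp : ∀ k i j l, ContinuousOn (partialD univ (christoffel univ G k i j) l) s := by
    intro k i j l
    refine (((hΓ k i j).continuousOn_fderiv_of_isOpen hG.isOpen (by simp)).clm_apply
      (continuousOn_const (c := stdVec l))).congr fun x _ => ?_
    rw [partialD, fderivWithin_univ]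
  have hi : ∀ i j, ContinuousOn (fun y => (G y)⁻¹ i j) s := fun i j x hx =>
    (hG.contDiffAt_inv hx i j).continuousAt.continuousWithinAt
  exact continuousOn_finsetSum _ fun j _ => continuousOn_finsetSum _ fun k _ => (hi j k).mul
    (continuousOn_finsetSum _ fun i _ => ((hp i j k i).sub (hp i i k j)).add
      (continuousOn_finsetSum _ fun p _ => ((hc i i p).mul (hc p j k)).sub
        ((hc i j p).mul (hc p i k))))

/-- Integrability of the scalar curvature in coordinates. -/
theorem IsMetricCoord.integrableOn_scalarCoeff {d : ℕ} {H : Type*} [TopologicalSpace H]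
    {I : ModelWithCorners ℝ (Euc d) H} {M : Type*} [TopologicalSpace M] [ChartedSpace H M]
    [IsManifold I ∞ M] [T2Space M] [SecondCountableTopology M] [MeasurableSpace M] [BorelSpace M]
    {g : SmoothMetric I M}
    {D : Set M} {τ : M → Euc d} {φ : Euc d → M} {s : Set (Euc d)}
    (hc : IsMetricCoord I (toField g) D τ (metricCoeff (toField g) s φ)) (hφ : IsParam I φ s)
    (hs : IsOpen s) (himg : τ '' D = s) (hinv : ∀ p ∈ D, φ (τ p) = p)
    (hfi : Integrable (scalarCurvature (toField g)) (riemannianVolume (toField g))) :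
    IntegrableOn (fun x => Real.sqrt (metricCoeff (toField g) s φ x).det *
      scalarCoeff univ (metricCoeff (toField g) s φ) x) s := by
  have hG := hφ.smoothMetricOn hs g
  have h1 := (hc.integral_eq (fieldBilin_toField g) (f := scalarCurvature (toField g))
    (b := scalarCoeff univ (metricCoeff (toField g) s φ)) ?_ ?_ ?_).1
  · rw [himg] at h1
    exact h1.1 hfi.integrableOn
  · rw [himg]
    intro x hx
    exact ((contDiffWithinAt_det fun i j => (hG.smooth i j) x hx).sqrt
      (hG.metric x hx).det_pos.ne').continuousWithinAt
  · rw [himg]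
    exact hG.continuousOn_scalarCoeff.aestronglyMeasurable hs.measurableSet
  · intro p hp
    rw [← hφ.scalarCurvature_eq hs (himg ▸ mem_image_of_mem τ hp) g, hinv p hp]

variable {n : ℕ} [NeZero n]
  {E : Type*} [TopologicalSpace E] [T2Space E] [SecondCountableTopology E]
  [ChartedSpace (Euc n) E] [IsManifold (𝓡 n) ∞ E] [MeasurableSpace E] [BorelSpace E]
  {M : Type*} [TopologicalSpace M] [T2Space M] [SecondCountableTopology M]
  [ChartedSpace (EuclideanHalfSpace n) M] [IsManifold (𝓡∂ n) ∞ M]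
  [MeasurableSpace M] [BorelSpace M]
  {h : SmoothMetric (𝓡 n) E}
  {g : SmoothMetric (𝓡∂ n) M}
  {Ψ : OpenPartialHomeomorph (Euc n) E} {Iv : Set ℝ} {F : M → E × ℝ}
  {N : ∀ p : M, TangentSpace ((𝓡 n).prod 𝓘(ℝ, ℝ)) (F p)} {ρ : ℝ} {Φ : Euc n → M} {f : Euc n → ℝ}

theorem SmoothCoord.isMetricCoord (hΨ : SmoothCoord Ψ) :
    IsMetricCoord (𝓡 n) (toField h) Ψ.target Ψ.symm (metricCoeff (toField h) Ψ.source Ψ) where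
  meas := Ψ.open_target.measurableSet
  inj := Ψ.symm.injOn
  diff := fun p hp => hΨ.mdiff_symm hp
  metric := fun p hp a b => by
    rw [← tD_of_mem_nhds (Ψ.open_target.mem_nhds hp)]
    exact (hΨ.bil_metricCoeff (fieldBilin_toField h) hp a b).symm

theorem IsAsymptoticallyFlat.smoothMetricOn (hE : IsAsymptoticallyFlat (toField h) Ψ) :
    SmoothMetricOn (metricCoeff (toField h) (exterior n 1) Ψ) (exterior n 1) := by
  rw [← hE.source_eq]
  exact hE.smoothCoord.isParam.smoothMetricOn Ψ.open_source h

theorem IsAsymptoticallyFlat.integrableOn_scalarCoeff (hE : IsAsymptoticallyFlat (toField h) Ψ) :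
    IntegrableOn (fun x => Real.sqrt (metricCoeff (toField h) (exterior n 1) Ψ x).det *
      scalarCoeff univ (metricCoeff (toField h) (exterior n 1) Ψ) x) (exterior n 1) := by
  rw [← hE.source_eq]
  exact hE.smoothCoord.isMetricCoord.integrableOn_scalarCoeff hE.smoothCoord.isParam Ψ.open_source
    Ψ.symm.image_source_eq_target (fun p hp => Ψ.right_inv hp) hE.integrable_scalar

namespace IsAFHypersurface

variable (hM : IsAFHypersurface (toField h) Ψ Iv (toField g) F N ρ Φ f)
  (hE : IsAsymptoticallyFlat (toField h) Ψ)
include hM hE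

theorem integrableOn_scalarCoeff :
    IntegrableOn (fun x => Real.sqrt (metricCoeff (toField g) (exterior n ρ) Φ x).det *
      scalarCoeff univ (metricCoeff (toField g) (exterior n ρ) Φ) x) (exterior n ρ) := by
  refine (hM.isMetricCoord_end hE le_rfl).integrableOn_scalarCoeff (hM.isParam hE)
    (isOpen_exterior ρ) (hM.image_endCoord hE le_rfl) ?_ hM.integrable_scalar
  rintro _ ⟨x, hx, rfl⟩
  rw [hM.endCoord_apply hE hx]

/-- The metric of `E` and the function `f` come with their own decay exponents; the minimum serves
both, and it is positive because `n ≥ 3`. -/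
theorem isGraphEnd (hn : 3 ≤ n) : ∃ τ : ℝ, ((n : ℝ) - 2) / 2 < τ ∧
    IsGraphEnd τ ρ (metricCoeff (toField g) (exterior n ρ) Φ)
      (metricCoeff (toField h) (exterior n 1) Ψ) (exterior n 1) (coordProj Ψ F Φ)
      (coordHeight F Φ) (coordNormal Ψ F N Φ) (coordAngle F N Φ) := by
  obtain ⟨τ₁, hτ₁, hd⟩ := hE.exists_isAFDecay
  obtain ⟨τ₂, hτ₂, h1, h2⟩ := hM.decay
  have hn' : (3 : ℝ) ≤ n := by exact_mod_cast hn
  have hu : ∀ x ∈ exterior n ρ, f =ᶠ[𝓝 x] coordHeight F Φ := fun x hx => by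
    filter_upwards [(isOpen_exterior ρ).mem_nhds hx] with y hy
    rw [coordHeight, hM.graph y hy]
  have hu1 : ∀ i, ∀ x ∈ exterior n ρ,
      partialD univ f i x = partialD univ (coordHeight F Φ) i x := fun i x hx =>
    partialD_congr univ_mem (hu x hx) i
  have hu2 : ∀ i j, ∀ x ∈ exterior n ρ, partialD univ (fun y => partialD univ f i y) j x =
      partialD univ (partialD univ (coordHeight F Φ) i) j x := fun i j x hx => by
    refine partialD_congr univ_mem ?_ j
    filter_upwards [(isOpen_exterior ρ).mem_nhds hx] with y hy using hu1 i y hy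
  refine ⟨min τ₁ τ₂, lt_min hτ₁ hτ₂, ?_, fun x hx => hM.endCoord_apply hE hx,
    lt_min (by linarith) (by linarith), hd.mono (min_le_left _ _), fun i => ?_, fun i j => ?_, ?_⟩
  · have := hM.isHypersurface.isHypWithin hE.smoothCoord (hM.isParam hE)
      fun x hx => hM.fst_mem_target hE hx
    rwa [hE.source_eq] at this
  · have : Dec (τ₂ / 2) fun x => partialD univ f i x := h1 i
    refine (this.mono (by linarith [min_le_right τ₁ τ₂])).congr ?_
    filter_upwards [eventually_lt_norm ρ] with x hx using hu1 i x hx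
  · have : Dec (τ₂ / 2 + 1) fun x => partialD univ (fun y => partialD univ f i y) j x := by
      have := h2 i j
      rwa [show -(τ₂ / 2) - 1 = -(τ₂ / 2 + 1) by ring] at this
    refine (this.mono (by linarith [min_le_right τ₁ τ₂])).congr ?_
    filter_upwards [eventually_lt_norm ρ] with x hx using hu2 i j x hx
  · exact hM.normal_at_infinity.congr fun x => angleFn_eq (Φ x)

/-- The masses exist, and their difference is the flux at infinity. -/
theorem exists_mass (hn : 3 ≤ n) : ∃ a b : ℝ,
    Tendsto (sphereFlux (admVec (metricCoeff (toField h) (exterior n 1) Ψ))) atTop (𝓝 a) ∧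
    Tendsto (sphereFlux (admVec (metricCoeff (toField g) (exterior n ρ) Φ))) atTop (𝓝 b) ∧
    Tendsto (sphereFlux (fluxDensity (toField h) (toField g) F N Φ (exterior n ρ))) atTop
      (𝓝 (b - a)) := by
  obtain ⟨τ, hτ, A⟩ := hM.isGraphEnd hE hn
  have hρ := hM.one_le_radius
  have hρ0 : 0 ≤ ρ := by linarith
  have hφ := hM.isParam hE
  have hGs := hφ.smoothMetricOn (isOpen_exterior ρ) g
  obtain ⟨a, ha⟩ := A.decay.exists_hasADMMass A.pos hE.smoothMetricOn zero_le_one hτ le_rfl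
    hE.integrableOn_scalarCoeff
  obtain ⟨b, hb⟩ := A.isAFDecay.exists_hasADMMass A.pos hGs hρ0 hτ le_rfl
    (hM.integrableOn_scalarCoeff hE)
  refine ⟨a, b, ha, hb, ?_⟩
  have hz := tendsto_sphereFlux_zero NeZero.one_le A.flux_sub (by linarith)
  rw [← add_zero (b - a)]
  refine ((hb.sub ha).add hz).congr' ?_
  filter_upwards [eventually_gt_atTop ρ] with r hr
  have cG := hGs.contDiffOn_admVec.continuousOn
  have cH := hE.smoothMetricOn.contDiffOn_admVec.continuousOn.mono (exterior_subset hρ)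
  have cV := (hM.isHypersurface.contDiffOn_fluxDensity hφ).continuousOn
  refine (congrArg _ (sphereFlux_congr (W := fun x =>
    fluxDensity (toField h) (toField g) F N Φ (exterior n ρ) x -
      (admVec (metricCoeff (toField g) (exterior n ρ) Φ) x -
        admVec (metricCoeff (toField h) (exterior n 1) Ψ) x)) (hρ0.trans hr.le)
    fun x hx => ?_)).trans ?_
  · have hxρ : x ∈ exterior n ρ := show ρ < ‖x‖ by rw [hx]; exact hr
    rw [fluxDensity, hM.isHypersurface.paramFlux_eq hE.smoothCoord hφ hxρ
      (hM.fst_mem_target hE hxρ), coordFlux, hE.source_eq]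
  · rw [sphereFlux_sub_fields hρ0 cV (cG.fun_sub cH) hr, sphereFlux_sub_fields hρ0 cG cH hr]
    ring

/-- The cores increase and exhaust `M`: a point belongs to the core of radius `max ρ |x|`, where `x`
is the value of `endCoord` at it, a meaningful position only on the end. -/
theorem tendsto_setIntegral_core {w : M → ℝ} (hw : Integrable w (riemannianVolume (toField g))) :
    Tendsto (fun r : ℝ => ∫ p in (Φ '' exterior n r)ᶜ, w p ∂(riemannianVolume (toField g))) atTop
      (𝓝 (∫ p, w p ∂(riemannianVolume (toField g)))) := by
  have h1 := tendsto_setIntegral_of_monotone (μ := riemannianVolume (toField g)) (f := w)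
    -- Below `ρ` nothing is known about the image of `Φ`, so the radius is truncated; this does not
    -- affect the limit.
    (s := fun r : ℝ => (Φ '' exterior n (max ρ r))ᶜ)
    (fun r => (hM.isOpen_image (le_max_left ρ r)).measurableSet.compl)
    (fun r s hrs => compl_subset_compl.2 (image_mono (exterior_subset (max_le_max_left ρ hrs))))
    hw.integrableOn
  have h2 : ⋃ r : ℝ, (Φ '' exterior n (max ρ r))ᶜ = univ := eq_univ_of_forall fun p =>
    mem_iUnion.2 ⟨‖endCoord Ψ F p‖, hM.mem_core hE (le_max_left _ _) (le_max_right _ _)⟩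
  rw [h2, setIntegral_univ] at h1
  refine h1.congr' ?_
  filter_upwards [eventually_ge_atTop ρ] with r hr
  rw [max_eq_right hr]

end IsAFHypersurface
end MassFormula

end

theorem theorem2 {n : ℕ} [NeZero n] (hn : 3 ≤ n)
    {E : Type*} [TopologicalSpace E] [T2Space E] [SecondCountableTopology E] [ConnectedSpace E]
    [ChartedSpace (Euc n) E] [IsManifold (𝓡 n) ∞ E] [MeasurableSpace E] [BorelSpace E]
    {M : Type*} [TopologicalSpace M] [T2Space M] [SecondCountableTopology M] [ConnectedSpace M]
    [ChartedSpace (EuclideanHalfSpace n) M] [IsManifold (𝓡∂ n) ∞ M]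
    [MeasurableSpace M] [BorelSpace M]
    {Γ : Type*} [TopologicalSpace Γ] [T2Space Γ] [SecondCountableTopology Γ] [CompactSpace Γ]
    [ChartedSpace (Euc (n - 1)) Γ] [IsManifold (𝓡 (n - 1)) ∞ Γ]
    [MeasurableSpace Γ] [BorelSpace Γ]
    (h : Bundle.ContMDiffRiemannianMetric (𝓡 n) ∞ (Euc n) (fun p : E => TangentSpace (𝓡 n) p))
    (g : Bundle.ContMDiffRiemannianMetric (𝓡∂ n) ∞ (Euc n) (fun p : M => TangentSpace (𝓡∂ n) p))
    (Ψ : OpenPartialHomeomorph (Euc n) E) (hE : IsAsymptoticallyFlat (toField h) Ψ)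
    (Iv : Set ℝ) (hIv : Iv.OrdConnected)
    (F : M → E × ℝ) (N : ∀ p : M, TangentSpace ((𝓡 n).prod 𝓘(ℝ, ℝ)) (F p))
    (ρ : ℝ) (Φ : Euc n → M) (f : Euc n → ℝ)
    (hM : IsAFHypersurface (toField h) Ψ Iv (toField g) F N ρ Φ f)
    (j : Γ → M) (t₀ : ℝ) (ht₀ : t₀ ∈ Iv) (Ω : Set E)
    (μ : ∀ q : Γ, TangentSpace (𝓡 n) (boundaryProj F j q))
    (hΓ : IsHorizon (toField h) (toField g) F N j t₀ Ω μ) :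
    ∃ m_h m_g J : ℝ,
      HasADMMass (metricCoeff (toField h) (exterior n 1) Ψ) m_h ∧
      HasADMMass (metricCoeff (toField g) (exterior n ρ) Φ) m_g ∧
      Integrable (fun q => meanCurvature (𝓡 (n - 1)) (toField h) (boundaryProj F j) q (μ q))
        (riemannianVolume (pullbackMetric (𝓡 (n - 1)) (toField h) (boundaryProj F j))) ∧
      (∀ r : ℝ, ρ < r → IntegrableOn (massDensity (toField h) (toField g) F N)
        (Φ '' exterior n r)ᶜ (riemannianVolume (toField g))) ∧
      Tendsto (fun r : ℝ => ∫ p in (Φ '' exterior n r)ᶜ,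
          massDensity (toField h) (toField g) F N p ∂(riemannianVolume (toField g)))
        atTop (𝓝 J) ∧
      (Integrable (massDensity (toField h) (toField g) F N) (riemannianVolume (toField g)) →
        J = ∫ p, massDensity (toField h) (toField g) F N p ∂(riemannianVolume (toField g))) ∧
      m_g = m_h
        + admConst n * ∫ q, meanCurvature (𝓡 (n - 1)) (toField h) (boundaryProj F j) q (μ q)
            ∂(riemannianVolume (pullbackMetric (𝓡 (n - 1)) (toField h) (boundaryProj F j)))
        + admConst n * J := by
  obtain ⟨a, b, ha, hb, hV⟩ := hM.exists_mass hE hn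
  have hcore := fun (r : ℝ) (hr : ρ < r) => hM.integral_core hE hΓ hn hr
  -- The identity on the core turns the limit of the fluxes into the limit of the integrals of the
  -- mass density. It exists without integrability on all of `M`.
  have hJ := (hV.sub_const (∫ q, meanCurvature (𝓡 (n - 1)) (toField h) (boundaryProj F j) q (μ q)
    ∂(riemannianVolume (pullbackMetric (𝓡 (n - 1)) (toField h) (boundaryProj F j))))).congr'
    ((eventually_gt_atTop ρ).mono fun r hr => (hcore r hr).2.2.symm)
  refine ⟨admConst n * a, admConst n * b, _, ?_, ?_, (hcore (ρ + 1) (lt_add_one ρ)).1,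
    fun r hr => (hcore r hr).2.1, hJ, fun hi => ?_, by ring⟩
  · exact (ha.const_mul _).congr fun r => (admFlux_eq r).symm
  · exact (hb.const_mul _).congr fun r => (admFlux_eq r).symm
  · exact tendsto_nhds_unique hJ (hM.tendsto_setIntegral_core hE hi)
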